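/- Let $n\ge 4$ and let $(M^n,g)$ be a connected complete smooth Riemannian manifold (without boundary). Let $u,h,\lambda:M\to\mathbb R$ be smooth, with $h$ everywhere positive or everywhere negative, such that $(M,g,\nabla u,h,\lambda)$ is an $h$-almost gradient Ricci soliton, i.e. $$\mathrm{Ric}_g+h\,\nabla du=\lambda g .$$ Assume that $g$ is Bach-flat, i.e. $B=\frac1{n-3}\,\delta^D\delta\mathcal W+\frac1{n-2}\,\mathring{\mathcal W}z=0$, where $\mathcal W$ is the Weyl tensor, $z$ the traceless Ricci tensor, $\mathring{\mathcal W}z(X,Y)=\sum_{i,j}\mathcal W(X,E_i,Y,E_j)\,z(E_i,E_j)$ for an orthonormal frame $(E_i)$ (signs are such that $R(X,Y,X,Y)$ is the sectional curvature of an orthonormal pair), $\delta$ is the negative divergence and $\delta^D$ the formal adjoint of $d^D\omega(X,Y,Z)=(\nabla_X\omega)(Y,Z)-(\nabla_Y\omega)(X,Z)$. Assume that every level set of $u$ is compact and that $h$ is a function of $u$ only with $\frac{dh}{du}>0$ on $M$: $h=\varphi\circ u$, where $\varphi$ is differentiable on $u(M)$ with positive derivative (this last condition is void if $u$ is constant).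 Then one of the following holds. 1. $g$ is Einstein ($\mathrm{Ric}_g=c\,g$ with a constant $c$), and $u$ and $h$ are constant. 2. $u$ is not constant, and wherever $\nabla u\neq0$ the metric $g$ is locally a warped product with $(n-1)$-dimensional Einstein fibers, the fibers lying in level sets of $u$. Say that a hypersurface $E\subset M$ has property (W) if, for some $\varepsilon>0$, some smooth $\psi:(-\varepsilon,\varepsilon)\to(0,\infty)$ and some constant $c$, the metric $\hat g_E$ induced on $E$ satisfies $\mathrm{Ric}_{\hat g_E}=c\,\hat g_E$, and there is an isometry $\Phi$ from $\big((-\varepsilon,\varepsilon)\times E,\ dt^2+\psi(t)^2\hat g_E\big)$ onto an open subset of $M$ with $\Phi(0,x)=x$ for $x\in E$, such that $u(\Phi(t,x))=f(t)$ depends only on $t$ and $f'>0$. Then * each $p\in M$ with $\nabla u(p)\ne0$ has an open neighbourhood $O$ such that $E=u^{-1}(u(p))\cap O$ has property (W); * for each regular value $c_0$ of $u$, every connected component $E$ of the level set $u^{-1}(c_0)$ has property (W). -/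

import Mathlib

open Set Bundle Manifold Matrix
open scoped ContDiff

noncomputable section

namespace BachFlat

/-! ### Tensor calculus in coordinates

A Riemannian metric on an open subset of `ℝᵏ` is given by its matrix `G y = (g_ij(y))`; tensor
fields are given by their components in the coordinate frame `∂_0, …, ∂_(k-1)`. -/

/-- The partial derivative `∂_i f (y)`. -/
def pd {k : ℕ} (f : EuclideanSpace ℝ (Fin k) → ℝ) (y : EuclideanSpace ℝ (Fin k)) (i : Fin k) : ℝ :=
  fderiv ℝ f y (EuclideanSpace.single i 1)

section Coordinates

variable {k : ℕ} (G : EuclideanSpace ℝ (Fin k) → Matrix (Fin k) (Fin k) ℝ)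

/-- The Christoffel symbol `Γ^c_{ij}` of the Levi-Civita connection. -/
def christoffel (y : EuclideanSpace ℝ (Fin k)) (c i j : Fin k) : ℝ :=
  (1 / 2) * ∑ l, (G y)⁻¹ c l *
    (pd (fun z => G z j l) y i + pd (fun z => G z i l) y j - pd (fun z => G z i j) y l)

/-- The component `(∇_a T)(∂_{I 0}, …, ∂_{I (r-1)})` of the covariant derivative of a covariant
`r`-tensor field `T`. -/
def covDeriv {r : ℕ} (T : EuclideanSpace ℝ (Fin k) → (Fin r → Fin k) → ℝ)
    (y : EuclideanSpace ℝ (Fin k)) (a : Fin k) (I : Fin r → Fin k) : ℝ :=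
  pd (fun z => T z I) y a
    - ∑ s, ∑ m, christoffel G y m a (I s) * T y (Function.update I s m)

/-- The negative divergence `(δT)(X₁, …, X_r) = - ∑_a (∇_{E_a} T)(E_a, X₁, …, X_r)`. -/
def negDiv {r : ℕ} (T : EuclideanSpace ℝ (Fin k) → (Fin (r + 1) → Fin k) → ℝ)
    (y : EuclideanSpace ℝ (Fin k)) (I : Fin r → Fin k) : ℝ :=
  - ∑ a, ∑ b, (G y)⁻¹ a b * covDeriv G T y a (Fin.cons b I)

/-- The Hessian `(∇df)_{ij}` of a function. -/
def hessian (f : EuclideanSpace ℝ (Fin k) → ℝ) (y : EuclideanSpace ℝ (Fin k)) (i j : Fin k) : ℝ :=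
  pd (fun z => pd f z j) y i - ∑ c, christoffel G y c i j * pd f y c

/-- The components of the curvature operator,
`R(∂_i, ∂_j) ∂_c = ∑_l (curvOp i j c l) ∂_l` with `R(X,Y) = [∇_X, ∇_Y] - ∇_[X,Y]`. -/
def curvOp (y : EuclideanSpace ℝ (Fin k)) (i j c l : Fin k) : ℝ :=
  pd (fun z => christoffel G z l j c) y i - pd (fun z => christoffel G z l i c) y j
    + ∑ m, (christoffel G y m j c * christoffel G y l i m
      - christoffel G y m i c * christoffel G y l j m)

/-- The covariant curvature tensor `R_{ijcl} = g(R(∂_i, ∂_j) ∂_l, ∂_c)`; thus `R(X,Y,X,Y)` is the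
sectional curvature of the plane spanned by orthonormal `X, Y`. -/
def riemann (y : EuclideanSpace ℝ (Fin k)) (i j c l : Fin k) : ℝ :=
  ∑ m, G y c m * curvOp G y i j l m

/-- The Ricci tensor `Ric(Y, Z) = tr (X ↦ R(X, Y) Z)`. -/
def ricci (y : EuclideanSpace ℝ (Fin k)) (i j : Fin k) : ℝ :=
  ∑ a, curvOp G y a i j a

/-- The scalar curvature. -/
def scalar (y : EuclideanSpace ℝ (Fin k)) : ℝ :=
  ∑ i, ∑ j, (G y)⁻¹ i j * ricci G y i j

/-- The traceless Ricci tensor `z = Ric - (s/k) g`. -/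
def tracelessRicci (y : EuclideanSpace ℝ (Fin k)) (i j : Fin k) : ℝ :=
  ricci G y i j - scalar G y / k * G y i j

/-- The Weyl tensor (for `k ≥ 3`), as a covariant 4-tensor. -/
def weyl (y : EuclideanSpace ℝ (Fin k)) (I : Fin 4 → Fin k) : ℝ :=
  riemann G y (I 0) (I 1) (I 2) (I 3)
    - 1 / ((k : ℝ) - 2) *
      (G y (I 0) (I 2) * ricci G y (I 1) (I 3) - G y (I 0) (I 3) * ricci G y (I 1) (I 2)
        - G y (I 1) (I 2) * ricci G y (I 0) (I 3) + G y (I 1) (I 3) * ricci G y (I 0) (I 2))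
    + scalar G y / (((k : ℝ) - 1) * ((k : ℝ) - 2)) *
      (G y (I 0) (I 2) * G y (I 1) (I 3) - G y (I 0) (I 3) * G y (I 1) (I 2))

/-- The divergence `δW`, viewed as a section of `Λ²M ⊗ T*M`: the first two arguments are the
skew-symmetric ones, i.e. `(X, Y, Z) ↦ (δW)(Z, X, Y)`. -/
def deltaWeyl (y : EuclideanSpace ℝ (Fin k)) (I : Fin 3 → Fin k) : ℝ :=
  negDiv G (weyl G) y ![I 2, I 0, I 1]

/-- The Bach tensor `B = 1/(k-3) δ^D δW + 1/(k-2) W̊z` (for `k ≥ 4`). Here `δ^D`, the formal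
adjoint of `d^D ω (X,Y,Z) = (∇_X ω)(Y,Z) - (∇_Y ω)(X,Z)`, is the negative divergence in the first
argument, and `W̊z (X,Y) = ∑_{a,b} W(X, E_a, Y, E_b) z(E_a, E_b)`. -/
def bach (y : EuclideanSpace ℝ (Fin k)) (i j : Fin k) : ℝ :=
  1 / ((k : ℝ) - 3) * negDiv G (deltaWeyl G) y ![i, j]
    + 1 / ((k : ℝ) - 2) * ∑ a, ∑ b, ∑ c, ∑ d,
      (G y)⁻¹ a c * (G y)⁻¹ b d * weyl G y ![i, a, j, b] * tracelessRicci G y c d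

end Coordinates

/-! ### Notions on a Riemannian manifold

The tensor identities are stated in every chart of the maximal smooth atlas. -/

section Manifold

variable {n : ℕ} {M : Type*} [TopologicalSpace M] [ChartedSpace (EuclideanSpace ℝ (Fin n)) M]
  [IsManifold (𝓡 n) ∞ M] [RiemannianBundle (fun x : M => TangentSpace (𝓡 n) x)]

variable (n) in
/-- The components of the pull-back of the Riemannian metric of `M` under a map `σ : ℝᵏ → M`
(for `σ` the inverse of a chart, the components of the metric in that chart; for `σ` a
parametrization of a submanifold, the components of the induced metric). -/
def gram {k : ℕ} (σ : EuclideanSpace ℝ (Fin k) → M) (y : EuclideanSpace ℝ (Fin k)) :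
    Matrix (Fin k) (Fin k) ℝ :=
  Matrix.of fun i j =>
    inner ℝ (mfderiv (𝓡 k) (𝓡 n) σ y (EuclideanSpace.single i 1) : TangentSpace (𝓡 n) (σ y))
      (mfderiv (𝓡 k) (𝓡 n) σ y (EuclideanSpace.single j 1) : TangentSpace (𝓡 n) (σ y))

variable (n M) in
/-- The Bach tensor of `M` vanishes. -/
def IsBachFlat : Prop :=
  ∀ e ∈ IsManifold.maximalAtlas (𝓡 n) ∞ M, ∀ y ∈ e.target, ∀ i j, bach (gram n e.symm) y i j = 0

variable (n M) in
/-- `M` is Einstein: `Ric = c g` with a constant `c`. -/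
def IsEinstein : Prop :=
  ∃ c : ℝ, ∀ e ∈ IsManifold.maximalAtlas (𝓡 n) ∞ M, ∀ y ∈ e.target, ∀ i j,
    ricci (gram n e.symm) y i j = c * gram n e.symm y i j

variable (n) in
/-- The defining data of an `h`-almost gradient Ricci soliton with potential `u`, signal function
`h` (smooth, everywhere positive or everywhere negative) and soliton function `lam`:
`Ric + h ∇du = lam g`. -/
structure IsAlmostSoliton (u h lam : M → ℝ) : Prop where
  smooth_u : ContMDiff (𝓡 n) 𝓘(ℝ, ℝ) ∞ u
  smooth_h : ContMDiff (𝓡 n) 𝓘(ℝ, ℝ) ∞ h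
  smooth_lam : ContMDiff (𝓡 n) 𝓘(ℝ, ℝ) ∞ lam
  signal : (∀ x, 0 < h x) ∨ (∀ x, h x < 0)
  equation : ∀ e ∈ IsManifold.maximalAtlas (𝓡 n) ∞ M, ∀ y ∈ e.target, ∀ i j,
    ricci (gram n e.symm) y i j + h (e.symm y) * hessian (gram n e.symm) (fun z => u (e.symm z)) y i j
      = lam (e.symm y) * gram n e.symm y i j

/-- `h` is a function of `u` only, with `dh/du > 0` on `M`. If `u` is not constant, the range of
`u` on connected `M` is a nondegenerate interval and `φ' (u x)` is the derivative of `φ` there. -/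
def IsIncreasingFunctionOf (h u : M → ℝ) : Prop :=
  ∃ φ φ' : ℝ → ℝ, (∀ x, h x = φ (u x)) ∧
    ∀ x, HasDerivWithinAt φ (φ' (u x)) (range u) (u x) ∧ 0 < φ' (u x)

variable (n) in
/-- A neighbourhood of `E ⊆ M` is isometric to the warped product
`((-ε, ε) × E, dt² + ψ(t)² ĝ_E)`, where `E` is a hypersurface, `ĝ_E` is its induced metric, and
`(E, ĝ_E)` is Einstein; the isometry `Φ` restricts to the identity on `{0} × E`, and `u ∘ Φ` is a
function of `t` alone with positive derivative, so that the slices `{t} × E` lie in level sets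
of `u`. Around each of its points `E` is parametrized by an immersion `σ` of an open set
`V ⊆ ℝⁿ⁻¹`. -/
def IsEinsteinWarpedNear (u : M → ℝ) (E : Set M) : Prop :=
  ∃ (ε : ℝ) (ψ f : ℝ → ℝ) (c : ℝ) (Φ : ℝ → M → M),
    0 < ε ∧ ContDiffOn ℝ ∞ ψ (Ioo (-ε) ε) ∧ (∀ t ∈ Ioo (-ε) ε, 0 < ψ t) ∧
    (∀ t ∈ Ioo (-ε) ε, 0 < deriv f t) ∧
    (∀ x ∈ E, Φ 0 x = x) ∧
    (∀ t ∈ Ioo (-ε) ε, ∀ x ∈ E, u (Φ t x) = f t) ∧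
    InjOn (fun z : ℝ × M => Φ z.1 z.2) (Ioo (-ε) ε ×ˢ E) ∧
    IsOpen ((fun z : ℝ × M => Φ z.1 z.2) '' (Ioo (-ε) ε ×ˢ E)) ∧
    ∀ x ∈ E, ∃ (V : Set (EuclideanSpace ℝ (Fin (n - 1)))) (O : Set M)
        (σ : EuclideanSpace ℝ (Fin (n - 1)) → M),
      IsOpen V ∧ IsOpen O ∧ x ∈ O ∧ σ '' V = E ∩ O ∧ InjOn σ V ∧
      ContMDiffOn (𝓡 (n - 1)) (𝓡 n) ∞ σ V ∧
      (∀ y ∈ V, Function.Injective (mfderiv (𝓡 (n - 1)) (𝓡 n) σ y)) ∧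
      -- the fibre is Einstein
      (∀ y ∈ V, ∀ i j, ricci (gram n σ) y i j = c * gram n σ y i j) ∧
      -- the metric of `M` pulls back to the warped product metric
      ContMDiffOn 𝓘(ℝ, ℝ × EuclideanSpace ℝ (Fin (n - 1))) (𝓡 n) ∞
        (fun z => Φ z.1 (σ z.2)) (Ioo (-ε) ε ×ˢ V) ∧
      ∀ t ∈ Ioo (-ε) ε, ∀ y ∈ V, ∀ (a b : ℝ) (v w : EuclideanSpace ℝ (Fin (n - 1))),
        inner ℝ
          (mfderiv 𝓘(ℝ, ℝ × EuclideanSpace ℝ (Fin (n - 1))) (𝓡 n)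
            (fun z : ℝ × EuclideanSpace ℝ (Fin (n - 1)) => Φ z.1 (σ z.2)) (t, y) (a, v) :
              TangentSpace (𝓡 n) (Φ t (σ y)))
          (mfderiv 𝓘(ℝ, ℝ × EuclideanSpace ℝ (Fin (n - 1))) (𝓡 n)
            (fun z : ℝ × EuclideanSpace ℝ (Fin (n - 1)) => Φ z.1 (σ z.2)) (t, y) (b, w) :
              TangentSpace (𝓡 n) (Φ t (σ y)))
        = a * b + ψ t ^ 2 * ∑ i, ∑ j, gram n σ y i j * v i * w j

end Manifold

end BachFlat

end

noncomputable section

namespace BachFlat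

/-! Write `w = |∇u|²`, `z` for the traceless Ricci tensor, `W` for the Weyl tensor and `C` for the
Cotton tensor. If `u` is constant, the soliton equation says `Ric = λ g`; Schur's lemma makes `λ`
constant, and `h = φ ∘ u` is constant as well. Suppose `u` is not constant.

Rigidity. By the contracted Bianchi identities, Bach-flatness reads `div C = - W̊z` (`bach_eq`).
Differentiating the soliton equation and using `dh = h' du` gives `C = - h W(·,·,·,∇u) + P T`, where
`P = h/(n-2) + h'/h` and `T` is a trace-free tensor built from `du` and `z` (`cotton_soliton`). In
the divergence of the 1-form `C(·,∇u,∇u)` the Weyl terms cancel, and what is left is `(1/(n-2) +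
h'/h²) D` with `D = w |z|² - n/(n-1) |z(∇u)|²` (`div_cottonForm`). Here `D = |T|²/2 ≥ 0`
(`half_sum_sq_eq`), and the factor is positive because `h' > 0`. The same 1-form can be written
through `u`, `h`, `w` and their differentials (`cottonForm_soliton`), and it annihilates `∇u`. Since
the level sets of `u` are compact, there are compactly supported cutoffs `χ` that are locally
functions of `u` (`exists_cutoff`). Then `∫ χ div X = - ∫ ⟨dχ, X⟩ = 0` for the corresponding form
`X`, so the nonnegative divergence vanishes and `D = 0` on all of `M` (`deviation_eq_zero`).

Local structure. Where `∇u ≠ 0`, the equality `D = 0` forces `z`, hence `Ric` and `∇du`, to be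
combinations of `g` and `du ⊗ du`. In `∇du = α g + β du ⊗ du` both `w` and `α` are constant along
the level sets (`pd_gradInner_self_of_hessian_eq`, `sum_mul_pd_hessCoeff`). In coordinates where
`∂_0 = ∇u/|∇u|` and a level set is a coordinate hyperplane, the equation `∂_0 g_ab = 2 (α/|∇u|)
g_ab` integrates to a warped product. Its fibres have Ricci tensor proportional to their metric and
dimension `n - 1 ≥ 3`, so Schur's lemma makes them Einstein (`exists_warped_of_adapted`). The
coordinates come from the smooth flow of the unit normal, which is obtained from the inverse
function theorem on a space of continuous curves.

Gluing. Unit normal curves through a common point coincide, and two charts meeting on the central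
slice have the same `f`, `ψ` and Einstein constant (`IsWarpedChart.curve_eq`,
`IsWarpedChart.data_eq`). On a connected piece of a level set the data are therefore constant and
the local isometries fit together. Compactness of a regular level set provides one width `ε` for all
charts of a component. -/

abbrev Eu (k : ℕ) : Type := EuclideanSpace ℝ (Fin k)

/-! ### Partial derivatives of scalar and matrix-valued functions -/

section PartialDerivatives

variable {k : ℕ} {f g : Eu k → ℝ} {y : Eu k} {Ω : Set (Eu k)}

theorem pd_congr (h : f =ᶠ[nhds y] g) (i : Fin k) : pd f y i = pd g y i := by
  unfold pd; rw [h.fderiv_eq]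

theorem pd_congr_on (hΩ : IsOpen Ω) (hy : y ∈ Ω) (h : ∀ z ∈ Ω, f z = g z) (i : Fin k) :
    pd f y i = pd g y i :=
  pd_congr (Filter.eventually_of_mem (hΩ.mem_nhds hy) h) i

theorem pd_add (hf : DifferentiableAt ℝ f y) (hg : DifferentiableAt ℝ g y) (i : Fin k) :
    pd (fun z => f z + g z) y i = pd f y i + pd g y i := by
  unfold pd; rw [fderiv_fun_add hf hg]; rfl

theorem pd_sub (hf : DifferentiableAt ℝ f y) (hg : DifferentiableAt ℝ g y) (i : Fin k) :
    pd (fun z => f z - g z) y i = pd f y i - pd g y i := by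
  unfold pd; rw [fderiv_fun_sub hf hg]; rfl

theorem pd_neg (i : Fin k) : pd (fun z => - f z) y i = - pd f y i := by
  unfold pd; rw [fderiv_fun_neg]; rfl

theorem pd_mul (hf : DifferentiableAt ℝ f y) (hg : DifferentiableAt ℝ g y) (i : Fin k) :
    pd (fun z => f z * g z) y i = pd f y i * g y + f y * pd g y i := by
  unfold pd; rw [fderiv_fun_mul hf hg]
  simp; ring

@[simp] theorem pd_const (c : ℝ) (i : Fin k) : pd (fun _ => c) y i = 0 := by
  unfold pd; simp

theorem pd_const_mul (hf : DifferentiableAt ℝ f y) (c : ℝ) (i : Fin k) :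
    pd (fun z => c * f z) y i = c * pd f y i := by
  rw [pd_mul (differentiableAt_const c) hf]; simp

theorem pd_sum {ι : Type*} {s : Finset ι} {F : ι → Eu k → ℝ}
    (hF : ∀ a ∈ s, DifferentiableAt ℝ (F a) y) (i : Fin k) :
    pd (fun z => ∑ a ∈ s, F a z) y i = ∑ a ∈ s, pd (F a) y i := by
  unfold pd; rw [fderiv_fun_sum hF]; simp

theorem contDiffOn_pd (hΩ : IsOpen Ω) (hf : ContDiffOn ℝ ∞ f Ω) (i : Fin k) :
    ContDiffOn ℝ ∞ (fun y => pd f y i) Ω := by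
  unfold pd
  exact (hf.fderiv_of_isOpen hΩ (m := ∞) (by simp)).clm_apply contDiffOn_const

theorem ContDiffOn.dAt (hf : ContDiffOn ℝ ∞ f Ω) (hΩ : IsOpen Ω) (hy : y ∈ Ω) :
    DifferentiableAt ℝ f y :=
  (hf.contDiffAt (hΩ.mem_nhds hy)).differentiableAt (by simp)

theorem pd_comm (hΩ : IsOpen Ω) (hf : ContDiffOn ℝ ∞ f Ω) (hy : y ∈ Ω) (i j : Fin k) :
    pd (fun z => pd f z j) y i = pd (fun z => pd f z i) y j := by
  have hs : IsSymmSndFDerivAt ℝ f y :=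
    (hf.contDiffAt (hΩ.mem_nhds hy)).isSymmSndFDerivAt (by simp; exact WithTop.coe_le_coe.2 (le_top : (2 : ℕ∞) ≤ ⊤))
  have hd : DifferentiableAt ℝ (fderiv ℝ f) y :=
    ((hf.fderiv_of_isOpen hΩ (m := ∞) (by simp)).contDiffAt (hΩ.mem_nhds hy)).differentiableAt
      (by simp)
  have key : ∀ a b : Fin k, pd (fun z => pd f z b) y a
      = fderiv ℝ (fderiv ℝ f) y (EuclideanSpace.single a 1) (EuclideanSpace.single b 1) := by
    intro a b
    unfold pd
    rw [fderiv_clm_apply hd (differentiableAt_const _)]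
    simp
  rw [key, key]
  exact hs.eq _ _

/-- The entrywise partial derivative of a matrix-valued function. -/
def pdM {l m : Type*} (F : Eu k → Matrix l m ℝ) (y : Eu k) (a : Fin k) : Matrix l m ℝ :=
  Matrix.of fun i j => pd (fun z => F z i j) y a

theorem pdM_mul {l m n : Type*} [Fintype m] {F : Eu k → Matrix l m ℝ} {H : Eu k → Matrix m n ℝ}
    (hF : ∀ i j, DifferentiableAt ℝ (fun z => F z i j) y)
    (hH : ∀ i j, DifferentiableAt ℝ (fun z => H z i j) y) (a : Fin k) :
    pdM (fun z => F z * H z) y a = pdM F y a * H y + F y * pdM H y a := by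
  ext i j
  simp only [pdM, Matrix.mul_apply, Matrix.of_apply, Matrix.add_apply]
  rw [pd_sum (fun b _ => (hF i b).fun_mul (hH b j)), ← Finset.sum_add_distrib]
  exact Finset.sum_congr rfl fun b _ => pd_mul (hF i b) (hH b j) a

theorem pdM_add {l m : Type*} {F H : Eu k → Matrix l m ℝ}
    (hF : ∀ i j, DifferentiableAt ℝ (fun z => F z i j) y)
    (hH : ∀ i j, DifferentiableAt ℝ (fun z => H z i j) y) (a : Fin k) :
    pdM (fun z => F z + H z) y a = pdM F y a + pdM H y a := by
  ext i j
  exact pd_add (hF i j) (hH i j) a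

theorem pdM_sub {l m : Type*} {F H : Eu k → Matrix l m ℝ}
    (hF : ∀ i j, DifferentiableAt ℝ (fun z => F z i j) y)
    (hH : ∀ i j, DifferentiableAt ℝ (fun z => H z i j) y) (a : Fin k) :
    pdM (fun z => F z - H z) y a = pdM F y a - pdM H y a := by
  ext i j
  exact pd_sub (hF i j) (hH i j) a

end PartialDerivatives

/-! ### Metrics in coordinates, Levi-Civita connection, algebraic symmetries of the curvature -/

section Metric

variable {k : ℕ}

/-- `G` is the matrix of a smooth Riemannian metric on the open set `Ω`. -/
structure IsMetricOn (G : Eu k → Matrix (Fin k) (Fin k) ℝ) (Ω : Set (Eu k)) : Prop where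
  isOpen : IsOpen Ω
  smooth : ∀ i j, ContDiffOn ℝ ∞ (fun y => G y i j) Ω
  posDef : ∀ y ∈ Ω, (G y).PosDef

namespace IsMetricOn

variable {G : Eu k → Matrix (Fin k) (Fin k) ℝ} {Ω : Set (Eu k)} {y : Eu k}

theorem symm (hG : IsMetricOn G Ω) (hy : y ∈ Ω) (i j : Fin k) : G y i j = G y j i := by
  simpa using (hG.posDef y hy).isHermitian.apply j i

theorem transpose_eq (hG : IsMetricOn G Ω) (hy : y ∈ Ω) : (G y)ᵀ = G y := by
  ext i j; exact hG.symm hy j i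

theorem isUnit_det (hG : IsMetricOn G Ω) (hy : y ∈ Ω) : IsUnit (G y).det :=
  (hG.posDef y hy).det_pos.ne'.isUnit

theorem inv_symm (hG : IsMetricOn G Ω) (hy : y ∈ Ω) (i j : Fin k) :
    (G y)⁻¹ i j = (G y)⁻¹ j i := by
  have : ((G y)⁻¹)ᵀ = (G y)⁻¹ := by rw [Matrix.transpose_nonsing_inv, hG.transpose_eq hy]
  exact congrFun (congrFun this j) i

theorem inv_mul (hG : IsMetricOn G Ω) (hy : y ∈ Ω) (i j : Fin k) :
    ∑ a, (G y)⁻¹ i a * G y a j = if i = j then 1 else 0 := by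
  rw [← Matrix.mul_apply, Matrix.nonsing_inv_mul _ (hG.isUnit_det hy), Matrix.one_apply]

theorem mul_inv (hG : IsMetricOn G Ω) (hy : y ∈ Ω) (i j : Fin k) :
    ∑ a, G y i a * (G y)⁻¹ a j = if i = j then 1 else 0 := by
  rw [← Matrix.mul_apply, Matrix.mul_nonsing_inv _ (hG.isUnit_det hy), Matrix.one_apply]

theorem smooth_det (hG : IsMetricOn G Ω) : ContDiffOn ℝ ∞ (fun y => (G y).det) Ω := by
  simp only [Matrix.det_apply]
  refine ContDiffOn.sum fun σ _ => ?_
  refine ContDiffOn.const_smul _ ?_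
  exact contDiffOn_prod fun i _ => hG.smooth _ _

/-- Cramer's rule: an entry of the inverse is a quotient of two determinants whose entries are
smooth or constant, and the denominator is positive. -/
theorem smooth_inv (hG : IsMetricOn G Ω) (i j : Fin k) :
    ContDiffOn ℝ ∞ (fun y => (G y)⁻¹ i j) Ω := by
  have h : ∀ y ∈ Ω, (G y)⁻¹ i j = ((G y).det)⁻¹ * ((G y).updateRow j (Pi.single i 1)).det := by
    intro y _
    rw [Matrix.inv_def, Matrix.smul_apply, Matrix.adjugate_apply, Ring.inverse_eq_inv', smul_eq_mul]
  refine ContDiffOn.congr ?_ h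
  refine (hG.smooth_det.inv fun y hy => (hG.posDef y hy).det_pos.ne').mul ?_
  simp only [Matrix.det_apply]
  refine ContDiffOn.sum fun σ _ => ContDiffOn.const_smul _ (contDiffOn_prod fun a _ => ?_)
  by_cases ha : σ a = j
  · simp only [Matrix.updateRow_apply, ha, if_true]; exact contDiffOn_const
  · simp only [Matrix.updateRow_apply, ha, if_false]; exact hG.smooth _ _

theorem smooth_christoffel (hG : IsMetricOn G Ω) (c i j : Fin k) :
    ContDiffOn ℝ ∞ (fun y => christoffel G y c i j) Ω := by
  unfold christoffel
  refine contDiffOn_const.mul (ContDiffOn.sum fun l _ => (hG.smooth_inv c l).mul ?_)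
  exact ((contDiffOn_pd hG.isOpen (hG.smooth _ _) _).add
    (contDiffOn_pd hG.isOpen (hG.smooth _ _) _)).sub (contDiffOn_pd hG.isOpen (hG.smooth _ _) _)

theorem smooth_curvOp (hG : IsMetricOn G Ω) (i j c l : Fin k) :
    ContDiffOn ℝ ∞ (fun y => curvOp G y i j c l) Ω := by
  unfold curvOp
  have h := hG.smooth_christoffel
  refine ((contDiffOn_pd hG.isOpen (h _ _ _) _).sub (contDiffOn_pd hG.isOpen (h _ _ _) _)).add ?_
  exact ContDiffOn.sum fun m _ => ((h _ _ _).mul (h _ _ _)).sub ((h _ _ _).mul (h _ _ _))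

theorem smooth_riemann (hG : IsMetricOn G Ω) (i j c l : Fin k) :
    ContDiffOn ℝ ∞ (fun y => riemann G y i j c l) Ω := by
  unfold riemann
  exact ContDiffOn.sum fun m _ => (hG.smooth _ _).mul (hG.smooth_curvOp _ _ _ _)

theorem smooth_ricci (hG : IsMetricOn G Ω) (i j : Fin k) :
    ContDiffOn ℝ ∞ (fun y => ricci G y i j) Ω := by
  unfold ricci
  exact ContDiffOn.sum fun m _ => hG.smooth_curvOp _ _ _ _

theorem smooth_scalar (hG : IsMetricOn G Ω) : ContDiffOn ℝ ∞ (fun y => scalar G y) Ω := by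
  unfold scalar
  exact ContDiffOn.sum fun i _ => ContDiffOn.sum fun j _ =>
    (hG.smooth_inv _ _).mul (hG.smooth_ricci _ _)

theorem christoffel_symm (hG : IsMetricOn G Ω) (hy : y ∈ Ω) (c i j : Fin k) :
    christoffel G y c i j = christoffel G y c j i := by
  unfold christoffel
  congr 1
  refine Finset.sum_congr rfl fun l _ => ?_
  rw [pd_congr_on hG.isOpen hy (fun z hz => hG.symm hz i j) l]
  ring

theorem sum_metric_christoffel (hG : IsMetricOn G Ω) (hy : y ∈ Ω) (b i j : Fin k) :
    ∑ c, G y b c * christoffel G y c i j = (1 / 2) *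
      (pd (fun z => G z j b) y i + pd (fun z => G z i b) y j - pd (fun z => G z i j) y b) := by
  unfold christoffel
  have : ∀ c, G y b c * ((1 / 2) * ∑ l, (G y)⁻¹ c l *
      (pd (fun z => G z j l) y i + pd (fun z => G z i l) y j - pd (fun z => G z i j) y l))
      = (1 / 2) * ∑ l, (G y b c * (G y)⁻¹ c l) *
      (pd (fun z => G z j l) y i + pd (fun z => G z i l) y j - pd (fun z => G z i j) y l) := by
    intro c
    rw [Finset.mul_sum, Finset.mul_sum, Finset.mul_sum]
    exact Finset.sum_congr rfl fun l _ => by ring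
  rw [Finset.sum_congr rfl fun c _ => this c, ← Finset.mul_sum, Finset.sum_comm]
  simp_rw [← Finset.sum_mul, hG.mul_inv hy]
  simp

/-- Metric compatibility of the Levi-Civita connection. -/
theorem pd_metric (hG : IsMetricOn G Ω) (hy : y ∈ Ω) (a i j : Fin k) :
    pd (fun z => G z i j) y a
      = ∑ m, christoffel G y m a i * G y m j + ∑ m, christoffel G y m a j * G y i m := by
  have h1 : ∑ m, christoffel G y m a i * G y m j = ∑ m, G y j m * christoffel G y m a i :=
    Finset.sum_congr rfl fun m _ => by rw [hG.symm hy m j, mul_comm]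
  have h2 : ∑ m, christoffel G y m a j * G y i m = ∑ m, G y i m * christoffel G y m a j :=
    Finset.sum_congr rfl fun m _ => mul_comm _ _
  rw [h1, h2, hG.sum_metric_christoffel hy, hG.sum_metric_christoffel hy,
    pd_congr_on hG.isOpen hy (fun z hz => hG.symm hz j i) a]
  ring

end IsMetricOn

/-- The matrix `(Γ^l_{ic})_{l,c}` of the connection form in the direction `∂_i`. -/
def connMatrix (G : Eu k → Matrix (Fin k) (Fin k) ℝ) (y : Eu k) (i : Fin k) :
    Matrix (Fin k) (Fin k) ℝ :=
  Matrix.of fun l c => christoffel G y l i c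

/-- The matrix of the curvature operator `R(∂_i, ∂_j)`. -/
def curvMatrix (G : Eu k → Matrix (Fin k) (Fin k) ℝ) (y : Eu k) (i j : Fin k) :
    Matrix (Fin k) (Fin k) ℝ :=
  Matrix.of fun l c => curvOp G y i j c l

theorem riemann_eq (G : Eu k → Matrix (Fin k) (Fin k) ℝ) (y : Eu k) (i j c l : Fin k) :
    riemann G y i j c l = (G y * curvMatrix G y i j) c l := by
  simp [riemann, curvMatrix, Matrix.mul_apply]

theorem curvMatrix_eq (G : Eu k → Matrix (Fin k) (Fin k) ℝ) (y : Eu k) (i j : Fin k) :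
    curvMatrix G y i j = pdM (fun z => connMatrix G z j) y i - pdM (fun z => connMatrix G z i) y j
      + (connMatrix G y i * connMatrix G y j - connMatrix G y j * connMatrix G y i) := by
  ext l c
  simp only [curvMatrix, connMatrix, pdM, curvOp, Matrix.add_apply, Matrix.sub_apply,
    Matrix.mul_apply, Matrix.of_apply, Finset.sum_sub_distrib]
  congr 2 <;> exact Finset.sum_congr rfl fun m _ => mul_comm _ _

namespace IsMetricOn

variable {G : Eu k → Matrix (Fin k) (Fin k) ℝ} {Ω : Set (Eu k)} {y : Eu k}

theorem dAt_metric (hG : IsMetricOn G Ω) (hy : y ∈ Ω) (i j : Fin k) :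
    DifferentiableAt ℝ (fun z => G z i j) y := ContDiffOn.dAt (hG.smooth i j) hG.isOpen hy

theorem dAt_conn (hG : IsMetricOn G Ω) (hy : y ∈ Ω) (a i j : Fin k) :
    DifferentiableAt ℝ (fun z => connMatrix G z a i j) y :=
  ContDiffOn.dAt (hG.smooth_christoffel i a j) hG.isOpen hy

/-- Metric compatibility in matrix form, with `A_a` the connection matrix: `∂_a G = A_aᵀ G + G A_a`.
In this notation the curvature identities become identities in a noncommutative ring. -/
theorem pdM_metric (hG : IsMetricOn G Ω) (hy : y ∈ Ω) (a : Fin k) :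
    pdM G y a = (connMatrix G y a)ᵀ * G y + G y * connMatrix G y a := by
  ext i j
  rw [pdM, Matrix.of_apply, hG.pd_metric hy]
  simp only [Matrix.add_apply, Matrix.mul_apply, Matrix.transpose_apply, connMatrix,
    Matrix.of_apply]
  congr 1
  exact Finset.sum_congr rfl fun m _ => mul_comm _ _

theorem pdM_pdM_metric (hG : IsMetricOn G Ω) (hy : y ∈ Ω) (a b : Fin k) :
    pdM (fun z => pdM G z b) y a =
      (pdM (fun z => connMatrix G z b) y a)ᵀ * G y + (connMatrix G y b)ᵀ * pdM G y a
      + (pdM G y a * connMatrix G y b + G y * pdM (fun z => connMatrix G z b) y a) := by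
  have h1 : pdM (fun z => pdM G z b) y a
      = pdM (fun z => (connMatrix G z b)ᵀ * G z + G z * connMatrix G z b) y a := by
    ext i j
    exact pd_congr_on hG.isOpen hy (fun z hz => congrFun (congrFun (hG.pdM_metric hz b) i) j) a
  have hA := hG.dAt_conn hy b
  have hAt : ∀ i j, DifferentiableAt ℝ (fun z => (connMatrix G z b)ᵀ i j) y := fun i j => hA j i
  have hg := hG.dAt_metric hy
  have hm1 : ∀ i j, DifferentiableAt ℝ (fun z => ((connMatrix G z b)ᵀ * G z) i j) y := by
    intro i j
    simp only [Matrix.mul_apply]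
    exact DifferentiableAt.fun_sum fun m _ => (hAt i m).fun_mul (hg m j)
  have hm2 : ∀ i j, DifferentiableAt ℝ (fun z => (G z * connMatrix G z b) i j) y := by
    intro i j
    simp only [Matrix.mul_apply]
    exact DifferentiableAt.fun_sum fun m _ => (hg i m).fun_mul (hA m j)
  rw [h1, pdM_add hm1 hm2, pdM_mul hAt hg, pdM_mul hg hA]
  rfl

/-- The second partial derivatives of `G` commute. Expanding both orders by metric compatibility,
their difference is exactly `G F + (G F)ᵀ` for the curvature matrix `F`. -/
theorem metric_mul_curvMatrix (hG : IsMetricOn G Ω) (hy : y ∈ Ω) (i j : Fin k) :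
    G y * curvMatrix G y i j = - (G y * curvMatrix G y i j)ᵀ := by
  have hc : pdM (fun z => pdM G z j) y i = pdM (fun z => pdM G z i) y j := by
    ext a b
    exact pd_comm hG.isOpen (hG.smooth a b) hy i j
  rw [hG.pdM_pdM_metric hy, hG.pdM_pdM_metric hy, hG.pdM_metric hy, hG.pdM_metric hy] at hc
  rw [curvMatrix_eq]
  simp only [Matrix.transpose_mul, Matrix.transpose_add, Matrix.transpose_sub,
    hG.transpose_eq hy]
  rw [← sub_eq_zero] at hc ⊢
  rw [← hc]
  noncomm_ring

theorem riemann_skew_right (hG : IsMetricOn G Ω) (hy : y ∈ Ω) (i j c l : Fin k) :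
    riemann G y i j c l = - riemann G y i j l c := by
  rw [riemann_eq, riemann_eq]
  exact congrFun (congrFun (hG.metric_mul_curvMatrix hy i j) c) l

end IsMetricOn

theorem curvOp_skew (G : Eu k → Matrix (Fin k) (Fin k) ℝ) (y : Eu k) (i j c l : Fin k) :
    curvOp G y i j c l = - curvOp G y j i c l := by
  simp only [curvOp, Finset.sum_sub_distrib]; ring

theorem riemann_skew_left (G : Eu k → Matrix (Fin k) (Fin k) ℝ) (y : Eu k) (i j c l : Fin k) :
    riemann G y i j c l = - riemann G y j i c l := by
  simp only [riemann, ← Finset.sum_neg_distrib]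
  exact Finset.sum_congr rfl fun m _ => by rw [curvOp_skew]; ring

namespace IsMetricOn

variable {G : Eu k → Matrix (Fin k) (Fin k) ℝ} {Ω : Set (Eu k)} {y : Eu k}

theorem curvOp_cyclic (hG : IsMetricOn G Ω) (hy : y ∈ Ω) (i j c l : Fin k) :
    curvOp G y i j c l + curvOp G y j c i l + curvOp G y c i j l = 0 := by
  simp only [curvOp, Finset.sum_sub_distrib]
  rw [pd_congr_on hG.isOpen hy (fun z hz => hG.christoffel_symm hz l j c) i,
    pd_congr_on hG.isOpen hy (fun z hz => hG.christoffel_symm hz l i c) j,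
    pd_congr_on hG.isOpen hy (fun z hz => hG.christoffel_symm hz l j i) c]
  simp only [hG.christoffel_symm hy _ j c, hG.christoffel_symm hy _ i c,
    hG.christoffel_symm hy _ j i]
  ring

theorem riemann_cyclic (hG : IsMetricOn G Ω) (hy : y ∈ Ω) (i j c l : Fin k) :
    riemann G y i j l c + riemann G y j c l i + riemann G y c i l j = 0 := by
  simp only [riemann, ← Finset.sum_add_distrib, ← mul_add]
  exact Finset.sum_eq_zero fun m _ => by rw [hG.curvOp_cyclic hy]; ring

/-- The classical argument: add the four cyclic identities for the permutations of `i, j, c, l` and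
cancel with the skew symmetries. -/
theorem riemann_pair (hG : IsMetricOn G Ω) (hy : y ∈ Ω) (i j c l : Fin k) :
    riemann G y i j c l = riemann G y c l i j := by
  have b := hG.riemann_cyclic hy
  have s := riemann_skew_left G y
  have r := hG.riemann_skew_right hy
  linarith [b i j c l, b j c l i, b c l i j, b l i j c, s i j c l, s i j l c, r i j l c, s c l i j,
    r c l i j, s j c i l, s j c l i, r j c l i, s l i c j, r l i c j, s l i j c, s c i j l,
    s c i l j, r c i j l, s j l i c, s j l c i, r j l i c, s i c j l, s l j i c, r i c j l,
    r l j i c, r c i l j]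

end IsMetricOn
end Metric

/-! ### Covariant derivatives of tensors of fixed rank, second Bianchi identity -/

section CovariantDerivatives

variable {k : ℕ} {G : Eu k → Matrix (Fin k) (Fin k) ℝ} {Ω : Set (Eu k)} {y : Eu k}

/-- The covariant derivative `(∇_a T)_i` of a 1-form. -/
def covD1 (G : Eu k → Matrix (Fin k) (Fin k) ℝ) (T : Eu k → Fin k → ℝ)
    (y : Eu k) (a i : Fin k) : ℝ :=
  pd (fun z => T z i) y a - ∑ m, christoffel G y m a i * T y m

/-- The covariant derivative `(∇_a T)_{ij}` of a covariant 2-tensor. -/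
def covD2 (G : Eu k → Matrix (Fin k) (Fin k) ℝ) (T : Eu k → Fin k → Fin k → ℝ)
    (y : Eu k) (a i j : Fin k) : ℝ :=
  pd (fun z => T z i j) y a - ∑ m, christoffel G y m a i * T y m j
    - ∑ m, christoffel G y m a j * T y i m

/-- The covariant derivative `(∇_a T)_{ijc}` of a covariant 3-tensor. -/
def covD3 (G : Eu k → Matrix (Fin k) (Fin k) ℝ) (T : Eu k → Fin k → Fin k → Fin k → ℝ)
    (y : Eu k) (a i j c : Fin k) : ℝ :=
  pd (fun z => T z i j c) y a - ∑ m, christoffel G y m a i * T y m j c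
    - ∑ m, christoffel G y m a j * T y i m c - ∑ m, christoffel G y m a c * T y i j m

/-- The covariant derivative `(∇_a T)_{ijcl}` of a covariant 4-tensor. -/
def covD4 (G : Eu k → Matrix (Fin k) (Fin k) ℝ) (T : Eu k → Fin k → Fin k → Fin k → Fin k → ℝ)
    (y : Eu k) (a i j c l : Fin k) : ℝ :=
  pd (fun z => T z i j c l) y a - ∑ m, christoffel G y m a i * T y m j c l
    - ∑ m, christoffel G y m a j * T y i m c l - ∑ m, christoffel G y m a c * T y i j m l
    - ∑ m, christoffel G y m a l * T y i j c m

/-- Translates between the multi-index derivative of the definitions and the version with explicit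
indices, for which product rules are easy to state. -/
theorem covDeriv_four (T : Eu k → (Fin 4 → Fin k) → ℝ) (a i j c l : Fin k) :
    covDeriv G T y a ![i, j, c, l] = covD4 G (fun z i j c l => T z ![i, j, c, l]) y a i j c l := by
  have h0 : ∀ m, Function.update ![i, j, c, l] 0 m = ![m, j, c, l] := fun m => by
    ext x; fin_cases x <;> rfl
  have h1 : ∀ m, Function.update ![i, j, c, l] 1 m = ![i, m, c, l] := fun m => by
    ext x; fin_cases x <;> rfl
  have h2 : ∀ m, Function.update ![i, j, c, l] 2 m = ![i, j, m, l] := fun m => by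
    ext x; fin_cases x <;> rfl
  have h3 : ∀ m, Function.update ![i, j, c, l] 3 m = ![i, j, c, m] := fun m => by
    ext x; fin_cases x <;> rfl
  simp only [covDeriv, covD4, Fin.sum_univ_four, h0, h1, h2, h3]
  simp
  ring

theorem covDeriv_three (T : Eu k → (Fin 3 → Fin k) → ℝ) (a i j c : Fin k) :
    covDeriv G T y a ![i, j, c] = covD3 G (fun z i j c => T z ![i, j, c]) y a i j c := by
  have h0 : ∀ m, Function.update ![i, j, c] 0 m = ![m, j, c] := fun m => by
    ext x; fin_cases x <;> rfl
  have h1 : ∀ m, Function.update ![i, j, c] 1 m = ![i, m, c] := fun m => by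
    ext x; fin_cases x <;> rfl
  have h2 : ∀ m, Function.update ![i, j, c] 2 m = ![i, j, m] := fun m => by
    ext x; fin_cases x <;> rfl
  simp only [covDeriv, covD3, Fin.sum_univ_three, h0, h1, h2]
  simp
  ring

theorem covD2_congr (hΩ : IsOpen Ω) (hy : y ∈ Ω) {S T : Eu k → Fin k → Fin k → ℝ}
    (h : ∀ z ∈ Ω, ∀ i j, S z i j = T z i j) (a i j : Fin k) :
    covD2 G S y a i j = covD2 G T y a i j := by
  simp only [covD2, pd_congr_on hΩ hy (fun z hz => h z hz i j), h y hy]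

theorem covD3_congr (hΩ : IsOpen Ω) (hy : y ∈ Ω) {S T : Eu k → Fin k → Fin k → Fin k → ℝ}
    (h : ∀ z ∈ Ω, ∀ i j c, S z i j c = T z i j c) (a i j c : Fin k) :
    covD3 G S y a i j c = covD3 G T y a i j c := by
  simp only [covD3, pd_congr_on hΩ hy (fun z hz => h z hz i j c), h y hy]

theorem covD3_const_mul {T : Eu k → Fin k → Fin k → Fin k → ℝ}
    (hT : ∀ i j c, DifferentiableAt ℝ (fun z => T z i j c) y) (r : ℝ) (a i j c : Fin k) :
    covD3 G (fun z i j c => r * T z i j c) y a i j c = r * covD3 G T y a i j c := by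
  simp only [covD3, pd_const_mul (hT i j c), mul_sub, Finset.mul_sum]
  congr 1
  · congr 1
    · congr 1
      exact Finset.sum_congr rfl fun m _ => by ring
    · exact Finset.sum_congr rfl fun m _ => by ring
  · exact Finset.sum_congr rfl fun m _ => by ring

theorem covD4_add {S T : Eu k → Fin k → Fin k → Fin k → Fin k → ℝ}
    (hS : ∀ i j c l, DifferentiableAt ℝ (fun z => S z i j c l) y)
    (hT : ∀ i j c l, DifferentiableAt ℝ (fun z => T z i j c l) y) (a i j c l : Fin k) :
    covD4 G (fun z i j c l => S z i j c l + T z i j c l) y a i j c l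
      = covD4 G S y a i j c l + covD4 G T y a i j c l := by
  simp only [covD4, pd_add (hS i j c l) (hT i j c l), mul_add, Finset.sum_add_distrib]
  ring

theorem covD4_sub {S T : Eu k → Fin k → Fin k → Fin k → Fin k → ℝ}
    (hS : ∀ i j c l, DifferentiableAt ℝ (fun z => S z i j c l) y)
    (hT : ∀ i j c l, DifferentiableAt ℝ (fun z => T z i j c l) y) (a i j c l : Fin k) :
    covD4 G (fun z i j c l => S z i j c l - T z i j c l) y a i j c l
      = covD4 G S y a i j c l - covD4 G T y a i j c l := by
  simp only [covD4, pd_sub (hS i j c l) (hT i j c l), mul_sub, Finset.sum_sub_distrib]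
  ring

theorem covD4_mul {f : Eu k → ℝ} {T : Eu k → Fin k → Fin k → Fin k → Fin k → ℝ}
    (hf : DifferentiableAt ℝ f y)
    (hT : ∀ i j c l, DifferentiableAt ℝ (fun z => T z i j c l) y) (a i j c l : Fin k) :
    covD4 G (fun z i j c l => f z * T z i j c l) y a i j c l
      = pd f y a * T y i j c l + f y * covD4 G T y a i j c l := by
  simp only [covD4, pd_mul hf (hT i j c l), mul_left_comm _ (f y), ← Finset.mul_sum]
  ring

theorem covD4_mul_ic_jl {S T : Eu k → Fin k → Fin k → ℝ}
    (hS : ∀ i j, DifferentiableAt ℝ (fun z => S z i j) y)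
    (hT : ∀ i j, DifferentiableAt ℝ (fun z => T z i j) y) (a i j c l : Fin k) :
    covD4 G (fun z i j c l => S z i c * T z j l) y a i j c l
      = covD2 G S y a i c * T y j l + S y i c * covD2 G T y a j l := by
  simp only [covD4, covD2, pd_mul (hS i c) (hT j l), mul_left_comm _ (S y i c), ← mul_assoc,
    ← Finset.sum_mul]
  simp only [mul_assoc, ← Finset.mul_sum]
  ring

theorem covD4_mul_il_jc {S T : Eu k → Fin k → Fin k → ℝ}
    (hS : ∀ i j, DifferentiableAt ℝ (fun z => S z i j) y)
    (hT : ∀ i j, DifferentiableAt ℝ (fun z => T z i j) y) (a i j c l : Fin k) :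
    covD4 G (fun z i j c l => S z i l * T z j c) y a i j c l
      = covD2 G S y a i l * T y j c + S y i l * covD2 G T y a j c := by
  simp only [covD4, covD2, pd_mul (hS i l) (hT j c), mul_left_comm _ (S y i l), ← mul_assoc,
    ← Finset.sum_mul]
  simp only [mul_assoc, ← Finset.mul_sum]
  ring

namespace IsMetricOn

theorem covD2_metric (hG : IsMetricOn G Ω) (hy : y ∈ Ω) (a i j : Fin k) :
    covD2 G (fun z => G z) y a i j = 0 := by
  simp only [covD2, hG.pd_metric hy]; ring

/-- Differentiate `G⁻¹ G = 1`, insert metric compatibility and multiply by `G⁻¹` on the right. -/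
theorem pdM_inv (hG : IsMetricOn G Ω) (hy : y ∈ Ω) (a : Fin k) :
    pdM (fun z => (G z)⁻¹) y a
      = - (connMatrix G y a * (G y)⁻¹) - (G y)⁻¹ * (connMatrix G y a)ᵀ := by
  have hq : ∀ i j, DifferentiableAt ℝ (fun z => (G z)⁻¹ i j) y := fun i j =>
    ContDiffOn.dAt (hG.smooth_inv i j) hG.isOpen hy
  have h := pdM_mul (H := G) hq (hG.dAt_metric hy) a
  have h0 : pdM (fun z => (G z)⁻¹ * G z) y a = 0 := by
    ext i j
    have : pd (fun z => ((G z)⁻¹ * G z) i j) y a = pd (fun _ => (1 : Matrix (Fin k) (Fin k) ℝ) i j) y a :=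
      pd_congr_on hG.isOpen hy (fun z hz => by
        rw [Matrix.nonsing_inv_mul _ (hG.isUnit_det hz)]) a
    simpa [pdM] using this
  rw [h0, hG.pdM_metric hy] at h
  have hu := hG.isUnit_det hy
  have h2 : pdM (fun z => (G z)⁻¹) y a * G y * (G y)⁻¹ = pdM (fun z => (G z)⁻¹) y a := by
    rw [Matrix.mul_assoc, Matrix.mul_nonsing_inv _ hu, Matrix.mul_one]
  rw [← h2, eq_neg_of_add_eq_zero_left h.symm, Matrix.mul_add, ← Matrix.mul_assoc (G y)⁻¹ (G y),
    Matrix.nonsing_inv_mul _ hu, Matrix.one_mul, Matrix.neg_mul, Matrix.add_mul,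
    ← Matrix.mul_assoc, Matrix.mul_assoc _ (G y) (G y)⁻¹, Matrix.mul_nonsing_inv _ hu,
    Matrix.mul_one]
  abel

theorem pd_inv (hG : IsMetricOn G Ω) (hy : y ∈ Ω) (a i j : Fin k) :
    pd (fun z => (G z)⁻¹ i j) y a = - ∑ m, christoffel G y i a m * (G y)⁻¹ m j
      - ∑ m, christoffel G y j a m * (G y)⁻¹ i m := by
  have := congrFun (congrFun (hG.pdM_inv hy a) i) j
  simp only [pdM, Matrix.of_apply, Matrix.sub_apply, Matrix.neg_apply, Matrix.mul_apply,
    connMatrix, Matrix.transpose_apply] at this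
  rw [this]
  congr 1
  exact Finset.sum_congr rfl fun m _ => mul_comm _ _

/-- Contraction with the inverse metric commutes with covariant differentiation. -/
theorem pd_trace (hG : IsMetricOn G Ω) (hy : y ∈ Ω) {T : Eu k → Fin k → Fin k → ℝ}
    (hT : ∀ i j, DifferentiableAt ℝ (fun z => T z i j) y) (a : Fin k) :
    pd (fun z => ∑ i, ∑ j, (G z)⁻¹ i j * T z i j) y a
      = ∑ i, ∑ j, (G y)⁻¹ i j * covD2 G T y a i j := by
  have hq : ∀ i j, DifferentiableAt ℝ (fun z => (G z)⁻¹ i j) y := fun i j =>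
    ContDiffOn.dAt (hG.smooth_inv i j) hG.isOpen hy
  have h1 : ∑ i, ∑ j, ∑ m, christoffel G y i a m * (G y)⁻¹ m j * T y i j
      = ∑ i, ∑ j, ∑ m, (G y)⁻¹ i j * (christoffel G y m a i * T y m j) := by
    calc _ = ∑ j, ∑ i, ∑ m, christoffel G y i a m * (G y)⁻¹ m j * T y i j := Finset.sum_comm
      _ = ∑ j, ∑ i, ∑ m, (G y)⁻¹ i j * (christoffel G y m a i * T y m j) := by
        refine Finset.sum_congr rfl fun j _ => ?_
        rw [Finset.sum_comm]
        exact Finset.sum_congr rfl fun i _ => Finset.sum_congr rfl fun m _ => by ring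
      _ = _ := Finset.sum_comm
  have h2 : ∑ i, ∑ j, ∑ m, christoffel G y j a m * (G y)⁻¹ i m * T y i j
      = ∑ i, ∑ j, ∑ m, (G y)⁻¹ i j * (christoffel G y m a j * T y i m) := by
    refine Finset.sum_congr rfl fun i _ => ?_
    rw [Finset.sum_comm]
    exact Finset.sum_congr rfl fun j _ => Finset.sum_congr rfl fun m _ => by ring
  rw [pd_sum fun i _ => DifferentiableAt.fun_sum fun j _ => (hq i j).fun_mul (hT i j)]
  simp_rw [pd_sum fun j _ => (hq _ j).fun_mul (hT _ j), pd_mul (hq _ _) (hT _ _), hG.pd_inv hy,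
    covD2, mul_sub, Finset.mul_sum, sub_mul, neg_mul, Finset.sum_mul, Finset.sum_add_distrib,
    Finset.sum_sub_distrib, Finset.sum_neg_distrib, h1, h2]
  ring

end IsMetricOn

/-- The matrix of `(∇_a R)(∂_i, ∂_j)`. -/
def curvDMatrix (G : Eu k → Matrix (Fin k) (Fin k) ℝ) (y : Eu k) (a i j : Fin k) :
    Matrix (Fin k) (Fin k) ℝ :=
  pdM (fun z => curvMatrix G z i j) y a + connMatrix G y a * curvMatrix G y i j
    - curvMatrix G y i j * connMatrix G y a
    - ∑ m, (christoffel G y m a i • curvMatrix G y m j + christoffel G y m a j • curvMatrix G y i m)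

theorem curvMatrix_skew (G : Eu k → Matrix (Fin k) (Fin k) ℝ) (y : Eu k) (i j : Fin k) :
    curvMatrix G y i j = - curvMatrix G y j i := by
  ext l c
  exact curvOp_skew G y i j c l

namespace IsMetricOn

theorem pdM_curvMatrix (hG : IsMetricOn G Ω) (hy : y ∈ Ω) (a i j : Fin k) :
    pdM (fun z => curvMatrix G z i j) y a =
      pdM (fun z => pdM (fun w => connMatrix G w j) z i) y a
      - pdM (fun z => pdM (fun w => connMatrix G w i) z j) y a
      + ((pdM (fun z => connMatrix G z i) y a * connMatrix G y j
          + connMatrix G y i * pdM (fun z => connMatrix G z j) y a)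
        - (pdM (fun z => connMatrix G z j) y a * connMatrix G y i
          + connMatrix G y j * pdM (fun z => connMatrix G z i) y a)) := by
  have hA := hG.dAt_conn hy
  have hdA : ∀ i j p q, DifferentiableAt ℝ (fun z => pdM (fun w => connMatrix G w j) z i p q) y :=
    fun i j p q => ContDiffOn.dAt (contDiffOn_pd hG.isOpen (hG.smooth_christoffel p j q) i)
      hG.isOpen hy
  have hm : ∀ i j p q, DifferentiableAt ℝ (fun z => (connMatrix G z i * connMatrix G z j) p q) y := by
    intro i j p q
    simp only [Matrix.mul_apply]
    exact DifferentiableAt.fun_sum fun m _ => (hA i p m).fun_mul (hA j m q)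
  have h1 : pdM (fun z => curvMatrix G z i j) y a = pdM (fun z =>
      (pdM (fun w => connMatrix G w j) z i - pdM (fun w => connMatrix G w i) z j)
      + (connMatrix G z i * connMatrix G z j - connMatrix G z j * connMatrix G z i)) y a := by
    congr 1; funext z; exact curvMatrix_eq G z i j
  rw [h1, pdM_add
    (F := fun z => pdM (fun w => connMatrix G w j) z i - pdM (fun w => connMatrix G w i) z j)
    (H := fun z => connMatrix G z i * connMatrix G z j - connMatrix G z j * connMatrix G z i)
    (fun p q => (hdA i j p q).fun_sub (hdA j i p q))
    (fun p q => (hm i j p q).fun_sub (hm j i p q)),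
    pdM_sub (hdA i j) (hdA j i), pdM_sub (hm i j) (hm j i), pdM_mul (hA i) (hA j),
    pdM_mul (hA j) (hA i)]

/-- The second Bianchi identity. -/
theorem curvDMatrix_cyclic (hG : IsMetricOn G Ω) (hy : y ∈ Ω) (a i j : Fin k) :
    curvDMatrix G y a i j + curvDMatrix G y i j a + curvDMatrix G y j a i = 0 := by
  have hs : ∀ a i j, pdM (fun z => pdM (fun w => connMatrix G w j) z i) y a
      = pdM (fun z => pdM (fun w => connMatrix G w j) z a) y i := by
    intro a i j
    ext p q
    exact pd_comm hG.isOpen (hG.smooth_christoffel p j q) hy a i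
  -- Corrections for the two form indices: in the cyclic sum they cancel in pairs, because the
  -- connection is torsion free and the curvature is skew.
  have ht : ∑ m, (christoffel G y m a i • curvMatrix G y m j + christoffel G y m a j • curvMatrix G y i m)
      + ∑ m, (christoffel G y m i j • curvMatrix G y m a + christoffel G y m i a • curvMatrix G y j m)
      + ∑ m, (christoffel G y m j a • curvMatrix G y m i + christoffel G y m j i • curvMatrix G y a m)
      = 0 := by
    rw [← Finset.sum_add_distrib, ← Finset.sum_add_distrib]
    refine Finset.sum_eq_zero fun m _ => ?_
    rw [hG.christoffel_symm hy m i a, hG.christoffel_symm hy m j a, hG.christoffel_symm hy m j i,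
      curvMatrix_skew G y i m, curvMatrix_skew G y j m, curvMatrix_skew G y a m]
    simp only [smul_neg]
    abel
  have e1 : curvDMatrix G y a i j + curvDMatrix G y i j a + curvDMatrix G y j a i
      = (pdM (fun z => curvMatrix G z i j) y a + connMatrix G y a * curvMatrix G y i j
          - curvMatrix G y i j * connMatrix G y a)
        + (pdM (fun z => curvMatrix G z j a) y i + connMatrix G y i * curvMatrix G y j a
          - curvMatrix G y j a * connMatrix G y i)
        + (pdM (fun z => curvMatrix G z a i) y j + connMatrix G y j * curvMatrix G y a i
          - curvMatrix G y a i * connMatrix G y j) := by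
    unfold curvDMatrix
    rw [eq_neg_of_add_eq_zero_right ht]
    abel
  -- What remains is `dF + [A, F] = 0` for `F = dA + A ∧ A`. Once the second partials of `A` are
  -- matched by `hs`, it is an identity of noncommutative polynomials.
  rw [e1, hG.pdM_curvMatrix hy, hG.pdM_curvMatrix hy, hG.pdM_curvMatrix hy, hs i a j, hs j a i,
    hs j i a, curvMatrix_eq, curvMatrix_eq, curvMatrix_eq]
  noncomm_ring

end IsMetricOn

end CovariantDerivatives

/-! ### Contracted Bianchi identities; the divergence of Weyl and the Bach tensor -/

section Contractions

variable {k : ℕ} {G : Eu k → Matrix (Fin k) (Fin k) ℝ} {Ω : Set (Eu k)} {y : Eu k}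

/-- `Ric` is a trace of the curvature endomorphism over an upper and a lower index, so its covariant
derivative is the same trace of `∇R` and no metric enters. -/
theorem covD2_ricci (hG : IsMetricOn G Ω) (hy : y ∈ Ω) (a i j : Fin k) :
    covD2 G (ricci G) y a i j = ∑ m, curvDMatrix G y a m i m j := by
  have h1 : ∑ m, ∑ p, connMatrix G y a m p * curvMatrix G y m i p j
      = ∑ m, ∑ p, christoffel G y p a m * curvMatrix G y p i m j := by
    rw [Finset.sum_comm]; rfl
  have h2 : ∑ m, ∑ p, curvMatrix G y m i m p * connMatrix G y a p j
      = ∑ p, ∑ m, christoffel G y p a j * curvMatrix G y m i m p := by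
    rw [Finset.sum_comm]
    exact Finset.sum_congr rfl fun p _ => Finset.sum_congr rfl fun m _ => mul_comm _ _
  have h3 : ∑ p, ∑ m, christoffel G y p a i * curvMatrix G y m p m j
      = ∑ m, ∑ p, christoffel G y p a i * curvMatrix G y m p m j := Finset.sum_comm
  have h4 : pd (fun z => ricci G z i j) y a = ∑ m, pdM (fun z => curvMatrix G z m i) y a m j := by
    unfold ricci
    rw [pd_sum fun m _ => ContDiffOn.dAt (hG.smooth_curvOp m i j m) hG.isOpen hy]
    rfl
  have h5 : ∀ p q, ricci G y p q = ∑ m, curvMatrix G y m p m q := fun p q => rfl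
  simp only [covD2, h4, h5, curvDMatrix, Matrix.sub_apply, Matrix.add_apply, Matrix.mul_apply,
    Matrix.sum_apply, Matrix.smul_apply, smul_eq_mul, Finset.sum_sub_distrib,
    Finset.sum_add_distrib, Finset.mul_sum, h1, h2, h3]
  ring

/-- Lowering an index commutes with `∇` because `G` is parallel. Identities for `∇R` can thus be
proved for the matrices `curvDMatrix` and transferred. -/
theorem covD4_riemann (hG : IsMetricOn G Ω) (hy : y ∈ Ω) (a i j c l : Fin k) :
    covD4 G (riemann G) y a i j c l = (G y * curvDMatrix G y a i j) c l := by
  have hF : ∀ p q, DifferentiableAt ℝ (fun z => curvMatrix G z i j p q) y := fun p q =>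
    ContDiffOn.dAt (hG.smooth_curvOp i j q p) hG.isOpen hy
  have h1 : pd (fun z => riemann G z i j c l) y a
      = (((connMatrix G y a)ᵀ * G y + G y * connMatrix G y a) * curvMatrix G y i j
        + G y * pdM (fun z => curvMatrix G z i j) y a) c l := by
    have := pdM_mul (F := G) (hG.dAt_metric hy) hF a
    rw [hG.pdM_metric hy] at this
    rw [← this]
    exact pd_congr_on hG.isOpen hy (fun z _ => riemann_eq G z i j c l) a
  have h2 : ∑ m, christoffel G y m a c * riemann G y i j m l
      = ((connMatrix G y a)ᵀ * G y * curvMatrix G y i j) c l := by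
    rw [Matrix.mul_assoc, Matrix.mul_apply]
    exact Finset.sum_congr rfl fun m _ => by rw [riemann_eq]; rfl
  have h3 : ∑ m, christoffel G y m a l * riemann G y i j c m
      = (G y * curvMatrix G y i j * connMatrix G y a) c l := by
    rw [Matrix.mul_apply]
    exact Finset.sum_congr rfl fun m _ => by rw [riemann_eq, mul_comm]; rfl
  have h4 : (G y * ∑ m, (christoffel G y m a i • curvMatrix G y m j
        + christoffel G y m a j • curvMatrix G y i m)) c l
      = ∑ m, christoffel G y m a i * riemann G y m j c l
        + ∑ m, christoffel G y m a j * riemann G y i m c l := by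
    rw [Matrix.mul_sum, Matrix.sum_apply, ← Finset.sum_add_distrib]
    refine Finset.sum_congr rfl fun m _ => ?_
    rw [Matrix.mul_add, Matrix.mul_smul, Matrix.mul_smul, riemann_eq, riemann_eq]
    rfl
  unfold covD4 curvDMatrix
  rw [h1, h2, h3, Matrix.mul_sub, Matrix.sub_apply, h4, Matrix.mul_sub, Matrix.mul_add,
    Matrix.add_mul]
  simp only [Matrix.add_apply, Matrix.sub_apply, Matrix.mul_assoc]
  ring

/-- Raising an index with `G⁻¹` and lowering it with `G`. -/
theorem sum_inv_metric_mul (hG : IsMetricOn G Ω) (hy : y ∈ Ω) (F : Matrix (Fin k) (Fin k) ℝ)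
    (a l : Fin k) : ∑ b, (G y)⁻¹ a b * (G y * F) b l = F a l := by
  rw [← Matrix.mul_apply, ← Matrix.mul_assoc, Matrix.nonsing_inv_mul _ (hG.isUnit_det hy),
    Matrix.one_mul]

theorem ricci_eq_sum_riemann (hG : IsMetricOn G Ω) (hy : y ∈ Ω) (i j : Fin k) :
    ricci G y i j = ∑ a, ∑ b, (G y)⁻¹ a b * riemann G y a i b j := by
  simp only [riemann_eq, sum_inv_metric_mul hG hy]
  rfl

theorem ricci_symm (hG : IsMetricOn G Ω) (hy : y ∈ Ω) (i j : Fin k) :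
    ricci G y i j = ricci G y j i := by
  rw [ricci_eq_sum_riemann hG hy, ricci_eq_sum_riemann hG hy, Finset.sum_comm]
  refine Finset.sum_congr rfl fun a _ => Finset.sum_congr rfl fun b _ => ?_
  rw [hG.inv_symm hy, hG.riemann_pair hy]

theorem covD2_ricci_eq_sum (hG : IsMetricOn G Ω) (hy : y ∈ Ω) (a i j : Fin k) :
    covD2 G (ricci G) y a i j
      = ∑ p, ∑ q, (G y)⁻¹ p q * covD4 G (riemann G) y a p i q j := by
  simp only [covD4_riemann hG hy, sum_inv_metric_mul hG hy, covD2_ricci hG hy]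

theorem covD2_ricci_symm (hG : IsMetricOn G Ω) (hy : y ∈ Ω) (a i j : Fin k) :
    covD2 G (ricci G) y a i j = covD2 G (ricci G) y a j i := by
  have h := pd_congr_on hG.isOpen hy (fun z hz => ricci_symm hG hz i j) a
  simp only [covD2, h, ricci_symm hG hy i, ricci_symm hG hy _ j]
  ring

theorem covD4_riemann_pair (hG : IsMetricOn G Ω) (hy : y ∈ Ω) (a i j c l : Fin k) :
    covD4 G (riemann G) y a i j c l = covD4 G (riemann G) y a c l i j := by
  have h := pd_congr_on hG.isOpen hy (fun z hz => hG.riemann_pair hz i j c l) a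
  simp only [covD4, h, hG.riemann_pair hy _ j c l, hG.riemann_pair hy i _ c l,
    hG.riemann_pair hy i j _ l, hG.riemann_pair hy i j c _]
  ring

theorem covD4_riemann_skew (hG : IsMetricOn G Ω) (hy : y ∈ Ω) (a i j c l : Fin k) :
    covD4 G (riemann G) y a i j c l = - covD4 G (riemann G) y a i j l c := by
  have h := pd_congr_on hG.isOpen hy (fun z hz => hG.riemann_skew_right hz i j c l) a
  simp only [covD4, h, pd_neg, hG.riemann_skew_right hy _ j c l, hG.riemann_skew_right hy i _ c l,
    hG.riemann_skew_right hy i j _ l, hG.riemann_skew_right hy i j c _, mul_neg,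
    Finset.sum_neg_distrib]
  ring

/-- The contracted second Bianchi identity. -/
theorem sum_curvDMatrix (hG : IsMetricOn G Ω) (hy : y ∈ Ω) (c i j : Fin k) :
    ∑ m, curvDMatrix G y m c i m j
      = covD2 G (ricci G) y c i j - covD2 G (ricci G) y i c j := by
  have hB : ∀ m, curvDMatrix G y m c i m j + curvDMatrix G y c i m m j
      + curvDMatrix G y i m c m j = 0 := fun m =>
    congrFun (congrFun (hG.curvDMatrix_cyclic hy m c i) m) j
  have hs : ∀ m, curvDMatrix G y c i m m j = - curvDMatrix G y c m i m j := by
    intro m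
    have hp : pdM (fun z => curvMatrix G z i m) y c = - pdM (fun z => curvMatrix G z m i) y c := by
      ext p q
      have : (fun z => curvMatrix G z i m p q) = fun z => - curvMatrix G z m i p q := by
        funext z; exact congrFun (congrFun (curvMatrix_skew G z i m) p) q
      simp only [pdM, Matrix.of_apply, Matrix.neg_apply, this, pd_neg]
    have : curvDMatrix G y c i m = - curvDMatrix G y c m i := by
      have hsum : ∑ p, (christoffel G y p c i • curvMatrix G y p m
            + christoffel G y p c m • curvMatrix G y i p)
          = - ∑ p, (christoffel G y p c m • curvMatrix G y p i
            + christoffel G y p c i • curvMatrix G y m p) := by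
        rw [← Finset.sum_neg_distrib]
        refine Finset.sum_congr rfl fun p _ => ?_
        rw [curvMatrix_skew G y p m, curvMatrix_skew G y i p, smul_neg, smul_neg]
        abel
      unfold curvDMatrix
      rw [hp, hsum, curvMatrix_skew G y i m]
      noncomm_ring
    rw [this, Matrix.neg_apply]
  rw [covD2_ricci hG hy, covD2_ricci hG hy, ← Finset.sum_sub_distrib]
  refine Finset.sum_congr rfl fun m _ => ?_
  linarith [hB m, hs m]

/-- The divergence of the curvature tensor. -/
theorem div_riemann (hG : IsMetricOn G Ω) (hy : y ∈ Ω) (j c i : Fin k) :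
    ∑ a, ∑ b, (G y)⁻¹ a b * covD4 G (riemann G) y a b j c i
      = covD2 G (ricci G) y c i j - covD2 G (ricci G) y i c j := by
  simp only [covD4_riemann_pair hG hy _ _ j c i, covD4_riemann hG hy, sum_inv_metric_mul hG hy,
    sum_curvDMatrix hG hy]

theorem pd_scalar (hG : IsMetricOn G Ω) (hy : y ∈ Ω) (a : Fin k) :
    pd (scalar G) y a = ∑ i, ∑ j, (G y)⁻¹ i j * covD2 G (ricci G) y a i j :=
  hG.pd_trace hy (fun i j => ContDiffOn.dAt (hG.smooth_ricci i j) hG.isOpen hy) a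

/-- The twice contracted second Bianchi identity. -/
theorem div_ricci (hG : IsMetricOn G Ω) (hy : y ∈ Ω) (c : Fin k) :
    ∑ i, ∑ j, (G y)⁻¹ i j * covD2 G (ricci G) y i j c = (1 / 2) * pd (scalar G) y c := by
  -- The double trace of `∇R` is computed twice: through the divergence of the curvature it is `ds -
  -- div Ric`, and tracing the other pair of indices first (`h2`) it is `div Ric`. Hence `2 div Ric
  -- = ds`.
  have h1 : ∑ i, ∑ j, (G y)⁻¹ i j * (∑ a, ∑ b, (G y)⁻¹ a b * covD4 G (riemann G) y a b j c i)
      = pd (scalar G) y c - ∑ i, ∑ j, (G y)⁻¹ i j * covD2 G (ricci G) y i j c := by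
    simp only [div_riemann hG hy, mul_sub, Finset.sum_sub_distrib, pd_scalar hG hy,
      covD2_ricci_symm hG hy _ c]
  have h2 : ∑ i, ∑ j, (G y)⁻¹ i j * (∑ a, ∑ b, (G y)⁻¹ a b * covD4 G (riemann G) y a b j c i)
      = ∑ a, ∑ b, (G y)⁻¹ a b * covD2 G (ricci G) y a b c := by
    simp only [covD2_ricci_symm hG hy _ _ c, covD2_ricci_eq_sum hG hy, Finset.mul_sum]
    calc _ = ∑ i, ∑ a, ∑ j, ∑ b, (G y)⁻¹ i j * ((G y)⁻¹ a b * covD4 G (riemann G) y a b j c i) :=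
          Finset.sum_congr rfl fun i _ => Finset.sum_comm
      _ = ∑ a, ∑ i, ∑ j, ∑ b, (G y)⁻¹ i j * ((G y)⁻¹ a b * covD4 G (riemann G) y a b j c i) :=
          Finset.sum_comm
      _ = ∑ a, ∑ i, ∑ b, ∑ j, (G y)⁻¹ i j * ((G y)⁻¹ a b * covD4 G (riemann G) y a b j c i) :=
          Finset.sum_congr rfl fun a _ => Finset.sum_congr rfl fun i _ => Finset.sum_comm
      _ = ∑ a, ∑ b, ∑ i, ∑ j, (G y)⁻¹ i j * ((G y)⁻¹ a b * covD4 G (riemann G) y a b j c i) :=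
          Finset.sum_congr rfl fun a _ => Finset.sum_comm
      _ = _ := by
          refine Finset.sum_congr rfl fun a _ => Finset.sum_congr rfl fun b _ =>
            Finset.sum_congr rfl fun i _ => Finset.sum_congr rfl fun j _ => ?_
          rw [covD4_riemann_skew hG hy, covD4_riemann_pair hG hy, covD4_riemann_skew hG hy]
          ring
  linarith

/-- The Cotton tensor `C_cij = ∇_c A_ij - ∇_i A_cj` with `A = Ric - s / (2 (k - 1)) g`. -/
def cotton (G : Eu k → Matrix (Fin k) (Fin k) ℝ) (y : Eu k) (c i j : Fin k) : ℝ :=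
  covD2 G (ricci G) y c i j - covD2 G (ricci G) y i c j
    - 1 / (2 * ((k : ℝ) - 1)) * (G y i j * pd (scalar G) y c - G y c j * pd (scalar G) y i)

theorem covD4_weyl (hG : IsMetricOn G Ω) (hy : y ∈ Ω) (a i j c l : Fin k) :
    covD4 G (fun z i j c l => weyl G z ![i, j, c, l]) y a i j c l
      = covD4 G (riemann G) y a i j c l
        - 1 / ((k : ℝ) - 2) * (G y i c * covD2 G (ricci G) y a j l - G y i l * covD2 G (ricci G) y a j c
          - G y j c * covD2 G (ricci G) y a i l + G y j l * covD2 G (ricci G) y a i c)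
        + pd (scalar G) y a / (((k : ℝ) - 1) * ((k : ℝ) - 2)) *
          (G y i c * G y j l - G y i l * G y j c) := by
  have hg := hG.dAt_metric hy
  have hr : ∀ i j, DifferentiableAt ℝ (fun z => ricci G z i j) y := fun i j =>
    ContDiffOn.dAt (hG.smooth_ricci i j) hG.isOpen hy
  have hR : ∀ i j c l, DifferentiableAt ℝ (fun z => riemann G z i j c l) y := fun i j c l =>
    ContDiffOn.dAt (hG.smooth_riemann i j c l) hG.isOpen hy
  have hs : DifferentiableAt ℝ (scalar G) y := ContDiffOn.dAt hG.smooth_scalar hG.isOpen hy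
  have e : (fun (z : Eu k) (i j c l : Fin k) => weyl G z ![i, j, c, l]) = fun z i j c l =>
      (riemann G z i j c l - 1 / ((k : ℝ) - 2) * (((G z i c * ricci G z j l - G z i l * ricci G z j c)
        - ricci G z i l * G z j c) + ricci G z i c * G z j l))
      + 1 / (((k : ℝ) - 1) * ((k : ℝ) - 2)) * (scalar G z * (G z i c * G z j l - G z i l * G z j c)) := by
    funext z i j c l
    simp only [weyl, Matrix.cons_val]
    ring
  have d1 : ∀ i j c l, DifferentiableAt ℝ (fun z => G z i c * ricci G z j l) y :=
    fun i j c l => (hg i c).fun_mul (hr j l)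
  have d2 : ∀ i j c l, DifferentiableAt ℝ (fun z => G z i l * ricci G z j c) y :=
    fun i j c l => (hg i l).fun_mul (hr j c)
  have d3 : ∀ i j c l, DifferentiableAt ℝ (fun z => ricci G z i l * G z j c) y :=
    fun i j c l => (hr i l).fun_mul (hg j c)
  have d4 : ∀ i j c l, DifferentiableAt ℝ (fun z => ricci G z i c * G z j l) y :=
    fun i j c l => (hr i c).fun_mul (hg j l)
  have d5 : ∀ i j c l, DifferentiableAt ℝ (fun z => G z i c * G z j l) y :=
    fun i j c l => (hg i c).fun_mul (hg j l)
  have d6 : ∀ i j c l, DifferentiableAt ℝ (fun z => G z i l * G z j c) y :=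
    fun i j c l => (hg i l).fun_mul (hg j c)
  have d12 := fun i j c l => (d1 i j c l).fun_sub (d2 i j c l)
  have d123 := fun i j c l => (d12 i j c l).fun_sub (d3 i j c l)
  have d1234 := fun i j c l => (d123 i j c l).fun_add (d4 i j c l)
  have d56 := fun i j c l => (d5 i j c l).fun_sub (d6 i j c l)
  have hc : ∀ r : ℝ, DifferentiableAt ℝ (fun _ : Eu k => r) y := fun r => differentiableAt_const r
  have hg0 := hG.covD2_metric hy
  rw [e, covD4_add (fun i j c l => (hR i j c l).fun_sub ((hc _).fun_mul (d1234 i j c l)))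
      (fun i j c l => (hc _).fun_mul (hs.fun_mul (d56 i j c l))),
    covD4_sub hR (fun i j c l => (hc _).fun_mul (d1234 i j c l)),
    covD4_mul (hc _) d1234, covD4_add d123 d4, covD4_sub d12 d3, covD4_sub d1 d2,
    covD4_mul (hc _) (fun i j c l => hs.fun_mul (d56 i j c l)), covD4_mul hs d56, covD4_sub d5 d6,
    covD4_mul_ic_jl hg hr, covD4_mul_il_jc hg hr, covD4_mul_il_jc hr hg, covD4_mul_ic_jl hr hg,
    covD4_mul_ic_jl hg hg, covD4_mul_il_jc hg hg]
  simp only [hg0, pd_const]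
  ring

/-- The divergence of the Weyl tensor is a multiple of the Cotton tensor. -/
theorem div_weyl (hG : IsMetricOn G Ω) (hy : y ∈ Ω) (hk : 4 ≤ k) (j c i : Fin k) :
    ∑ a, ∑ b, (G y)⁻¹ a b * covD4 G (fun z i j c l => weyl G z ![i, j, c, l]) y a b j c i
      = ((k : ℝ) - 3) / ((k : ℝ) - 2) * cotton G y c i j := by
  have hk' : (4 : ℝ) ≤ k := by exact_mod_cast hk
  have hδ : ∀ (c : Fin k) (f : Fin k → ℝ), ∑ a, ∑ b, (G y)⁻¹ a b * (G y b c * f a) = f c := by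
    intro c f
    simp only [← mul_assoc, ← Finset.sum_mul, hG.inv_mul hy]
    simp
  have e1 := div_riemann hG hy j c i
  have e2 := hδ c (fun a => covD2 G (ricci G) y a j i)
  have e3 := hδ i (fun a => covD2 G (ricci G) y a j c)
  have e4 : ∀ r, ∑ a, ∑ b, (G y)⁻¹ a b * covD2 G (ricci G) y a b r = 1 / 2 * pd (scalar G) y r :=
    div_ricci hG hy
  have e5 := hδ c (fun a => pd (scalar G) y a)
  have e6 := hδ i (fun a => pd (scalar G) y a)
  have key : ∑ a, ∑ b, (G y)⁻¹ a b * covD4 G (fun z i j c l => weyl G z ![i, j, c, l]) y a b j c i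
      = ∑ a, ∑ b, (G y)⁻¹ a b * covD4 G (riemann G) y a b j c i
        - 1 / ((k : ℝ) - 2) * (∑ a, ∑ b, (G y)⁻¹ a b * (G y b c * covD2 G (ricci G) y a j i)
          - ∑ a, ∑ b, (G y)⁻¹ a b * (G y b i * covD2 G (ricci G) y a j c)
          - G y j c * ∑ a, ∑ b, (G y)⁻¹ a b * covD2 G (ricci G) y a b i
          + G y j i * ∑ a, ∑ b, (G y)⁻¹ a b * covD2 G (ricci G) y a b c)
        + 1 / (((k : ℝ) - 1) * ((k : ℝ) - 2)) * (
          G y j i * ∑ a, ∑ b, (G y)⁻¹ a b * (G y b c * pd (scalar G) y a)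
          - G y j c * ∑ a, ∑ b, (G y)⁻¹ a b * (G y b i * pd (scalar G) y a)) := by
    simp only [covD4_weyl hG hy, Finset.mul_sum, ← Finset.sum_sub_distrib, ← Finset.sum_add_distrib]
    exact Finset.sum_congr rfl fun a _ => Finset.sum_congr rfl fun b _ => by ring
  rw [key, e1, e2, e3, e4, e4, e5, e6, cotton, hG.symm hy i j, hG.symm hy c j,
    covD2_ricci_symm hG hy c j i, covD2_ricci_symm hG hy i j c]
  have h1 : (k : ℝ) - 1 ≠ 0 := by linarith
  have h2 : (k : ℝ) - 2 ≠ 0 := by linarith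
  field_simp
  ring

/-- In `deltaWeyl` the skew pair comes first, so the third index of the Cotton tensor is the first
argument of `δW`. The minus sign is that of the negative divergence. -/
theorem deltaWeyl_eq (hG : IsMetricOn G Ω) (hy : y ∈ Ω) (hk : 4 ≤ k) (c i j : Fin k) :
    deltaWeyl G y ![c, i, j] = - (((k : ℝ) - 3) / ((k : ℝ) - 2)) * cotton G y c i j := by
  rw [neg_mul, ← div_weyl hG hy hk]
  unfold deltaWeyl negDiv
  congr 1
  exact Finset.sum_congr rfl fun a _ => Finset.sum_congr rfl fun b _ => by
    congr 1
    exact covDeriv_four (weyl G) a b j c i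

theorem smooth_covD2_ricci (hG : IsMetricOn G Ω) (a i j : Fin k) :
    ContDiffOn ℝ ∞ (fun y => covD2 G (ricci G) y a i j) Ω := by
  unfold covD2
  refine ((contDiffOn_pd hG.isOpen (hG.smooth_ricci i j) a).sub ?_).sub ?_ <;>
  exact ContDiffOn.sum fun m _ => (hG.smooth_christoffel _ _ _).mul (hG.smooth_ricci _ _)

theorem smooth_cotton (hG : IsMetricOn G Ω) (c i j : Fin k) :
    ContDiffOn ℝ ∞ (fun y => cotton G y c i j) Ω := by
  unfold cotton
  refine ((smooth_covD2_ricci hG _ _ _).sub (smooth_covD2_ricci hG _ _ _)).sub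
    (contDiffOn_const.mul (((hG.smooth _ _).mul ?_).sub ((hG.smooth _ _).mul ?_))) <;>
  exact contDiffOn_pd hG.isOpen hG.smooth_scalar _

/-- The factor `(k-3)/(k-2)` from the divergence of Weyl cancels `1/(k-3)`, and the minus signs of
`δ` and `δ^D` cancel each other. -/
theorem bach_eq (hG : IsMetricOn G Ω) (hy : y ∈ Ω) (hk : 4 ≤ k) (i j : Fin k) :
    ((k : ℝ) - 2) * bach G y i j
      = ∑ a, ∑ b, (G y)⁻¹ a b * covD3 G (cotton G) y a b i j
        + ∑ a, ∑ b, ∑ c, ∑ d,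
      (G y)⁻¹ a c * (G y)⁻¹ b d * weyl G y ![i, a, j, b] * tracelessRicci G y c d := by
  have hk' : (4 : ℝ) ≤ k := by exact_mod_cast hk
  have h2 : (k : ℝ) - 2 ≠ 0 := by linarith
  have h3 : (k : ℝ) - 3 ≠ 0 := by linarith
  have e : negDiv G (deltaWeyl G) y ![i, j]
      = ((k : ℝ) - 3) / ((k : ℝ) - 2) * ∑ a, ∑ b, (G y)⁻¹ a b * covD3 G (cotton G) y a b i j := by
    unfold negDiv
    rw [Finset.mul_sum, ← Finset.sum_neg_distrib]
    refine Finset.sum_congr rfl fun a _ => ?_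
    rw [Finset.mul_sum, ← Finset.sum_neg_distrib]
    refine Finset.sum_congr rfl fun b _ => ?_
    have := covDeriv_three (G := G) (y := y) (deltaWeyl G) a b i j
    rw [covD3_congr hG.isOpen hy (fun z hz c i j => deltaWeyl_eq hG hz hk c i j),
      covD3_const_mul (fun c i j => ContDiffOn.dAt (smooth_cotton hG c i j) hG.isOpen hy)] at this
    rw [show (Fin.cons b ![i, j] : Fin 3 → Fin k) = ![b, i, j] from rfl, this]
    ring
  rw [bach, e, mul_add, ← mul_assoc, ← mul_assoc, ← mul_assoc]
  congr 1
  · rw [show ((k : ℝ) - 2) * (1 / ((k : ℝ) - 3)) * (((k : ℝ) - 3) / ((k : ℝ) - 2)) = 1 by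
      field_simp, one_mul]
  · rw [show ((k : ℝ) - 2) * (1 / ((k : ℝ) - 2)) = 1 by field_simp, one_mul]

end Contractions

/-! ### The Cotton tensor of a soliton -/

section Soliton

variable {k : ℕ} {G : Eu k → Matrix (Fin k) (Fin k) ℝ} {Ω : Set (Eu k)} {y : Eu k}

/-- The components `∇^l f` of the gradient of a function. -/
def gradV (G : Eu k → Matrix (Fin k) (Fin k) ℝ) (f : Eu k → ℝ) (y : Eu k) (l : Fin k) : ℝ :=
  ∑ m, (G y)⁻¹ l m * pd f y m

theorem smooth_gradV (hG : IsMetricOn G Ω) {f : Eu k → ℝ} (hf : ContDiffOn ℝ ∞ f Ω) (l : Fin k) :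
    ContDiffOn ℝ ∞ (fun z => gradV G f z l) Ω := by
  unfold gradV
  exact ContDiffOn.sum fun m _ => (hG.smooth_inv _ _).mul (contDiffOn_pd hG.isOpen hf _)

theorem smooth_hessian (hG : IsMetricOn G Ω) {f : Eu k → ℝ} (hf : ContDiffOn ℝ ∞ f Ω)
    (i j : Fin k) : ContDiffOn ℝ ∞ (fun z => hessian G f z i j) Ω := by
  unfold hessian
  exact (contDiffOn_pd hG.isOpen (contDiffOn_pd hG.isOpen hf _) _).sub
    (ContDiffOn.sum fun m _ => (hG.smooth_christoffel _ _ _).mul (contDiffOn_pd hG.isOpen hf _))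

theorem hessian_symm (hG : IsMetricOn G Ω) (hy : y ∈ Ω) {f : Eu k → ℝ} (hf : ContDiffOn ℝ ∞ f Ω)
    (i j : Fin k) : hessian G f y i j = hessian G f y j i := by
  unfold hessian
  rw [pd_comm hG.isOpen hf hy]
  simp only [hG.christoffel_symm hy _ i j]

theorem sum_metric_gradV (hG : IsMetricOn G Ω) (hy : y ∈ Ω) (f : Eu k → ℝ) (i : Fin k) :
    ∑ l, G y i l * gradV G f y l = pd f y i := by
  simp only [gradV, Finset.mul_sum, ← mul_assoc]
  rw [Finset.sum_comm]
  simp only [← Finset.sum_mul, hG.mul_inv hy]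
  simp

/-- The Ricci identity for the differential of a function. -/
theorem ricci_identity (hG : IsMetricOn G Ω) (hy : y ∈ Ω) {f : Eu k → ℝ}
    (hf : ContDiffOn ℝ ∞ f Ω) (c i j : Fin k) :
    covD2 G (hessian G f) y c i j - covD2 G (hessian G f) y i c j
      = ∑ l, riemann G y c i j l * gradV G f y l := by
  have hR : ∑ l, riemann G y c i j l * gradV G f y l = - ∑ p, curvOp G y c i j p * pd f y p := by
    rw [Finset.sum_congr rfl fun l _ => by rw [hG.riemann_skew_right hy c i j l, neg_mul],
      Finset.sum_neg_distrib]
    simp only [riemann, Finset.sum_mul]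
    rw [Finset.sum_comm]
    congr 1
    refine Finset.sum_congr rfl fun p _ => ?_
    rw [← sum_metric_gradV hG hy f p, Finset.mul_sum]
    exact Finset.sum_congr rfl fun l _ => by rw [hG.symm hy p l]; ring
  have hdf : ∀ m, DifferentiableAt ℝ (fun z => pd f z m) y := fun m =>
    ContDiffOn.dAt (contDiffOn_pd hG.isOpen hf m) hG.isOpen hy
  have hdd : ∀ m n, DifferentiableAt ℝ (fun z => pd (fun w => pd f w n) z m) y := fun m n =>
    ContDiffOn.dAt (contDiffOn_pd hG.isOpen (contDiffOn_pd hG.isOpen hf n) m) hG.isOpen hy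
  have hΓ : ∀ m a b, DifferentiableAt ℝ (fun z => christoffel G z m a b) y := fun m a b =>
    ContDiffOn.dAt (hG.smooth_christoffel m a b) hG.isOpen hy
  have hpd : ∀ c i, pd (fun z => hessian G f z i j) y c
      = pd (fun z => pd (fun w => pd f w j) z i) y c
        - ∑ m, (pd (fun z => christoffel G z m i j) y c * pd f y m
          + christoffel G y m i j * pd (fun z => pd f z m) y c) := by
    intro c i
    unfold hessian
    rw [pd_sub (hdd i j) (DifferentiableAt.fun_sum fun m _ => (hΓ m i j).fun_mul (hdf m)),
      pd_sum fun m _ => (hΓ m i j).fun_mul (hdf m)]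
    simp only [pd_mul (hΓ _ _ _) (hdf _)]
  have h3 : pd (fun z => pd (fun w => pd f w j) z i) y c
      = pd (fun z => pd (fun w => pd f w j) z c) y i :=
    pd_comm hG.isOpen (contDiffOn_pd hG.isOpen hf j) hy c i
  have hq : ∀ c i, ∑ m, christoffel G y m c j * ∑ p, christoffel G y p i m * pd f y p
      = ∑ p, (∑ m, christoffel G y m c j * christoffel G y p i m) * pd f y p := by
    intro c i
    simp only [Finset.mul_sum, Finset.sum_mul]
    rw [Finset.sum_comm]
    exact Finset.sum_congr rfl fun p _ => Finset.sum_congr rfl fun m _ => by ring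
  have hH : ∀ m n, pd (fun z => pd f z n) y m - ∑ p, christoffel G y p m n * pd f y p
      = hessian G f y m n := fun m n => rfl
  rw [hR]
  simp only [covD2, hpd, h3]
  simp only [hG.christoffel_symm hy _ i c]
  simp only [hessian, mul_sub, Finset.sum_sub_distrib, Finset.sum_add_distrib, hq, curvOp, add_mul,
    sub_mul, pd_comm hG.isOpen hf hy c, pd_comm hG.isOpen hf hy i]
  ring

theorem covD2_soliton (hG : IsMetricOn G Ω) (hy : y ∈ Ω) {u h lam : Eu k → ℝ}
    (hu : ContDiffOn ℝ ∞ u Ω) (hh : ContDiffOn ℝ ∞ h Ω) (hl : ContDiffOn ℝ ∞ lam Ω)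
    (heq : ∀ z ∈ Ω, ∀ i j, ricci G z i j + h z * hessian G u z i j = lam z * G z i j)
    (a i j : Fin k) :
    covD2 G (ricci G) y a i j = pd lam y a * G y i j
      - (pd h y a * hessian G u y i j + h y * covD2 G (hessian G u) y a i j) := by
  have dh := ContDiffOn.dAt hh hG.isOpen hy
  have dl := ContDiffOn.dAt hl hG.isOpen hy
  have dH : ∀ i j, DifferentiableAt ℝ (fun z => hessian G u z i j) y := fun i j =>
    ContDiffOn.dAt (smooth_hessian hG hu i j) hG.isOpen hy
  have dG := hG.dAt_metric hy
  rw [covD2_congr hG.isOpen hy (T := fun z i j => lam z * G z i j - h z * hessian G u z i j)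
    (fun z hz i j => by linarith [heq z hz i j])]
  have hm := hG.covD2_metric hy a i j
  simp only [covD2] at hm ⊢
  rw [pd_sub (dl.fun_mul (dG i j)) (dh.fun_mul (dH i j)), pd_mul dl (dG i j), pd_mul dh (dH i j)]
  simp only [mul_sub, Finset.sum_sub_distrib, mul_left_comm _ (lam y), mul_left_comm _ (h y),
    ← Finset.mul_sum]
  linear_combination (lam y) * hm

theorem trace_metric (hG : IsMetricOn G Ω) (hy : y ∈ Ω) :
    ∑ i, ∑ j, (G y)⁻¹ i j * G y i j = k := by
  have : ∀ i, ∑ j, (G y)⁻¹ i j * G y i j = 1 := fun i => by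
    rw [Finset.sum_congr rfl fun j _ => by rw [hG.symm hy i j], hG.inv_mul hy, if_pos rfl]
  simp [this]

theorem tracelessRicci_symm (hG : IsMetricOn G Ω) (hy : y ∈ Ω) (i j : Fin k) :
    tracelessRicci G y i j = tracelessRicci G y j i := by
  simp only [tracelessRicci, ricci_symm hG hy i j, hG.symm hy i j]

theorem trace_tracelessRicci (hG : IsMetricOn G Ω) (hy : y ∈ Ω) (hk : 4 ≤ k) :
    ∑ i, ∑ j, (G y)⁻¹ i j * tracelessRicci G y i j = 0 := by
  have hk' : (4 : ℝ) ≤ k := by exact_mod_cast hk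
  simp only [tracelessRicci, mul_sub, Finset.sum_sub_distrib, mul_left_comm _ (scalar G y / k),
    ← Finset.mul_sum, trace_metric hG hy]
  rw [← scalar]
  field_simp
  ring

theorem weyl_skew_right (hG : IsMetricOn G Ω) (hy : y ∈ Ω) (i j c l : Fin k) :
    weyl G y ![i, j, c, l] = - weyl G y ![i, j, l, c] := by
  simp only [weyl, Matrix.cons_val, hG.riemann_skew_right hy i j c l]
  ring

theorem weyl_skew_left (i j c l : Fin k) :
    weyl G y ![i, j, c, l] = - weyl G y ![j, i, c, l] := by
  simp only [weyl, Matrix.cons_val, riemann_skew_left G y i j c l]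
  ring

theorem sum_inv_mul_left (hG : IsMetricOn G Ω) (hy : y ∈ Ω) (c : Fin k) (f : Fin k → ℝ) :
    ∑ a, ∑ b, (G y)⁻¹ a b * (G y c b * f a) = f c := by
  simp only [← mul_assoc, ← Finset.sum_mul, hG.symm hy c, hG.inv_mul hy]
  simp

theorem sum_inv_mul_right (hG : IsMetricOn G Ω) (hy : y ∈ Ω) (c : Fin k) (f : Fin k → ℝ) :
    ∑ a, ∑ b, (G y)⁻¹ a b * (G y c a * f b) = f c := by
  rw [Finset.sum_comm, ← sum_inv_mul_left hG hy c f]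
  exact Finset.sum_congr rfl fun a _ => Finset.sum_congr rfl fun b _ => by
    rw [hG.inv_symm hy]

theorem trace_riemann (hG : IsMetricOn G Ω) (hy : y ∈ Ω) (c l : Fin k) :
    ∑ i, ∑ j, (G y)⁻¹ i j * riemann G y c i j l = - ricci G y c l := by
  rw [ricci_eq_sum_riemann hG hy, ← Finset.sum_neg_distrib]
  refine Finset.sum_congr rfl fun i _ => ?_
  rw [← Finset.sum_neg_distrib]
  exact Finset.sum_congr rfl fun j _ => by rw [riemann_skew_left]; ring

theorem trace_weyl (hG : IsMetricOn G Ω) (hy : y ∈ Ω) (hk : 4 ≤ k) (c l : Fin k) :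
    ∑ i, ∑ j, (G y)⁻¹ i j * weyl G y ![c, i, j, l] = 0 := by
  have hk' : (4 : ℝ) ≤ k := by exact_mod_cast hk
  have e : ∑ i, ∑ j, (G y)⁻¹ i j * weyl G y ![c, i, j, l]
      = ∑ i, ∑ j, (G y)⁻¹ i j * riemann G y c i j l - 1 / ((k : ℝ) - 2) *
        (∑ i, ∑ j, (G y)⁻¹ i j * (G y c j * ricci G y i l)
          - G y c l * ∑ i, ∑ j, (G y)⁻¹ i j * ricci G y i j
          - ricci G y c l * ∑ i, ∑ j, (G y)⁻¹ i j * G y i j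
          + ∑ i, ∑ j, (G y)⁻¹ i j * (G y l i * ricci G y c j))
        + scalar G y / (((k : ℝ) - 1) * ((k : ℝ) - 2)) *
        (∑ i, ∑ j, (G y)⁻¹ i j * (G y c j * G y i l)
          - G y c l * ∑ i, ∑ j, (G y)⁻¹ i j * G y i j) := by
    simp only [Finset.mul_sum, ← Finset.sum_sub_distrib, ← Finset.sum_add_distrib]
    refine Finset.sum_congr rfl fun i _ => Finset.sum_congr rfl fun j _ => ?_
    simp only [weyl, Matrix.cons_val]
    rw [hG.symm hy l i]
    ring
  rw [e, trace_riemann hG hy, sum_inv_mul_left hG hy c (fun i => ricci G y i l),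
    sum_inv_mul_right hG hy l (fun j => ricci G y c j),
    sum_inv_mul_left hG hy c (fun i => G y i l), trace_metric hG hy, ← scalar]
  have h1 : (k : ℝ) - 1 ≠ 0 := by linarith
  have h2 : (k : ℝ) - 2 ≠ 0 := by linarith
  field_simp
  ring

theorem trace_cotton (hG : IsMetricOn G Ω) (hy : y ∈ Ω) (hk : 4 ≤ k) (c : Fin k) :
    ∑ i, ∑ j, (G y)⁻¹ i j * cotton G y c i j = 0 := by
  have hk' : (4 : ℝ) ≤ k := by exact_mod_cast hk
  have e : ∑ i, ∑ j, (G y)⁻¹ i j * cotton G y c i j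
      = ∑ i, ∑ j, (G y)⁻¹ i j * covD2 G (ricci G) y c i j
        - ∑ i, ∑ j, (G y)⁻¹ i j * covD2 G (ricci G) y i j c
        - 1 / (2 * ((k : ℝ) - 1)) * (pd (scalar G) y c * ∑ i, ∑ j, (G y)⁻¹ i j * G y i j
          - ∑ i, ∑ j, (G y)⁻¹ i j * (G y c j * pd (scalar G) y i)) := by
    simp only [Finset.mul_sum, ← Finset.sum_sub_distrib]
    refine Finset.sum_congr rfl fun i _ => Finset.sum_congr rfl fun j _ => ?_
    rw [cotton, covD2_ricci_symm hG hy i j c]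
    ring
  rw [e, ← pd_scalar hG hy, div_ricci hG hy, trace_metric hG hy,
    sum_inv_mul_left hG hy c (fun i => pd (scalar G) y i)]
  have h1 : (k : ℝ) - 1 ≠ 0 := by linarith
  field_simp
  ring

theorem cotton_skew (c i j : Fin k) : cotton G y c i j = - cotton G y i c j := by
  unfold cotton; ring

/-- The Cotton tensor of an almost gradient Ricci soliton whose signal function satisfies
`dh = h' du`. -/
theorem cotton_soliton (hG : IsMetricOn G Ω) (hy : y ∈ Ω) (hk : 4 ≤ k) {u h lam : Eu k → ℝ}
    (hu : ContDiffOn ℝ ∞ u Ω) (hh : ContDiffOn ℝ ∞ h Ω) (hl : ContDiffOn ℝ ∞ lam Ω)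
    (heq : ∀ z ∈ Ω, ∀ i j, ricci G z i j + h z * hessian G u z i j = lam z * G z i j)
    (h0 : h y ≠ 0) {h' : ℝ} (hh' : ∀ i, pd h y i = h' * pd u y i) (c i j : Fin k) :
    cotton G y c i j = - h y * ∑ l, weyl G y ![c, i, j, l] * gradV G u y l
      + (h y / ((k : ℝ) - 2) + h' / h y) * (pd u y c * tracelessRicci G y i j
        - pd u y i * tracelessRicci G y c j + 1 / ((k : ℝ) - 1) *
        (G y i j * ∑ l, tracelessRicci G y c l * gradV G u y l
          - G y c j * ∑ l, tracelessRicci G y i l * gradV G u y l)) := by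
  have hk' : (4 : ℝ) ≤ k := by exact_mod_cast hk
  have h1 : (k : ℝ) - 1 ≠ 0 := by linarith
  have h2 : (k : ℝ) - 2 ≠ 0 := by linarith
  have h3 : (k : ℝ) ≠ 0 := by linarith
  set P := h y / ((k : ℝ) - 2) + h' / h y with hP
  have hH : ∀ i j, hessian G u y i j = (lam y * G y i j - ricci G y i j) / h y := by
    intro i j
    rw [eq_div_iff h0]
    linarith [heq y hy i j]
  have hRW : ∀ c i j, ∑ l, riemann G y c i j l * gradV G u y l
      = ∑ l, weyl G y ![c, i, j, l] * gradV G u y l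
        + 1 / ((k : ℝ) - 2) * (G y c j * ∑ l, ricci G y i l * gradV G u y l
          - pd u y c * ricci G y i j - G y i j * ∑ l, ricci G y c l * gradV G u y l
          + pd u y i * ricci G y c j)
        - scalar G y / (((k : ℝ) - 1) * ((k : ℝ) - 2)) *
          (G y c j * pd u y i - pd u y c * G y i j) := by
    intro c i j
    rw [← sum_metric_gradV hG hy u i, ← sum_metric_gradV hG hy u c]
    simp only [Finset.mul_sum, Finset.sum_mul, ← Finset.sum_sub_distrib, ← Finset.sum_add_distrib]
    refine Finset.sum_congr rfl fun l _ => ?_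
    simp only [weyl, Matrix.cons_val]
    ring
  -- Skew-symmetrise the differentiated soliton equation and replace the third derivatives of `u` by
  -- curvature, split into Weyl and Ricci parts. All terms in `dλ`, `ds`, `Ric(∇u)` and the
  -- multiples of `du` that multiply the metric are collected in one covector `v`.
  have hv : ∃ v : Fin k → ℝ, ∀ c i j, cotton G y c i j
      = - h y * ∑ l, weyl G y ![c, i, j, l] * gradV G u y l
        + P * (pd u y c * tracelessRicci G y i j - pd u y i * tracelessRicci G y c j)
        + (G y i j * v c - G y c j * v i) := by
    refine ⟨fun c => pd lam y c - h' * lam y / h y * pd u y c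
      + h y / ((k : ℝ) - 2) * (∑ l, ricci G y c l * gradV G u y l)
      - h y * scalar G y / (((k : ℝ) - 1) * ((k : ℝ) - 2)) * pd u y c
      - 1 / (2 * ((k : ℝ) - 1)) * pd (scalar G) y c + P * (scalar G y / k) * pd u y c, ?_⟩
    intro c i j
    have e1 := covD2_soliton hG hy hu hh hl heq c i j
    have e2 := covD2_soliton hG hy hu hh hl heq i c j
    have e3 := ricci_identity hG hy hu c i j
    rw [hRW] at e3
    rw [hh', hH] at e1 e2
    rw [cotton, e1, e2, hP]
    simp only [tracelessRicci]
    have e4 : covD2 G (hessian G u) y c i j = covD2 G (hessian G u) y i c j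
      + (∑ l, weyl G y ![c, i, j, l] * gradV G u y l
        + 1 / ((k : ℝ) - 2) * (G y c j * ∑ l, ricci G y i l * gradV G u y l
          - pd u y c * ricci G y i j - G y i j * ∑ l, ricci G y c l * gradV G u y l
          + pd u y i * ricci G y c j)
        - scalar G y / (((k : ℝ) - 1) * ((k : ℝ) - 2)) *
          (G y c j * pd u y i - pd u y c * G y i j)) := by linarith
    rw [e4]
    field_simp
    ring
  obtain ⟨v, hv⟩ := hv
  -- There is no need to simplify `v`: since `C`, `W` and `z` are trace free, contracting the
  -- formula over `i, j` forces `v = P/(k-1) z(∇u)`.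
  have hvv : ∀ c, v c = P * (1 / ((k : ℝ) - 1)) * ∑ l, tracelessRicci G y c l * gradV G u y l := by
    intro c
    have t := trace_cotton hG hy hk c
    obtain ⟨S, hS⟩ : ∃ S : Fin k → Fin k → ℝ, ∀ i j,
        ∑ l, weyl G y ![c, i, j, l] * gradV G u y l = S i j := ⟨_, fun _ _ => rfl⟩
    have e : ∑ i, ∑ j, (G y)⁻¹ i j * cotton G y c i j
        = - h y * ∑ l, (∑ i, ∑ j, (G y)⁻¹ i j * weyl G y ![c, i, j, l]) * gradV G u y l
          + P * (pd u y c * ∑ i, ∑ j, (G y)⁻¹ i j * tracelessRicci G y i j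
            - ∑ l, tracelessRicci G y c l * gradV G u y l)
          + (v c * ∑ i, ∑ j, (G y)⁻¹ i j * G y i j
            - ∑ i, ∑ j, (G y)⁻¹ i j * (G y c j * v i)) := by
      have a1 : ∑ l, (∑ i, ∑ j, (G y)⁻¹ i j * weyl G y ![c, i, j, l]) * gradV G u y l
          = ∑ i, ∑ j, (G y)⁻¹ i j * ∑ l, weyl G y ![c, i, j, l] * gradV G u y l := by
        simp only [Finset.sum_mul, Finset.mul_sum]
        rw [Finset.sum_comm]
        refine Finset.sum_congr rfl fun i _ => ?_
        rw [Finset.sum_comm]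
        exact Finset.sum_congr rfl fun j _ => Finset.sum_congr rfl fun l _ => by ring
      have a2 : ∑ l, tracelessRicci G y c l * gradV G u y l
          = ∑ i, ∑ j, (G y)⁻¹ i j * (pd u y i * tracelessRicci G y c j) := by
        simp only [gradV, Finset.mul_sum]
        rw [Finset.sum_comm]
        exact Finset.sum_congr rfl fun j _ => Finset.sum_congr rfl fun l _ => by
          rw [hG.inv_symm hy]; ring
      rw [a1, a2]
      simp only [hv, hS]
      simp only [Finset.mul_sum, ← Finset.sum_sub_distrib, ← Finset.sum_add_distrib]
      refine Finset.sum_congr rfl fun i _ => Finset.sum_congr rfl fun j _ => ?_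
      ring
    rw [e, trace_tracelessRicci hG hy hk, trace_metric hG hy, sum_inv_mul_left hG hy c v] at t
    simp only [trace_weyl hG hy hk, zero_mul, Finset.sum_const_zero, mul_zero] at t
    field_simp
    linarith
  rw [hv, hvv, hvv]
  ring

end Soliton

/-! ### The divergence of `C(·, ∇u, ∇u)` -/

section Divergence

variable {k : ℕ} {G : Eu k → Matrix (Fin k) (Fin k) ℝ} {Ω : Set (Eu k)} {y : Eu k}

/-- The inner product `⟨∇a, ∇b⟩` of two gradients. -/
def gradInner (G : Eu k → Matrix (Fin k) (Fin k) ℝ) (a b : Eu k → ℝ) (y : Eu k) : ℝ :=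
  ∑ i, pd a y i * gradV G b y i

theorem smooth_gradInner (hG : IsMetricOn G Ω) {a b : Eu k → ℝ} (ha : ContDiffOn ℝ ∞ a Ω)
    (hb : ContDiffOn ℝ ∞ b Ω) : ContDiffOn ℝ ∞ (gradInner G a b) Ω := by
  unfold gradInner
  exact ContDiffOn.sum fun i _ => (contDiffOn_pd hG.isOpen ha i).mul (smooth_gradV hG hb i)

theorem gradInner_comm (hG : IsMetricOn G Ω) (hy : y ∈ Ω) (a b : Eu k → ℝ) :
    gradInner G a b y = gradInner G b a y := by
  simp only [gradInner, gradV, Finset.mul_sum]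
  rw [Finset.sum_comm]
  exact Finset.sum_congr rfl fun i _ => Finset.sum_congr rfl fun j _ => by
    rw [hG.inv_symm hy]; ring

/-- The covariant derivative of the gradient is the Hessian with an index raised. -/
theorem pd_gradV (hG : IsMetricOn G Ω) (hy : y ∈ Ω) {f : Eu k → ℝ} (hf : ContDiffOn ℝ ∞ f Ω)
    (a i : Fin k) : pd (fun z => gradV G f z i) y a
      = ∑ l, (G y)⁻¹ i l * hessian G f y a l - ∑ m, christoffel G y i a m * gradV G f y m := by
  have hq : ∀ j, DifferentiableAt ℝ (fun z => (G z)⁻¹ i j) y := fun j =>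
    ContDiffOn.dAt (hG.smooth_inv i j) hG.isOpen hy
  have hdf : ∀ m, DifferentiableAt ℝ (fun z => pd f z m) y := fun m =>
    ContDiffOn.dAt (contDiffOn_pd hG.isOpen hf m) hG.isOpen hy
  have h1 : ∑ l, ∑ m, christoffel G y i a m * (G y)⁻¹ m l * pd f y l
      = ∑ m, christoffel G y i a m * gradV G f y m := by
    simp only [gradV, Finset.mul_sum]
    rw [Finset.sum_comm]
    exact Finset.sum_congr rfl fun m _ => Finset.sum_congr rfl fun l _ => by ring
  have h2 : ∑ l, ∑ m, christoffel G y l a m * (G y)⁻¹ i m * pd f y l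
      = ∑ l, ∑ c, (G y)⁻¹ i l * (christoffel G y c a l * pd f y c) := by
    rw [Finset.sum_comm]
    exact Finset.sum_congr rfl fun m _ => Finset.sum_congr rfl fun l _ => by ring
  unfold gradV at *
  rw [pd_sum fun m _ => (hq m).fun_mul (hdf m)]
  simp only [pd_mul (hq _) (hdf _), hG.pd_inv hy, hessian, mul_sub, sub_mul, neg_mul,
    Finset.sum_mul, Finset.sum_add_distrib, Finset.sum_sub_distrib, Finset.sum_neg_distrib,
    Finset.mul_sum] at h1 h2 ⊢
  rw [h1, h2]
  ring

theorem pd_gradInner_self (hG : IsMetricOn G Ω) (hy : y ∈ Ω) {f : Eu k → ℝ}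
    (hf : ContDiffOn ℝ ∞ f Ω) (a : Fin k) :
    pd (gradInner G f f) y a = 2 * ∑ l, hessian G f y a l * gradV G f y l := by
  have hdf : ∀ m, DifferentiableAt ℝ (fun z => pd f z m) y := fun m =>
    ContDiffOn.dAt (contDiffOn_pd hG.isOpen hf m) hG.isOpen hy
  have hdV : ∀ m, DifferentiableAt ℝ (fun z => gradV G f z m) y := fun m =>
    ContDiffOn.dAt (smooth_gradV hG hf m) hG.isOpen hy
  have h1 : ∑ i, pd f y i * ∑ l, (G y)⁻¹ i l * hessian G f y a l
      = ∑ l, hessian G f y a l * gradV G f y l := by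
    simp only [gradV, Finset.mul_sum]
    rw [Finset.sum_comm]
    exact Finset.sum_congr rfl fun m _ => Finset.sum_congr rfl fun l _ => by
      rw [hG.inv_symm hy]; ring
  have h2 : ∑ l, (∑ c, christoffel G y c a l * pd f y c) * gradV G f y l
      = ∑ i, pd f y i * ∑ m, christoffel G y i a m * gradV G f y m := by
    simp only [Finset.mul_sum, Finset.sum_mul]
    rw [Finset.sum_comm]
    exact Finset.sum_congr rfl fun m _ => Finset.sum_congr rfl fun l _ => by ring
  have h3 : ∑ i, pd (fun z => pd f z i) y a * gradV G f y i
      = ∑ l, hessian G f y a l * gradV G f y l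
        + ∑ i, pd f y i * ∑ m, christoffel G y i a m * gradV G f y m := by
    rw [← h2, ← Finset.sum_add_distrib]
    exact Finset.sum_congr rfl fun l _ => by rw [hessian]; ring
  have h4 : pd (gradInner G f f) y a = ∑ i, (pd (fun z => pd f z i) y a * gradV G f y i
      + pd f y i * pd (fun z => gradV G f z i) y a) := by
    unfold gradInner
    rw [pd_sum fun m _ => (hdf m).fun_mul (hdV m)]
    simp only [pd_mul (hdf _) (hdV _)]
  rw [h4]
  simp only [pd_gradV hG hy hf, mul_sub, Finset.sum_add_distrib, Finset.sum_sub_distrib, h1, h3]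
  ring

/-- The 1-form `C(·, ∇u, ∇u)`. -/
def cottonForm (G : Eu k → Matrix (Fin k) (Fin k) ℝ) (u : Eu k → ℝ) (y : Eu k) (c : Fin k) : ℝ :=
  ∑ i, ∑ j, cotton G y c i j * (gradV G u y i * gradV G u y j)

/-- Leibniz rule, with `∇(∇u)` replaced by the Hessian with one index raised. All Christoffel terms
are absorbed in covariant derivatives. -/
theorem covD1_cottonForm (hG : IsMetricOn G Ω) (hy : y ∈ Ω) {u : Eu k → ℝ}
    (hu : ContDiffOn ℝ ∞ u Ω) (a c : Fin k) :
    covD1 G (cottonForm G u) y a c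
      = ∑ i, ∑ j, covD3 G (cotton G) y a c i j * (gradV G u y i * gradV G u y j)
        + ∑ i, ∑ j, cotton G y c i j * ((∑ l, (G y)⁻¹ i l * hessian G u y a l) * gradV G u y j)
        + ∑ i, ∑ j, cotton G y c i j * (gradV G u y i * ∑ l, (G y)⁻¹ j l * hessian G u y a l) := by
  have hdC : ∀ i j, DifferentiableAt ℝ (fun z => cotton G z c i j) y := fun i j =>
    ContDiffOn.dAt (smooth_cotton hG c i j) hG.isOpen hy
  have hdV : ∀ m, DifferentiableAt ℝ (fun z => gradV G u z m) y := fun m =>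
    ContDiffOn.dAt (smooth_gradV hG hu m) hG.isOpen hy
  have hp : pd (fun z => cottonForm G u z c) y a
      = ∑ i, ∑ j, (pd (fun z => cotton G z c i j) y a * (gradV G u y i * gradV G u y j)
        + cotton G y c i j * (pd (fun z => gradV G u z i) y a * gradV G u y j
          + gradV G u y i * pd (fun z => gradV G u z j) y a)) := by
    unfold cottonForm
    rw [pd_sum fun i _ => DifferentiableAt.fun_sum fun j _ =>
      (hdC i j).fun_mul ((hdV i).fun_mul (hdV j))]
    refine Finset.sum_congr rfl fun i _ => ?_
    rw [pd_sum fun j _ => (hdC i j).fun_mul ((hdV i).fun_mul (hdV j))]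
    refine Finset.sum_congr rfl fun j _ => ?_
    rw [pd_mul (hdC i j) ((hdV i).fun_mul (hdV j)), pd_mul (hdV i) (hdV j)]
  have e1 : ∑ m, christoffel G y m a c * cottonForm G u y m
      = ∑ i, ∑ j, (∑ m, christoffel G y m a c * cotton G y m i j)
        * (gradV G u y i * gradV G u y j) := by
    simp only [cottonForm, Finset.mul_sum, Finset.sum_mul]
    rw [Finset.sum_comm]
    refine Finset.sum_congr rfl fun i _ => ?_
    rw [Finset.sum_comm]
    exact Finset.sum_congr rfl fun j _ => Finset.sum_congr rfl fun m _ => by ring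
  have e2 : ∑ i, ∑ j, (∑ m, christoffel G y m a i * cotton G y c m j)
        * (gradV G u y i * gradV G u y j)
      = ∑ i, ∑ j, cotton G y c i j * ((∑ m, christoffel G y i a m * gradV G u y m)
        * gradV G u y j) := by
    simp only [Finset.mul_sum, Finset.sum_mul]
    calc _ = ∑ i, ∑ m, ∑ j, christoffel G y m a i * cotton G y c m j
          * (gradV G u y i * gradV G u y j) := Finset.sum_congr rfl fun i _ => Finset.sum_comm
      _ = ∑ m, ∑ i, ∑ j, christoffel G y m a i * cotton G y c m j
          * (gradV G u y i * gradV G u y j) := Finset.sum_comm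
      _ = ∑ m, ∑ j, ∑ i, christoffel G y m a i * cotton G y c m j
          * (gradV G u y i * gradV G u y j) := Finset.sum_congr rfl fun i _ => Finset.sum_comm
      _ = _ := Finset.sum_congr rfl fun m _ => Finset.sum_congr rfl fun j _ =>
          Finset.sum_congr rfl fun i _ => by ring
  have e3 : ∑ i, ∑ j, (∑ m, christoffel G y m a j * cotton G y c i m)
        * (gradV G u y i * gradV G u y j)
      = ∑ i, ∑ j, cotton G y c i j * (gradV G u y i
        * ∑ m, christoffel G y j a m * gradV G u y m) := by
    simp only [Finset.mul_sum, Finset.sum_mul]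
    refine Finset.sum_congr rfl fun i _ => ?_
    rw [Finset.sum_comm]
    exact Finset.sum_congr rfl fun j _ => Finset.sum_congr rfl fun m _ => by ring
  have e0 : ∑ i, ∑ j, covD3 G (cotton G) y a c i j * (gradV G u y i * gradV G u y j)
      = ∑ i, ∑ j, pd (fun z => cotton G z c i j) y a * (gradV G u y i * gradV G u y j)
        - ∑ i, ∑ j, (∑ m, christoffel G y m a c * cotton G y m i j)
          * (gradV G u y i * gradV G u y j)
        - ∑ i, ∑ j, (∑ m, christoffel G y m a i * cotton G y c m j)
          * (gradV G u y i * gradV G u y j)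
        - ∑ i, ∑ j, (∑ m, christoffel G y m a j * cotton G y c i m)
          * (gradV G u y i * gradV G u y j) := by
    simp only [← Finset.sum_sub_distrib, covD3]
    exact Finset.sum_congr rfl fun i _ => Finset.sum_congr rfl fun j _ => by ring
  rw [covD1, hp, e1, e0, e2, e3]
  simp only [← Finset.sum_sub_distrib, ← Finset.sum_add_distrib, pd_gradV hG hy hu]
  exact Finset.sum_congr rfl fun i _ => Finset.sum_congr rfl fun j _ => by
    rw [Finset.sum_sub_distrib, Finset.sum_sub_distrib]; ring

/-- Raising both indices of a 2-tensor. -/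
def raise (q : Matrix (Fin k) (Fin k) ℝ) (z : Fin k → Fin k → ℝ) (c j : Fin k) : ℝ := ∑ a, ∑ b, q c a * q j b * z a b

theorem raise_symm {q : Matrix (Fin k) (Fin k) ℝ} {z : Fin k → Fin k → ℝ} (hz : ∀ i j, z i j = z j i) (c j : Fin k) :
    raise q z c j = raise q z j c := by
  unfold raise
  rw [Finset.sum_comm]
  exact Finset.sum_congr rfl fun a _ => Finset.sum_congr rfl fun b _ => by rw [hz]; ring

theorem raise_metric (hG : IsMetricOn G Ω) (hy : y ∈ Ω) (c j : Fin k) :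
    raise (G y)⁻¹ (fun a b => G y a b) c j = (G y)⁻¹ c j := by
  unfold raise
  rw [Finset.sum_comm]
  have : ∀ b, ∑ a, (G y)⁻¹ c a * (G y)⁻¹ j b * G y a b = (G y)⁻¹ j b * if c = b then 1 else 0 := by
    intro b
    rw [← hG.inv_mul hy, Finset.mul_sum]
    exact Finset.sum_congr rfl fun a _ => by ring
  simp only [this]
  simp [hG.inv_symm hy j c]

theorem sum_metric_mul_raise (hG : IsMetricOn G Ω) (hy : y ∈ Ω) (z : Fin k → Fin k → ℝ)
    (i j : Fin k) : ∑ c, G y i c * raise (G y)⁻¹ z c j = ∑ b, (G y)⁻¹ j b * z i b := by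
  simp only [raise, Finset.mul_sum]
  rw [Finset.sum_comm]
  have : ∀ a, ∑ c, ∑ b, G y i c * ((G y)⁻¹ c a * (G y)⁻¹ j b * z a b)
      = (if i = a then 1 else 0) * ∑ b, (G y)⁻¹ j b * z a b := by
    intro a
    rw [← hG.mul_inv hy, Finset.sum_mul]
    refine Finset.sum_congr rfl fun c _ => ?_
    rw [Finset.mul_sum]
    exact Finset.sum_congr rfl fun b _ => by ring
  simp only [this]
  simp

/-- The deviation `|∇u|² |z|² - k / (k - 1) |z(∇u)|²` for a symmetric 2-tensor `z`. -/
def deviation (q : Matrix (Fin k) (Fin k) ℝ) (z : Fin k → Fin k → ℝ) (u : Fin k → ℝ) : ℝ :=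
  (∑ i, ∑ j, q i j * u i * u j) * (∑ c, ∑ j, z c j * raise q z c j)
    - k / ((k : ℝ) - 1) * ∑ c, (∑ l, z c l * ∑ m, q l m * u m)
      * (∑ d, q c d * ∑ l, z d l * ∑ m, q l m * u m)

/-- The value of the divergence of `C(·, ∇u, ∇u)` when the Bach tensor vanishes. -/
theorem div_cottonForm (hG : IsMetricOn G Ω) (hy : y ∈ Ω) (hk : 4 ≤ k) {u h lam : Eu k → ℝ}
    (hu : ContDiffOn ℝ ∞ u Ω) (hh : ContDiffOn ℝ ∞ h Ω) (hl : ContDiffOn ℝ ∞ lam Ω)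
    (heq : ∀ z ∈ Ω, ∀ i j, ricci G z i j + h z * hessian G u z i j = lam z * G z i j)
    (h0 : h y ≠ 0) {h' : ℝ} (hh' : ∀ i, pd h y i = h' * pd u y i)
    (hB : ∀ i j, bach G y i j = 0) :
    ∑ a, ∑ c, (G y)⁻¹ a c * covD1 G (cottonForm G u) y a c
      = (1 / ((k : ℝ) - 2) + h' / h y ^ 2) * deviation (G y)⁻¹ (tracelessRicci G y) (pd u y) := by
  have hk' : (4 : ℝ) ≤ k := by exact_mod_cast hk
  have h1 : (k : ℝ) - 1 ≠ 0 := by linarith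
  have h2 : (k : ℝ) - 2 ≠ 0 := by linarith
  set U := gradV G u y with hU
  set q := (G y)⁻¹ with hq
  set z := tracelessRicci G y with hz
  set H := hessian G u y with hH
  have hzs : ∀ i j, z i j = z j i := tracelessRicci_symm hG hy
  have hHs : ∀ i j, H i j = H j i := hessian_symm hG hy hu
  have hqs : ∀ i j, q i j = q j i := hG.inv_symm hy
  set W : Fin k → Fin k → Fin k → Fin k → ℝ := fun i j c l => weyl G y ![i, j, c, l] with hW
  -- the derivative of the Cotton tensor
  have t1 : ∑ a, ∑ c, q a c * ∑ i, ∑ j, covD3 G (cotton G) y a c i j * (U i * U j)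
      = - ∑ i, ∑ j, U i * U j * ∑ a, ∑ b, W i a j b * raise q z a b := by
    -- Bach-flatness enters only here, as `div C = - W̊z`.
    have e : ∀ i j, ∑ a, ∑ c, q a c * covD3 G (cotton G) y a c i j
        = - ∑ a, ∑ b, W i a j b * raise q z a b := by
      intro i j
      have := bach_eq hG hy hk i j
      rw [hB, mul_zero] at this
      rw [eq_neg_iff_add_eq_zero, this]
      congr 1
      refine Finset.sum_congr rfl fun a _ => Finset.sum_congr rfl fun b _ => ?_
      simp only [raise, Finset.mul_sum]
      exact Finset.sum_congr rfl fun c _ => Finset.sum_congr rfl fun d _ => by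
        simp only [hW]; ring
    have : ∑ a, ∑ c, q a c * ∑ i, ∑ j, covD3 G (cotton G) y a c i j * (U i * U j)
        = ∑ i, ∑ j, U i * U j * ∑ a, ∑ c, q a c * covD3 G (cotton G) y a c i j := by
      simp only [Finset.mul_sum]
      calc _ = ∑ a, ∑ i, ∑ c, ∑ j, q a c * (covD3 G (cotton G) y a c i j * (U i * U j)) :=
            Finset.sum_congr rfl fun a _ => Finset.sum_comm
        _ = ∑ i, ∑ a, ∑ c, ∑ j, q a c * (covD3 G (cotton G) y a c i j * (U i * U j)) :=
            Finset.sum_comm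
        _ = ∑ i, ∑ a, ∑ j, ∑ c, q a c * (covD3 G (cotton G) y a c i j * (U i * U j)) :=
            Finset.sum_congr rfl fun i _ => Finset.sum_congr rfl fun a _ => Finset.sum_comm
        _ = ∑ i, ∑ j, ∑ a, ∑ c, q a c * (covD3 G (cotton G) y a c i j * (U i * U j)) :=
            Finset.sum_congr rfl fun i _ => Finset.sum_comm
        _ = _ := Finset.sum_congr rfl fun i _ => Finset.sum_congr rfl fun j _ =>
            Finset.sum_congr rfl fun a _ => Finset.sum_congr rfl fun c _ => by ring
    rw [this]
    simp only [e, mul_neg, Finset.sum_neg_distrib]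
  -- the derivative of the first gradient
  have t2 : ∑ a, ∑ c, q a c * ∑ i, ∑ j, cotton G y c i j * ((∑ l, q i l * H a l) * U j) = 0 := by
    have e : ∑ a, ∑ c, q a c * ∑ i, ∑ j, cotton G y c i j * ((∑ l, q i l * H a l) * U j)
        = ∑ c, ∑ i, raise q H c i * ∑ j, cotton G y c i j * U j := by
      rw [Finset.sum_comm]
      refine Finset.sum_congr rfl fun c _ => ?_
      simp only [raise, Finset.mul_sum, Finset.sum_mul]
      rw [Finset.sum_comm]
      refine Finset.sum_congr rfl fun i _ => ?_
      rw [Finset.sum_comm]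
      exact Finset.sum_congr rfl fun j _ => Finset.sum_congr rfl fun a _ =>
        Finset.sum_congr rfl fun l _ => by rw [hqs a c]; ring
    -- The Cotton tensor is skew in its first two indices and the Hessian is symmetric, so the
    -- contraction equals its own negative.
    have e2 : ∑ c, ∑ i, raise q H c i * ∑ j, cotton G y c i j * U j
        = - ∑ c, ∑ i, raise q H c i * ∑ j, cotton G y c i j * U j := by
      conv_lhs => rw [Finset.sum_comm]
      rw [← Finset.sum_neg_distrib]
      refine Finset.sum_congr rfl fun i _ => ?_
      rw [← Finset.sum_neg_distrib]
      refine Finset.sum_congr rfl fun c _ => ?_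
      rw [raise_symm hHs, ← mul_neg, ← Finset.sum_neg_distrib]
      congr 1
      exact Finset.sum_congr rfl fun j _ => by rw [cotton_skew]; ring
    rw [e]; linarith
  -- the derivative of the second gradient
  have hHz : ∀ c j, raise q H c j = (lam y - scalar G y / k) / h y * q c j - raise q z c j / h y := by
    intro c j
    rw [show q c j = raise q (fun a b => G y a b) c j from (raise_metric hG hy c j).symm]
    simp only [raise, Finset.mul_sum, Finset.sum_div, ← Finset.sum_sub_distrib]
    refine Finset.sum_congr rfl fun a _ => Finset.sum_congr rfl fun b _ => ?_
    have : H a b = (lam y * G y a b - ricci G y a b) / h y := by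
      rw [eq_div_iff h0]; linarith [heq y hy a b]
    rw [this, hz, tracelessRicci]
    field_simp
    ring
  -- The metric part of the Hessian only produces a trace of the Cotton tensor, which is zero. Of
  -- the Hessian there remains `-z/h`.
  have trC : ∀ i, ∑ c, ∑ j, q c j * cotton G y c i j = 0 := by
    intro i
    rw [← neg_eq_zero, ← trace_cotton hG hy hk i, ← Finset.sum_neg_distrib]
    refine Finset.sum_congr rfl fun c _ => ?_
    rw [← Finset.sum_neg_distrib]
    exact Finset.sum_congr rfl fun j _ => by rw [cotton_skew c i j]; ring
  have t3 : ∑ a, ∑ c, q a c * ∑ i, ∑ j, cotton G y c i j * (U i * ∑ l, q j l * H a l)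
      = - (1 / h y) * ∑ c, ∑ i, ∑ j, cotton G y c i j * U i * raise q z c j := by
    have e : ∑ a, ∑ c, q a c * ∑ i, ∑ j, cotton G y c i j * (U i * ∑ l, q j l * H a l)
        = ∑ c, ∑ i, ∑ j, cotton G y c i j * U i * raise q H c j := by
      rw [Finset.sum_comm]
      refine Finset.sum_congr rfl fun c _ => ?_
      simp only [raise, Finset.mul_sum]
      rw [Finset.sum_comm]
      refine Finset.sum_congr rfl fun i _ => ?_
      rw [Finset.sum_comm]
      exact Finset.sum_congr rfl fun j _ => Finset.sum_congr rfl fun a _ =>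
        Finset.sum_congr rfl fun l _ => by rw [hqs a c]; ring
    have e2 : ∑ c, ∑ i, ∑ j, cotton G y c i j * U i * raise q H c j
        = (lam y - scalar G y / k) / h y * ∑ i, U i * ∑ c, ∑ j, q c j * cotton G y c i j
          - (1 / h y) * ∑ c, ∑ i, ∑ j, cotton G y c i j * U i * raise q z c j := by
      have : ∑ i, U i * ∑ c, ∑ j, q c j * cotton G y c i j
          = ∑ c, ∑ i, ∑ j, U i * (q c j * cotton G y c i j) := by
        simp only [Finset.mul_sum]
        exact Finset.sum_comm
      rw [this]
      simp only [Finset.mul_sum, ← Finset.sum_sub_distrib, hHz]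
      exact Finset.sum_congr rfl fun c _ => Finset.sum_congr rfl fun i _ =>
        Finset.sum_congr rfl fun j _ => by ring
    rw [e, e2]
    simp only [trC, mul_zero, Finset.sum_const_zero]
    ring
  -- evaluation by means of the soliton equation
  set P := h y / ((k : ℝ) - 2) + h' / h y with hP
  set Z : Fin k → ℝ := fun c => ∑ l, z c l * U l with hZ
  have t4 : ∑ c, ∑ i, ∑ j, cotton G y c i j * U i * raise q z c j
      = - h y * ∑ i, ∑ j, U i * U j * (∑ a, ∑ b, W i a j b * raise q z a b)
        + P * (∑ c, ∑ i, ∑ j, pd u y c * z i j * U i * raise q z c j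
          - (∑ i, pd u y i * U i) * (∑ c, ∑ j, z c j * raise q z c j)
          + 1 / ((k : ℝ) - 1) * (∑ c, ∑ i, ∑ j, G y i j * Z c * U i * raise q z c j
            - (∑ i, Z i * U i) * ∑ c, ∑ j, G y c j * raise q z c j)) := by
    have e1 : ∑ i, ∑ j, U i * U j * (∑ a, ∑ b, W i a j b * raise q z a b)
        = ∑ c, ∑ i, ∑ j, (∑ l, W c i j l * U l) * U i * raise q z c j := by
      simp only [Finset.mul_sum, Finset.sum_mul]
      calc _ = ∑ i, ∑ a, ∑ j, ∑ b, U i * U j * (W i a j b * raise q z a b) :=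
            Finset.sum_congr rfl fun i _ => Finset.sum_comm
        _ = ∑ a, ∑ i, ∑ j, ∑ b, U i * U j * (W i a j b * raise q z a b) := Finset.sum_comm
        _ = ∑ a, ∑ i, ∑ b, ∑ j, U i * U j * (W i a j b * raise q z a b) :=
            Finset.sum_congr rfl fun a _ => Finset.sum_congr rfl fun i _ => Finset.sum_comm
        _ = _ := Finset.sum_congr rfl fun a _ => Finset.sum_congr rfl fun i _ =>
            Finset.sum_congr rfl fun b _ => Finset.sum_congr rfl fun l _ => by
              simp only [hW]
              rw [weyl_skew_left i a l b, weyl_skew_right hG hy a i l b]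
              ring
    have e2 : (∑ i, pd u y i * U i) * (∑ c, ∑ j, z c j * raise q z c j)
        = ∑ c, ∑ i, ∑ j, pd u y i * z c j * U i * raise q z c j := by
      rw [Finset.sum_mul]
      symm
      rw [Finset.sum_comm]
      refine Finset.sum_congr rfl fun i _ => ?_
      simp only [Finset.mul_sum]
      exact Finset.sum_congr rfl fun c _ => Finset.sum_congr rfl fun j _ => by ring
    have e3 : (∑ i, Z i * U i) * ∑ c, ∑ j, G y c j * raise q z c j
        = ∑ c, ∑ i, ∑ j, G y c j * Z i * U i * raise q z c j := by
      rw [Finset.sum_mul]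
      symm
      rw [Finset.sum_comm]
      refine Finset.sum_congr rfl fun i _ => ?_
      simp only [Finset.mul_sum]
      exact Finset.sum_congr rfl fun c _ => Finset.sum_congr rfl fun j _ => by ring
    have e4 : ∀ c i j, cotton G y c i j = - h y * ∑ l, W c i j l * U l
        + P * (pd u y c * z i j - pd u y i * z c j + 1 / ((k : ℝ) - 1) *
        (G y i j * Z c - G y c j * Z i)) := fun c i j =>
      cotton_soliton hG hy hk hu hh hl heq h0 hh' c i j
    obtain ⟨S, hS⟩ : ∃ S : Fin k → Fin k → Fin k → ℝ, ∀ c i j,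
        ∑ l, W c i j l * U l = S c i j := ⟨_, fun _ _ _ => rfl⟩
    simp only [hS] at e4 e1
    rw [e1, e2, e3]
    simp only [Finset.mul_sum, ← Finset.sum_sub_distrib, ← Finset.sum_add_distrib]
    exact Finset.sum_congr rfl fun c _ => Finset.sum_congr rfl fun i _ =>
      Finset.sum_congr rfl fun j _ => by rw [e4]; ring
  have hgz : ∑ c, ∑ j, G y c j * raise q z c j = 0 := by
    rw [Finset.sum_comm, ← trace_tracelessRicci hG hy hk]
    refine Finset.sum_congr rfl fun j _ => ?_
    rw [← sum_metric_mul_raise hG hy z j j]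
    exact Finset.sum_congr rfl fun c _ => by rw [hG.symm hy]
  have hn : ∑ c, ∑ i, ∑ j, pd u y c * z i j * U i * raise q z c j
      = ∑ c, Z c * ∑ d, q c d * Z d := by
    have : ∀ j, ∑ c, pd u y c * raise q z c j = ∑ d, q j d * Z d := by
      intro j
      simp only [raise, Finset.mul_sum, hZ]
      calc _ = ∑ a, ∑ c, ∑ b, pd u y c * (q c a * q j b * z a b) := Finset.sum_comm
        _ = ∑ a, ∑ b, ∑ c, pd u y c * (q c a * q j b * z a b) :=
            Finset.sum_congr rfl fun a _ => Finset.sum_comm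
        _ = ∑ b, ∑ a, ∑ c, pd u y c * (q c a * q j b * z a b) := Finset.sum_comm
        _ = _ := Finset.sum_congr rfl fun b _ => Finset.sum_congr rfl fun a _ => by
            rw [hU, gradV, Finset.mul_sum, Finset.mul_sum]
            exact Finset.sum_congr rfl fun c _ => by
              rw [hqs c a, hzs a b]; simp only [hq]; ring
    simp only [← this]
    simp only [hZ, Finset.sum_mul, Finset.mul_sum]
    calc _ = ∑ c, ∑ j, ∑ i, pd u y c * z i j * U i * raise q z c j :=
          Finset.sum_congr rfl fun c _ => Finset.sum_comm
      _ = ∑ j, ∑ c, ∑ i, pd u y c * z i j * U i * raise q z c j := Finset.sum_comm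
      _ = _ := Finset.sum_congr rfl fun j _ => by
          exact Finset.sum_congr rfl fun c _ => Finset.sum_congr rfl fun i _ => by
            rw [hzs i j]; ring
  have hn2 : ∑ c, ∑ i, ∑ j, G y i j * Z c * U i * raise q z c j
      = ∑ c, Z c * ∑ d, q c d * Z d := by
    refine Finset.sum_congr rfl fun c _ => ?_
    have : ∀ i, ∑ j, G y i j * Z c * U i * raise q z c j
        = Z c * (U i * ∑ b, q c b * z i b) := by
      intro i
      rw [← sum_metric_mul_raise hG hy z i c, Finset.mul_sum, Finset.mul_sum]
      exact Finset.sum_congr rfl fun j _ => by rw [raise_symm hzs c j]; ring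
    simp only [this, ← Finset.mul_sum]
    congr 1
    simp only [hZ, Finset.mul_sum]
    rw [Finset.sum_comm]
    exact Finset.sum_congr rfl fun b _ => Finset.sum_congr rfl fun i _ => by rw [hzs i b]; ring
  have hw : ∑ i, pd u y i * U i = ∑ i, ∑ j, q i j * pd u y i * pd u y j := by
    refine Finset.sum_congr rfl fun i _ => ?_
    rw [hU, gradV, Finset.mul_sum]
    exact Finset.sum_congr rfl fun j _ => by ring
  have hd : deviation q z (pd u y) = (∑ i, pd u y i * U i) * (∑ c, ∑ j, z c j * raise q z c j)
      - k / ((k : ℝ) - 1) * ∑ c, Z c * ∑ d, q c d * Z d := by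
    rw [hw]; rfl
  rw [hd]
  simp only [covD1_cottonForm hG hy hu, mul_add, Finset.sum_add_distrib]
  -- The Weyl term in `t3` is `(-1/h)(-h) = 1` times the sum that `t1` contains with a minus sign,
  -- so these cancel. The other terms give `P/h` times the deviation, and `P/h = 1/(k-2) + h'/h²`.
  rw [t1, t2, t3, t4, hgz, hn, hn2, hP]
  field_simp
  ring

end Divergence

/-! ### The same 1-form in terms of `u`, `h` and `|∇u|²` -/

section Evaluation

variable {k : ℕ} {G : Eu k → Matrix (Fin k) (Fin k) ℝ} {Ω : Set (Eu k)} {y : Eu k}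

/-- The 1-form `h² (w dw - ⟨∇w, ∇u⟩ du) + (k - 2) (⟨∇h, ∇u⟩ dw - ⟨∇w, ∇u⟩ dh)`, `w = |∇u|²`. -/
def fluxForm (G : Eu k → Matrix (Fin k) (Fin k) ℝ) (u h : Eu k → ℝ) (y : Eu k) (c : Fin k) : ℝ :=
  h y ^ 2 * (gradInner G u u y * pd (gradInner G u u) y c
      - gradInner G (gradInner G u u) u y * pd u y c)
    + ((k : ℝ) - 2) * (gradInner G h u y * pd (gradInner G u u) y c
      - gradInner G (gradInner G u u) u y * pd h y c)

/-- The Weyl term vanishes by skewness in the last two slots, so the form depends on the curvature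
through `z(∇u)` alone. By the soliton equation and `∇du(∇u) = dw/2` this is a combination of `du`
and `dw`. The resulting expression contains only gradients and their inner products, whose
independence of the chart is elementary; writing `h' du` as `dh` also makes the regularity of `h'`
irrelevant. -/
theorem cottonForm_soliton (hG : IsMetricOn G Ω) (hy : y ∈ Ω) (hk : 4 ≤ k) {u h lam : Eu k → ℝ}
    (hu : ContDiffOn ℝ ∞ u Ω) (hh : ContDiffOn ℝ ∞ h Ω) (hl : ContDiffOn ℝ ∞ lam Ω)
    (heq : ∀ z ∈ Ω, ∀ i j, ricci G z i j + h z * hessian G u z i j = lam z * G z i j)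
    (h0 : h y ≠ 0) {h' : ℝ} (hh' : ∀ i, pd h y i = h' * pd u y i) (c : Fin k) :
    cottonForm G u y c = 1 / (2 * ((k : ℝ) - 1)) * fluxForm G u h y c := by
  have hk' : (4 : ℝ) ≤ k := by exact_mod_cast hk
  have h1 : (k : ℝ) - 1 ≠ 0 := by linarith
  have h2 : (k : ℝ) - 2 ≠ 0 := by linarith
  have h3 : (k : ℝ) ≠ 0 := by linarith
  set U := gradV G u y with hU
  set z := tracelessRicci G y with hz
  set W : Fin k → Fin k → Fin k → Fin k → ℝ := fun i j c l => weyl G y ![i, j, c, l] with hW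
  set P := h y / ((k : ℝ) - 2) + h' / h y with hP
  obtain ⟨Z, hZ⟩ : ∃ Z : Fin k → ℝ, ∀ c, ∑ l, z c l * U l = Z c := ⟨_, fun _ => rfl⟩
  have hgU : ∀ i, ∑ l, G y i l * U l = pd u y i := sum_metric_gradV hG hy u
  have hC := fun c i j => cotton_soliton hG hy hk hu hh hl heq h0 hh' c i j
  have hw : gradInner G u u y = ∑ i, pd u y i * U i := rfl
  set w := gradInner G u u y with hwdef
  -- The soliton equation applied to `∇u`, with `∇du(∇u) = dw/2`. Every multiple of `du` found here
  -- drops out of the final formula.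
  have hZe : ∀ c, Z c = (lam y - scalar G y / k) * pd u y c
      - h y / 2 * pd (gradInner G u u) y c := by
    intro c
    rw [pd_gradInner_self hG hy hu, ← hZ, ← hgU c]
    simp only [Finset.mul_sum, ← Finset.sum_sub_distrib]
    refine Finset.sum_congr rfl fun l _ => ?_
    rw [hz, tracelessRicci]
    linear_combination (U l) * heq y hy c l
  have hWz : ∑ i, ∑ j, (∑ l, W c i j l * U l) * (U i * U j) = 0 := by
    refine Finset.sum_eq_zero fun i _ => ?_
    have e : ∑ j, (∑ l, W c i j l * U l) * (U i * U j)
        = - ∑ j, (∑ l, W c i j l * U l) * (U i * U j) := by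
      simp only [Finset.sum_mul]
      conv_lhs => rw [Finset.sum_comm]
      rw [← Finset.sum_neg_distrib]
      refine Finset.sum_congr rfl fun j _ => ?_
      rw [← Finset.sum_neg_distrib]
      exact Finset.sum_congr rfl fun l _ => by
        simp only [hW]; rw [weyl_skew_right hG hy c i j l]; ring
    linarith
  have e1 : cottonForm G u y c = - h y * ∑ i, ∑ j, (∑ l, W c i j l * U l) * (U i * U j)
      + P * (pd u y c * ∑ i, (∑ j, z i j * U j) * U i - (∑ i, pd u y i * U i) * ∑ j, z c j * U j
        + 1 / ((k : ℝ) - 1) * (Z c * ∑ i, (∑ j, G y i j * U j) * U i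
          - (∑ j, G y c j * U j) * ∑ i, Z i * U i)) := by
    rw [show (∑ i, pd u y i * U i) * ∑ j, z c j * U j
        = ∑ i, ∑ j, pd u y i * U i * (z c j * U j) from Finset.sum_mul_sum _ _ _ _,
      show (∑ j, G y c j * U j) * ∑ i, Z i * U i = ∑ i, ∑ j, (G y c j * U j) * (Z i * U i) by
        rw [Finset.sum_mul_sum, Finset.sum_comm]]
    obtain ⟨S, hS⟩ : ∃ S : Fin k → Fin k → ℝ, ∀ i j,
        ∑ l, W c i j l * U l = S i j := ⟨_, fun _ _ => rfl⟩
    have hC' : ∀ i j, cotton G y c i j = - h y * S i j + P * (pd u y c * z i j - pd u y i * z c j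
        + 1 / ((k : ℝ) - 1) * (G y i j * Z c - G y c j * Z i)) := by
      intro i j
      rw [← hS, ← hZ, ← hZ]; exact hC c i j
    simp only [hS, Finset.sum_mul, cottonForm]
    simp only [Finset.mul_sum, ← Finset.sum_sub_distrib, ← Finset.sum_add_distrib]
    exact Finset.sum_congr rfl fun i _ => Finset.sum_congr rfl fun j _ => by
      rw [hC']; ring
  have hτ : ∑ i, Z i * U i = (lam y - scalar G y / k) * w
      - h y / 2 * gradInner G (gradInner G u u) u y := by
    rw [hw, gradInner]
    simp only [hZe, Finset.mul_sum, ← Finset.sum_sub_distrib]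
    exact Finset.sum_congr rfl fun i _ => by ring
  have hhu : gradInner G h u y = h' * w := by
    rw [hw, gradInner, Finset.mul_sum]
    exact Finset.sum_congr rfl fun i _ => by rw [hh', mul_assoc]
  rw [e1, hWz]
  simp only [hZ, hgU, ← hw]
  rw [hτ, hZe, fluxForm, hhu, hh', hP]
  field_simp
  ring

theorem smooth_fluxForm (hG : IsMetricOn G Ω) {u h : Eu k → ℝ}
    (hu : ContDiffOn ℝ ∞ u Ω) (hh : ContDiffOn ℝ ∞ h Ω) (c : Fin k) :
    ContDiffOn ℝ ∞ (fun z => fluxForm G u h z c) Ω := by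
  have hw := smooth_gradInner hG hu hu
  have hp := fun {f : Eu k → ℝ} (hf : ContDiffOn ℝ ∞ f Ω) => contDiffOn_pd hG.isOpen hf c
  unfold fluxForm
  exact ((hh.pow 2).mul ((hw.mul (hp hw)).sub ((smooth_gradInner hG hw hu).mul (hp hu)))).add
    (contDiffOn_const.mul (((smooth_gradInner hG hh hu).mul (hp hw)).sub
      ((smooth_gradInner hG hw hu).mul (hp hh))))

theorem covD1_congr (hΩ : IsOpen Ω) (hy : y ∈ Ω) {S T : Eu k → Fin k → ℝ}
    (h : ∀ z ∈ Ω, ∀ i, S z i = T z i) (a i : Fin k) :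
    covD1 G S y a i = covD1 G T y a i := by
  simp only [covD1, pd_congr_on hΩ hy (fun z hz => h z hz i), h y hy]

/-- The divergence of the flux form of a Bach-flat soliton. -/
theorem div_fluxForm (hG : IsMetricOn G Ω) (hy : y ∈ Ω) (hk : 4 ≤ k) {u h lam : Eu k → ℝ}
    (hu : ContDiffOn ℝ ∞ u Ω) (hh : ContDiffOn ℝ ∞ h Ω) (hl : ContDiffOn ℝ ∞ lam Ω)
    (heq : ∀ z ∈ Ω, ∀ i j, ricci G z i j + h z * hessian G u z i j = lam z * G z i j)
    (h0 : ∀ z ∈ Ω, h z ≠ 0) {h' : Eu k → ℝ}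
    (hh' : ∀ z ∈ Ω, ∀ i, pd h z i = h' z * pd u z i) (hB : ∀ i j, bach G y i j = 0) :
    ∑ a, ∑ c, (G y)⁻¹ a c * covD1 G (fluxForm G u h) y a c
      = 2 * ((k : ℝ) - 1) * (1 / ((k : ℝ) - 2) + h' y / h y ^ 2)
        * deviation (G y)⁻¹ (tracelessRicci G y) (pd u y) := by
  have hk' : (4 : ℝ) ≤ k := by exact_mod_cast hk
  have h1 : (k : ℝ) - 1 ≠ 0 := by linarith
  rw [mul_assoc, ← div_cottonForm hG hy hk hu hh hl heq (h0 y hy) (hh' y hy) hB, Finset.mul_sum]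
  refine Finset.sum_congr rfl fun a _ => ?_
  rw [Finset.mul_sum]
  refine Finset.sum_congr rfl fun c _ => ?_
  rw [covD1_congr hG.isOpen hy (fun z hz c => cottonForm_soliton hG hz hk hu hh hl heq (h0 z hz)
    (hh' z hz) c)]
  have hd := ContDiffOn.dAt (smooth_fluxForm hG hu hh c) hG.isOpen hy
  simp only [covD1, pd_const_mul hd, mul_left_comm _ (1 / (2 * ((k : ℝ) - 1))), ← Finset.mul_sum]
  field_simp

end Evaluation

/-! ### The deviation as the square of a norm -/

section Deviation

variable {k : ℕ}

/-- The squared tensor is the one that multiplies `P` in the Cotton tensor of a soliton, written in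
an orthonormal frame. Expanding the square leaves ten contractions, each of which is `|u|²|z|²`, a
multiple of `|z(u)|²`, or zero by the trace condition. -/
theorem half_sum_sq_eq (hk : 4 ≤ k) (z : Fin k → Fin k → ℝ) (u : Fin k → ℝ)
    (hz : ∀ i j, z i j = z j i) (htr : ∑ i, z i i = 0) :
    1 / 2 * ∑ c, ∑ i, ∑ j, (u c * z i j - u i * z c j + 1 / ((k : ℝ) - 1) *
        ((if i = j then 1 else 0) * (∑ l, z c l * u l)
          - (if c = j then 1 else 0) * ∑ l, z i l * u l)) ^ 2
      = (∑ i, u i ^ 2) * (∑ i, ∑ j, z i j ^ 2)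
        - k / ((k : ℝ) - 1) * ∑ c, (∑ l, z c l * u l) ^ 2 := by
  have hk' : (4 : ℝ) ≤ k := by exact_mod_cast hk
  have h1 : (k : ℝ) - 1 ≠ 0 := by linarith
  obtain ⟨Z, hZ⟩ : ∃ Z : Fin k → ℝ, ∀ c, ∑ l, z c l * u l = Z c := ⟨_, fun _ => rfl⟩
  simp only [hZ]
  set r := 1 / ((k : ℝ) - 1) with hr
  have e : ∀ c i j, (u c * z i j - u i * z c j + r *
        ((if i = j then 1 else 0) * Z c - (if c = j then 1 else 0) * Z i)) ^ 2
      = u c ^ 2 * z i j ^ 2 + u i ^ 2 * z c j ^ 2 + r ^ 2 * ((if i = j then 1 else 0) * Z c ^ 2)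
        + r ^ 2 * ((if c = j then 1 else 0) * Z i ^ 2) - 2 * ((z i j * u i) * (z c j * u c))
        + 2 * r * ((if i = j then 1 else 0) * (u c * Z c * z i j))
        - 2 * r * ((if c = j then 1 else 0) * (z i j * u c * Z i))
        - 2 * r * ((if i = j then 1 else 0) * (z c j * u i * Z c))
        + 2 * r * ((if c = j then 1 else 0) * (u i * Z i * z c j))
        - 2 * r ^ 2 * ((if i = j then 1 else 0) * ((if c = j then 1 else 0) * (Z c * Z i))) := by
    intro c i j
    split_ifs <;> ring
  rw [Finset.sum_congr rfl fun c _ => Finset.sum_congr rfl fun i _ =>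
    Finset.sum_congr rfl fun j _ => e c i j]
  simp only [Finset.sum_add_distrib, Finset.sum_sub_distrib, ← Finset.mul_sum]
  have s1 : ∑ c, ∑ i, ∑ j, z i j * u i * (z c j * u c) = ∑ c, Z c ^ 2 := by
    have : ∀ j, Z j ^ 2 = (∑ c, z c j * u c) * ∑ i, z i j * u i := by
      intro j
      rw [← hZ, sq]
      simp only [hz j]
    simp only [this, Finset.sum_mul_sum]
    calc _ = ∑ c, ∑ j, ∑ i, z i j * u i * (z c j * u c) :=
          Finset.sum_congr rfl fun c _ => Finset.sum_comm
      _ = ∑ j, ∑ c, ∑ i, z i j * u i * (z c j * u c) := Finset.sum_comm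
      _ = _ := Finset.sum_congr rfl fun j _ => Finset.sum_congr rfl fun c _ =>
          Finset.sum_congr rfl fun i _ => by ring
  have s2 : ∑ c, ∑ i, ∑ j, (if c = j then (1 : ℝ) else 0) * (z i j * u c * Z i) = ∑ c, Z c ^ 2 := by
    simp only [ite_mul, one_mul, zero_mul, Finset.sum_ite_eq, Finset.mem_univ, if_true]
    rw [Finset.sum_comm]
    exact Finset.sum_congr rfl fun i _ => by rw [← Finset.sum_mul, hZ]; ring
  have s3 : ∑ c, ∑ i, ∑ j, (if i = j then (1 : ℝ) else 0) * (z c j * u i * Z c) = ∑ c, Z c ^ 2 := by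
    simp only [ite_mul, one_mul, zero_mul, Finset.sum_ite_eq, Finset.mem_univ, if_true]
    exact Finset.sum_congr rfl fun i _ => by rw [← Finset.sum_mul, hZ]; ring
  have s4 : ∑ c, ∑ i, ∑ j, (if c = j then (1 : ℝ) else 0) * (u i * Z i * z c j) = 0 := by
    simp only [ite_mul, one_mul, zero_mul, Finset.sum_ite_eq, Finset.mem_univ, if_true]
    rw [Finset.sum_comm]; simp only [← Finset.mul_sum, htr, mul_zero, Finset.sum_const_zero]
  have s4' : ∑ c, ∑ i, ∑ j, (if i = j then (1 : ℝ) else 0) * (u c * Z c * z i j) = 0 := by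
    simp only [ite_mul, one_mul, zero_mul, Finset.sum_ite_eq, Finset.mem_univ, if_true]
    simp only [← Finset.mul_sum, htr, mul_zero, Finset.sum_const_zero]
  have s5 : ∑ c : Fin k, ∑ i : Fin k, ∑ j : Fin k, (if i = j then (1 : ℝ) else 0) * Z c ^ 2
      = k * ∑ c, Z c ^ 2 := by
    simp only [ite_mul, one_mul, zero_mul, Finset.sum_ite_eq, Finset.mem_univ, if_true]
    rw [Finset.sum_comm]; simp
  have s6 : ∑ c : Fin k, ∑ i : Fin k, ∑ j : Fin k, (if c = j then (1 : ℝ) else 0) * Z i ^ 2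
      = k * ∑ c, Z c ^ 2 := by
    simp only [ite_mul, one_mul, zero_mul, Finset.sum_ite_eq, Finset.mem_univ, if_true]
    simp
  have s7 : ∑ c, ∑ i, ∑ j, u c ^ 2 * z i j ^ 2 = (∑ i, u i ^ 2) * ∑ i, ∑ j, z i j ^ 2 := by
    rw [Finset.sum_mul]
    simp only [Finset.mul_sum]
  have s7' : ∑ c, ∑ i, ∑ j, u i ^ 2 * z c j ^ 2 = (∑ i, u i ^ 2) * ∑ i, ∑ j, z i j ^ 2 := by
    rw [Finset.sum_comm, s7]
  have s8 : ∑ c : Fin k, ∑ i : Fin k, ∑ j : Fin k, (if i = j then (1 : ℝ) else 0)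
      * ((if c = j then (1 : ℝ) else 0) * (Z c * Z i)) = ∑ c, Z c ^ 2 := by
    simp [sq]
  simp only [Finset.mul_sum] at s1 s2 s3 s4 s4' s5 s6 s7 s7' s8 ⊢
  simp only [← Finset.mul_sum] at s1 s2 s3 s4 s4' s5 s6 s7 s7' s8 ⊢
  rw [s1, s2, s3, s4, s4', s5, s6, s7, s7', s8, hr]
  field_simp
  ring

end Deviation

/-! ### Passage to an orthonormal frame; the equality case -/

section Frames

variable {k : ℕ}

-- For `q = g⁻¹` the rows of `E` form an orthonormal frame, in which a covector `u` and a 2-tensor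
-- `z` have the components `E u` and `E z Eᵀ`.
open scoped MatrixOrder Matrix.Norms.L2Operator in
theorem exists_frame {q : Matrix (Fin k) (Fin k) ℝ} (hq : q.PosDef) :
    ∃ E : Matrix (Fin k) (Fin k) ℝ, q = Eᵀ * E := by
  obtain ⟨B, hB⟩ := CStarAlgebra.nonneg_iff_eq_star_mul_self.mp hq.posSemidef.nonneg
  exact ⟨B, by rw [hB, Matrix.star_eq_conjTranspose, Matrix.conjTranspose_eq_transpose_of_trivial]⟩

theorem deviation_eq {q E : Matrix (Fin k) (Fin k) ℝ} (hE : q = Eᵀ * E) (z : Fin k → Fin k → ℝ)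
    (u : Fin k → ℝ) :
    deviation q z u = (∑ i, ((E *ᵥ u) i) ^ 2) * (∑ i, ∑ j, ((E * Matrix.of z * Eᵀ) i j) ^ 2)
      - k / ((k : ℝ) - 1) * ∑ c, (∑ l, (E * Matrix.of z * Eᵀ) c l * (E *ᵥ u) l) ^ 2 := by
  have h1 : ∑ i, ∑ j, q i j * u i * u j = ∑ i, ((E *ᵥ u) i) ^ 2 := by
    have e : ∑ i, ∑ j, q i j * u i * u j = u ⬝ᵥ (q *ᵥ u) := by
      simp only [dotProduct, Matrix.mulVec, Finset.mul_sum]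
      exact Finset.sum_congr rfl fun i _ => Finset.sum_congr rfl fun j _ => by ring
    rw [e, hE, ← Matrix.mulVec_mulVec, Matrix.dotProduct_mulVec, Matrix.vecMul_transpose]
    simp [dotProduct, sq]
  have h2 : ∑ c, ∑ j, z c j * raise q z c j = ∑ i, ∑ j, ((E * Matrix.of z * Eᵀ) i j) ^ 2 := by
    have e : ∑ c, ∑ j, z c j * raise q z c j = ((Matrix.of z)ᵀ * (q * Matrix.of z * qᵀ)).trace := by
      simp only [Matrix.trace, Matrix.diag, Matrix.mul_apply, raise, Matrix.transpose_apply,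
        Matrix.of_apply, Finset.sum_mul, Finset.mul_sum]
      rw [Finset.sum_comm]
      refine Finset.sum_congr rfl fun j _ => Finset.sum_congr rfl fun c _ => ?_
      rw [Finset.sum_comm]
      exact Finset.sum_congr rfl fun b _ => Finset.sum_congr rfl fun a _ => by ring
    have e2 : ∑ i, ∑ j, ((E * Matrix.of z * Eᵀ) i j) ^ 2
        = ((E * Matrix.of z * Eᵀ)ᵀ * (E * Matrix.of z * Eᵀ)).trace := by
      rw [Finset.sum_comm]
      refine Finset.sum_congr rfl fun j _ => ?_
      rw [Matrix.diag, Matrix.mul_apply]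
      exact Finset.sum_congr rfl fun i _ => by rw [Matrix.transpose_apply, sq]
    rw [e, e2, hE]
    simp only [Matrix.transpose_mul, Matrix.transpose_transpose, Matrix.mul_assoc]
    rw [Matrix.trace_mul_comm E]
    simp only [Matrix.mul_assoc]
  have h3 : ∀ c, ∑ l, z c l * ∑ m, q l m * u m = (Matrix.of z *ᵥ (q *ᵥ u)) c := fun c => rfl
  have h4 : ∑ c, (∑ l, z c l * ∑ m, q l m * u m) * (∑ d, q c d * ∑ l, z d l * ∑ m, q l m * u m)
      = ∑ c, (∑ l, (E * Matrix.of z * Eᵀ) c l * (E *ᵥ u) l) ^ 2 := by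
    have e : ∑ c, (∑ l, z c l * ∑ m, q l m * u m) * (∑ d, q c d * ∑ l, z d l * ∑ m, q l m * u m)
        = (Matrix.of z *ᵥ (q *ᵥ u)) ⬝ᵥ (q *ᵥ (Matrix.of z *ᵥ (q *ᵥ u))) := rfl
    have e2 : ∑ c, (∑ l, (E * Matrix.of z * Eᵀ) c l * (E *ᵥ u) l) ^ 2
        = ((E * Matrix.of z * Eᵀ) *ᵥ (E *ᵥ u)) ⬝ᵥ ((E * Matrix.of z * Eᵀ) *ᵥ (E *ᵥ u)) :=
      Finset.sum_congr rfl fun c _ => sq _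
    rw [e, e2]
    nth_rewrite 2 [hE]
    rw [← Matrix.mulVec_mulVec _ Eᵀ E, Matrix.dotProduct_mulVec, Matrix.vecMul_transpose, hE]
    simp only [Matrix.mulVec_mulVec, Matrix.mul_assoc]
  rw [deviation, h1, h2, h4]

theorem trace_frame {q E : Matrix (Fin k) (Fin k) ℝ} (hE : q = Eᵀ * E) {z : Fin k → Fin k → ℝ}
    (htr : ∑ i, ∑ j, q i j * z i j = 0) : ∑ i, (E * Matrix.of z * Eᵀ) i i = 0 := by
  have e : ∑ i, ∑ j, q i j * z i j = (qᵀ * Matrix.of z).trace := by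
    rw [Finset.sum_comm]
    simp [Matrix.trace, Matrix.mul_apply]
  have e2 : ∑ i, (E * Matrix.of z * Eᵀ) i i = (E * Matrix.of z * Eᵀ).trace := rfl
  rw [e2, Matrix.trace_mul_comm, ← Matrix.mul_assoc, ← htr, e, hE]
  simp

theorem symm_frame (E : Matrix (Fin k) (Fin k) ℝ) {z : Fin k → Fin k → ℝ}
    (hz : ∀ i j, z i j = z j i) (i j : Fin k) :
    (E * Matrix.of z * Eᵀ) i j = (E * Matrix.of z * Eᵀ) j i := by
  have : (E * Matrix.of z * Eᵀ)ᵀ = E * Matrix.of z * Eᵀ := by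
    have hzt : (Matrix.of z)ᵀ = Matrix.of z := by ext a b; exact hz b a
    simp [Matrix.transpose_mul, Matrix.mul_assoc, hzt]
  exact congrFun (congrFun this j) i

theorem deviation_nonneg (hk : 4 ≤ k) {q : Matrix (Fin k) (Fin k) ℝ} (hq : q.PosDef)
    {z : Fin k → Fin k → ℝ} (hz : ∀ i j, z i j = z j i) (htr : ∑ i, ∑ j, q i j * z i j = 0)
    (u : Fin k → ℝ) : 0 ≤ deviation q z u := by
  obtain ⟨E, hE⟩ := exists_frame hq
  rw [deviation_eq hE, ← half_sum_sq_eq hk _ _ (symm_frame E hz) (trace_frame hE htr)]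
  positivity

/-- In the equality case, the tensor `z` is a combination of the metric and `u ⊗ u`. -/
theorem eq_of_deviation_eq_zero (hk : 4 ≤ k) {g : Matrix (Fin k) (Fin k) ℝ} (hg : g.PosDef)
    {z : Fin k → Fin k → ℝ} (hz : ∀ i j, z i j = z j i) (htr : ∑ i, ∑ j, g⁻¹ i j * z i j = 0)
    {u : Fin k → ℝ} (hu : u ≠ 0) (hdev : deviation g⁻¹ z u = 0) :
    ∃ a b : ℝ, ∀ i j, z i j = a * g i j + b * (u i * u j) := by
  have hk' : (4 : ℝ) ≤ k := by exact_mod_cast hk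
  have h1 : (k : ℝ) - 1 ≠ 0 := by linarith
  obtain ⟨E, hE⟩ := exists_frame hg.inv
  have hgu : IsUnit g.det := hg.det_pos.ne'.isUnit
  have hEu : IsUnit E.det := by
    have : (g⁻¹).det ≠ 0 := hg.inv.det_pos.ne'
    rw [hE, Matrix.det_mul] at this
    exact (right_ne_zero_of_mul this).isUnit
  obtain ⟨z', hz'⟩ : ∃ z' : Matrix (Fin k) (Fin k) ℝ, z' = E * Matrix.of z * Eᵀ := ⟨_, rfl⟩
  obtain ⟨v, hv⟩ : ∃ v : Fin k → ℝ, v = E *ᵥ u := ⟨_, rfl⟩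
  rw [deviation_eq hE, ← half_sum_sq_eq hk _ _ (symm_frame E hz) (trace_frame hE htr), ← hz',
    ← hv] at hdev
  have hs : ∀ i j, z' i j = z' j i := by rw [hz']; exact symm_frame E hz
  obtain ⟨Z, hZ⟩ : ∃ Z : Fin k → ℝ, ∀ c, ∑ l, z' c l * v l = Z c := ⟨_, fun _ => rfl⟩
  simp only [hZ] at hdev
  -- A vanishing sum of squares: every component of the tensor is zero.
  have hT : ∀ c i j, v c * z' i j - v i * z' c j + 1 / ((k : ℝ) - 1) *
      ((if i = j then 1 else 0) * Z c - (if c = j then 1 else 0) * Z i) = 0 := by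
    have h0 := (mul_eq_zero.1 hdev).resolve_left (by norm_num)
    rw [Finset.sum_eq_zero_iff_of_nonneg (fun _ _ => by positivity)] at h0
    intro c i j
    have h0 := h0 c (Finset.mem_univ _)
    rw [Finset.sum_eq_zero_iff_of_nonneg (fun _ _ => by positivity)] at h0
    have h0 := h0 i (Finset.mem_univ _)
    rw [Finset.sum_eq_zero_iff_of_nonneg (fun _ _ => by positivity)] at h0
    exact pow_eq_zero_iff (two_ne_zero) |>.1 (h0 j (Finset.mem_univ _))
  set r := 1 / ((k : ℝ) - 1) with hr
  obtain ⟨w, hw⟩ : ∃ w : ℝ, w = ∑ c, v c ^ 2 := ⟨_, rfl⟩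
  obtain ⟨τ, hτ⟩ : ∃ τ : ℝ, τ = ∑ c, v c * Z c := ⟨_, rfl⟩
  have hw0 : w ≠ 0 := by
    intro h
    apply hu
    rw [hw, Finset.sum_eq_zero_iff_of_nonneg (fun _ _ => by positivity)] at h
    have hv0 : v = 0 := funext fun c => pow_eq_zero_iff (two_ne_zero) |>.1 (h c (Finset.mem_univ _))
    rw [hv] at hv0
    exact Matrix.eq_zero_of_mulVec_eq_zero hEu.ne_zero hv0
  -- Contract the first slot with `v`; this isolates `w z'`.
  have hc : ∀ i j, w * z' i j - v i * Z j + r * ((if i = j then 1 else 0) * τ - v j * Z i) = 0 := by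
    intro i j
    have e : ∑ c, v c * (v c * z' i j - v i * z' c j + r *
        ((if i = j then 1 else 0) * Z c - (if c = j then 1 else 0) * Z i)) = 0 :=
      Finset.sum_eq_zero fun c _ => by rw [hT, mul_zero]
    have e2 : ∀ c, v c * (v c * z' i j - v i * z' c j + r *
        ((if i = j then 1 else 0) * Z c - (if c = j then 1 else 0) * Z i))
        = v c ^ 2 * z' i j - v i * (z' j c * v c) + r * ((if i = j then 1 else 0) * (v c * Z c))
          - (if c = j then r * (v c * Z i) else 0) := by
      intro c; rw [hs c j]; split_ifs <;> ring
    simp only [e2, Finset.sum_add_distrib, Finset.sum_sub_distrib, ← Finset.mul_sum,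
      ← Finset.sum_mul, hZ, ← hw, ← hτ, Finset.sum_ite_eq', Finset.mem_univ, if_true] at e
    linarith
  have hr1 : r ≠ 1 := by
    rw [hr]; intro h; field_simp at h; linarith
  -- The skew part of `hc` is `(1 - r)` times `v ∧ Z`, and `r = 1/(k-1) ≠ 1`. So `z(v)` is parallel
  -- to `v`.
  have hanti : ∀ i j, v i * Z j = v j * Z i := by
    intro i j
    have a := hc i j
    have b := hc j i
    have hd : (if i = j then (1 : ℝ) else 0) = if j = i then 1 else 0 := by
      by_cases h : i = j <;> simp [h, eq_comm]
    rw [hs j i, ← hd] at b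
    have : (1 - r) * (v i * Z j - v j * Z i) = 0 := by linarith
    have := (mul_eq_zero.1 this).resolve_left (sub_ne_zero.2 hr1.symm)
    linarith
  have hZv : ∀ j, Z j = τ / w * v j := by
    intro j
    have : ∑ i, v i * (v i * Z j) = ∑ i, v i * (v j * Z i) :=
      Finset.sum_congr rfl fun i _ => by rw [hanti]
    have e1 : ∑ i, v i * (v i * Z j) = w * Z j := by
      rw [hw, Finset.sum_mul]; exact Finset.sum_congr rfl fun i _ => by ring
    have e2 : ∑ i, v i * (v j * Z i) = τ * v j := by
      rw [hτ, Finset.sum_mul]; exact Finset.sum_congr rfl fun i _ => by ring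
    rw [e1, e2] at this
    field_simp
    linarith
  -- Both coefficients are read off `hc` after substituting `Z = (τ/w) v`.
  refine ⟨- (r * τ / w), (1 + r) * τ / w ^ 2, ?_⟩
  have hmat : z' = (- (r * τ / w)) • (1 : Matrix (Fin k) (Fin k) ℝ)
      + ((1 + r) * τ / w ^ 2) • Matrix.vecMulVec v v := by
    ext i j
    have := hc i j
    rw [hZv, hZv] at this
    simp only [Matrix.add_apply, Matrix.smul_apply, Matrix.one_apply, Matrix.vecMulVec_apply,
      smul_eq_mul]
    field_simp
    field_simp at this
    linear_combination this
  have hback : Matrix.of z = (- (r * τ / w)) • g + ((1 + r) * τ / w ^ 2) • Matrix.vecMulVec u u := by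
    have hg' : g = E⁻¹ * (E⁻¹)ᵀ := by
      rw [← Matrix.nonsing_inv_nonsing_inv g hgu, hE, Matrix.mul_inv_rev,
        Matrix.transpose_nonsing_inv]
    have hu' : u = E⁻¹ *ᵥ v := by
      rw [hv, Matrix.mulVec_mulVec, Matrix.nonsing_inv_mul _ hEu, Matrix.one_mulVec]
    have hzz : Matrix.of z = E⁻¹ * z' * (E⁻¹)ᵀ := by
      have hEt : IsUnit (Eᵀ).det := by rwa [Matrix.det_transpose]
      calc Matrix.of z = (E⁻¹ * E) * Matrix.of z * (Eᵀ * (Eᵀ)⁻¹) := by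
            rw [Matrix.mul_nonsing_inv _ hEt, Matrix.nonsing_inv_mul _ hEu, Matrix.one_mul,
              Matrix.mul_one]
        _ = _ := by
            rw [hz', Matrix.transpose_nonsing_inv]
            simp only [Matrix.mul_assoc]
    rw [hzz, hmat, hg', hu']
    simp only [Matrix.mul_add, Matrix.add_mul, Matrix.mul_smul, Matrix.smul_mul, Matrix.mul_one,
      Matrix.mul_vecMulVec, Matrix.vecMulVec_mul, Matrix.vecMul_transpose]
  intro i j
  have := congrFun (congrFun hback i) j
  simpa [Matrix.vecMulVec_apply] using this

end Frames

/-! ### The Riemannian volume density -/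

section Density

variable {k : ℕ} {G : Eu k → Matrix (Fin k) (Fin k) ℝ} {Ω : Set (Eu k)} {y : Eu k}

theorem differentiable_det :
    Differentiable ℝ fun A : Fin k → Fin k → ℝ => (Matrix.of A).det := by
  simp only [Matrix.det_apply, Matrix.of_apply]
  fun_prop

/-- The derivative of `det (1 + t M)` at `t = 0` is the trace of `M`, by the expansion of this
polynomial to second order. -/
theorem fderiv_det_one (M : Fin k → Fin k → ℝ) :
    fderiv ℝ (fun A : Fin k → Fin k → ℝ => (Matrix.of A).det)
      (fun i j => (1 : Matrix (Fin k) (Fin k) ℝ) i j) M = ∑ i, M i i := by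
  set J : Fin k → Fin k → ℝ := fun i j => (1 : Matrix (Fin k) (Fin k) ℝ) i j with hJ
  have h1 : HasDerivAt (fun t : ℝ => (Matrix.of (J + t • M)).det)
      (fderiv ℝ (fun A : Fin k → Fin k → ℝ => (Matrix.of A).det) J M) 0 := by
    have hl : HasDerivAt (fun t : ℝ => J + t • M) M 0 := by
      simpa using ((hasDerivAt_id (0 : ℝ)).smul_const M).const_add J
    have hd : HasFDerivAt (fun A : Fin k → Fin k → ℝ => (Matrix.of A).det)
        (fderiv ℝ (fun A : Fin k → Fin k → ℝ => (Matrix.of A).det) J) (J + (0 : ℝ) • M) := by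
      simpa using (differentiable_det J).hasFDerivAt
    exact hd.comp_hasDerivAt (0 : ℝ) hl
  obtain ⟨p, hp⟩ : ∃ p : Polynomial ℝ, ∀ t : ℝ, (Matrix.of (J + t • M)).det
      = 1 + (∑ i, M i i) * t + p.eval t * t ^ 2 := by
    refine ⟨_, fun t => Matrix.det_one_add_smul t (Matrix.of M)⟩
  have h2 : HasDerivAt (fun t : ℝ => (Matrix.of (J + t • M)).det) (∑ i, M i i) 0 := by
    have e : (fun t : ℝ => (Matrix.of (J + t • M)).det)
        = fun t => 1 + (∑ i, M i i) * t + p.eval t * t ^ 2 := funext hp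
    rw [e]
    have a := ((hasDerivAt_id (0 : ℝ)).const_mul (∑ i, M i i)).const_add 1
    have b := (p.hasDerivAt 0).fun_mul ((hasDerivAt_id' (0 : ℝ)).fun_pow 2)
    have ab := a.fun_add b
    simp only [id_eq, mul_one, zero_pow, mul_zero, ne_eq, OfNat.ofNat_ne_zero,
      not_false_eq_true, Nat.cast_ofNat, add_zero, Nat.add_one_sub_one, pow_one] at ab
    exact ab
  exact h1.unique h2

/-- Jacobi's formula for the derivative of a determinant. -/
theorem pd_det (hG : IsMetricOn G Ω) (hy : y ∈ Ω) (a : Fin k) :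
    pd (fun z => (G z).det) y a
      = (G y).det * ∑ i, ∑ j, (G y)⁻¹ i j * pd (fun z => G z i j) y a := by
  have hu := hG.isUnit_det hy
  -- Normalising by `(G y)⁻¹` makes the matrix equal to `1` at `y`, where the derivative of the
  -- determinant is the trace.
  set N : Eu k → Fin k → Fin k → ℝ := fun z i j => ((G y)⁻¹ * G z) i j with hN
  have hNd : ∀ i j, DifferentiableAt ℝ (fun z => N z i j) y := by
    intro i j
    simp only [hN, Matrix.mul_apply]
    exact DifferentiableAt.fun_sum fun m _ => (differentiableAt_const _).fun_mul (hG.dAt_metric hy m j)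
  have hND : DifferentiableAt ℝ N y :=
    differentiableAt_pi.2 fun i => differentiableAt_pi.2 fun j => hNd i j
  have hNy : N y = fun i j => (1 : Matrix (Fin k) (Fin k) ℝ) i j := by
    simp only [hN, Matrix.nonsing_inv_mul _ hu]
    rfl
  have e : ∀ z, (G z).det = (G y).det * (Matrix.of (N z)).det := by
    intro z
    have : Matrix.of (N z) = (G y)⁻¹ * G z := rfl
    rw [this, ← Matrix.det_mul, ← Matrix.mul_assoc, Matrix.mul_nonsing_inv _ hu, Matrix.one_mul]
  have hdN : ∀ i j, fderiv ℝ N y (EuclideanSpace.single a 1) i j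
      = ∑ m, (G y)⁻¹ i m * pd (fun z => G z m j) y a := by
    intro i j
    have h1 : fderiv ℝ N y (EuclideanSpace.single a 1) i j = pd (fun z => N z i j) y a := by
      have := ((hasFDerivAt_pi'.1 ((hasFDerivAt_pi'.1 hND.hasFDerivAt) i)) j).fderiv
      unfold pd
      rw [this]
      rfl
    rw [h1]
    simp only [hN, Matrix.mul_apply]
    rw [pd_sum fun m _ => (differentiableAt_const _).fun_mul (hG.dAt_metric hy m j)]
    exact Finset.sum_congr rfl fun m _ => pd_const_mul (hG.dAt_metric hy m j) _ _
  have hcomp : HasFDerivAt (fun z => (Matrix.of (N z)).det)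
      ((fderiv ℝ (fun A : Fin k → Fin k → ℝ => (Matrix.of A).det) (N y)).comp (fderiv ℝ N y)) y :=
    ((differentiable_det (N y)).hasFDerivAt).comp y hND.hasFDerivAt
  have e2 : pd (fun z => (Matrix.of (N z)).det) y a
      = ∑ i, ∑ m, (G y)⁻¹ i m * pd (fun z => G z m i) y a := by
    unfold pd at hdN ⊢
    rw [hcomp.fderiv, ContinuousLinearMap.comp_apply, hNy, fderiv_det_one]
    exact Finset.sum_congr rfl fun i _ => hdN i i
  rw [show (fun z => (G z).det) = _ from funext e]
  rw [pd_const_mul hcomp.differentiableAt, e2]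
  congr 1
  refine Finset.sum_congr rfl fun i _ => Finset.sum_congr rfl fun m _ => ?_
  rw [pd_congr_on hG.isOpen hy (fun z hz => hG.symm hz m i)]

/-- The Riemannian volume density. -/
def density (G : Eu k → Matrix (Fin k) (Fin k) ℝ) (y : Eu k) : ℝ := Real.sqrt (G y).det

theorem density_pos (hG : IsMetricOn G Ω) (hy : y ∈ Ω) : 0 < density G y :=
  Real.sqrt_pos.2 (hG.posDef y hy).det_pos

theorem smooth_density (hG : IsMetricOn G Ω) : ContDiffOn ℝ ∞ (density G) Ω := by
  unfold density
  exact hG.smooth_det.sqrt fun y hy => (hG.posDef y hy).det_pos.ne'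

/-- Half of the logarithmic derivative of `det G` is `Γ^m_{am}`, by Jacobi's formula and metric
compatibility. The square of the density is differentiated, and a factor of the density is divided
out. -/
theorem pd_density (hG : IsMetricOn G Ω) (hy : y ∈ Ω) (a : Fin k) :
    pd (density G) y a = density G y * ∑ m, christoffel G y m a m := by
  have hpos := density_pos hG hy
  have h1 : pd (fun z => density G z * density G z) y a = pd (fun z => (G z).det) y a :=
    pd_congr_on hG.isOpen hy (fun z hz =>
      Real.mul_self_sqrt (hG.posDef z hz).det_pos.le) a
  have hd := ContDiffOn.dAt (smooth_density hG) hG.isOpen hy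
  have h2 : ∑ i, ∑ j, (G y)⁻¹ i j * pd (fun z => G z i j) y a
      = 2 * ∑ m, christoffel G y m a m := by
    simp only [hG.pd_metric hy, mul_add, Finset.sum_add_distrib, Finset.mul_sum]
    have e1 : ∑ i, ∑ j, ∑ m, (G y)⁻¹ i j * (christoffel G y m a i * G y m j)
        = ∑ m, christoffel G y m a m := by
      have : ∀ i, ∑ j, ∑ m, (G y)⁻¹ i j * (christoffel G y m a i * G y m j)
          = ∑ m, christoffel G y m a i * if i = m then 1 else 0 := by
        intro i
        rw [Finset.sum_comm]
        refine Finset.sum_congr rfl fun m _ => ?_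
        rw [← hG.inv_mul hy, Finset.mul_sum]
        exact Finset.sum_congr rfl fun j _ => by rw [hG.symm hy m j]; ring
      simp only [this]
      simp
    have e2 : ∑ i, ∑ j, ∑ m, (G y)⁻¹ i j * (christoffel G y m a j * G y i m)
        = ∑ m, christoffel G y m a m := by
      rw [← e1, Finset.sum_comm]
      exact Finset.sum_congr rfl fun i _ => Finset.sum_congr rfl fun j _ =>
        Finset.sum_congr rfl fun m _ => by rw [hG.inv_symm hy j i, hG.symm hy j m]
    rw [e1, e2, ← Finset.mul_sum, two_mul]
  rw [pd_mul hd hd, pd_det hG hy, h2] at h1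
  have h3 : (G y).det = density G y * density G y :=
    (Real.mul_self_sqrt (hG.posDef y hy).det_pos.le).symm
  rw [h3] at h1
  have : density G y * (pd (density G) y a - density G y * ∑ m, christoffel G y m a m) = 0 := by
    linarith
  linarith [(mul_eq_zero.1 this).resolve_left hpos.ne']

/-- The divergence of a 1-form in terms of the volume density. -/
theorem sum_pd_density_mul (hG : IsMetricOn G Ω) (hy : y ∈ Ω) {X : Eu k → Fin k → ℝ}
    (hX : ∀ c, DifferentiableAt ℝ (fun z => X z c) y) :
    ∑ a, pd (fun z => density G z * ∑ c, (G z)⁻¹ a c * X z c) y a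
      = density G y * ∑ a, ∑ c, (G y)⁻¹ a c * covD1 G X y a c := by
  have hd := ContDiffOn.dAt (smooth_density hG) hG.isOpen hy
  have hq : ∀ i j, DifferentiableAt ℝ (fun z => (G z)⁻¹ i j) y := fun i j =>
    ContDiffOn.dAt (hG.smooth_inv i j) hG.isOpen hy
  have hs : ∀ a, DifferentiableAt ℝ (fun z => ∑ c, (G z)⁻¹ a c * X z c) y := fun a =>
    DifferentiableAt.fun_sum fun c _ => (hq a c).fun_mul (hX c)
  have e : ∀ a, pd (fun z => ∑ c, (G z)⁻¹ a c * X z c) y a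
      = ∑ c, ((- ∑ m, christoffel G y a a m * (G y)⁻¹ m c
        - ∑ m, christoffel G y c a m * (G y)⁻¹ a m) * X y c
        + (G y)⁻¹ a c * pd (fun z => X z c) y a) := by
    intro a
    rw [pd_sum fun c _ => (hq a c).fun_mul (hX c)]
    exact Finset.sum_congr rfl fun c _ => by rw [pd_mul (hq a c) (hX c), hG.pd_inv hy]
  have e1 : ∑ a, (∑ m, christoffel G y m a m) * ∑ c, (G y)⁻¹ a c * X y c
      = ∑ a, ∑ c, (∑ m, christoffel G y a a m * (G y)⁻¹ m c) * X y c := by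
    simp only [Finset.sum_mul_sum]
    rw [Finset.sum_comm]
    refine Finset.sum_congr rfl fun m _ => ?_
    rw [Finset.sum_comm]
    refine Finset.sum_congr rfl fun c _ => ?_
    rw [Finset.sum_mul]
    exact Finset.sum_congr rfl fun a _ => by rw [hG.christoffel_symm hy m a m]; ring
  have e2 : ∑ a, ∑ c, (∑ m, christoffel G y c a m * (G y)⁻¹ a m) * X y c
      = ∑ a, ∑ c, (G y)⁻¹ a c * ∑ m, christoffel G y m a c * X y m := by
    refine Finset.sum_congr rfl fun a _ => ?_
    simp only [Finset.sum_mul, Finset.mul_sum]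
    rw [Finset.sum_comm]
    exact Finset.sum_congr rfl fun m _ => Finset.sum_congr rfl fun c _ => by ring
  simp only [pd_mul hd (hs _), pd_density hG hy, e, mul_assoc, Finset.sum_add_distrib,
    ← Finset.mul_sum, e1]
  rw [← mul_add]
  congr 1
  simp only [covD1, mul_sub, sub_mul, neg_mul, Finset.sum_sub_distrib, Finset.sum_add_distrib,
    Finset.sum_neg_distrib, e2]
  ring

end Density

/-! ### The Riemannian metric in charts and parametrisations -/

section Charts

variable {n : ℕ} {M : Type*} [TopologicalSpace M] [ChartedSpace (EuclideanSpace ℝ (Fin n)) M]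
  [IsManifold (𝓡 n) ∞ M]
  {F : Type*} [NormedAddCommGroup F] [NormedSpace ℝ F]

/-- The tangent map of `σ` composed with the constant vector field `a`. In this form the smoothness
of the bundle metric applies to inner products of derivatives. -/
theorem contMDiffOn_mfderiv_apply {σ : F → M} {V : Set F} (hV : IsOpen V)
    (hσ : ContMDiffOn 𝓘(ℝ, F) (𝓡 n) ∞ σ V) (a : F) :
    ContMDiffOn 𝓘(ℝ, F) (𝓡 n).tangent ∞
      (fun z => (⟨σ z, mfderiv 𝓘(ℝ, F) (𝓡 n) σ z a⟩ : TangentBundle (𝓡 n) M)) V := by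
  have h1 := hσ.contMDiffOn_tangentMapWithin (m := ∞) (by simp) hV.uniqueMDiffOn
  have h2 : ContMDiff 𝓘(ℝ, F) 𝓘(ℝ, F).tangent ∞ (fun z : F => (⟨z, a⟩ : TangentBundle 𝓘(ℝ, F) F)) := by
    exact contMDiff_vectorSpace_iff_contDiff.2 contDiff_const
  refine (h1.comp h2.contMDiffOn (fun z hz => hz)).congr fun z hz => ?_
  have := tangentMapWithin_eq_tangentMap (p := (⟨z, a⟩ : TangentBundle 𝓘(ℝ, F) F))
    (hV.uniqueMDiffOn z hz)
    ((hσ.contMDiffAt (hV.mem_nhds hz)).mdifferentiableAt (by simp))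
  exact this.symm

/-- The differential of a map into `M`, computed in a chart. -/
theorem mfderiv_eq_chart {σ : F → M} {z : F} (hσ : MDifferentiableAt 𝓘(ℝ, F) (𝓡 n) σ z)
    {e : OpenPartialHomeomorph M (Eu n)} (he : e ∈ IsManifold.maximalAtlas (𝓡 n) ∞ M)
    (hz : σ z ∈ e.source) (a : F) :
    DifferentiableAt ℝ (fun z => e (σ z)) z ∧
    (mfderiv 𝓘(ℝ, F) (𝓡 n) σ z a : Eu n)
      = mfderiv (𝓡 n) (𝓡 n) e.symm (e (σ z)) (fderiv ℝ (fun z => e (σ z)) z a) := by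
  have h1 := (contMDiffAt_of_mem_maximalAtlas he hz).mdifferentiableAt (by simp)
  have h2 := (contMDiffAt_symm_of_mem_maximalAtlas he (e.map_source hz)).mdifferentiableAt (by simp)
  have h3 : MDifferentiableAt 𝓘(ℝ, F) (𝓡 n) (e ∘ σ) z := h1.comp z hσ
  have h4 : DifferentiableAt ℝ (e ∘ σ) z := h3.differentiableAt
  refine ⟨h4, ?_⟩
  have h5 : σ =ᶠ[nhds z] e.symm ∘ (e ∘ σ) := by
    filter_upwards [hσ.continuousAt.preimage_mem_nhds (e.open_source.mem_nhds hz)] with w hw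
    exact (e.left_inv hw).symm
  have h6 := h5.mfderiv_eq (I := 𝓘(ℝ, F)) (I' := 𝓡 n)
  have h7 := mfderiv_comp_apply (I := 𝓘(ℝ, F)) (I' := 𝓡 n) (I'' := 𝓡 n) z h2 h3 a
  have h8 : mfderiv 𝓘(ℝ, F) (𝓡 n) (e ∘ σ) z = fderiv ℝ (e ∘ σ) z := mfderiv_eq_fderiv
  rw [h8] at h7
  exact (congrArg (fun L : F →L[ℝ] Eu n => L a) h6).trans h7

theorem mfderiv_symm_injective {e : OpenPartialHomeomorph M (Eu n)}
    (he : e ∈ IsManifold.maximalAtlas (𝓡 n) ∞ M) {y : Eu n} (hy : y ∈ e.target) :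
    Function.Injective (mfderiv (𝓡 n) (𝓡 n) e.symm y) := by
  have h : e.MDifferentiable (𝓡 n) (𝓡 n) :=
    ⟨fun x hx => ((contMDiffAt_of_mem_maximalAtlas he hx).mdifferentiableAt (by simp)).mdifferentiableWithinAt,
     fun x hx => ((contMDiffAt_symm_of_mem_maximalAtlas he hx).mdifferentiableAt (by simp)).mdifferentiableWithinAt⟩
  exact h.symm.mfderiv_injective hy

variable [RiemannianBundle (fun x : M => TangentSpace (𝓡 n) x)]

theorem smooth_inner_mfderiv [IsContMDiffRiemannianBundle (𝓡 n) ∞ (EuclideanSpace ℝ (Fin n))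
      (fun x : M => TangentSpace (𝓡 n) x)] {σ : F → M} {V : Set F} (hV : IsOpen V)
    (hσ : ContMDiffOn 𝓘(ℝ, F) (𝓡 n) ∞ σ V) (a b : F) :
    ContDiffOn ℝ ∞ (fun z => inner ℝ (mfderiv 𝓘(ℝ, F) (𝓡 n) σ z a : TangentSpace (𝓡 n) (σ z))
      (mfderiv 𝓘(ℝ, F) (𝓡 n) σ z b : TangentSpace (𝓡 n) (σ z))) V :=
  (ContMDiffOn.inner_bundle (contMDiffOn_mfderiv_apply hV hσ a)
    (contMDiffOn_mfderiv_apply hV hσ b)).contDiffOn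

theorem inner_sum_single {k : ℕ} {x : M} (L : Eu k →L[ℝ] TangentSpace (𝓡 n) x) (v w : Eu k) :
    inner ℝ (L v) (L w) = ∑ i, ∑ j,
      inner ℝ (L (EuclideanSpace.single i 1)) (L (EuclideanSpace.single j 1)) * v i * w j := by
  have hv : ∀ v : Eu k, L v = ∑ i, v i • L (EuclideanSpace.single i 1) := by
    intro v
    conv_lhs => rw [← (EuclideanSpace.basisFun (Fin k) ℝ).sum_repr v, map_sum]
    simp
  rw [hv v, hv w]
  simp only [sum_inner, inner_sum, inner_smul_left, inner_smul_right]
  simp only [conj_trivial, Finset.mul_sum]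
  rw [Finset.sum_comm]
  exact Finset.sum_congr rfl fun i _ => Finset.sum_congr rfl fun j _ => by ring

theorem inner_mfderiv_eq_gram {k : ℕ} (σ : Eu k → M) (y v w : Eu k) :
    inner ℝ (mfderiv (𝓡 k) (𝓡 n) σ y v : TangentSpace (𝓡 n) (σ y))
      (mfderiv (𝓡 k) (𝓡 n) σ y w : TangentSpace (𝓡 n) (σ y))
      = ∑ i, ∑ j, gram n σ y i j * v i * w j :=
  inner_sum_single (mfderiv (𝓡 k) (𝓡 n) σ y) v w

theorem isMetricOn_gram [IsContMDiffRiemannianBundle (𝓡 n) ∞ (EuclideanSpace ℝ (Fin n))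
      (fun x : M => TangentSpace (𝓡 n) x)] {k : ℕ} {σ : Eu k → M} {V : Set (Eu k)} (hV : IsOpen V)
    (hσ : ContMDiffOn (𝓡 k) (𝓡 n) ∞ σ V)
    (hi : ∀ y ∈ V, Function.Injective (mfderiv (𝓡 k) (𝓡 n) σ y)) :
    IsMetricOn (gram n σ) V where
  isOpen := hV
  smooth i j := smooth_inner_mfderiv hV hσ _ _
  posDef y hy := by
    rw [Matrix.posDef_iff_dotProduct_mulVec]
    refine ⟨?_, fun x hx => ?_⟩
    · refine Matrix.IsHermitian.ext fun i j => ?_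
      simp only [gram, Matrix.of_apply, star_trivial]
      exact real_inner_comm (F := TangentSpace (𝓡 n) (σ y)) _ _
    · have h := inner_mfderiv_eq_gram (n := n) σ y (WithLp.toLp 2 x) (WithLp.toLp 2 x)
      have h0 : (mfderiv (𝓡 k) (𝓡 n) σ y (WithLp.toLp 2 x) : TangentSpace (𝓡 n) (σ y)) ≠ 0 := by
        intro h0
        apply hx
        have := hi y hy (h0.trans (map_zero _).symm)
        exact congrArg WithLp.ofLp this
      have h1 : 0 < inner ℝ (mfderiv (𝓡 k) (𝓡 n) σ y (WithLp.toLp 2 x) : TangentSpace (𝓡 n) (σ y))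
          (mfderiv (𝓡 k) (𝓡 n) σ y (WithLp.toLp 2 x)) := real_inner_self_pos.2 h0
      rw [h] at h1
      refine lt_of_lt_of_eq h1 ?_
      change _ = ∑ i, x i * ∑ j, gram n σ y i j * x j
      simp only [Finset.mul_sum]
      exact Finset.sum_congr rfl fun i _ => Finset.sum_congr rfl fun j _ => by ring

theorem inner_mfderiv_eq_chart {σ : F → M} {z : F} (hσ : MDifferentiableAt 𝓘(ℝ, F) (𝓡 n) σ z)
    {e : OpenPartialHomeomorph M (Eu n)} (he : e ∈ IsManifold.maximalAtlas (𝓡 n) ∞ M)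
    (hz : σ z ∈ e.source) (a b : F) :
    inner ℝ (mfderiv 𝓘(ℝ, F) (𝓡 n) σ z a : TangentSpace (𝓡 n) (σ z))
      (mfderiv 𝓘(ℝ, F) (𝓡 n) σ z b : TangentSpace (𝓡 n) (σ z))
      = ∑ i, ∑ j, gram n e.symm (e (σ z)) i j * fderiv ℝ (fun z => e (σ z)) z a i
        * fderiv ℝ (fun z => e (σ z)) z b j := by
  rw [← inner_mfderiv_eq_gram]
  obtain ⟨-, h1⟩ := mfderiv_eq_chart hσ he hz a
  obtain ⟨-, h2⟩ := mfderiv_eq_chart hσ he hz b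
  -- The two inner products live in the tangent spaces at `e.symm (e (σ z))` and at `σ z`. The base
  -- points agree only through `left_inv`, but both fibres are `ℝⁿ` by definition, so the vectors
  -- can be transported by substitution.
  have key : ∀ (x : M) (hx : x = σ z) (p q : Eu n),
      inner ℝ (show TangentSpace (𝓡 n) (σ z) from p) (show TangentSpace (𝓡 n) (σ z) from q)
        = inner ℝ (show TangentSpace (𝓡 n) x from p) (show TangentSpace (𝓡 n) x from q) := by
    rintro x rfl p q; rfl
  rw [show (mfderiv 𝓘(ℝ, F) (𝓡 n) σ z a : TangentSpace (𝓡 n) (σ z)) = _ from h1,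
    show (mfderiv 𝓘(ℝ, F) (𝓡 n) σ z b : TangentSpace (𝓡 n) (σ z)) = _ from h2]
  exact key _ (e.left_inv hz) _ _

variable [IsContMDiffRiemannianBundle (𝓡 n) ∞ (EuclideanSpace ℝ (Fin n))
      (fun x : M => TangentSpace (𝓡 n) x)]

theorem isMetricOn_chart {e : OpenPartialHomeomorph M (Eu n)}
    (he : e ∈ IsManifold.maximalAtlas (𝓡 n) ∞ M) : IsMetricOn (gram n e.symm) e.target :=
  isMetricOn_gram e.open_target (contMDiffOn_symm_of_mem_maximalAtlas he)
    fun _ hy => mfderiv_symm_injective he hy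

end Charts

/-! ### Change of charts -/

section Transition

variable {n : ℕ} {M : Type*} [TopologicalSpace M] [ChartedSpace (EuclideanSpace ℝ (Fin n)) M]
  [IsManifold (𝓡 n) ∞ M] [RiemannianBundle (fun x : M => TangentSpace (𝓡 n) x)]
  [IsContMDiffRiemannianBundle (𝓡 n) ∞ (EuclideanSpace ℝ (Fin n))
      (fun x : M => TangentSpace (𝓡 n) x)]
  {e e' : OpenPartialHomeomorph M (Eu n)} {y : Eu n}

theorem smooth_chart_comp {a : M → ℝ} (ha : ContMDiff (𝓡 n) 𝓘(ℝ, ℝ) ∞ a)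
    (he : e ∈ IsManifold.maximalAtlas (𝓡 n) ∞ M) :
    ContDiffOn ℝ ∞ (fun z => a (e.symm z)) e.target :=
  (ha.comp_contMDiffOn (contMDiffOn_symm_of_mem_maximalAtlas he)).contDiffOn

theorem smooth_transition (he : e ∈ IsManifold.maximalAtlas (𝓡 n) ∞ M)
    (he' : e' ∈ IsManifold.maximalAtlas (𝓡 n) ∞ M) :
    ContDiffOn ℝ ∞ (fun z => e' (e.symm z)) (e.symm.trans e').source :=
  ((contMDiffOn_of_mem_maximalAtlas he').comp (contMDiffOn_symm_of_mem_maximalAtlas he |>.mono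
    fun x hx => by simp only [OpenPartialHomeomorph.trans_source] at hx; exact hx.1)
    fun x hx => by simp only [OpenPartialHomeomorph.trans_source] at hx; exact hx.2).contDiffOn

/-- The Jacobian matrix of the transition map from `e` to `e'`. -/
def jacobian (e e' : OpenPartialHomeomorph M (Eu n)) (y : Eu n) : Matrix (Fin n) (Fin n) ℝ :=
  Matrix.of fun k i => fderiv ℝ (fun z => e' (e.symm z)) y (EuclideanSpace.single i 1) k

theorem gram_transition (he : e ∈ IsManifold.maximalAtlas (𝓡 n) ∞ M)
    (he' : e' ∈ IsManifold.maximalAtlas (𝓡 n) ∞ M) (hy : y ∈ e.target)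
    (hy' : e.symm y ∈ e'.source) :
    gram n e.symm y
      = (jacobian e e' y)ᵀ * gram n e'.symm (e' (e.symm y)) * jacobian e e' y := by
  ext i j
  have h := inner_mfderiv_eq_chart (n := n) (σ := e.symm)
    ((contMDiffAt_symm_of_mem_maximalAtlas he hy).mdifferentiableAt (by simp)) he' hy'
    (EuclideanSpace.single i 1) (EuclideanSpace.single j 1)
  simp only [Matrix.mul_apply, Matrix.transpose_apply, Finset.sum_mul]
  rw [Finset.sum_comm]
  refine h.trans ?_
  exact Finset.sum_congr rfl fun k _ => Finset.sum_congr rfl fun l _ => by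
    simp only [jacobian, Matrix.of_apply]; ring

theorem pd_transition {a : M → ℝ} (ha : ContMDiff (𝓡 n) 𝓘(ℝ, ℝ) ∞ a)
    (he : e ∈ IsManifold.maximalAtlas (𝓡 n) ∞ M)
    (he' : e' ∈ IsManifold.maximalAtlas (𝓡 n) ∞ M) (hy : y ∈ e.target)
    (hy' : e.symm y ∈ e'.source) (i : Fin n) :
    pd (fun z => a (e.symm z)) y i
      = ∑ k, pd (fun z => a (e'.symm z)) (e' (e.symm y)) k * jacobian e e' y k i := by
  have hs : y ∈ (e.symm.trans e').source := by
    simp only [OpenPartialHomeomorph.trans_source]; exact ⟨hy, hy'⟩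
  have ho := (e.symm.trans e').open_source
  rw [pd_congr_on (f := fun z => a (e.symm z)) (g := fun z => a (e'.symm (e' (e.symm z)))) ho hs
    (fun z hz => by
      simp only [OpenPartialHomeomorph.trans_source] at hz
      rw [e'.left_inv hz.2])]
  have h1 := ContDiffOn.dAt (smooth_chart_comp ha he') e'.open_target (e'.map_source hy')
  have h2 : DifferentiableAt ℝ (fun z => e' (e.symm z)) y :=
    ((smooth_transition he he').contDiffAt (ho.mem_nhds hs)).differentiableAt (by simp)
  have h3 := (h1.hasFDerivAt.comp y h2.hasFDerivAt).fderiv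
  unfold pd
  rw [show (fun z => a (e'.symm (e' (e.symm z))))
    = (fun z => a (e'.symm z)) ∘ (fun z => e' (e.symm z)) from rfl, h3,
    ContinuousLinearMap.comp_apply]
  conv_lhs => rw [← (EuclideanSpace.basisFun (Fin n) ℝ).sum_repr
    (fderiv ℝ (fun z => e' (e.symm z)) y (EuclideanSpace.single i 1)), map_sum]
  simp [jacobian, mul_comm]

theorem isUnit_jacobian (he : e ∈ IsManifold.maximalAtlas (𝓡 n) ∞ M)
    (he' : e' ∈ IsManifold.maximalAtlas (𝓡 n) ∞ M) (hy : y ∈ e.target)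
    (hy' : e.symm y ∈ e'.source) : IsUnit (jacobian e e' y).det := by
  have h := (isMetricOn_chart (n := n) he).isUnit_det hy
  rw [gram_transition he he' hy hy', Matrix.det_mul] at h
  exact isUnit_of_mul_isUnit_right h

theorem density_transition (he : e ∈ IsManifold.maximalAtlas (𝓡 n) ∞ M)
    (he' : e' ∈ IsManifold.maximalAtlas (𝓡 n) ∞ M) (hy : y ∈ e.target)
    (hy' : e.symm y ∈ e'.source) :
    density (gram n e.symm) y
      = |(jacobian e e' y).det| * density (gram n e'.symm) (e' (e.symm y)) := by
  unfold density
  rw [gram_transition he he' hy hy', Matrix.det_mul, Matrix.det_mul, Matrix.det_transpose,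
    mul_comm, ← mul_assoc, Real.sqrt_mul (mul_self_nonneg _), Real.sqrt_mul_self_eq_abs]

/-- Differentials transform by `Jᵀ` and the metric by `Jᵀ G' J`; the statement is the identity `J
(Jᵀ G' J)⁻¹ Jᵀ = G'⁻¹`. -/
theorem gradInner_transition {a b : M → ℝ} (ha : ContMDiff (𝓡 n) 𝓘(ℝ, ℝ) ∞ a)
    (hb : ContMDiff (𝓡 n) 𝓘(ℝ, ℝ) ∞ b)
    (he : e ∈ IsManifold.maximalAtlas (𝓡 n) ∞ M)
    (he' : e' ∈ IsManifold.maximalAtlas (𝓡 n) ∞ M) (hy : y ∈ e.target)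
    (hy' : e.symm y ∈ e'.source) :
    gradInner (gram n e.symm) (fun z => a (e.symm z)) (fun z => b (e.symm z)) y
      = gradInner (gram n e'.symm) (fun z => a (e'.symm z)) (fun z => b (e'.symm z))
        (e' (e.symm y)) := by
  have hJ := isUnit_jacobian he he' hy hy'
  have hG := (isMetricOn_chart (n := n) he').isUnit_det (e'.map_source hy')
  set J := jacobian e e' y with hJd
  set G' := gram n e'.symm (e' (e.symm y)) with hGd
  have key : J * (Jᵀ * G' * J)⁻¹ * Jᵀ = G'⁻¹ := by
    have hJt : IsUnit (Jᵀ).det := by rwa [Matrix.det_transpose]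
    rw [Matrix.mul_inv_rev, Matrix.mul_inv_rev, ← Matrix.mul_assoc, Matrix.mul_nonsing_inv _ hJ,
      Matrix.one_mul, Matrix.mul_assoc, Matrix.nonsing_inv_mul _ hJt, Matrix.mul_one]
  have e1 : ∀ (q : Matrix (Fin n) (Fin n) ℝ) (f g : Fin n → ℝ),
      ∑ i, f i * ∑ m, q i m * g m = f ⬝ᵥ q *ᵥ g := fun q f g => rfl
  unfold gradInner gradV
  rw [e1, e1, gram_transition he he' hy hy', ← hJd, ← hGd, ← key]
  have pda : ∀ {a : M → ℝ} (ha : ContMDiff (𝓡 n) 𝓘(ℝ, ℝ) ∞ a),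
      pd (fun z => a (e.symm z)) y = Jᵀ *ᵥ pd (fun z => a (e'.symm z)) (e' (e.symm y)) := by
    intro a ha
    funext i
    rw [pd_transition ha he he' hy hy']
    simp [Matrix.mulVec, dotProduct, ← hJd, mul_comm]
  rw [pda ha, pda hb, Matrix.mulVec_transpose, ← Matrix.dotProduct_mulVec, Matrix.mulVec_mulVec,
    Matrix.mulVec_mulVec, Matrix.mul_assoc]

variable (n) in
/-- The function `⟨∇a, ∇b⟩` on a Riemannian manifold. -/
def gradProd (a b : M → ℝ) (x : M) : ℝ :=
  gradInner (gram n (chartAt (Eu n) x).symm) (fun z => a ((chartAt (Eu n) x).symm z))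
    (fun z => b ((chartAt (Eu n) x).symm z)) (chartAt (Eu n) x x)

/-- The definition uses the preferred chart at each point; by invariance any other chart of the
atlas gives the same value, which makes the function smooth. -/
theorem gradProd_chart {a b : M → ℝ} (ha : ContMDiff (𝓡 n) 𝓘(ℝ, ℝ) ∞ a)
    (hb : ContMDiff (𝓡 n) 𝓘(ℝ, ℝ) ∞ b) (he : e ∈ IsManifold.maximalAtlas (𝓡 n) ∞ M)
    (hy : y ∈ e.target) :
    gradProd n a b (e.symm y)
      = gradInner (gram n e.symm) (fun z => a (e.symm z)) (fun z => b (e.symm z)) y :=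
  (gradInner_transition ha hb he (IsManifold.chart_mem_maximalAtlas _) hy
    (mem_chart_source (Eu n) _)).symm

theorem contMDiff_gradProd {a b : M → ℝ} (ha : ContMDiff (𝓡 n) 𝓘(ℝ, ℝ) ∞ a)
    (hb : ContMDiff (𝓡 n) 𝓘(ℝ, ℝ) ∞ b) : ContMDiff (𝓡 n) 𝓘(ℝ, ℝ) ∞ (gradProd n a b) := by
  intro x
  set e := chartAt (Eu n) x with hed
  have he : e ∈ IsManifold.maximalAtlas (𝓡 n) ∞ M := IsManifold.chart_mem_maximalAtlas _
  have h1 : ContMDiffOn (𝓡 n) 𝓘(ℝ, ℝ) ∞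
      (fun z => gradInner (gram n e.symm) (fun z => a (e.symm z)) (fun z => b (e.symm z)) (e z))
      e.source :=
    (smooth_gradInner (isMetricOn_chart he) (smooth_chart_comp ha he)
      (smooth_chart_comp hb he)).contMDiffOn.comp (contMDiffOn_of_mem_maximalAtlas he)
      fun z hz => e.map_source hz
  refine (h1.contMDiffAt (e.open_source.mem_nhds (mem_chart_source _ x))).congr_of_eventuallyEq ?_
  filter_upwards [e.open_source.mem_nhds (mem_chart_source _ x)] with z hz
  rw [← gradProd_chart ha hb he (e.map_source hz), e.left_inv hz]

end Transition

/-! ### Integration against the Riemannian volume in charts -/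

section Integral

open MeasureTheory

variable {n : ℕ} {M : Type*} [TopologicalSpace M] [ChartedSpace (EuclideanSpace ℝ (Fin n)) M]
  [IsManifold (𝓡 n) ∞ M] [RiemannianBundle (fun x : M => TangentSpace (𝓡 n) x)]
  [IsContMDiffRiemannianBundle (𝓡 n) ∞ (EuclideanSpace ℝ (Fin n))
      (fun x : M => TangentSpace (𝓡 n) x)]
  {e e' : OpenPartialHomeomorph M (Eu n)}

/-- The integral, against the Riemannian volume, of a function supported in a chart domain. -/
def chartIntegral (e : OpenPartialHomeomorph M (Eu n)) (f : M → ℝ) : ℝ :=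
  ∫ y in e.target, f (e.symm y) * density (gram n e.symm) y

theorem integrableOn_of_eq_zero {k : ℕ} {Ω K : Set (Eu k)} {f : Eu k → ℝ} (hΩ : IsOpen Ω)
    (hK : IsCompact K) (hKΩ : K ⊆ Ω) (hf : ContinuousOn f Ω) (h0 : ∀ y ∈ Ω, y ∉ K → f y = 0) :
    IntegrableOn f Ω :=
  ((hf.mono hKΩ).integrableOn_compact hK).of_forall_sdiff_eq_zero hΩ.measurableSet
    fun y hy => h0 y hy.1 hy.2

theorem integrableOn_chart (he : e ∈ IsManifold.maximalAtlas (𝓡 n) ∞ M) {f : M → ℝ} {K : Set M}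
    (hf : Continuous f) (hK : IsCompact K) (hKe : K ⊆ e.source) (h0 : ∀ x, x ∉ K → f x = 0) :
    IntegrableOn (fun y => f (e.symm y) * density (gram n e.symm) y) e.target := by
  refine integrableOn_of_eq_zero e.open_target (hK.image_of_continuousOn (e.continuousOn.mono hKe))
    (by rintro _ ⟨x, hx, rfl⟩; exact e.map_source (hKe hx))
    ((hf.comp_continuousOn e.continuousOn_symm).mul
      (smooth_density (isMetricOn_chart he)).continuousOn) fun y hy hyK => ?_
  rw [h0, zero_mul]
  intro hx
  exact hyK ⟨_, hx, e.right_inv hy⟩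

theorem chartIntegral_eq_setIntegral (e : OpenPartialHomeomorph M (Eu n)) {f : M → ℝ} {S : Set (Eu n)}
    (hS : S ⊆ e.target) (h0 : ∀ y ∈ e.target, y ∉ S → f (e.symm y) = 0) :
    chartIntegral e f = ∫ y in S, f (e.symm y) * density (gram n e.symm) y := by
  unfold chartIntegral
  refine setIntegral_eq_of_subset_of_forall_sdiff_eq_zero e.open_target.measurableSet hS ?_
  intro y hy
  rw [h0 y hy.1 hy.2, zero_mul]

/-- Change of variables, with the factor `|det J|` absorbed by the density. Functions supported in
chart domains are all that has to be integrated, so neither an orientation nor a global measure is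
required. -/
theorem chartIntegral_congr_chart (he : e ∈ IsManifold.maximalAtlas (𝓡 n) ∞ M)
    (he' : e' ∈ IsManifold.maximalAtlas (𝓡 n) ∞ M) {f : M → ℝ}
    (h0 : ∀ x, f x ≠ 0 → x ∈ e.source ∧ x ∈ e'.source) :
    chartIntegral e f = chartIntegral e' f := by
  have hs : ∀ y, y ∈ (e.symm.trans e').source ↔ y ∈ e.target ∧ e.symm y ∈ e'.source := by
    intro y; simp
  have ht : ∀ y, y ∈ (e.symm.trans e').target ↔ y ∈ e'.target ∧ e'.symm y ∈ e.source := by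
    intro y; simp
  rw [chartIntegral_eq_setIntegral e (S := (e.symm.trans e').source) (fun y hy => ((hs y).1 hy).1)
      (fun y hy hyS => by
        by_contra hne
        exact hyS ((hs y).2 ⟨hy, (h0 _ hne).2⟩)),
    chartIntegral_eq_setIntegral e' (S := (e.symm.trans e').target) (fun y hy => ((ht y).1 hy).1)
      (fun y hy hyS => by
        by_contra hne
        exact hyS ((ht y).2 ⟨hy, (h0 _ hne).1⟩)),
    ← (e.symm.trans e').image_source_eq_target]
  rw [integral_image_eq_integral_abs_det_fderiv_smul volume
    (f' := fun y => fderiv ℝ (fun z => e' (e.symm z)) y)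
    (e.symm.trans e').open_source.measurableSet ?_ (e.symm.trans e').injOn]
  · refine setIntegral_congr_fun (e.symm.trans e').open_source.measurableSet fun y hy => ?_
    obtain ⟨hy1, hy2⟩ := (hs y).1 hy
    have hd : (fderiv ℝ (fun z => e' (e.symm z)) y).det = (jacobian e e' y).det := by
      rw [ContinuousLinearMap.det, ← LinearMap.det_toMatrix (EuclideanSpace.basisFun (Fin n) ℝ).toBasis]
      congr 1
    simp only [OpenPartialHomeomorph.coe_trans, Function.comp_apply, smul_eq_mul]
    rw [hd, density_transition he he' hy1 hy2, e'.left_inv hy2]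
    ring
  · intro y hy
    exact (((smooth_transition he he').contDiffAt
      ((e.symm.trans e').open_source.mem_nhds hy)).differentiableAt
      (by simp)).hasFDerivAt.hasFDerivWithinAt

end Integral

/-! ### Integration by parts in an open set of `ℝᵏ` -/

section IntegrationByParts

open MeasureTheory

variable {k : ℕ} {G : Eu k → Matrix (Fin k) (Fin k) ℝ} {Ω K : Set (Eu k)}

theorem contDiff_indicator (hΩ : IsOpen Ω) (hK : IsClosed K) (hKΩ : K ⊆ Ω) {f : Eu k → ℝ}
    (hf : ContDiffOn ℝ ∞ f Ω) (h0 : ∀ y ∈ Ω, y ∉ K → f y = 0) :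
    ContDiff ℝ ∞ (Ω.indicator f) := by
  rw [contDiff_iff_contDiffAt]
  intro y
  by_cases hy : y ∈ K
  · have hn := hΩ.mem_nhds (hKΩ hy)
    refine (hf.contDiffAt hn).congr_of_eventuallyEq ?_
    filter_upwards [hn] with z hz
    exact indicator_of_mem hz f
  · refine (contDiffAt_const (c := (0 : ℝ))).congr_of_eventuallyEq ?_
    filter_upwards [hK.isOpen_compl.mem_nhds hy] with z hz
    by_cases hzΩ : z ∈ Ω
    · rw [indicator_of_mem hzΩ, h0 z hzΩ hz]
    · exact indicator_of_notMem hzΩ f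

theorem setIntegral_pd_eq_zero (hΩ : IsOpen Ω) (hK : IsCompact K) (hKΩ : K ⊆ Ω) {f : Eu k → ℝ}
    (hf : ContDiffOn ℝ ∞ f Ω) (h0 : ∀ y ∈ Ω, y ∉ K → f y = 0) (a : Fin k) :
    IntegrableOn (fun y => pd f y a) Ω ∧ ∫ y in Ω, pd f y a = 0 := by
  have hF := contDiff_indicator hΩ hK.isClosed hKΩ hf h0
  set F := Ω.indicator f with hFd
  have hpd : ∀ y ∈ Ω, pd f y a = pd F y a := fun y hy =>
    pd_congr_on hΩ hy (fun z hz => (indicator_of_mem hz f).symm) a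
  have hF0 : ∀ y, y ∉ K → F =ᶠ[nhds y] fun _ => 0 := by
    intro y hy
    filter_upwards [hK.isClosed.isOpen_compl.mem_nhds hy] with z hz
    by_cases hzΩ : z ∈ Ω
    · rw [hFd, indicator_of_mem hzΩ, h0 z hzΩ hz]
    · exact indicator_of_notMem hzΩ f
  have hp0 : ∀ y, y ∉ K → pd F y a = 0 := by
    intro y hy
    rw [pd_congr (hF0 y hy), pd_const]
  have hFs : HasCompactSupport F := HasCompactSupport.intro hK fun y hy => (hF0 y hy).eq_of_nhds
  have hps : HasCompactSupport fun y => pd F y a := HasCompactSupport.intro hK hp0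
  have hpc : Continuous fun y => pd F y a :=
    (hF.continuous_fderiv (by simp)).clm_apply continuous_const
  have hint : ∫ y, pd F y a = 0 := by
    have := integral_mul_fderiv_eq_neg_fderiv_mul_of_integrable (μ := (volume : Measure (Eu k)))
      -- Integration by parts against the constant `1`, for the extension of `f` by zero, which is
      -- smooth with compact support.
      (f := fun _ : Eu k => (1 : ℝ)) (g := F) (v := EuclideanSpace.single a 1)
      (by simp) (by simpa [pd] using hpc.integrable_of_hasCompactSupport hps)
      (by simpa using hF.continuous.integrable_of_hasCompactSupport hFs)
      (fun _ _ => differentiableAt_const _)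
      (fun y _ => hF.differentiable (by simp) y)
    simpa [pd] using this
  constructor
  · exact (hpc.integrable_of_hasCompactSupport hps).integrableOn.congr_fun
      (fun y hy => (hpd y hy).symm) hΩ.measurableSet
  · rw [setIntegral_congr_fun hΩ.measurableSet hpd, ← hint]
    exact setIntegral_eq_integral_of_forall_compl_eq_zero fun y hy => hp0 y fun h => hy (hKΩ h)

/-- The divergence theorem for `f X`, with `f` compactly supported. -/
theorem setIntegral_div_eq_zero (hG : IsMetricOn G Ω) (hK : IsCompact K) (hKΩ : K ⊆ Ω)
    {f : Eu k → ℝ} (hf : ContDiffOn ℝ ∞ f Ω) (h0 : ∀ y ∈ Ω, y ∉ K → f y = 0)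
    {X : Eu k → Fin k → ℝ} (hX : ∀ c, ContDiffOn ℝ ∞ (fun z => X z c) Ω) :
    ∫ y in Ω, (f y * (∑ a, ∑ c, (G y)⁻¹ a c * covD1 G X y a c)
      + ∑ a, pd f y a * ∑ c, (G y)⁻¹ a c * X y c) * density G y = 0 := by
  have hV : ∀ a, ContDiffOn ℝ ∞ (fun z => density G z * ∑ c, (G z)⁻¹ a c * X z c) Ω := fun a =>
    (smooth_density hG).mul (ContDiffOn.sum fun c _ => (hG.smooth_inv a c).mul (hX c))
  have h := fun a => setIntegral_pd_eq_zero hG.isOpen hK hKΩ (hf.mul (hV a))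
    (fun y hy hyK => by simp [h0 y hy hyK]) a
  have hsum : ∫ y in Ω, ∑ a, pd (fun z => f z * (density G z * ∑ c, (G z)⁻¹ a c * X z c)) y a = 0 := by
    rw [integral_finsetSum _ fun a _ => (h a).1]
    exact Finset.sum_eq_zero fun a _ => (h a).2
  rw [← hsum]
  refine setIntegral_congr_fun hG.isOpen.measurableSet fun y hy => ?_
  have e1 : ∀ a, pd (fun z => f z * (density G z * ∑ c, (G z)⁻¹ a c * X z c)) y a
      = pd f y a * (density G y * ∑ c, (G y)⁻¹ a c * X y c)
        + f y * pd (fun z => density G z * ∑ c, (G z)⁻¹ a c * X z c) y a := fun a =>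
    pd_mul (ContDiffOn.dAt hf hG.isOpen hy) (ContDiffOn.dAt (hV a) hG.isOpen hy) a
  simp only [e1, Finset.sum_add_distrib, ← Finset.mul_sum,
    sum_pd_density_mul hG hy fun c => ContDiffOn.dAt (hX c) hG.isOpen hy]
  rw [add_mul, add_comm, Finset.sum_mul]
  congr 1
  · exact Finset.sum_congr rfl fun a _ => by ring
  · ring

end IntegrationByParts

/-! ### A divergence theorem with cutoff on the manifold -/

section DivergenceTheorem

open MeasureTheory

variable {n : ℕ} {M : Type*} [TopologicalSpace M] [ChartedSpace (EuclideanSpace ℝ (Fin n)) M]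
  [IsManifold (𝓡 n) ∞ M] [RiemannianBundle (fun x : M => TangentSpace (𝓡 n) x)]
  [IsContMDiffRiemannianBundle (𝓡 n) ∞ (EuclideanSpace ℝ (Fin n))
      (fun x : M => TangentSpace (𝓡 n) x)]

theorem smooth_div {k : ℕ} {G : Eu k → Matrix (Fin k) (Fin k) ℝ} {Ω : Set (Eu k)}
    (hG : IsMetricOn G Ω) {X : Eu k → Fin k → ℝ} (hX : ∀ c, ContDiffOn ℝ ∞ (fun z => X z c) Ω) :
    ContDiffOn ℝ ∞ (fun y => ∑ a, ∑ c, (G y)⁻¹ a c * covD1 G X y a c) Ω := by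
  refine ContDiffOn.sum fun a _ => ContDiffOn.sum fun c _ => (hG.smooth_inv a c).mul ?_
  unfold covD1
  exact (contDiffOn_pd hG.isOpen (hX c) a).sub
    (ContDiffOn.sum fun m _ => (hG.smooth_christoffel m a c).mul (hX m))

/-- If a covector field, tangent to a compactly supported cutoff function, has nonnegative
divergence, then its divergence vanishes where the cutoff function is positive. -/
theorem div_eq_zero_of_nonneg [T2Space M] [SigmaCompactSpace M]
    {X : OpenPartialHomeomorph M (Eu n) → Eu n → Fin n → ℝ} {P : (M → ℝ) → M → ℝ}
    (hX : ∀ e ∈ IsManifold.maximalAtlas (𝓡 n) ∞ M, ∀ c,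
      ContDiffOn ℝ ∞ (fun z => X e z c) e.target)
    (hPX : ∀ f : M → ℝ, ContMDiff (𝓡 n) 𝓘(ℝ, ℝ) ∞ f →
      ∀ e ∈ IsManifold.maximalAtlas (𝓡 n) ∞ M, ∀ y ∈ e.target, P f (e.symm y)
        = ∑ a, pd (fun z => f (e.symm z)) y a * ∑ c, (gram n e.symm y)⁻¹ a c * X e y c)
    (hPc : ∀ f : M → ℝ, ContMDiff (𝓡 n) 𝓘(ℝ, ℝ) ∞ f → Continuous (P f))
    (hdiv : ∀ e ∈ IsManifold.maximalAtlas (𝓡 n) ∞ M, ∀ y ∈ e.target,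
      0 ≤ ∑ a, ∑ c, (gram n e.symm y)⁻¹ a c * covD1 (gram n e.symm) (X e) y a c)
    {χ : M → ℝ} {K : Set M} (hχ : ContMDiff (𝓡 n) 𝓘(ℝ, ℝ) ∞ χ) (hK : IsCompact K)
    (hχK : ∀ x, x ∉ K → χ x = 0) (hχ0 : ∀ x, 0 ≤ χ x) (hPχ : ∀ x, P χ x = 0)
    {e : OpenPartialHomeomorph M (Eu n)} (he : e ∈ IsManifold.maximalAtlas (𝓡 n) ∞ M)
    {y : Eu n} (hy : y ∈ e.target) (hp : 0 < χ (e.symm y)) :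
    ∑ a, ∑ c, (gram n e.symm y)⁻¹ a c * covD1 (gram n e.symm) (X e) y a c = 0 := by
  classical
  set p := e.symm y with hpd
  have hpe : p ∈ e.source := e.map_target hy
  have hpK : p ∈ K := by
    by_contra h; exact hp.ne' (hχK p h)
  -- The partition of unity is subordinate to a cover in which only the member indexed by `p`
  -- contains `p`. Hence `ρ p p = 1`, and the conclusion can be read off in the prescribed chart
  -- `e`. The family `X` is not assumed to transform as a covector; compatibility between charts
  -- enters through the global pairing `P` alone.
  set E : M → OpenPartialHomeomorph M (Eu n) := fun i => if i = p then e else chartAt (Eu n) i with hE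
  set U : M → Set M := fun i => if i = p then e.source else (chartAt (Eu n) i).source \ {p} with hU
  have hEp : E p = e := if_pos rfl
  have hEm : ∀ i, E i ∈ IsManifold.maximalAtlas (𝓡 n) ∞ M := by
    intro i
    by_cases hi : i = p
    · simp only [hE, if_pos hi]; exact he
    · simp only [hE, if_neg hi]; exact IsManifold.chart_mem_maximalAtlas _
  have hUE : ∀ i, U i ⊆ (E i).source := by
    intro i
    by_cases hi : i = p
    · simp only [hE, hU, if_pos hi]; exact subset_rfl
    · simp only [hE, hU, if_neg hi]; exact sdiff_subset
  have hUo : ∀ i, IsOpen (U i) := by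
    intro i
    by_cases hi : i = p
    · simp only [hU, if_pos hi]; exact e.open_source
    · simp only [hU, if_neg hi]; exact (chartAt (Eu n) i).open_source.sdiff isClosed_singleton
  have hpU : ∀ i, i ≠ p → p ∉ U i := by
    intro i hi
    simp only [hU, if_neg hi]
    exact fun h => h.2 rfl
  have hcov : (univ : Set M) ⊆ ⋃ i, U i := by
    intro x _
    refine mem_iUnion.2 ⟨x, ?_⟩
    by_cases hx : x = p
    · simp only [hU, if_pos hx]; rwa [hx]
    · simp only [hU, if_neg hx]; exact ⟨mem_chart_source _ x, hx⟩
  obtain ⟨ρ, hρU⟩ := SmoothPartitionOfUnity.exists_isSubordinate (𝓡 n) isClosed_univ U hUo hcov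
  have hρs : ∀ i, ContMDiff (𝓡 n) 𝓘(ℝ, ℝ) ∞ (ρ i) := fun i => (ρ i).contMDiff
  have hfin := ρ.locallyFinite.finite_nonempty_inter_compact hK
  set F : Finset M := hfin.toFinset with hF
  have hsum : ∀ x ∈ K, ∑ i ∈ F, ρ i x = 1 := by
    intro x hx
    rw [← ρ.sum_eq_one (mem_univ x)]
    refine (finsum_eq_sum_of_support_subset _ fun i hi => ?_).symm
    rw [hF, Finite.coe_toFinset]
    exact ⟨x, hi, hx⟩
  have hρ0 : ∀ i x, x ∉ tsupport (ρ i) → ρ i x = 0 := fun i x hx => image_eq_zero_of_notMem_tsupport hx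
  have hρp : ρ p p = 1 := by
    rw [← ρ.sum_eq_one (mem_univ p)]
    exact (finsum_eq_single _ p fun i hi => hρ0 i p fun h => hpU i hi (hρU i h)).symm
  have hpF : p ∈ F := by
    rw [hF, Finite.mem_toFinset]
    exact ⟨p, by rw [Function.mem_support, hρp]; exact one_ne_zero, hpK⟩
  have hSc : ∀ i, IsCompact (tsupport (ρ i) ∩ K) := fun i => hK.inter_left (isClosed_tsupport _)
  have hSE : ∀ i, tsupport (ρ i) ∩ K ⊆ (E i).source := fun i x hx => hUE i (hρU i hx.1)
  have hPρ : ∀ i x, x ∉ tsupport (ρ i) → P (ρ i) x = 0 := by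
    intro i x hx
    have h1 := hPX (ρ i) (hρs i) _ (IsManifold.chart_mem_maximalAtlas x) (chartAt (Eu n) x x)
      ((chartAt (Eu n) x).map_source (mem_chart_source _ x))
    rw [(chartAt (Eu n) x).left_inv (mem_chart_source _ x)] at h1
    rw [h1]
    refine Finset.sum_eq_zero fun a _ => ?_
    rw [pd_congr (g := fun _ => 0), pd_const, zero_mul]
    have hc : ContinuousAt (chartAt (Eu n) x).symm (chartAt (Eu n) x x) :=
      (chartAt (Eu n) x).continuousAt_symm ((chartAt (Eu n) x).map_source (mem_chart_source _ x))
    have : (tsupport (ρ i))ᶜ ∈ nhds ((chartAt (Eu n) x).symm (chartAt (Eu n) x x)) := by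
      rw [(chartAt (Eu n) x).left_inv (mem_chart_source _ x)]
      exact (isClosed_tsupport _).isOpen_compl.mem_nhds hx
    filter_upwards [hc.preimage_mem_nhds this] with z hz
    exact hρ0 i _ hz
  set d : M → Eu n → ℝ := fun i y =>
    ∑ a, ∑ c, (gram n (E i).symm y)⁻¹ a c * covD1 (gram n (E i).symm) (X (E i)) y a c with hd
  -- The product rule for `ρ_i χ X` has three terms. As `⟨dχ, X⟩ = 0`, the boundary term of the
  -- `i`-th chart is `χ ⟨dρ_i, X⟩`, and these sum to zero because `∑ ρ_i = 1` near every point where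
  -- `χ ≠ 0`.
  set f : M → M → ℝ := fun i x => χ x * P (ρ i) x with hf
  have hfc : ∀ i, Continuous (f i) := fun i => hχ.continuous.mul (hPc _ (hρs i))
  have hf0 : ∀ i x, x ∉ tsupport (ρ i) ∩ K → f i x = 0 := by
    intro i x hx
    by_cases hxK : x ∈ K
    · simp only [hf]; rw [hPρ i x fun h => hx ⟨h, hxK⟩, mul_zero]
    · simp only [hf]; rw [hχK x hxK, zero_mul]
  -- the divergence theorem in each chart
  have hdc : ∀ i, ContinuousOn (fun y => ρ i ((E i).symm y) * χ ((E i).symm y) * d i y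
      * density (gram n (E i).symm) y) (E i).target := fun i =>
    ((((hρs i).continuous.comp_continuousOn (E i).continuousOn_symm).mul
      (hχ.continuous.comp_continuousOn (E i).continuousOn_symm)).mul
      (smooth_div (isMetricOn_chart (hEm i)) (hX _ (hEm i))).continuousOn).mul
      (smooth_density (isMetricOn_chart (hEm i))).continuousOn
  have hKi : ∀ i, IsCompact (E i '' (tsupport (ρ i) ∩ K)) := fun i =>
    (hSc i).image_of_continuousOn ((E i).continuousOn.mono (hSE i))
  have hKt : ∀ i, E i '' (tsupport (ρ i) ∩ K) ⊆ (E i).target := by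
    rintro i _ ⟨x, hx, rfl⟩; exact (E i).map_source (hSE i hx)
  have hKn : ∀ i, ∀ y ∈ (E i).target, y ∉ E i '' (tsupport (ρ i) ∩ K) →
      ρ i ((E i).symm y) * χ ((E i).symm y) = 0 := by
    intro i y hy hyK
    by_cases h1 : (E i).symm y ∈ tsupport (ρ i)
    · rw [hχK, mul_zero]
      exact fun h2 => hyK ⟨_, ⟨h1, h2⟩, (E i).right_inv hy⟩
    · rw [hρ0 i _ h1, zero_mul]
  have hdi : ∀ i, IntegrableOn (fun y => ρ i ((E i).symm y) * χ ((E i).symm y) * d i y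
      * density (gram n (E i).symm) y) (E i).target := fun i =>
    integrableOn_of_eq_zero (E i).open_target (hKi i) (hKt i) (hdc i) fun y hy hyK => by
      rw [hKn i y hy hyK, zero_mul, zero_mul]
  have hfi : ∀ i, IntegrableOn (fun y => f i ((E i).symm y) * density (gram n (E i).symm) y)
      (E i).target := fun i => integrableOn_chart (hEm i) (hfc i) (hSc i) (hSE i) (hf0 i)
  have hab : ∀ i, (∫ y in (E i).target, ρ i ((E i).symm y) * χ ((E i).symm y) * d i y
      * density (gram n (E i).symm) y) + chartIntegral (E i) (f i) = 0 := by
    intro i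
    have hs := smooth_chart_comp (hρs i) (hEm i)
    have hs' := smooth_chart_comp hχ (hEm i)
    have h := setIntegral_div_eq_zero (isMetricOn_chart (n := n) (hEm i)) (hKi i) (hKt i)
      (hs.mul hs') (hKn i) (hX _ (hEm i))
    unfold chartIntegral
    rw [← integral_add (hdi i) (hfi i), ← h]
    refine setIntegral_congr_fun (E i).open_target.measurableSet fun y hy => ?_
    have h1 := hPX (ρ i) (hρs i) _ (hEm i) y hy
    have h2 := hPX χ hχ _ (hEm i) y hy
    rw [hPχ] at h2
    have h3 : ∑ a, pd (fun z => ρ i ((E i).symm z) * χ ((E i).symm z)) y a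
        * ∑ c, (gram n (E i).symm y)⁻¹ a c * X (E i) y c = f i ((E i).symm y) := by
      simp only [pd_mul (ContDiffOn.dAt hs (E i).open_target hy)
        (ContDiffOn.dAt hs' (E i).open_target hy), add_mul, Finset.sum_add_distrib]
      have e1 : ∑ a, pd (fun z => ρ i ((E i).symm z)) y a * χ ((E i).symm y)
          * ∑ c, (gram n (E i).symm y)⁻¹ a c * X (E i) y c = f i ((E i).symm y) := by
        simp only [hf, h1, Finset.mul_sum]
        exact Finset.sum_congr rfl fun a _ => Finset.sum_congr rfl fun c _ => by ring
      have e2 : ∑ a, ρ i ((E i).symm y) * pd (fun z => χ ((E i).symm z)) y a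
          * ∑ c, (gram n (E i).symm y)⁻¹ a c * X (E i) y c = 0 := by
        simp only [mul_assoc, ← Finset.mul_sum]
        rw [← h2, mul_zero]
      rw [e1, e2, add_zero]
    have h4 := congrArg (fun t => t * density (gram n (E i).symm) y) h3
    exact (congrArg (fun t => _ + t) h4.symm).trans (add_mul _ _ _).symm
  -- the boundary terms cancel
  have hfz : ∀ x, ∑ i ∈ F, f i x = 0 := by
    intro x
    by_cases hx : χ x = 0
    · exact Finset.sum_eq_zero fun i _ => by simp only [hf]; rw [hx, zero_mul]
    · simp only [hf, ← Finset.mul_sum]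
      have he' := IsManifold.chart_mem_maximalAtlas (I := 𝓡 n) (n := ∞) x
      set c := chartAt (Eu n) x with hc
      have hxc : x ∈ c.source := mem_chart_source _ x
      have h1 := fun i => hPX (ρ i) (hρs i) c he' (c x) (c.map_source hxc)
      simp only [c.left_inv hxc] at h1
      simp only [h1]
      rw [Finset.sum_comm]
      simp only [← Finset.sum_mul]
      have h2 : ∀ a, ∑ i ∈ F, pd (fun z => ρ i (c.symm z)) (c x) a = 0 := by
        intro a
        have e1 : pd (fun z => ∑ i ∈ F, ρ i (c.symm z)) (c x) a
            = ∑ i ∈ F, pd (fun z => ρ i (c.symm z)) (c x) a := by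
          unfold pd
          rw [fderiv_fun_sum fun i _ => ContDiffOn.dAt (smooth_chart_comp (hρs i) he')
            c.open_target (c.map_source hxc)]
          simp
        rw [← e1, pd_congr (g := fun _ => 1), pd_const]
        have hcx : ContinuousAt c.symm (c x) := c.continuousAt_symm (c.map_source hxc)
        have ho : {x | χ x ≠ 0} ∈ nhds (c.symm (c x)) := by
          rw [c.left_inv hxc]
          exact (isOpen_ne_fun hχ.continuous continuous_const).mem_nhds hx
        filter_upwards [hcx.preimage_mem_nhds ho] with z hz
        refine hsum _ ?_
        by_contra h
        exact hz (hχK _ h)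
      simp [h2]
  -- The functions `f i` are integrated in different charts. Split each one as `∑_j ρ_j f_i`, move
  -- the piece `ρ_j f_i` to chart `j`, and sum over `i` first.
  have hb : ∑ i ∈ F, chartIntegral (E i) (f i) = 0 := by
    have hρf0 : ∀ i j x, x ∉ tsupport (ρ j) ∩ K → ρ j x * f i x = 0 := by
      intro i j x hx
      by_cases hxj : x ∈ tsupport (ρ j)
      · rw [hf0 i x fun h => hx ⟨hxj, h.2⟩, mul_zero]
      · rw [hρ0 j x hxj, zero_mul]
    have h1 : ∀ i, chartIntegral (E i) (f i) = ∑ j ∈ F, chartIntegral (E j) (fun x => ρ j x * f i x) := by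
      intro i
      have e1 : ∀ j, chartIntegral (E j) (fun x => ρ j x * f i x)
          = chartIntegral (E i) (fun x => ρ j x * f i x) := by
        intro j
        refine chartIntegral_congr_chart (hEm j) (hEm i) fun x hx => ⟨?_, ?_⟩
        · by_contra h
          exact hx (hρf0 i j x fun h' => h (hSE j h'))
        · by_contra h
          exact hx (by rw [hf0 i x fun h' => h (hSE i h'), mul_zero])
      simp only [e1]
      unfold chartIntegral
      rw [← integral_finsetSum]
      · refine setIntegral_congr_fun (E i).open_target.measurableSet fun y hy => ?_
        simp only [← Finset.sum_mul]
        by_cases hK' : (E i).symm y ∈ K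
        · rw [hsum _ hK', one_mul]
        · rw [hf0 i _ fun h => hK' h.2, mul_zero]
      · intro j _
        exact integrableOn_chart (hEm i) ((hρs j).continuous.mul (hfc i)) (hSc i) (hSE i)
          fun x hx => by change ρ j x * f i x = 0; rw [hf0 i x hx, mul_zero]
    simp only [h1]
    rw [Finset.sum_comm]
    refine Finset.sum_eq_zero fun j _ => ?_
    unfold chartIntegral
    rw [← integral_finsetSum]
    · refine (setIntegral_congr_fun (g := fun _ => 0) (E j).open_target.measurableSet
        fun y hy => ?_).trans (by simp)
      simp only [← Finset.sum_mul, ← Finset.mul_sum]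
      rw [hfz, mul_zero, zero_mul]
    · intro i _
      exact integrableOn_chart (hEm j) ((hρs j).continuous.mul (hfc i)) (hSc j) (hSE j)
        fun x hx => hρf0 i j x hx
  have hnn : ∀ i, ∀ y ∈ (E i).target, 0 ≤ ρ i ((E i).symm y) * χ ((E i).symm y) * d i y
      * density (gram n (E i).symm) y := fun i y hy =>
    mul_nonneg (mul_nonneg (mul_nonneg (ρ.nonneg i _) (hχ0 _)) (hdiv _ (hEm i) y hy))
      (density_pos (isMetricOn_chart (hEm i)) hy).le
  have ha : ∑ i ∈ F, ∫ y in (E i).target, ρ i ((E i).symm y) * χ ((E i).symm y) * d i y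
      * density (gram n (E i).symm) y = 0 := by
    have := Finset.sum_congr (s₁ := F) rfl fun i _ => hab i
    rw [Finset.sum_add_distrib, hb, add_zero] at this
    simpa using this
  -- Nonnegative integrals with sum zero vanish one by one. For the index `p` the integrand is then
  -- zero almost everywhere, and by continuity everywhere in the chart.
  have hap := (Finset.sum_eq_zero_iff_of_nonneg fun i _ =>
    setIntegral_nonneg (E i).open_target.measurableSet (hnn i)).1 ha p hpF
  have hae : (0 : Eu n → ℝ) ≤ᵐ[volume.restrict (E p).target] fun y =>
      ρ p ((E p).symm y) * χ ((E p).symm y) * d p y * density (gram n (E p).symm) y :=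
    (ae_restrict_iff' (E p).open_target.measurableSet).2 (Filter.Eventually.of_forall (hnn p))
  have hz := (setIntegral_eq_zero_iff_of_nonneg_ae hae (hdi p)).1 hap
  have hz' := Measure.eqOn_open_of_ae_eq hz (E p).open_target (hdc p) continuousOn_const
  have hyp := hz' (x := y) (by rw [hEp]; exact hy)
  simp only [hEp, hd, ← hpd, hρp, one_mul, Pi.zero_apply] at hyp
  have hden := (density_pos (isMetricOn_chart (n := n) he) hy).ne'
  exact (mul_eq_zero.1 ((mul_eq_zero.1 hyp).resolve_right hden)).resolve_left hp.ne'

end DivergenceTheorem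

/-! ### Pairing the flux form with a differential -/

section Flux

variable {k : ℕ} {G : Eu k → Matrix (Fin k) (Fin k) ℝ} {Ω : Set (Eu k)} {y : Eu k}

theorem gradInner_congr_left (hΩ : IsOpen Ω) (hy : y ∈ Ω) {a a' : Eu k → ℝ}
    (h : ∀ z ∈ Ω, a z = a' z) (b : Eu k → ℝ) : gradInner G a b y = gradInner G a' b y := by
  unfold gradInner
  exact Finset.sum_congr rfl fun i _ => by rw [pd_congr_on hΩ hy h]

/-- Expresses the pairing with `df` through gradient products, so that it is a function on the
manifold. For `f = u` both brackets cancel: the form is tangent to the level sets of `u`. -/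
theorem pair_fluxForm (hG : IsMetricOn G Ω) (hy : y ∈ Ω) (u h f : Eu k → ℝ) :
    ∑ a, pd f y a * ∑ c, (G y)⁻¹ a c * fluxForm G u h y c
      = h y ^ 2 * (gradInner G u u y * gradInner G (gradInner G u u) f y
          - gradInner G (gradInner G u u) u y * gradInner G u f y)
        + ((k : ℝ) - 2) * (gradInner G h u y * gradInner G (gradInner G u u) f y
          - gradInner G (gradInner G u u) u y * gradInner G h f y) := by
  have e : ∀ b, gradInner G b f y = ∑ a, pd f y a * ∑ c, (G y)⁻¹ a c * pd b y c := fun b => by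
    rw [gradInner_comm hG hy]; rfl
  simp only [e (gradInner G u u), e h, e u, Finset.mul_sum, ← Finset.sum_sub_distrib,
    ← Finset.sum_add_distrib]
  refine Finset.sum_congr rfl fun a _ => Finset.sum_congr rfl fun c _ => ?_
  unfold fluxForm
  ring

end Flux

/-! ### Cutoff functions adapted to compact level sets -/

section Cutoff

variable {n : ℕ} {M : Type*} [TopologicalSpace M] [ChartedSpace (EuclideanSpace ℝ (Fin n)) M]

/-- A function with compact level sets admits compactly supported cutoff functions which are
locally functions of it. -/
theorem exists_cutoff [T2Space M] [LocallyCompactSpace M] {u : M → ℝ}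
    (hu : ContMDiff (𝓡 n) 𝓘(ℝ, ℝ) ∞ u) {p : M} (hL : IsCompact (u ⁻¹' {u p})) :
    ∃ (χ : M → ℝ) (K : Set M), ContMDiff (𝓡 n) 𝓘(ℝ, ℝ) ∞ χ ∧ IsCompact K ∧
      (∀ x, x ∉ K → χ x = 0) ∧ (∀ x, 0 ≤ χ x) ∧ 0 < χ p ∧
      ∀ x, ∃ g : ℝ → ℝ, ContDiff ℝ ∞ g ∧ χ =ᶠ[nhds x] fun z => g (u z) := by
  -- The cutoff is a bump function of `u` inside a relatively compact neighbourhood `U` of the level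
  -- set and zero outside. It is only locally a function of `u`, since `u` may come close to `u p`
  -- again outside `U`.
  obtain ⟨U, hUo, hLU, hUc⟩ := exists_isOpen_superset_and_isCompact_closure hL
  have hfr : IsCompact (frontier U) := hUc.of_isClosed_subset isClosed_frontier frontier_subset_closure
  -- On the compact frontier of `U` the function `u` keeps a distance `δ` from `u p`. The bump
  -- vanishes at distance `δ / 2` already, so the extension by zero is smooth across the frontier.
  obtain ⟨δ, hδ, hδU⟩ := hfr.exists_forall_le' (f := fun x => dist (u x) (u p))
    ((hu.continuous.dist continuous_const).continuousOn) (a := 0) (by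
      intro x hx
      refine dist_pos.2 fun h => ?_
      have := hLU (show x ∈ u ⁻¹' {u p} from h)
      rw [hUo.frontier_eq] at hx
      exact hx.2 this)
  let g : ContDiffBump (u p) := ⟨δ / 4, δ / 2, by linarith, by linarith⟩
  have hloc : ∀ x, ∃ g : ℝ → ℝ, ContDiff ℝ ∞ g ∧
      U.indicator (fun z => (⇑(⟨δ / 4, δ / 2, by linarith, by linarith⟩ : ContDiffBump (u p))) (u z))
        =ᶠ[nhds x] fun z => g (u z) := by
    intro x
    by_cases hx : x ∈ U
    · refine ⟨g, g.contDiff, ?_⟩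
      filter_upwards [hUo.mem_nhds hx] with z hz
      rw [indicator_of_mem hz]
    · refine ⟨fun _ => 0, contDiff_const, ?_⟩
      by_cases hx' : x ∈ closure U
      · have hxf : x ∈ frontier U := by rw [hUo.frontier_eq]; exact ⟨hx', hx⟩
        have h1 : δ / 2 < dist (u x) (u p) := by linarith [hδU x hxf]
        filter_upwards [(isOpen_lt continuous_const (hu.continuous.dist continuous_const)).mem_nhds h1]
          with z hz
        by_cases hzU : z ∈ U
        · rw [indicator_of_mem hzU]
          exact g.zero_of_le_dist (le_of_lt hz)
        · exact indicator_of_notMem hzU _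
      · filter_upwards [isClosed_closure.isOpen_compl.mem_nhds hx'] with z hz
        exact indicator_of_notMem (fun h => hz (subset_closure h)) _
  refine ⟨U.indicator fun z => g (u z), closure U, ?_, hUc, ?_, ?_, ?_, hloc⟩
  · intro x
    obtain ⟨f, hf, hfx⟩ := hloc x
    exact (hf.contMDiff.comp hu).contMDiffAt.congr_of_eventuallyEq hfx
  · exact fun x hx => indicator_of_notMem (fun h => hx (subset_closure h)) _
  · exact fun x => indicator_nonneg (fun _ _ => g.nonneg) x
  · rw [indicator_of_mem (hLU (show p ∈ u ⁻¹' {u p} from rfl)),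
      g.one_of_mem_closedBall (Metric.mem_closedBall_self (by show 0 ≤ δ / 4; linarith))]
    exact one_pos

end Cutoff

/-! ### Vanishing of the deviation -/

section Rigidity

variable {n : ℕ} {M : Type*} [TopologicalSpace M] [ChartedSpace (EuclideanSpace ℝ (Fin n)) M]
  [IsManifold (𝓡 n) ∞ M] [RiemannianBundle (fun x : M => TangentSpace (𝓡 n) x)]
  [IsContMDiffRiemannianBundle (𝓡 n) ∞ (EuclideanSpace ℝ (Fin n))
      (fun x : M => TangentSpace (𝓡 n) x)]
  {e : OpenPartialHomeomorph M (Eu n)} {y : Eu n} {u h lam : M → ℝ}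

/-- Chain rule. The derivative of `φ` is taken within the range of `u`, which suffices because `u`
maps into its range. The factor `h'` is a positive function without further regularity. -/
theorem IsIncreasingFunctionOf.exists_pd (hhu : IsIncreasingFunctionOf h u)
    (hu : ContMDiff (𝓡 n) 𝓘(ℝ, ℝ) ∞ u) : ∃ h' : M → ℝ, (∀ x, 0 < h' x) ∧
      ∀ e ∈ IsManifold.maximalAtlas (𝓡 n) ∞ M, ∀ y ∈ e.target, ∀ i,
        pd (fun z => h (e.symm z)) y i = h' (e.symm y) * pd (fun z => u (e.symm z)) y i := by
  obtain ⟨φ, φ', h1, h2⟩ := hhu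
  refine ⟨fun x => φ' (u x), fun x => (h2 x).2, fun e he y hy i => ?_⟩
  have hd := (ContDiffOn.dAt (smooth_chart_comp hu he) e.open_target hy).hasFDerivAt
  have := ((h2 (e.symm y)).1.comp_hasFDerivAt y hd
    (Filter.Eventually.of_forall fun z => mem_range_self _)).fderiv
  unfold pd
  rw [show (fun z => h (e.symm z)) = φ ∘ fun z => u (e.symm z) from funext fun z => h1 _, this]
  rfl

/-- The divergence of the flux form is a positive multiple of the deviation, hence nonnegative;
positivity of the factor uses `h' > 0`, while `h` enters only squared. The form pairs to zero with
every function that is locally a function of `u`, in particular with the cutoff that is positive at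
the given point. -/
theorem deviation_eq_zero [T2Space M] [SecondCountableTopology M] (hn : 4 ≤ n)
    (hsol : IsAlmostSoliton n u h lam) (hbach : IsBachFlat n M)
    (hlevel : ∀ c : ℝ, IsCompact (u ⁻¹' {c})) (hhu : IsIncreasingFunctionOf h u)
    (he : e ∈ IsManifold.maximalAtlas (𝓡 n) ∞ M) (hy : y ∈ e.target) :
    deviation (gram n e.symm y)⁻¹ (tracelessRicci (gram n e.symm) y)
      (pd (fun z => u (e.symm z)) y) = 0 := by
  have : LocallyCompactSpace M := Manifold.locallyCompact_of_finiteDimensional (𝓡 n)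
  have : SigmaCompactSpace M := sigmaCompactSpace_of_locallyCompact_secondCountable
  have hn' : (4 : ℝ) ≤ n := by exact_mod_cast hn
  have hu := hsol.smooth_u
  have hh := hsol.smooth_h
  have h0 : ∀ x, h x ≠ 0 := fun x => hsol.signal.elim (fun H => (H x).ne') fun H => (H x).ne
  obtain ⟨h', hh'pos, hh'⟩ := hhu.exists_pd hu
  have hw := contMDiff_gradProd (n := n) hu hu
  set w := gradProd n u u with hwd
  set X : OpenPartialHomeomorph M (Eu n) → Eu n → Fin n → ℝ := fun e =>
    fluxForm (gram n e.symm) (fun z => u (e.symm z)) (fun z => h (e.symm z)) with hX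
  set P : (M → ℝ) → M → ℝ := fun f x =>
    h x ^ 2 * (w x * gradProd n w f x - gradProd n w u x * gradProd n u f x)
      + ((n : ℝ) - 2) * (gradProd n h u x * gradProd n w f x
        - gradProd n w u x * gradProd n h f x) with hP
  have hPX : ∀ f : M → ℝ, ContMDiff (𝓡 n) 𝓘(ℝ, ℝ) ∞ f →
      ∀ e ∈ IsManifold.maximalAtlas (𝓡 n) ∞ M, ∀ y ∈ e.target, P f (e.symm y)
        = ∑ a, pd (fun z => f (e.symm z)) y a * ∑ c, (gram n e.symm y)⁻¹ a c * X e y c := by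
    intro f hf e he y hy
    rw [hX, pair_fluxForm (isMetricOn_chart he) hy]
    have hwe : ∀ b, gradInner (gram n e.symm)
        (gradInner (gram n e.symm) (fun z => u (e.symm z)) fun z => u (e.symm z)) b y
        = gradInner (gram n e.symm) (fun z => w (e.symm z)) b y := fun b =>
      gradInner_congr_left e.open_target hy (fun z hz => (gradProd_chart hu hu he hz).symm) b
    simp only [hP]
    rw [hwe, hwe, ← gradProd_chart hw hf he hy, ← gradProd_chart hw hu he hy,
      ← gradProd_chart hu hu he hy, ← gradProd_chart hu hf he hy, ← gradProd_chart hh hu he hy,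
      ← gradProd_chart hh hf he hy]
  have hdivX : ∀ e ∈ IsManifold.maximalAtlas (𝓡 n) ∞ M, ∀ y ∈ e.target,
      ∑ a, ∑ c, (gram n e.symm y)⁻¹ a c * covD1 (gram n e.symm) (X e) y a c
        = 2 * ((n : ℝ) - 1) * (1 / ((n : ℝ) - 2) + h' (e.symm y) / h (e.symm y) ^ 2)
          * deviation (gram n e.symm y)⁻¹ (tracelessRicci (gram n e.symm) y)
            (pd (fun z => u (e.symm z)) y) := fun e he y hy =>
    div_fluxForm (isMetricOn_chart he) hy hn (smooth_chart_comp hu he) (smooth_chart_comp hh he)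
      (smooth_chart_comp hsol.smooth_lam he) (fun z hz => hsol.equation e he z hz)
      (fun z _ => h0 _) (h' := fun z => h' (e.symm z)) (hh' e he) (hbach e he y hy)
  have hpos : ∀ x, 0 < 2 * ((n : ℝ) - 1) * (1 / ((n : ℝ) - 2) + h' x / h x ^ 2) := by
    intro x
    have h1 : 0 < (n : ℝ) - 1 := by linarith
    have h2 : 0 < (n : ℝ) - 2 := by linarith
    have h3 := hh'pos x
    have h4 : 0 < h x ^ 2 := by have := h0 x; positivity
    positivity
  obtain ⟨χ, K, hχ, hK, hχK, hχ0, hχp, hloc⟩ := exists_cutoff hu (p := e.symm y) (hlevel _)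
  -- Near `x` the cutoff is `g ∘ u`, so `∇χ = g'(u) ∇u` and the pairing of the flux form with `dχ`
  -- is a multiple of its pairing with `du`.
  have hgr : ∀ (g : ℝ → ℝ) (b : M → ℝ) (x : M), ContDiff ℝ ∞ g → ContMDiff (𝓡 n) 𝓘(ℝ, ℝ) ∞ b →
      (χ =ᶠ[nhds x] fun z => g (u z)) → gradProd n b χ x = deriv g (u x) * gradProd n b u x := by
    intro g b x hg hb hgx
    have hc := IsManifold.chart_mem_maximalAtlas (I := 𝓡 n) (n := ∞) x
    set c := chartAt (Eu n) x with hcd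
    have hxc : c x ∈ c.target := c.map_source (mem_chart_source _ x)
    have hinv : c.symm (c x) = x := c.left_inv (mem_chart_source _ x)
    have e1 := gradProd_chart hb hχ hc hxc
    have e2 := gradProd_chart hb hu hc hxc
    rw [hinv] at e1 e2
    rw [e1, e2, gradInner_comm (isMetricOn_chart hc) hxc,
      gradInner_comm (isMetricOn_chart hc) hxc (fun z => b (c.symm z))]
    unfold gradInner
    rw [Finset.mul_sum]
    refine Finset.sum_congr rfl fun i _ => ?_
    rw [← mul_assoc]
    congr 1
    have hcx : ContinuousAt c.symm (c x) := c.continuousAt_symm hxc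
    rw [pd_congr (g := fun z => g (u (c.symm z)))]
    · have hd := (ContDiffOn.dAt (smooth_chart_comp hu hc) c.open_target hxc).hasFDerivAt
      have hg' : HasDerivAt g (deriv g (u (c.symm (c x)))) (u (c.symm (c x))) :=
        (hg.differentiable (by simp) _).hasDerivAt
      have := (hg'.comp_hasFDerivAt (c x) hd).fderiv
      unfold pd
      rw [show (fun z => g (u (c.symm z))) = g ∘ fun z => u (c.symm z) from rfl, this, hinv]
      rfl
    · have : Filter.Tendsto c.symm (nhds (c x)) (nhds x) := by
        have := hcx.tendsto; rwa [hinv] at this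
      exact this.eventually hgx
  have key := div_eq_zero_of_nonneg (X := X) (P := P)
    (fun e he c => smooth_fluxForm (isMetricOn_chart he) (smooth_chart_comp hu he)
      (smooth_chart_comp hh he) c) hPX
    (fun f hf => by
      have c1 := (contMDiff_gradProd hw hf).continuous
      have c2 := (contMDiff_gradProd hw hu).continuous
      have c3 := (contMDiff_gradProd hu hf).continuous
      have c4 := (contMDiff_gradProd hh hu).continuous
      have c5 := (contMDiff_gradProd hh hf).continuous
      exact ((hh.continuous.pow 2).mul ((hw.continuous.mul c1).sub (c2.mul c3))).add
        (continuous_const.mul ((c4.mul c1).sub (c2.mul c5))))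
    (fun e he y hy => by
      rw [hdivX e he y hy]
      exact mul_nonneg (hpos _).le (deviation_nonneg hn ((isMetricOn_chart he).posDef y hy).inv
        (tracelessRicci_symm (isMetricOn_chart he) hy)
        (trace_tracelessRicci (isMetricOn_chart he) hy hn) _))
    hχ hK hχK hχ0
    (fun x => by
      obtain ⟨g, hg, hgx⟩ := hloc x
      simp only [hP]
      rw [hgr g w x hg hw hgx, hgr g u x hg hu hgx, hgr g h x hg hh hgx, ← hwd]
      ring)
    he hy hχp
  rw [hdivX e he y hy] at key
  exact (mul_eq_zero.1 key).resolve_left (hpos _).ne'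

end Rigidity

/-! ### Smoothness of composition operators on spaces of curves -/

section Superposition

open ContinuousMap

variable {T : Type} [TopologicalSpace T] [CompactSpace T]
  {A E F : Type} [NormedAddCommGroup A] [NormedSpace ℝ A] [NormedAddCommGroup E] [NormedSpace ℝ E]
  [NormedAddCommGroup F] [NormedSpace ℝ F]

/-- The pointwise application of a bounded bilinear map to continuous functions. -/
def pointwiseBilin (T : Type) [TopologicalSpace T] [CompactSpace T] (B : A →L[ℝ] E →L[ℝ] F) :
    C(T, A) →L[ℝ] C(T, E) →L[ℝ] C(T, F) :=
  LinearMap.mkContinuous₂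
    (LinearMap.mk₂ ℝ (fun (α : C(T, A)) (η : C(T, E)) => (⟨fun t => B (α t) (η t),
        (B.continuous.comp α.continuous).clm_apply η.continuous⟩ : C(T, F)))
      (fun _ _ _ => by ext; simp) (fun _ _ _ => by ext; simp)
      (fun _ _ _ => by ext; simp) (fun _ _ _ => by ext; simp)) ‖B‖
    (fun α η => by
      refine (ContinuousMap.norm_le _ (by positivity)).2 fun t => ?_
      have h0 : 0 ≤ ‖B‖ := ContinuousLinearMap.opNorm_nonneg B
      have h1 := mul_le_mul_of_nonneg_left (α.norm_coe_le_norm t) h0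
      exact (B.le_opNorm₂ _ _).trans (mul_le_mul h1 (η.norm_coe_le_norm t) (norm_nonneg _)
        (mul_nonneg h0 (norm_nonneg _))))

/-- Apply the mean value inequality at each parameter `t`. The estimate is uniform in `t` because `γ
↦ f' ∘ γ` is continuous for the sup norm, so `f'` varies little on all segments from `γ t` to `γ t +
η t` at once. -/
theorem hasFDerivAt_comp_continuousMap (B : A →L[ℝ] E →L[ℝ] F) {f : E → F} {f' : E → A}
    (hfc : Continuous f) (hf : ∀ x, HasFDerivAt f (B (f' x)) x) (hf' : Continuous f') (γ : C(T, E)) :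
    HasFDerivAt (fun γ : C(T, E) => (⟨f, hfc⟩ : C(E, F)).comp γ)
      (pointwiseBilin T B ((⟨f', hf'⟩ : C(E, A)).comp γ)) γ := by
  have hB0 : 0 ≤ ‖B‖ := ContinuousLinearMap.opNorm_nonneg B
  rw [hasFDerivAt_iff_isLittleO_nhds_zero, Asymptotics.isLittleO_iff]
  intro c hc
  have hcont : Continuous fun γ : C(T, E) => (⟨f', hf'⟩ : C(E, A)).comp γ :=
    ContinuousMap.continuous_postcomp _
  obtain ⟨δ, hδ, hδc⟩ := Metric.continuousAt_iff.1 hcont.continuousAt (c / (‖B‖ + 1)) (by positivity)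
  filter_upwards [Metric.ball_mem_nhds (0 : C(T, E)) hδ] with η hη
  rw [mem_ball_zero_iff] at hη
  refine (ContinuousMap.norm_le _ (by positivity)).2 fun t => ?_
  have hb : ∀ x ∈ segment ℝ (γ t) (γ t + η t), ‖B (f' x) - B (f' (γ t))‖ ≤ c := by
    intro x hx
    rw [segment_eq_image'] at hx
    obtain ⟨s, hs, rfl⟩ := hx
    have h1 : dist (γ + s • η) γ < δ := by
      rw [dist_eq_norm, add_sub_cancel_left, norm_smul, Real.norm_of_nonneg hs.1]
      exact lt_of_le_of_lt (mul_le_of_le_one_left (norm_nonneg _) hs.2) hη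
    have h3 := (ContinuousMap.dist_apply_le_dist t).trans (hδc h1).le
    rw [dist_eq_norm] at h3
    have h4 : ‖f' (γ t + s • (γ t + η t - γ t)) - f' (γ t)‖ ≤ c / (‖B‖ + 1) := by
      rw [add_sub_cancel_left]; exact h3
    rw [← map_sub]
    refine (B.le_opNorm _).trans ((mul_le_mul_of_nonneg_left h4 hB0).trans ?_)
    rw [mul_div_assoc', div_le_iff₀ (by positivity), mul_comm]
    exact mul_le_mul_of_nonneg_left (by linarith) hc.le
  have := Convex.norm_image_sub_le_of_norm_hasFDerivWithin_le' (𝕜 := ℝ) (f := f)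
    (φ := B (f' (γ t))) (fun x _ => (hf x).hasFDerivWithinAt) hb (convex_segment _ _)
    (left_mem_segment ℝ _ _) (right_mem_segment ℝ (γ t) (γ t + η t))
  rw [add_sub_cancel_left] at this
  exact this.trans (mul_le_mul_of_nonneg_left (η.norm_coe_le_norm t) hc.le)

/-- Composition with a smooth map is a smooth map between spaces of continuous functions. -/
theorem contDiff_comp_continuousMap_nat (k : ℕ) :
    ∀ {F : Type} [NormedAddCommGroup F] [NormedSpace ℝ F] {f : E → F} (hf : ContDiff ℝ ∞ f),
      ContDiff ℝ k fun γ : C(T, E) => (⟨f, hf.continuous⟩ : C(E, F)).comp γ := by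
  -- The derivative of `γ ↦ f ∘ γ` is again a composition operator, with `f'` in place of `f`,
  -- followed by a bounded linear map. As `f'` takes values in `E →L[ℝ] F`, the induction hypothesis
  -- must hold for every target space.
  induction k with
  | zero =>
    intro F _ _ f hf
    exact contDiff_zero.2 (ContinuousMap.continuous_postcomp _)
  | succ k ih =>
    intro F _ _ f hf
    have hf' : ContDiff ℝ ∞ (fderiv ℝ f) := hf.fderiv_right (by simp)
    have hd := hasFDerivAt_comp_continuousMap (T := T) (ContinuousLinearMap.id ℝ (E →L[ℝ] F))
      hf.continuous (fun x => (hf.differentiable (by simp) x).hasFDerivAt) hf'.continuous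
    refine contDiff_succ_iff_hasFDerivAt.2 ⟨_, ?_, hd⟩
    exact (pointwiseBilin T (ContinuousLinearMap.id ℝ (E →L[ℝ] F))).contDiff.comp (ih hf')

theorem contDiff_comp_continuousMap {f : E → F} (hf : ContDiff ℝ ∞ f) :
    ContDiff ℝ ∞ fun γ : C(T, E) => (⟨f, hf.continuous⟩ : C(E, F)).comp γ :=
  contDiff_infty.2 fun k => contDiff_comp_continuousMap_nat k hf

end Superposition

/-! ### Smooth local inverses -/

section LocalDiffeo

/-- The inverse function theorem for smooth maps. -/
theorem exists_smooth_local_inverse {E F : Type*} [NormedAddCommGroup E] [NormedSpace ℝ E]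
    [CompleteSpace E] [NormedAddCommGroup F] [NormedSpace ℝ F] {f : E → F} {U : Set E}
    (hU : IsOpen U) (hf : ContDiffOn ℝ ∞ f U) {a : E} (ha : a ∈ U) (f' : E ≃L[ℝ] F)
    (hf' : HasFDerivAt f (f' : E →L[ℝ] F) a) :
    ∃ φ : OpenPartialHomeomorph E F, a ∈ φ.source ∧ φ.source ⊆ U ∧ (∀ x, φ x = f x) ∧
      ContDiffOn ℝ ∞ φ.symm φ.target := by
  have hca : ContDiffAt ℝ ∞ f a := hf.contDiffAt (hU.mem_nhds ha)
  set φ₀ := hca.toOpenPartialHomeomorph f hf' (by simp) with hφ₀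
  have hc : ContinuousOn (fderiv ℝ f) U := hf.continuousOn_fderiv_of_isOpen hU (by simp)
  have hopen : IsOpen (U ∩ fderiv ℝ f ⁻¹' range ((↑) : (E ≃L[ℝ] F) → E →L[ℝ] F)) :=
    hc.isOpen_inter_preimage hU ContinuousLinearEquiv.isOpen
  -- Shrink to the open set where the derivative is invertible; then the inverse is smooth on its
  -- whole domain and not just at `f a`.
  set S := U ∩ fderiv ℝ f ⁻¹' range ((↑) : (E ≃L[ℝ] F) → E →L[ℝ] F)
  have haS : a ∈ S := ⟨ha, f', hf'.fderiv.symm⟩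
  refine ⟨φ₀.restrOpen S hopen, ⟨hca.mem_toOpenPartialHomeomorph_source hf' (by simp), haS⟩,
    fun x hx => hx.2.1, fun x => rfl, fun y hy => ?_⟩
  have hy' := (φ₀.restrOpen S hopen).map_target hy
  obtain ⟨L, hL⟩ := hy'.2.2
  refine (OpenPartialHomeomorph.contDiffAt_symm (f := φ₀.restrOpen S hopen) (f₀' := L) hy ?_
    ?_).contDiffWithinAt
  · rw [hL]
    exact ((hf.contDiffAt (hU.mem_nhds hy'.2.1)).differentiableAt (by simp)).hasFDerivAt
  · exact hf.contDiffAt (hU.mem_nhds hy'.2.1)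

end LocalDiffeo

/-! ### Smooth dependence of flows on time and initial value -/

section Flow

open unitInterval

variable {E : Type} [NormedAddCommGroup E] [NormedSpace ℝ E]

theorem continuous_extend_unitInterval (γ : C(I, E)) :
    Continuous fun t : ℝ => γ (projIcc 0 1 zero_le_one t) :=
  γ.continuous.comp continuous_projIcc

/-- Constant functions, as a bounded linear map. -/
def constCurve : E →L[ℝ] C(I, E) :=
  LinearMap.mkContinuous
    { toFun := fun x => ContinuousMap.const I x
      map_add' := fun _ _ => rfl
      map_smul' := fun _ _ => rfl } 1
    (fun x => by
      rw [one_mul]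
      exact (ContinuousMap.norm_le _ (norm_nonneg _)).2 fun _ => le_rfl)

theorem constCurve_apply (x : E) (t : I) : constCurve x t = x := rfl

/-- Integration of curves from `0`, as a bounded linear map. -/
def integralCurve : C(I, E) →L[ℝ] C(I, E) :=
  LinearMap.mkContinuous
    { toFun := fun γ => ⟨fun t => ∫ τ in (0 : ℝ)..t, γ (projIcc 0 1 zero_le_one τ),
        (intervalIntegral.continuous_primitive
          (fun a b => (continuous_extend_unitInterval γ).intervalIntegrable a b) 0).comp
          continuous_subtype_val⟩
      map_add' := fun γ η => by
        ext t
        exact intervalIntegral.integral_add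
          ((continuous_extend_unitInterval γ).intervalIntegrable _ _)
          ((continuous_extend_unitInterval η).intervalIntegrable _ _)
      map_smul' := fun c γ => by
        ext t
        exact intervalIntegral.integral_smul _ _ } 1
    (fun γ => by
      rw [one_mul]
      refine (ContinuousMap.norm_le _ (norm_nonneg _)).2 fun t => ?_
      refine (intervalIntegral.norm_integral_le_of_norm_le_const (C := ‖γ‖)
        fun x _ => γ.norm_coe_le_norm _).trans ?_
      rw [sub_zero, abs_of_nonneg t.2.1]
      exact mul_le_of_le_one_right (norm_nonneg _) t.2.2)

theorem integralCurve_apply (γ : C(I, E)) (t : I) :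
    integralCurve γ t = ∫ τ in (0 : ℝ)..t, γ (projIcc 0 1 zero_le_one τ) := rfl

/-- A bounded smooth vector field has a smooth local flow. -/
theorem exists_smooth_flow_of_bounded [CompleteSpace E] {X : E → E} (hX : ContDiff ℝ ∞ X) {C : ℝ}
    (hC : ∀ x, ‖X x‖ ≤ C) (x₀ : E) :
    ∃ ε > 0, ∃ θ : ℝ × E → E, ContDiffOn ℝ ∞ θ (Ioo (-ε) ε ×ˢ Metric.ball x₀ ε) ∧
      ∀ x ∈ Metric.ball x₀ ε, θ (0, x) = x ∧
        ∀ t ∈ Ioo (-ε) ε, HasDerivAt (fun t => θ (t, x)) (X (θ (t, x))) t := by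
  set N : C(I, E) → C(I, E) := fun γ => (⟨X, hX.continuous⟩ : C(E, E)).comp γ with hN
  have hNs : ContDiff ℝ ∞ N := contDiff_comp_continuousMap hX
  -- After rescaling time, an integral curve from `x` run up to time `s` is a solution on `[0, 1]`
  -- of `γ = x + s ∫ X ∘ γ`, that is, `Ψ ((s, x), γ) = ((s, x), 0)`. At `s = 0` the derivative of
  -- `Ψ` in `γ` is the identity, so the inverse function theorem gives `γ` as a smooth function of
  -- `(s, x)`; the flow is its value at `1`.
  set Ψ : (ℝ × E) × C(I, E) → (ℝ × E) × C(I, E) := fun q =>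
    (q.1, q.2 - constCurve q.1.2 - q.1.1 • integralCurve (N q.2)) with hΨ
  have hΨs : ContDiff ℝ ∞ Ψ :=
    contDiff_fst.prodMk ((contDiff_snd.sub (constCurve.contDiff.comp contDiff_fst.snd)).sub
      (contDiff_fst.fst.smul (integralCurve.contDiff.comp (hNs.comp contDiff_snd))))
  set γ₀ : C(I, E) := constCurve x₀
  set a : (ℝ × E) × C(I, E) := ((0, x₀), γ₀) with ha
  set K : ℝ × E →L[ℝ] C(I, E) := constCurve.comp (ContinuousLinearMap.snd ℝ ℝ E)
    + (ContinuousLinearMap.fst ℝ ℝ E).smulRight (integralCurve (N γ₀)) with hK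
  set π₁ := ContinuousLinearMap.fst ℝ (ℝ × E) C(I, E)
  set π₂ := ContinuousLinearMap.snd ℝ (ℝ × E) C(I, E)
  -- The derivative at `a` is block triangular with identity blocks on the diagonal; changing the
  -- sign of `K` inverts it.
  let L : ((ℝ × E) × C(I, E)) ≃L[ℝ] ((ℝ × E) × C(I, E)) :=
    ContinuousLinearEquiv.equivOfInverse (π₁.prod (π₂ - K.comp π₁)) (π₁.prod (π₂ + K.comp π₁))
      (fun q => by ext <;> simp [π₁, π₂]) (fun q => by ext <;> simp [π₁, π₂])
  have hL : HasFDerivAt Ψ (L : ((ℝ × E) × C(I, E)) →L[ℝ] ((ℝ × E) × C(I, E))) a := by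
    have h1 : HasFDerivAt (fun q : (ℝ × E) × C(I, E) => integralCurve (N q.2))
        ((integralCurve.comp (fderiv ℝ N γ₀)).comp π₂) a := by
      have h0 : HasFDerivAt (integralCurve ∘ N) (integralCurve.comp (fderiv ℝ N γ₀)) a.2 :=
        integralCurve.hasFDerivAt.comp γ₀ (hNs.differentiable (by simp) γ₀).hasFDerivAt
      exact h0.comp a hasFDerivAt_snd
    have h2 : HasFDerivAt (fun q : (ℝ × E) × C(I, E) => q.1.1)
        ((ContinuousLinearMap.fst ℝ ℝ E).comp π₁) a :=
      hasFDerivAt_fst.comp a hasFDerivAt_fst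
    have h3 : HasFDerivAt (fun q : (ℝ × E) × C(I, E) => constCurve q.1.2)
        (constCurve.comp ((ContinuousLinearMap.snd ℝ ℝ E).comp π₁)) a :=
      (constCurve.comp ((ContinuousLinearMap.snd ℝ ℝ E).comp π₁)).hasFDerivAt
    have h4 := hasFDerivAt_fst.prodMk (((hasFDerivAt_snd (p := a)).sub h3).sub (h2.smul h1))
    refine h4.congr_fderiv ?_
    refine ContinuousLinearMap.ext fun q => Prod.ext rfl ?_
    simp [L, π₁, π₂, hK, ha, sub_sub]
  obtain ⟨φ, hφa, -, hφ, hφs⟩ := exists_smooth_local_inverse isOpen_univ hΨs.contDiffOn (mem_univ a)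
    L hL
  have hΨa : Ψ a = ((0, x₀), 0) := by simp [hΨ, ha, γ₀]
  have hta : ((0, x₀), (0 : C(I, E))) ∈ φ.target := by
    rw [← hΨa, ← hφ]; exact φ.map_source hφa
  obtain ⟨δ, hδ, hδs⟩ := Metric.isOpen_iff.1 φ.open_source a hφa
  have hj : Continuous fun p : ℝ × E => (p, (0 : C(I, E))) := by fun_prop
  obtain ⟨δ', hδ', hδt⟩ := Metric.isOpen_iff.1 (φ.open_target.preimage hj) (0, x₀) hta
  -- Picard–Lindelöf supplies the integral curves, the inverse function theorem the smoothness;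
  -- `key` identifies the two.
  obtain ⟨r, hr, ε₀, hε₀, hα⟩ :=
    (hX.contDiffAt (x := x₀)).of_le (m := 1) (by simp)
      |>.exists_forall_mem_closedBall_exists_eq_forall_mem_Ioo_hasDerivAt 0
  have hC0 : 0 ≤ C := (norm_nonneg _).trans (hC x₀)
  set ε := min (min δ' r) (min (min (δ / 2) ε₀) (δ / (2 * (C + 1)))) with hε
  have hεpos : 0 < ε := by positivity
  have e1 : ε ≤ δ' := (min_le_left _ _).trans (min_le_left _ _)
  have e2 : ε ≤ r := (min_le_left _ _).trans (min_le_right _ _)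
  have e3 : ε ≤ δ / 2 := (min_le_right _ _).trans ((min_le_left _ _).trans (min_le_left _ _))
  have e4 : ε ≤ ε₀ := (min_le_right _ _).trans ((min_le_left _ _).trans (min_le_right _ _))
  have e5 : (C + 1) * ε ≤ δ / 2 := by
    have := (min_le_right _ _).trans (min_le_right _ _) |>.trans_eq' hε
    rw [le_div_iff₀ (by positivity)] at this
    linarith
  set θ : ℝ × E → E := fun p => (φ.symm (p, 0)).2 1 with hθ
  have key : ∀ x ∈ Metric.ball x₀ ε, ∀ α : ℝ → E, α 0 = x →
      (∀ t ∈ Ioo (0 - ε₀) (0 + ε₀), HasDerivAt α (X (α t)) t) →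
      ∀ s ∈ Ioo (-ε) ε, θ (s, x) = α s := by
    intro x hx α h0 hd s hs
    rw [zero_sub, zero_add] at hd
    have hst : ∀ t ∈ Icc (0 : ℝ) 1, s * t ∈ Ioo (-ε) ε := by
      intro t ht
      rw [mem_Ioo, ← abs_lt, abs_mul, abs_of_nonneg ht.1]
      exact lt_of_le_of_lt (mul_le_of_le_one_right (abs_nonneg _) ht.2) (abs_lt.2 hs)
    have hst' : ∀ t ∈ Icc (0 : ℝ) 1, s * t ∈ Ioo (-ε₀) ε₀ := fun t ht =>
      ⟨lt_of_le_of_lt (neg_le_neg e4) (hst t ht).1, lt_of_lt_of_le (hst t ht).2 e4⟩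
    have hdd : ∀ t ∈ Icc (0 : ℝ) 1, HasDerivAt (fun t => α (s * t)) (s • X (α (s * t))) t := by
      intro t ht
      have := (hd _ (hst' t ht)).scomp t ((hasDerivAt_id' t).const_mul s)
      rw [mul_one] at this
      exact this
    have hcα : ContinuousOn (fun t => α (s * t)) (Icc 0 1) := fun t ht =>
      (hdd t ht).continuousAt.continuousWithinAt
    obtain ⟨γ, hγ⟩ : ∃ γ : C(I, E), ∀ t : I, γ t = α (s * t) :=
      ⟨⟨fun t => α (s * t), continuousOn_iff_continuous_domRestrict.1 hcα⟩, fun _ => rfl⟩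
    have hγint : ∀ t : I, γ t = x + s • integralCurve (N γ) t := by
      intro t
      have hsub : uIcc (0 : ℝ) t ⊆ Icc 0 1 := by
        rw [uIcc_of_le t.2.1]; exact Icc_subset_Icc_right t.2.2
      have hF := intervalIntegral.integral_eq_sub_of_hasDerivAt (a := 0) (b := (t : ℝ))
        (fun τ hτ => hdd τ (hsub hτ))
        (((hX.continuous.comp_continuousOn hcα).const_smul s).mono hsub).intervalIntegrable
      rw [mul_zero, h0, intervalIntegral.integral_smul] at hF
      rw [integralCurve_apply]
      have : ∫ τ in (0 : ℝ)..t, (N γ) (projIcc 0 1 zero_le_one τ) = ∫ τ in (0 : ℝ)..t, X (α (s * τ)) := by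
        refine intervalIntegral.integral_congr fun τ hτ => ?_
        have hp : projIcc 0 1 zero_le_one τ = ⟨τ, hsub hτ⟩ := projIcc_of_mem _ _
        change X (γ (projIcc 0 1 zero_le_one τ)) = _
        rw [hp, hγ]
      rw [this, hF, hγ, add_sub_cancel]
    have hγa : dist γ γ₀ < δ := by
      refine lt_of_le_of_lt (b := δ / 2 + dist x x₀) ?_ (by
        have := Metric.mem_ball.1 hx; linarith)
      rw [dist_eq_norm]
      refine (ContinuousMap.norm_le _ (by positivity)).2 fun t => ?_
      have h1 : ‖α (s * t) - x‖ ≤ δ / 2 := by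
        have := Convex.norm_image_sub_le_of_norm_hasDerivWithin_le (C := C) (s := Ioo (-ε₀) ε₀)
          (fun τ hτ => (hd τ hτ).hasDerivWithinAt) (fun τ _ => hC _) (convex_Ioo _ _)
          (x := 0) (y := s * t) ⟨by linarith, hε₀⟩ (hst' t t.2)
        rw [h0, sub_zero] at this
        refine this.trans (le_trans ?_ e5)
        have h3 : ‖s * (t : ℝ)‖ ≤ ε := (abs_lt.2 (hst t t.2)).le
        nlinarith [norm_nonneg (s * (t : ℝ))]
      calc ‖(γ - γ₀) t‖ = ‖(α (s * t) - x) + (x - x₀)‖ := by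
            rw [ContinuousMap.sub_apply, hγ, constCurve_apply, sub_add_sub_cancel]
        _ ≤ δ / 2 + dist x x₀ := by
            rw [dist_eq_norm]; exact (norm_add_le _ _).trans (by linarith)
    -- Being in the source of `φ` identifies `γ` with the solution selected by `φ.symm`.
    have hsrc : ((s, x), γ) ∈ φ.source := by
      refine hδs ?_
      rw [Metric.mem_ball, Prod.dist_eq, Prod.dist_eq, max_lt_iff, max_lt_iff]
      refine ⟨⟨?_, ?_⟩, hγa⟩
      · rw [Real.dist_eq, sub_zero]; exact lt_of_lt_of_le (abs_lt.2 hs) (by linarith)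
      · exact lt_of_lt_of_le (Metric.mem_ball.1 hx) (by linarith)
    have hval : φ ((s, x), γ) = ((s, x), 0) := by
      rw [hφ]
      refine Prod.ext rfl ?_
      ext t
      have := hγint t
      simp only [hΨ, ContinuousMap.sub_apply, ContinuousMap.smul_apply, ContinuousMap.zero_apply]
      rw [this, constCurve_apply, add_sub_cancel_left, sub_self]
    have : φ.symm ((s, x), 0) = ((s, x), γ) := by rw [← hval, φ.left_inv hsrc]
    simp only [hθ, this, hγ]
    simp
  refine ⟨ε, hεpos, θ, ?_, fun x hx => ?_⟩
  · have h1 : ContDiffOn ℝ ∞ (fun p : ℝ × E => φ.symm (p, 0)) (Ioo (-ε) ε ×ˢ Metric.ball x₀ ε) := by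
      refine hφs.comp (contDiff_id.prodMk contDiff_const).contDiffOn fun p hp => hδt ?_
      rw [Metric.mem_ball, Prod.dist_eq, max_lt_iff]
      refine ⟨?_, lt_of_lt_of_le (Metric.mem_ball.1 hp.2) e1⟩
      rw [Real.dist_eq, sub_zero]; exact lt_of_lt_of_le (abs_lt.2 hp.1) e1
    exact (ContinuousMap.evalCLM ℝ (1 : I)).contDiff.comp_contDiffOn h1.snd
  · obtain ⟨α, h0, hd⟩ := hα x (Metric.ball_subset_closedBall (Metric.ball_subset_ball e2 hx))
    have hk := key x hx α h0 hd
    refine ⟨by rw [hk 0 ⟨by linarith, hεpos⟩, h0], fun t ht => ?_⟩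
    rw [hk t ht]
    refine (hd t ⟨by linarith [ht.1], by linarith [ht.2]⟩).congr_of_eventuallyEq ?_
    filter_upwards [isOpen_Ioo.mem_nhds ht] with τ hτ
    exact hk τ hτ

end Flow

/-! ### The Hessian and its coefficients when the deviation vanishes -/

section Structure

variable {k : ℕ} {G : Eu k → Matrix (Fin k) (Fin k) ℝ} {Ω : Set (Eu k)} {y : Eu k}

theorem gradInner_self_pos (hG : IsMetricOn G Ω) (hy : y ∈ Ω) {u : Eu k → ℝ} (hu : pd u y ≠ 0) :
    0 < gradInner G u u y := by
  have h := (Matrix.posDef_iff_dotProduct_mulVec.1 (hG.posDef y hy).inv).2 hu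
  exact h

theorem sum_pd_mul_gradV (G : Eu k → Matrix (Fin k) (Fin k) ℝ) (f g : Eu k → ℝ) (y : Eu k) :
    ∑ i, pd f y i * gradV G g y i = gradInner G f g y := rfl

/-- The coefficient of the metric in a Hessian of the form `α g + β du ⊗ du`. -/
def hessCoeff (G : Eu k → Matrix (Fin k) (Fin k) ℝ) (u : Eu k → ℝ) (y : Eu k) : ℝ :=
  (∑ i, ∑ j, (G y)⁻¹ i j * hessian G u y i j
    - gradInner G (gradInner G u u) u y / (2 * gradInner G u u y)) / ((k : ℝ) - 1)

/-- The coefficient of `du ⊗ du` in a Hessian of the form `α g + β du ⊗ du`. -/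
def hessCoeff' (G : Eu k → Matrix (Fin k) (Fin k) ℝ) (u : Eu k → ℝ) (y : Eu k) : ℝ :=
  (gradInner G (gradInner G u u) u y / (2 * gradInner G u u y) - hessCoeff G u y) / gradInner G u u y

/-- The coefficients supplied pointwise by the equality case carry no regularity. The formulas
through the trace of the Hessian and its value on the unit normal, which is `⟨∇w, ∇u⟩ / (2w)`, show
that they are smooth. -/
theorem smooth_hessCoeff (hG : IsMetricOn G Ω) {u : Eu k → ℝ} (hu : ContDiffOn ℝ ∞ u Ω)
    (h0 : ∀ z ∈ Ω, pd u z ≠ 0) :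
    ContDiffOn ℝ ∞ (hessCoeff G u) Ω ∧ ContDiffOn ℝ ∞ (hessCoeff' G u) Ω := by
  have hw := smooth_gradInner hG hu hu
  have hwne : ∀ z ∈ Ω, gradInner G u u z ≠ 0 := fun z hz => (gradInner_self_pos hG hz (h0 z hz)).ne'
  have hm : ContDiffOn ℝ ∞
      (fun y => gradInner G (gradInner G u u) u y / (2 * gradInner G u u y)) Ω :=
    (smooth_gradInner hG hw hu).div (contDiffOn_const.mul hw) fun z hz =>
      mul_ne_zero two_ne_zero (hwne z hz)
  have h1 : ContDiffOn ℝ ∞ (hessCoeff G u) Ω :=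
    ((ContDiffOn.sum fun i _ => ContDiffOn.sum fun j _ =>
      (hG.smooth_inv i j).mul (smooth_hessian hG hu i j)).sub hm).div_const _
  exact ⟨h1, (hm.sub h1).div hw hwne⟩

theorem hessCoeff_eq (hG : IsMetricOn G Ω) (hy : y ∈ Ω) (hk : 4 ≤ k) {u : Eu k → ℝ}
    (hu : ContDiffOn ℝ ∞ u Ω) (h0 : pd u y ≠ 0) {a b : ℝ}
    (hH : ∀ i j, hessian G u y i j = a * G y i j + b * (pd u y i * pd u y j)) :
    hessCoeff G u y = a ∧ hessCoeff' G u y = b := by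
  have hk' : (4 : ℝ) ≤ k := by exact_mod_cast hk
  have hw := gradInner_self_pos hG hy h0
  set w := gradInner G u u y with hwd
  have hHu : ∀ i, ∑ l, hessian G u y i l * gradV G u y l = (a + b * w) * pd u y i := by
    intro i
    simp only [hH, add_mul, Finset.sum_add_distrib, mul_assoc, ← Finset.mul_sum,
      sum_metric_gradV hG hy, sum_pd_mul_gradV, ← hwd]
    ring
  have h1 : gradInner G (gradInner G u u) u y = 2 * (a + b * w) * w := by
    rw [gradInner]
    simp only [pd_gradInner_self hG hy hu, hHu]
    simp only [mul_assoc, ← Finset.mul_sum, sum_pd_mul_gradV, ← hwd]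
  have h2 : ∑ i, ∑ j, (G y)⁻¹ i j * hessian G u y i j = k * a + b * w := by
    simp only [hH, mul_add, Finset.sum_add_distrib, mul_left_comm _ a, mul_left_comm _ b,
      ← Finset.mul_sum, trace_metric hG hy]
    have : ∑ i, ∑ j, (G y)⁻¹ i j * (pd u y i * pd u y j) = w := by
      rw [hwd]; unfold gradInner gradV
      simp only [Finset.mul_sum]
      exact Finset.sum_congr rfl fun i _ => Finset.sum_congr rfl fun j _ => by ring
    rw [this]; ring
  have hm : gradInner G (gradInner G u u) u y / (2 * w) = a + b * w := by
    rw [h1]; field_simp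
  have h3 : hessCoeff G u y = a := by
    unfold hessCoeff
    rw [h2, ← hwd, hm, div_eq_iff (by linarith)]; ring
  refine ⟨h3, ?_⟩
  unfold hessCoeff'
  rw [← hwd, hm, h3, div_eq_iff hw.ne']; ring

/-- For a soliton, the vanishing of the deviation determines the Hessian. -/
theorem hessian_eq_of_deviation (hG : IsMetricOn G Ω) (hy : y ∈ Ω) (hk : 4 ≤ k) {u : Eu k → ℝ}
    {h lam : ℝ} (hu : ContDiffOn ℝ ∞ u Ω) (h0 : pd u y ≠ 0) (hh : h ≠ 0)
    (heq : ∀ i j, ricci G y i j + h * hessian G u y i j = lam * G y i j)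
    (hdev : deviation (G y)⁻¹ (tracelessRicci G y) (pd u y) = 0) (i j : Fin k) :
    hessian G u y i j = hessCoeff G u y * G y i j + hessCoeff' G u y * (pd u y i * pd u y j) := by
  obtain ⟨a, b, hab⟩ := eq_of_deviation_eq_zero hk (hG.posDef y hy) (tracelessRicci_symm hG hy)
    (trace_tracelessRicci hG hy hk) h0 hdev
  have hH : ∀ i j, hessian G u y i j
      = ((lam - a - scalar G y / k) / h) * G y i j + (- b / h) * (pd u y i * pd u y j) := by
    intro i j
    have h1 := hab i j
    have h2 := heq i j
    unfold tracelessRicci at h1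
    rw [← mul_right_inj' hh]
    have e : h * ((lam - a - scalar G y / k) / h * G y i j + -b / h * (pd u y i * pd u y j))
        = (lam - a - scalar G y / k) * G y i j - b * (pd u y i * pd u y j) := by
      rw [mul_add, ← mul_assoc, ← mul_assoc, mul_div_cancel₀ _ hh, mul_div_cancel₀ _ hh]; ring
    rw [e]
    linear_combination h2 - h1
  obtain ⟨h1, h2⟩ := hessCoeff_eq hG hy hk hu h0 hH
  rw [h1, h2, hH]

/-- Since `dw = 2 ∇du(∇u)` is a multiple of `du`, the length of `∇u` is constant along connected
pieces of level sets. -/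
theorem pd_gradInner_self_of_hessian_eq (hG : IsMetricOn G Ω) (hy : y ∈ Ω) {u : Eu k → ℝ}
    (hu : ContDiffOn ℝ ∞ u Ω) {a b : ℝ}
    (hH : ∀ i j, hessian G u y i j = a * G y i j + b * (pd u y i * pd u y j)) (i : Fin k) :
    pd (gradInner G u u) y i = 2 * (a + b * gradInner G u u y) * pd u y i := by
  rw [pd_gradInner_self hG hy hu]
  simp only [hH, add_mul, Finset.sum_add_distrib, mul_assoc, ← Finset.mul_sum,
    sum_metric_gradV hG hy, sum_pd_mul_gradV]
  ring

/-- The coefficient `α` in `∇du = α g + β du ⊗ du` is constant in directions tangent to the level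
sets of `u`, when the Ricci tensor has the same form. -/
theorem sum_mul_pd_hessCoeff (hG : IsMetricOn G Ω) (hy : y ∈ Ω) (hk : 4 ≤ k) {u : Eu k → ℝ}
    {α β : Eu k → ℝ} (hu : ContDiffOn ℝ ∞ u Ω) (hα : ContDiffOn ℝ ∞ α Ω) (hβ : ContDiffOn ℝ ∞ β Ω)
    (h0 : pd u y ≠ 0)
    (hH : ∀ z ∈ Ω, ∀ i j, hessian G u z i j = α z * G z i j + β z * (pd u z i * pd u z j))
    {a b : ℝ} (hR : ∀ i j, ricci G y i j = a * G y i j + b * (pd u y i * pd u y j))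
    {v : Fin k → ℝ} (hv : ∑ i, v i * pd u y i = 0) : ∑ i, v i * pd α y i = 0 := by
  have hk' : (4 : ℝ) ≤ k := by exact_mod_cast hk
  have hw := gradInner_self_pos hG hy h0
  set w := gradInner G u u y with hwd
  have dα := ContDiffOn.dAt hα hG.isOpen hy
  have dβ := ContDiffOn.dAt hβ hG.isOpen hy
  have du : ∀ i, DifferentiableAt ℝ (fun z => pd u z i) y := fun i =>
    ContDiffOn.dAt (contDiffOn_pd hG.isOpen hu i) hG.isOpen hy
  have dG : ∀ i j, DifferentiableAt ℝ (fun z => G z i j) y := fun i j => hG.dAt_metric hy i j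
  have hD : ∀ c i j, covD2 G (hessian G u) y c i j
      = pd α y c * G y i j + pd β y c * (pd u y i * pd u y j)
        + β y * (hessian G u y c i * pd u y j + pd u y i * hessian G u y c j) := by
    intro c i j
    rw [covD2_congr (T := fun z i j => α z * G z i j + β z * (pd u z i * pd u z j)) hG.isOpen hy hH]
    have hm := hG.covD2_metric hy c i j
    unfold covD2 at hm ⊢
    rw [pd_add (dα.fun_mul (dG i j)) (dβ.fun_mul ((du i).fun_mul (du j))), pd_mul dα (dG i j),
      pd_mul dβ ((du i).fun_mul (du j)), pd_mul (du i) (du j)]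
    have e1 : ∑ m, christoffel G y m c i * (α y * G y m j + β y * (pd u y m * pd u y j))
        = α y * ∑ m, christoffel G y m c i * G y m j
          + β y * pd u y j * ∑ m, christoffel G y m c i * pd u y m := by
      simp only [Finset.mul_sum, ← Finset.sum_add_distrib]
      exact Finset.sum_congr rfl fun m _ => by ring
    have e2 : ∑ m, christoffel G y m c j * (α y * G y i m + β y * (pd u y i * pd u y m))
        = α y * ∑ m, christoffel G y m c j * G y i m
          + β y * pd u y i * ∑ m, christoffel G y m c j * pd u y m := by
      simp only [Finset.mul_sum, ← Finset.sum_add_distrib]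
      exact Finset.sum_congr rfl fun m _ => by ring
    rw [e1, e2]
    simp only [hessian]
    linear_combination α y * hm
  set V : Fin k → ℝ := fun l => gradV G u y l with hV
  set gv : Fin k → ℝ := fun j => ∑ c, v c * G y c j with hgv
  have hVu : ∑ i, pd u y i * V i = w := rfl
  have hgV : ∑ j, gv j * V j = 0 := by
    simp only [hgv, Finset.sum_mul]
    rw [Finset.sum_comm]
    simp only [mul_assoc, ← Finset.mul_sum]
    rw [← hv]
    exact Finset.sum_congr rfl fun c _ => by rw [hV, sum_metric_gradV hG hy]
  have hHv : ∀ j, ∑ c, v c * hessian G u y c j = α y * gv j := by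
    intro j
    have : ∀ c, v c * hessian G u y c j
        = α y * (v c * G y c j) + (v c * pd u y c) * (β y * pd u y j) := fun c => by
      rw [hH y hy]; ring
    simp only [this, Finset.sum_add_distrib, ← Finset.mul_sum, ← Finset.sum_mul, hv]
    ring
  set A := ∑ c, v c * pd α y c with hA
  set B := ∑ c, v c * pd β y c with hB
  -- The curvature `R(v, ·, ·, ∇u)` for a vector `v` tangent to the level set, by the Ricci identity
  -- applied to `∇du = α g + β du ⊗ du`.
  have hT : ∀ i j, ∑ c, v c * ∑ l, riemann G y c i j l * V l
      = A * G y i j - pd α y i * gv j + B * (pd u y i * pd u y j) + β y * α y * (pd u y i * gv j) := by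
    intro i j
    have e : ∀ c, v c * ∑ l, riemann G y c i j l * V l
        = (v c * pd α y c) * G y i j - pd α y i * (v c * G y c j)
          + (v c * pd β y c) * (pd u y i * pd u y j)
          - (v c * pd u y c) * (pd β y i * pd u y j + β y * hessian G u y i j)
          + β y * pd u y i * (v c * hessian G u y c j) := by
      intro c
      rw [hV, ← ricci_identity hG hy hu, hD, hD, hessian_symm hG hy hu i c]
      ring
    simp only [e, Finset.sum_add_distrib, Finset.sum_sub_distrib, ← Finset.sum_mul,
      ← Finset.mul_sum, hHv, hv]
    rw [← hA, ← hB]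
    simp only [hgv]
    ring
  -- Insert `∇u` in the two free slots: the curvature side vanishes by skewness.
  have hc1 : A * w + B * (w * w) = 0 := by
    have e1 : ∑ i, V i * ∑ j, V j * ∑ c, v c * ∑ l, riemann G y c i j l * V l = 0 := by
      refine Finset.sum_eq_zero fun i _ => mul_eq_zero_of_right _ ?_
      have : ∑ j, V j * ∑ c, v c * ∑ l, riemann G y c i j l * V l
          = ∑ c, v c * ∑ j, ∑ l, riemann G y c i j l * (V j * V l) := by
        simp only [Finset.mul_sum]
        rw [Finset.sum_comm]
        exact Finset.sum_congr rfl fun c _ => Finset.sum_congr rfl fun j _ =>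
          Finset.sum_congr rfl fun l _ => by ring
      rw [this]
      refine Finset.sum_eq_zero fun c _ => mul_eq_zero_of_right _ ?_
      have h2 : ∑ j, ∑ l, riemann G y c i j l * (V j * V l)
          = - ∑ j, ∑ l, riemann G y c i j l * (V j * V l) := by
        conv_lhs => rw [Finset.sum_comm]
        rw [← Finset.sum_neg_distrib]
        refine Finset.sum_congr rfl fun j _ => ?_
        rw [← Finset.sum_neg_distrib]
        exact Finset.sum_congr rfl fun l _ => by rw [hG.riemann_skew_right hy c i l j]; ring
      linarith
    simp only [hT] at e1
    have e2 : ∀ i, ∑ j, V j * (A * G y i j - pd α y i * gv j + B * (pd u y i * pd u y j)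
        + β y * α y * (pd u y i * gv j)) = (A + B * w) * pd u y i := by
      intro i
      have : ∀ j, V j * (A * G y i j - pd α y i * gv j + B * (pd u y i * pd u y j)
        + β y * α y * (pd u y i * gv j))
          = A * (G y i j * V j) + (β y * α y * pd u y i - pd α y i) * (gv j * V j)
            + B * pd u y i * (pd u y j * V j) := fun j => by ring
      simp only [this, Finset.sum_add_distrib, ← Finset.mul_sum, hgV, hVu]
      rw [hV, sum_metric_gradV hG hy]
      ring
    simp only [e2] at e1
    have e3 : ∀ i, V i * ((A + B * w) * pd u y i) = (A + B * w) * (pd u y i * V i) := fun i => by ring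
    simp only [e3, ← Finset.mul_sum, hVu] at e1
    linarith
  -- Trace over the two free slots: the curvature side becomes `-Ric(v, ∇u)`, which is zero because
  -- `Ric` has the same form as the Hessian and `v ⊥ ∇u`. Together with `hc1` this gives `(k - 2) A
  -- = 0`.
  have hc2 : ((k : ℝ) - 1) * A + B * w = 0 := by
    have e1 : ∑ i, ∑ j, (G y)⁻¹ i j * ∑ c, v c * ∑ l, riemann G y c i j l * V l = 0 := by
      have : ∑ i, ∑ j, (G y)⁻¹ i j * ∑ c, v c * ∑ l, riemann G y c i j l * V l
          = ∑ c, v c * ∑ l, (∑ i, ∑ j, (G y)⁻¹ i j * riemann G y c i j l) * V l := by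
        simp only [Finset.mul_sum, Finset.sum_mul]
        calc _ = ∑ i, ∑ c, ∑ j, ∑ l, (G y)⁻¹ i j * (v c * (riemann G y c i j l * V l)) :=
              Finset.sum_congr rfl fun i _ => Finset.sum_comm
          _ = ∑ c, ∑ i, ∑ j, ∑ l, (G y)⁻¹ i j * (v c * (riemann G y c i j l * V l)) :=
              Finset.sum_comm
          _ = ∑ c, ∑ i, ∑ l, ∑ j, (G y)⁻¹ i j * (v c * (riemann G y c i j l * V l)) :=
              Finset.sum_congr rfl fun c _ => Finset.sum_congr rfl fun i _ => Finset.sum_comm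
          _ = ∑ c, ∑ l, ∑ i, ∑ j, (G y)⁻¹ i j * (v c * (riemann G y c i j l * V l)) :=
              Finset.sum_congr rfl fun c _ => Finset.sum_comm
          _ = _ := Finset.sum_congr rfl fun c _ => Finset.sum_congr rfl fun l _ =>
              Finset.sum_congr rfl fun i _ => Finset.sum_congr rfl fun j _ => by ring
      rw [this]
      have h3 : ∀ c, ∑ l, (∑ i, ∑ j, (G y)⁻¹ i j * riemann G y c i j l) * V l
          = - (a + b * w) * pd u y c := by
        intro c
        simp only [trace_riemann hG hy, hR]
        have : ∀ l, -(a * G y c l + b * (pd u y c * pd u y l)) * V l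
            = - a * (G y c l * V l) - b * pd u y c * (pd u y l * V l) := fun l => by ring
        simp only [this, Finset.sum_sub_distrib, ← Finset.mul_sum, hVu]
        rw [hV, sum_metric_gradV hG hy]; ring
      simp only [h3, mul_left_comm _ (-(a + b * w)), ← Finset.mul_sum, hv, mul_zero]
    simp only [hT] at e1
    have e2 : ∀ i j, (G y)⁻¹ i j * (A * G y i j - pd α y i * gv j + B * (pd u y i * pd u y j)
        + β y * α y * (pd u y i * gv j))
        = A * ((G y)⁻¹ i j * G y i j) + B * ((G y)⁻¹ i j * (pd u y i * pd u y j))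
          + (G y)⁻¹ i j * ((β y * α y * pd u y i - pd α y i) * gv j) := fun i j => by ring
    have e3 : ∀ f : Fin k → ℝ, ∑ i, ∑ j, (G y)⁻¹ i j * (f i * gv j) = ∑ c, v c * f c := by
      intro f
      have : ∀ i j, (G y)⁻¹ i j * (f i * gv j) = ∑ c, v c * ((G y)⁻¹ i j * (G y c j * f i)) := by
        intro i j
        simp only [hgv, Finset.mul_sum]
        exact Finset.sum_congr rfl fun c _ => by ring
      simp only [this]
      rw [Finset.sum_congr rfl fun i _ => Finset.sum_comm, Finset.sum_comm]
      simp only [← Finset.mul_sum]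
      exact Finset.sum_congr rfl fun c _ => by rw [sum_inv_mul_left hG hy c f]
    have e4 : ∑ i, ∑ j, (G y)⁻¹ i j * (pd u y i * pd u y j) = w := by
      rw [hwd]; unfold gradInner gradV
      simp only [Finset.mul_sum]
      exact Finset.sum_congr rfl fun i _ => Finset.sum_congr rfl fun j _ => by ring
    simp only [e2, Finset.sum_add_distrib, ← Finset.mul_sum, trace_metric hG hy, e4, e3] at e1
    have e5 : ∑ c, v c * (β y * α y * pd u y c - pd α y c) = - A := by
      have : ∀ c, v c * (β y * α y * pd u y c - pd α y c)
          = β y * α y * (v c * pd u y c) - v c * pd α y c := fun c => by ring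
      simp only [this, Finset.sum_sub_distrib, ← Finset.mul_sum, hv, ← hA]
      ring
    rw [e5] at e1
    linarith
  have h3 : A + B * w = 0 := by
    have : w * (A + B * w) = 0 := by linarith
    exact (mul_eq_zero.1 this).resolve_left hw.ne'
  have h4 : ((k : ℝ) - 2) * A = 0 := by linarith
  exact (mul_eq_zero.1 h4).resolve_left (by linarith)

/-- Schur's lemma. -/
theorem pd_eq_zero_of_ricci_eq (hG : IsMetricOn G Ω) (hy : y ∈ Ω) (hk : 3 ≤ k) {ρ : Eu k → ℝ}
    (hρ : ∀ z ∈ Ω, ∀ i j, ricci G z i j = ρ z * G z i j) (c : Fin k) : pd ρ y c = 0 := by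
  have hk' : (3 : ℝ) ≤ k := by exact_mod_cast hk
  have hs : ∀ z ∈ Ω, scalar G z = k * ρ z := by
    intro z hz
    unfold scalar
    simp only [hρ z hz, mul_left_comm _ (ρ z), ← Finset.mul_sum, trace_metric hG hz]
    ring
  have hρs : ∀ z ∈ Ω, ρ z = (1 / k) * scalar G z := by
    intro z hz
    rw [hs z hz]; field_simp
  have ds := ContDiffOn.dAt hG.smooth_scalar hG.isOpen hy
  have dρ : DifferentiableAt ℝ ρ y := by
    refine (ds.const_mul (1 / (k : ℝ))).congr_of_eventuallyEq ?_
    filter_upwards [hG.isOpen.mem_nhds hy] with z hz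
    exact hρs z hz
  -- For `Ric = ρ g` the left side is `dρ` and the right side is `(k/2) dρ`.
  have h1 := div_ricci hG hy c
  rw [pd_congr_on hG.isOpen hy hs, pd_const_mul dρ] at h1
  have h2 : ∀ i j, covD2 G (ricci G) y i j c = pd ρ y i * G y j c := by
    intro i j
    rw [covD2_congr (T := fun z i j => ρ z * G z i j) hG.isOpen hy hρ]
    have hm := hG.covD2_metric hy i j c
    unfold covD2 at hm ⊢
    rw [pd_mul dρ (hG.dAt_metric hy j c)]
    simp only [mul_left_comm _ (ρ y), ← Finset.mul_sum]
    linear_combination ρ y * hm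
  simp only [h2] at h1
  have h3 : ∑ i, ∑ j, (G y)⁻¹ i j * (pd ρ y i * G y j c) = pd ρ y c := by
    rw [← sum_inv_mul_left hG hy c (pd ρ y)]
    exact Finset.sum_congr rfl fun i _ => Finset.sum_congr rfl fun j _ => by
      rw [hG.symm hy j c]; ring
  rw [h3] at h1
  have : pd ρ y c * ((k : ℝ) - 2) = 0 := by linarith
  exact (mul_eq_zero.1 this).resolve_right (by linarith)

end Structure

/-! ### Splitting off the first coordinate -/

section Splitting

variable {m : ℕ}

/-- The splitting `ℝ^(m+1) = ℝ × ℝ^m` off the first coordinate. -/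
def split (m : ℕ) : Eu (m + 1) ≃L[ℝ] ℝ × Eu m :=
  LinearEquiv.toContinuousLinearEquiv
    { toFun := fun z => (z 0, WithLp.toLp 2 fun i : Fin m => z i.succ)
      invFun := fun q => WithLp.toLp 2 (Fin.cons q.1 fun i => q.2 i)
      map_add' := fun _ _ => rfl
      map_smul' := fun _ _ => rfl
      left_inv := fun z => by
        ext i; refine Fin.cases ?_ (fun j => ?_) i <;> rfl
      right_inv := fun _ => rfl }

/-- The point of `ℝ^(m+1)` with first coordinate `t` and remaining coordinates `y`. -/
def joinPt (t : ℝ) (y : Eu m) : Eu (m + 1) := (split m).symm (t, y)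

@[simp] theorem joinPt_zero (t : ℝ) (y : Eu m) : joinPt t y 0 = t := rfl

@[simp] theorem joinPt_succ (t : ℝ) (y : Eu m) (i : Fin m) : joinPt t y i.succ = y i := rfl

@[simp] theorem split_joinPt (t : ℝ) (y : Eu m) : split m (joinPt t y) = (t, y) :=
  (split m).apply_symm_apply _

@[simp] theorem joinPt_split (z : Eu (m + 1)) : joinPt (split m z).1 (split m z).2 = z :=
  (split m).symm_apply_apply z

theorem joinPt_single_zero : joinPt 1 (0 : Eu m) = EuclideanSpace.single 0 1 := by
  ext i; refine Fin.cases ?_ (fun j => ?_) i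
  · simp
  · simp

theorem joinPt_single_succ (a : Fin m) :
    joinPt 0 (EuclideanSpace.single a 1 : Eu m) = EuclideanSpace.single a.succ 1 := by
  ext i; refine Fin.cases ?_ (fun j => ?_) i
  · simp [Fin.succ_ne_zero, eq_comm]
  · simp [Pi.single_apply]

theorem hasFDerivAt_joinPt_right (t : ℝ) (y : Eu m) :
    HasFDerivAt (fun y => joinPt t y)
      (((split m).symm : ℝ × Eu m →L[ℝ] Eu (m + 1)).comp (ContinuousLinearMap.inr ℝ ℝ (Eu m))) y :=
  (split m).symm.hasFDerivAt.comp y (hasFDerivAt_prodMk_right t y)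

theorem hasDerivAt_joinPt_left (t : ℝ) (y : Eu m) :
    HasDerivAt (fun t => joinPt t y) (EuclideanSpace.single 0 1) t := by
  have h := ((split m).symm.hasFDerivAt.comp t (hasFDerivAt_prodMk_left t y)).hasDerivAt
  rw [← joinPt_single_zero]
  exact h

/-- The product of an interval and a set in `ℝ^m`, as a subset of `ℝ^(m+1)`. -/
def box (ε : ℝ) (V : Set (Eu m)) : Set (Eu (m + 1)) := split m ⁻¹' (Ioo (-ε) ε ×ˢ V)

theorem isOpen_box (ε : ℝ) {V : Set (Eu m)} (hV : IsOpen V) : IsOpen (box ε V) :=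
  (isOpen_Ioo.prod hV).preimage (split m).continuous

theorem joinPt_mem_box {ε : ℝ} {V : Set (Eu m)} {t : ℝ} {y : Eu m} :
    joinPt t y ∈ box ε V ↔ t ∈ Ioo (-ε) ε ∧ y ∈ V := by
  unfold box; rw [mem_preimage, split_joinPt]; rfl

theorem forall_mem_box {ε : ℝ} {V : Set (Eu m)} {P : Eu (m + 1) → Prop} :
    (∀ z ∈ box ε V, P z) ↔ ∀ t ∈ Ioo (-ε) ε, ∀ y ∈ V, P (joinPt t y) := by
  constructor
  · exact fun h t ht y hy => h _ (joinPt_mem_box.2 ⟨ht, hy⟩)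
  · intro h z hz
    rw [← joinPt_split z] at hz ⊢
    exact h _ (joinPt_mem_box.1 hz).1 _ (joinPt_mem_box.1 hz).2

theorem exists_box_subset {U : Set (Eu (m + 1))} (hU : IsOpen U) {y₀ : Eu m}
    (h : joinPt 0 y₀ ∈ U) : ∃ ε > 0, box ε (Metric.ball y₀ ε) ⊆ U := by
  have h1 : (split m).symm ⁻¹' U ∈ nhds ((0 : ℝ), y₀) :=
    (hU.preimage (split m).symm.continuous).mem_nhds h
  obtain ⟨ε, hε, hs⟩ := Metric.mem_nhds_iff.1 h1
  refine ⟨ε, hε, fun z hz => ?_⟩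
  rw [← joinPt_split z]
  apply hs
  rw [← ball_prod_same, Real.ball_eq_Ioo]
  simpa [box] using hz

end Splitting

/-! ### Local flows and straightening of a transversal vector field -/

section Straightening

variable {m : ℕ}

/-- The local flow of a smooth vector field. -/
theorem exists_smooth_local_flow {E : Type} [NormedAddCommGroup E] [NormedSpace ℝ E]
    [FiniteDimensional ℝ E] {X : E → E} {Ω : Set E} (hΩ : IsOpen Ω) (hX : ContDiffOn ℝ ∞ X Ω)
    {x₀ : E} (hx₀ : x₀ ∈ Ω) :
    ∃ ε > 0, ∃ θ : ℝ × E → E, ContDiffOn ℝ ∞ θ (Ioo (-ε) ε ×ˢ Metric.ball x₀ ε) ∧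
      ∀ x ∈ Metric.ball x₀ ε, θ (0, x) = x ∧
        ∀ t ∈ Ioo (-ε) ε, θ (t, x) ∈ Ω ∧ HasDerivAt (fun t => θ (t, x)) (X (θ (t, x))) t := by
  haveI : CompleteSpace E := FiniteDimensional.complete ℝ E
  obtain ⟨r, hr, hrΩ⟩ := Metric.isOpen_iff.1 hΩ x₀ hx₀
  -- A bump function turns `X` into a bounded vector field on the whole space. The time and space
  -- intervals are then shrunk so that the flow stays in the ball of radius `r / 4`, where the bump
  -- is `1`.
  let χ : ContDiffBump x₀ := ⟨r / 4, r / 2, by linarith, by linarith⟩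
  set Y : E → E := fun x => χ x • X x with hY
  have hts : tsupport (χ : E → ℝ) ⊆ Ω := by
    rw [χ.tsupport_eq]
    exact (Metric.closedBall_subset_ball (by change r / 2 < r; linarith)).trans hrΩ
  have hYs : ContDiff ℝ ∞ Y := by
    rw [contDiff_iff_contDiffAt]
    intro x
    by_cases hx : x ∈ tsupport (χ : E → ℝ)
    · exact χ.contDiff.contDiffAt.smul (hX.contDiffAt (hΩ.mem_nhds (hts hx)))
    · have : Y =ᶠ[nhds x] fun _ => 0 := by
        filter_upwards [(isClosed_tsupport _).isOpen_compl.mem_nhds hx] with z hz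
        simp only [hY, image_eq_zero_of_notMem_tsupport hz, zero_smul]
      exact contDiffAt_const.congr_of_eventuallyEq this
  have hYc : HasCompactSupport Y := χ.hasCompactSupport.smul_right
  obtain ⟨C, hC⟩ := hYs.continuous.bounded_above_of_compact_support hYc
  obtain ⟨ε, hε, θ, hθ, hflow⟩ := exists_smooth_flow_of_bounded hYs hC x₀
  have h0 : θ (0, x₀) = x₀ := (hflow x₀ (Metric.mem_ball_self hε)).1
  have hopen : IsOpen ((Ioo (-ε) ε ×ˢ Metric.ball x₀ ε) ∩ θ ⁻¹' Metric.ball x₀ (r / 4)) :=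
    hθ.continuousOn.isOpen_inter_preimage (isOpen_Ioo.prod Metric.isOpen_ball) Metric.isOpen_ball
  have hmem : ((0 : ℝ), x₀) ∈
      (Ioo (-ε) ε ×ˢ Metric.ball x₀ ε) ∩ θ ⁻¹' Metric.ball x₀ (r / 4) := by
    refine ⟨⟨by simp [hε], Metric.mem_ball_self hε⟩, ?_⟩
    rw [mem_preimage, h0]
    exact Metric.mem_ball_self (by linarith)
  obtain ⟨δ, hδ, hs⟩ := Metric.mem_nhds_iff.1 (hopen.mem_nhds hmem)
  rw [← ball_prod_same, Real.ball_eq_Ioo, zero_sub, zero_add] at hs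
  refine ⟨δ, hδ, θ, hθ.mono fun z hz => (hs hz).1, fun x hx => ?_⟩
  have hin : ∀ t ∈ Ioo (-δ) δ, t ∈ Ioo (-ε) ε ∧ x ∈ Metric.ball x₀ ε ∧
      θ (t, x) ∈ Metric.ball x₀ (r / 4) := fun t ht =>
    ⟨(hs (mk_mem_prod ht hx)).1.1, (hs (mk_mem_prod ht hx)).1.2, (hs (mk_mem_prod ht hx)).2⟩
  have hxe := (hin 0 (by simp [hδ])).2.1
  refine ⟨(hflow x hxe).1, fun t ht => ⟨hrΩ (Metric.ball_subset_ball (by linarith) (hin t ht).2.2), ?_⟩⟩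
  have h1 := (hflow x hxe).2 t (hin t ht).1
  have h2 : Y (θ (t, x)) = X (θ (t, x)) := by
    simp only [hY]
    rw [χ.one_of_mem_closedBall (Metric.ball_subset_closedBall (hin t ht).2.2), one_smul]
  rwa [h2] at h1

/-- A linear functional `ℓ` that does not vanish at `X₀` extends to a linear isomorphism onto
`ℝ × ℝ^m` under which `X₀` corresponds to a multiple of `(1, 0)`. -/
theorem exists_equiv_of_functional (ℓ : Eu (m + 1) →L[ℝ] ℝ) {X₀ : Eu (m + 1)} (h : ℓ X₀ ≠ 0) :
    ∃ A : Eu (m + 1) ≃L[ℝ] ℝ × Eu m, (∀ y, (A y).1 = ℓ y) ∧ A X₀ = (ℓ X₀, 0) := by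
  have hfr : Module.finrank ℝ (LinearMap.ker (ℓ : Eu (m + 1) →ₗ[ℝ] ℝ)) = m := by
    have h1 := LinearMap.finrank_range_add_finrank_ker (ℓ : Eu (m + 1) →ₗ[ℝ] ℝ)
    have h2 : LinearMap.range (ℓ : Eu (m + 1) →ₗ[ℝ] ℝ) = ⊤ := by
      rw [LinearMap.range_eq_top]
      intro c
      exact ⟨(c / ℓ X₀) • X₀, by simp [h]⟩
    rw [h2, finrank_top, Module.finrank_self, finrank_euclideanSpace_fin] at h1
    omega
  let K : LinearMap.ker (ℓ : Eu (m + 1) →ₗ[ℝ] ℝ) ≃ₗ[ℝ] Eu m :=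
    LinearEquiv.ofFinrankEq _ _ (by rw [hfr, finrank_euclideanSpace_fin])
  -- The projection onto `ker ℓ` along `X₀`; it kills `X₀`, which gives the second property.
  let P : Eu (m + 1) →ₗ[ℝ] LinearMap.ker (ℓ : Eu (m + 1) →ₗ[ℝ] ℝ) :=
    { toFun := fun y => ⟨y - (ℓ y / ℓ X₀) • X₀, by simp [LinearMap.mem_ker, h]⟩
      map_add' := fun y z => by
        ext1; simp only [map_add, add_div, add_smul, Submodule.coe_add]; abel
      map_smul' := fun c y => by
        ext1
        simp only [map_smul, smul_eq_mul, mul_div_assoc, mul_smul, RingHom.id_apply,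
          Submodule.coe_smul, smul_sub] }
  let B : Eu (m + 1) →ₗ[ℝ] ℝ × Eu m := (ℓ : Eu (m + 1) →ₗ[ℝ] ℝ).prod (K.toLinearMap.comp P)
  have hB : Function.Injective B := by
    rw [injective_iff_map_eq_zero]
    intro y hy
    have h1 : ℓ y = 0 := congrArg Prod.fst hy
    have h2 : K (P y) = 0 := congrArg Prod.snd hy
    have h3 : P y = 0 := by simpa using h2
    have h4 : y - (ℓ y / ℓ X₀) • X₀ = 0 := congrArg Subtype.val h3
    simpa [h1] using h4
  refine ⟨(LinearMap.linearEquivOfInjective B hB (by simp [add_comm])).toContinuousLinearEquiv,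
    fun y => rfl, ?_⟩
  change B X₀ = _
  have : P X₀ = 0 := by ext1; simp [P, h]
  change (ℓ X₀, K (P X₀)) = _
  rw [this, map_zero]

/-- Straightening a vector field `X` transversal to the level sets of `u`: in suitable coordinates
`X` is the first coordinate vector field and a level set of `u` is a coordinate hyperplane. -/
theorem exists_straightening {Ω : Set (Eu (m + 1))} (hΩ : IsOpen Ω) {u : Eu (m + 1) → ℝ}
    {X : Eu (m + 1) → Eu (m + 1)} (hu : ContDiffOn ℝ ∞ u Ω) (hX : ContDiffOn ℝ ∞ X Ω)
    {x₀ : Eu (m + 1)} (hx₀ : x₀ ∈ Ω) (h0 : fderiv ℝ u x₀ (X x₀) ≠ 0) :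
    ∃ (ε : ℝ) (v₀ : Eu m) (φ : OpenPartialHomeomorph (Eu (m + 1)) (Eu (m + 1))),
      0 < ε ∧ φ.source = box ε (Metric.ball v₀ ε) ∧ φ.target ⊆ Ω ∧ φ (joinPt 0 v₀) = x₀ ∧
      ContDiffOn ℝ ∞ φ φ.source ∧ ContDiffOn ℝ ∞ φ.symm φ.target ∧
      (∀ v ∈ Metric.ball v₀ ε, u (φ (joinPt 0 v)) = u x₀) ∧
      ∀ z ∈ φ.source, fderiv ℝ φ z (EuclideanSpace.single 0 1) = X (φ z) := by
  set ℓ := fderiv ℝ u x₀ with hℓ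
  have hud : HasFDerivAt u ℓ x₀ :=
    ((hu.contDiffAt (hΩ.mem_nhds hx₀)).differentiableAt (by simp)).hasFDerivAt
  obtain ⟨A, hA1, hA2⟩ := exists_equiv_of_functional ℓ h0
  set B : Eu (m + 1) →L[ℝ] Eu m := (ContinuousLinearMap.snd ℝ ℝ (Eu m)).comp (A : Eu (m + 1) →L[ℝ] ℝ × Eu m) with hB
  -- `u` is completed by linear functions `B` to coordinates near `x₀`. Freezing the value of `u` in
  -- their inverse parametrises the level set, by `s`.
  have hΨ : HasFDerivAt (fun y => (u y, B y)) (A : Eu (m + 1) →L[ℝ] ℝ × Eu m) x₀ := by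
    have : (A : Eu (m + 1) →L[ℝ] ℝ × Eu m) = ℓ.prod B := by
      ext y : 1
      exact Prod.ext (hA1 y) rfl
    rw [this]
    exact hud.prodMk B.hasFDerivAt
  obtain ⟨φ₁, hs1, hsub1, he1, hsm1⟩ :=
    exists_smooth_local_inverse hΩ (hu.prodMk B.contDiff.contDiffOn) hx₀ A hΨ
  set c := u x₀ with hc
  set v₀ := B x₀ with hv₀
  have he1x : φ₁ x₀ = (c, v₀) := he1 x₀
  have ht1 : (c, v₀) ∈ φ₁.target := he1x ▸ φ₁.map_source hs1
  set s : Eu m → Eu (m + 1) := fun v => φ₁.symm (c, v) with hsd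
  have hs0 : s v₀ = x₀ := by rw [hsd]; change φ₁.symm (c, v₀) = x₀; rw [← he1x, φ₁.left_inv hs1]
  set S : Set (Eu m) := (fun v => (c, v)) ⁻¹' φ₁.target with hS
  have hSo : IsOpen S := φ₁.open_target.preimage (by fun_prop)
  have hss : ContDiffOn ℝ ∞ s S := hsm1.comp (by fun_prop) fun v hv => hv
  have hus : ∀ v ∈ S, u (s v) = c := by
    intro v hv
    have := φ₁.right_inv hv
    rw [he1] at this
    exact congrArg Prod.fst this
  have hAs : HasFDerivAt s ((A.symm : ℝ × Eu m →L[ℝ] Eu (m + 1)).comp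
      (ContinuousLinearMap.inr ℝ ℝ (Eu m))) v₀ := by
    have h1 : HasFDerivAt φ₁.symm (A.symm : ℝ × Eu m →L[ℝ] Eu (m + 1)) (c, v₀) := by
      refine φ₁.hasFDerivAt_symm ht1 ?_
      have : φ₁.symm (c, v₀) = x₀ := hs0
      rw [this]
      exact hΨ.congr_of_eventuallyEq (Filter.Eventually.of_forall he1)
    exact h1.comp v₀ (hasFDerivAt_prodMk_right c v₀)
  obtain ⟨δ, hδ, θ, hθ, hflow⟩ := exists_smooth_local_flow hΩ hX hx₀
  set U : Set (Eu m) := S ∩ s ⁻¹' Metric.ball x₀ δ with hU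
  have hUo : IsOpen U := hss.continuousOn.isOpen_inter_preimage hSo Metric.isOpen_ball
  have hv₀U : v₀ ∈ U := ⟨ht1, by rw [mem_preimage, hs0]; exact Metric.mem_ball_self hδ⟩
  -- The new coordinates: start at `s v` on the level set and follow `X` for time `t`.
  set F : Eu (m + 1) → Eu (m + 1) := fun z => θ ((split m z).1, s (split m z).2) with hF
  have hFs : ContDiffOn ℝ ∞ F (box δ U) := by
    refine hθ.comp (t := Ioo (-δ) δ ×ˢ Metric.ball x₀ δ) ?_ fun z hz => ⟨hz.1, hz.2.2⟩
    exact (contDiff_fst.comp (split m).contDiff).contDiffOn.prodMk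
      (hss.comp (contDiff_snd.comp (split m).contDiff).contDiffOn fun z hz => hz.2.1)
  have hz₀ : joinPt 0 v₀ ∈ box δ U := joinPt_mem_box.2 ⟨by simp [hδ], hv₀U⟩
  have hF0 : ∀ v ∈ U, F (joinPt 0 v) = s v := fun v hv => (hflow (s v) hv.2).1
  have hFt : ∀ t ∈ Ioo (-δ) δ, ∀ v ∈ U,
      F (joinPt t v) ∈ Ω ∧ fderiv ℝ F (joinPt t v) (EuclideanSpace.single 0 1)
        = X (F (joinPt t v)) := by
    intro t ht v hv
    obtain ⟨h1, h2⟩ := (hflow (s v) hv.2).2 t ht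
    refine ⟨h1, ?_⟩
    have h3 : DifferentiableAt ℝ F (joinPt t v) :=
      (hFs.contDiffAt ((isOpen_box δ hUo).mem_nhds (joinPt_mem_box.2 ⟨ht, hv⟩))).differentiableAt
        (by simp)
    have h4 : HasDerivAt (fun t => θ (t, s v))
        (fderiv ℝ F (joinPt t v) (EuclideanSpace.single 0 1)) t :=
      HasFDerivAt.comp_hasDerivAt (l := F) (f := fun t => joinPt t v) t h3.hasFDerivAt
        (hasDerivAt_joinPt_left t v)
    exact h4.unique h2
  set D := fderiv ℝ F (joinPt 0 v₀) with hD
  have hFd : HasFDerivAt F D (joinPt 0 v₀) :=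
    ((hFs.contDiffAt ((isOpen_box δ hUo).mem_nhds hz₀)).differentiableAt (by simp)).hasFDerivAt
  have hD1 : D (EuclideanSpace.single 0 1) = X x₀ := by
    rw [hD, (hFt 0 (by simp [hδ]) v₀ hv₀U).2, hF0 v₀ hv₀U, hs0]
  have hD2 : ∀ w, D (joinPt 0 w) = A.symm (0, w) := by
    have h1 := hFd.comp v₀ (hasFDerivAt_joinPt_right 0 v₀)
    have h2 : HasFDerivAt (fun v => F (joinPt 0 v)) ((A.symm : ℝ × Eu m →L[ℝ] Eu (m + 1)).comp
      (ContinuousLinearMap.inr ℝ ℝ (Eu m))) v₀ := by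
      refine hAs.congr_of_eventuallyEq ?_
      filter_upwards [hUo.mem_nhds hv₀U] with v hv
      exact hF0 v hv
    intro w
    exact congrArg (fun L : Eu m →L[ℝ] Eu (m + 1) => L w) (h1.unique h2)
  -- The derivative maps `∂_0` to `X x₀` and the slice directions onto `ker du`; these are
  -- complementary by transversality.
  have hDinj : Function.Injective D := by
    rw [injective_iff_map_eq_zero]
    intro z hz
    have e1 : z = (split m z).1 • EuclideanSpace.single 0 1 + joinPt 0 (split m z).2 := by
      rw [← joinPt_single_zero]
      conv_lhs => rw [← joinPt_split z]
      unfold joinPt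
      rw [← map_smul, ← map_add]
      simp
    rw [e1, map_add, map_smul, hD1, hD2] at hz
    have h2 := congrArg A hz
    rw [map_add, map_smul, A.apply_symm_apply, hA2, map_zero] at h2
    have h3 : (split m z).1 * ℓ (X x₀) + 0 = 0 := congrArg Prod.fst h2
    have h4 : (split m z).1 • (0 : Eu m) + (split m z).2 = 0 := congrArg Prod.snd h2
    have h5 : (split m z).1 = 0 := by
      rw [add_zero] at h3
      exact (mul_eq_zero.1 h3).resolve_right h0
    rw [smul_zero, zero_add] at h4
    rw [← joinPt_split z, h5, h4]
    exact map_zero (split m).symm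
  let D' : Eu (m + 1) ≃L[ℝ] Eu (m + 1) :=
    (LinearEquiv.ofInjectiveEndo (D : Eu (m + 1) →ₗ[ℝ] Eu (m + 1)) hDinj).toContinuousLinearEquiv
  obtain ⟨φ, hs2, hsub2, he2, hsm2⟩ := exists_smooth_local_inverse (isOpen_box δ hUo) hFs hz₀ D'
    (by
      have : (D' : Eu (m + 1) →L[ℝ] Eu (m + 1)) = D := rfl
      rw [this]; exact hFd)
  have hφF : (φ : Eu (m + 1) → Eu (m + 1)) = F := funext he2
  obtain ⟨ε, hε, hbox⟩ := exists_box_subset φ.open_source hs2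
  set ψ := φ.restrOpen (box ε (Metric.ball v₀ ε)) (isOpen_box ε Metric.isOpen_ball) with hψ
  have hψs : ψ.source = box ε (Metric.ball v₀ ε) := by
    rw [hψ, φ.restrOpen_source]; exact inter_eq_right.2 hbox
  have hψF : (ψ : Eu (m + 1) → Eu (m + 1)) = F := hφF
  have hin : ∀ z ∈ ψ.source, z ∈ box δ U := fun z hz => hsub2 (hbox (hψs ▸ hz))
  have hψt : ∀ z ∈ ψ.target, z ∈ φ.target := by
    intro z hz
    have h1 := ψ.map_target hz
    rw [hψs] at h1
    have h2 := φ.map_source (hbox h1)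
    have h3 : φ (ψ.symm z) = z := ψ.right_inv hz
    rwa [h3] at h2
  refine ⟨ε, v₀, ψ, hε, hψs, ?_, ?_, ?_, ?_, ?_, ?_⟩
  · intro z hz
    have h1 := hin _ (ψ.map_target hz)
    rw [← ψ.right_inv hz, hψF, ← joinPt_split (ψ.symm z)]
    exact (hFt _ h1.1 _ h1.2).1
  · rw [hψF, hF0 v₀ hv₀U, hs0]
  · rw [hψF]; exact hFs.mono hin
  · exact hsm2.mono hψt
  · intro v hv
    have h1 : joinPt 0 v ∈ ψ.source := by
      rw [hψs]; exact joinPt_mem_box.2 ⟨by simp [hε], hv⟩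
    have h2 := (joinPt_mem_box.1 (hin _ h1)).2
    rw [hψF, hF0 v h2, hus v h2.1]
  · intro z hz
    have h1 := hin z hz
    rw [hψF, ← joinPt_split z]
    exact (hFt _ h1.1 _ h1.2).2

end Straightening

/-! ### Calculus on the product of an interval and a set -/

section BoxCalculus

variable {m : ℕ} {ε : ℝ} {V : Set (Eu m)}

theorem hasDerivAt_joinPt_comp {F : Eu (m + 1) → ℝ} {t : ℝ} {y : Eu m}
    (hF : DifferentiableAt ℝ F (joinPt t y)) :
    HasDerivAt (fun t => F (joinPt t y)) (pd F (joinPt t y) 0) t :=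
  HasFDerivAt.comp_hasDerivAt (l := F) (f := fun t => joinPt t y) t hF.hasFDerivAt
    (hasDerivAt_joinPt_left t y)

theorem hasFDerivAt_joinPt_comp {F : Eu (m + 1) → ℝ} {t : ℝ} {y : Eu m}
    (hF : DifferentiableAt ℝ F (joinPt t y)) :
    HasFDerivAt (fun y => F (joinPt t y)) ((fderiv ℝ F (joinPt t y)).comp
      (((split m).symm : ℝ × Eu m →L[ℝ] Eu (m + 1)).comp
        (ContinuousLinearMap.inr ℝ ℝ (Eu m)))) y :=
  HasFDerivAt.comp (g := F) y hF.hasFDerivAt (hasFDerivAt_joinPt_right t y)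

theorem pd_joinPt_comp {F : Eu (m + 1) → ℝ} {t : ℝ} {y : Eu m}
    (hF : DifferentiableAt ℝ F (joinPt t y)) (a : Fin m) :
    pd (fun y => F (joinPt t y)) y a = pd F (joinPt t y) a.succ := by
  unfold pd
  rw [(hasFDerivAt_joinPt_comp hF).fderiv, ← joinPt_single_succ]
  rfl

theorem contDiffOn_joinPt_left {F : Eu (m + 1) → ℝ} (hF : ContDiffOn ℝ ∞ F (box ε V)) {y : Eu m}
    (hy : y ∈ V) : ContDiffOn ℝ ∞ (fun t => F (joinPt t y)) (Ioo (-ε) ε) :=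
  hF.comp ((split m).symm.contDiff.comp (contDiff_id.prodMk contDiff_const)).contDiffOn
    fun _ ht => joinPt_mem_box.2 ⟨ht, hy⟩

theorem contDiffOn_joinPt_right {F : Eu (m + 1) → ℝ} (hF : ContDiffOn ℝ ∞ F (box ε V)) {t : ℝ}
    (ht : t ∈ Ioo (-ε) ε) : ContDiffOn ℝ ∞ (fun y => F (joinPt t y)) V :=
  hF.comp ((split m).symm.contDiff.comp (contDiff_const.prodMk contDiff_id)).contDiffOn
    fun _ hy => joinPt_mem_box.2 ⟨ht, hy⟩

theorem fderiv_eq_zero_of_pd {k : ℕ} {F : Eu k → ℝ} {y : Eu k} (h : ∀ i, pd F y i = 0) :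
    fderiv ℝ F y = 0 := by
  ext v
  have hv := (EuclideanSpace.basisFun (Fin k) ℝ).sum_repr v
  rw [← hv, map_sum]
  refine Finset.sum_eq_zero fun i _ => ?_
  rw [map_smul, EuclideanSpace.basisFun_apply]
  have := h i
  unfold pd at this
  rw [this, smul_zero]

theorem eq_of_pd_eq_zero {k : ℕ} {F : Eu k → ℝ} {Ω : Set (Eu k)} (hΩ : IsOpen Ω)
    (hc : IsPreconnected Ω) (hF : ContDiffOn ℝ ∞ F Ω) (h : ∀ z ∈ Ω, ∀ i, pd F z i = 0)
    {y y' : Eu k} (hy : y ∈ Ω) (hy' : y' ∈ Ω) : F y = F y' :=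
  hΩ.is_const_of_fderiv_eq_zero hc (hF.differentiableOn (by simp))
    (fun z hz => fderiv_eq_zero_of_pd (h z hz)) hy hy'

/-- A function on a box whose derivatives along the slices vanish depends on the first coordinate
only. -/
theorem joinPt_eq_of_pd_succ (hV : IsOpen V) (hVc : IsPreconnected V) {F : Eu (m + 1) → ℝ}
    (hF : ContDiffOn ℝ ∞ F (box ε V)) (h : ∀ z ∈ box ε V, ∀ a : Fin m, pd F z a.succ = 0)
    {t : ℝ} (ht : t ∈ Ioo (-ε) ε) {y y' : Eu m} (hy : y ∈ V) (hy' : y' ∈ V) :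
    F (joinPt t y) = F (joinPt t y') :=
  eq_of_pd_eq_zero hV hVc (contDiffOn_joinPt_right hF ht) (fun z hz a => by
    have hz' : joinPt t z ∈ box ε V := joinPt_mem_box.2 ⟨ht, hz⟩
    rw [pd_joinPt_comp (ContDiffOn.dAt hF (isOpen_box ε hV) hz'), h _ hz']) hy hy'

theorem exists_smooth_primitive {a : ℝ → ℝ} (hε : 0 < ε) (ha : ContDiffOn ℝ ∞ a (Ioo (-ε) ε)) :
    ∃ A : ℝ → ℝ, A 0 = 0 ∧ ContDiffOn ℝ ∞ A (Ioo (-ε) ε) ∧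
      ∀ t ∈ Ioo (-ε) ε, HasDerivAt A (a t) t := by
  have h0 : (0 : ℝ) ∈ Ioo (-ε) ε := by simp [hε]
  have hd : ∀ t ∈ Ioo (-ε) ε, HasDerivAt (fun t => ∫ s in (0 : ℝ)..t, a s) (a t) t := by
    intro t ht
    refine intervalIntegral.integral_hasDerivAt_right
      ((ha.continuousOn.mono ?_).intervalIntegrable)
      (ha.continuousOn.stronglyMeasurableAtFilter isOpen_Ioo t ht)
      (ha.continuousOn.continuousAt (isOpen_Ioo.mem_nhds ht))
    exact ordConnected_Ioo.uIcc_subset h0 ht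
  refine ⟨fun t => ∫ s in (0 : ℝ)..t, a s, by simp, ?_, hd⟩
  refine (contDiffOn_infty_iff_deriv_of_isOpen isOpen_Ioo).2
    ⟨fun t ht => (hd t ht).differentiableAt.differentiableWithinAt, ha.congr fun t ht => (hd t ht).deriv⟩

/-- Uniqueness for the linear equation `b' = A' b`. -/
theorem eq_mul_exp_of_hasDerivAt {a A b : ℝ → ℝ} (hA0 : A 0 = 0)
    (hA : ∀ t ∈ Ioo (-ε) ε, HasDerivAt A (a t) t)
    (hb : ∀ t ∈ Ioo (-ε) ε, HasDerivAt b (a t * b t) t) {t : ℝ} (ht : t ∈ Ioo (-ε) ε) :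
    b t = b 0 * Real.exp (A t) := by
  have h0 : (0 : ℝ) ∈ Ioo (-ε) ε := by
    have := ht.1.trans ht.2
    constructor <;> linarith
  have hd : ∀ s ∈ Ioo (-ε) ε, HasDerivAt (fun s => b s * Real.exp (-A s)) 0 s := by
    intro s hs
    have h := (hb s hs).mul (hA s hs).neg.exp
    refine h.congr_deriv ?_
    ring
  have h := isOpen_Ioo.is_const_of_deriv_eq_zero isPreconnected_Ioo
    (fun s hs => (hd s hs).differentiableAt.differentiableWithinAt)
    (fun s hs => (hd s hs).deriv) ht h0
  simp only [hA0, neg_zero, Real.exp_zero, mul_one] at h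
  rw [← h, mul_assoc, ← Real.exp_add]
  simp

end BoxCalculus

/-! ### Connection and Ricci tensor of a warped product -/

section WarpedMetric

variable {m : ℕ} {ε : ℝ} {V : Set (Eu m)} {G : Eu (m + 1) → Matrix (Fin (m + 1)) (Fin (m + 1)) ℝ}
  {g : Eu m → Matrix (Fin m) (Fin m) ℝ} {ψ : ℝ → ℝ}

theorem pd_succ_slice {F : Eu (m + 1) → ℝ} (hF : ContDiffOn ℝ ∞ F (box ε V)) (hV : IsOpen V)
    {p : ℝ} {f : Eu m → ℝ} {t : ℝ} (ht : t ∈ Ioo (-ε) ε) {y : Eu m} (hy : y ∈ V)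
    (hf : DifferentiableAt ℝ f y)
    (h : ∀ z ∈ V, F (joinPt t z) = p * f z) (a : Fin m) :
    pd F (joinPt t y) a.succ = p * pd f y a := by
  rw [← pd_joinPt_comp (ContDiffOn.dAt hF (isOpen_box ε hV) (joinPt_mem_box.2 ⟨ht, hy⟩)),
    pd_congr_on hV hy h, pd_const_mul hf]

theorem pd_zero_slice {F : Eu (m + 1) → ℝ} (hF : ContDiffOn ℝ ∞ F (box ε V)) (hV : IsOpen V)
    {p : ℝ → ℝ} {p' : ℝ} {f : ℝ} {t : ℝ} (ht : t ∈ Ioo (-ε) ε) {y : Eu m} (hy : y ∈ V)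
    (hp : HasDerivAt p p' t) (h : ∀ s ∈ Ioo (-ε) ε, F (joinPt s y) = p s * f) :
    pd F (joinPt t y) 0 = p' * f := by
  have h1 := hasDerivAt_joinPt_comp
    (ContDiffOn.dAt hF (isOpen_box ε hV) (joinPt_mem_box.2 ⟨ht, hy⟩))
  refine h1.unique ((hp.mul_const f).congr_of_eventuallyEq ?_)
  filter_upwards [isOpen_Ioo.mem_nhds ht] with s hs
  exact h s hs

theorem inv_warped (hG : IsMetricOn G (box ε V)) (hg : IsMetricOn g V)
    (h00 : ∀ z ∈ box ε V, G z 0 0 = 1) (h0a : ∀ z ∈ box ε V, ∀ a : Fin m, G z 0 a.succ = 0)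
    (hab : ∀ t ∈ Ioo (-ε) ε, ∀ y ∈ V, ∀ a b : Fin m,
      G (joinPt t y) a.succ b.succ = ψ t ^ 2 * g y a b) (hψ : ∀ t ∈ Ioo (-ε) ε, 0 < ψ t)
    {t : ℝ} (ht : t ∈ Ioo (-ε) ε) {y : Eu m} (hy : y ∈ V) :
    (G (joinPt t y))⁻¹ 0 0 = 1 ∧ (∀ a : Fin m, (G (joinPt t y))⁻¹ 0 a.succ = 0) ∧
      (∀ a : Fin m, (G (joinPt t y))⁻¹ a.succ 0 = 0) ∧
      ∀ a b : Fin m, (G (joinPt t y))⁻¹ a.succ b.succ = (g y)⁻¹ a b / ψ t ^ 2 := by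
  have hz : joinPt t y ∈ box ε V := joinPt_mem_box.2 ⟨ht, hy⟩
  set K : Matrix (Fin (m + 1)) (Fin (m + 1)) ℝ := Matrix.of fun i j =>
    Fin.cases (Fin.cases (1 : ℝ) (fun _ => 0) j)
      (fun a => Fin.cases (0 : ℝ) (fun b => (g y)⁻¹ a b / ψ t ^ 2) j) i with hK
  have hψ0 := (hψ t ht).ne'
  have h : G (joinPt t y) * K = 1 := by
    ext i j
    rw [Matrix.mul_apply, Fin.sum_univ_succ]
    refine Fin.cases ?_ (fun a => ?_) i <;> refine Fin.cases ?_ (fun b => ?_) j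
    · simp [hK, h00 _ hz, h0a _ hz]
    · simp [hK, h0a _ hz, Matrix.one_apply, (Fin.succ_ne_zero b).symm]
    · simp [hK, hG.symm hz a.succ 0, h0a _ hz, Matrix.one_apply]
    · have e : ∀ c, ψ t ^ 2 * g y a c * ((g y)⁻¹ c b / ψ t ^ 2) = g y a c * (g y)⁻¹ c b := by
        intro c; field_simp
      have := hg.mul_inv hy a b
      simp [hK, hab t ht y hy, e, this, Matrix.one_apply]
  rw [Matrix.inv_eq_right_inv h]
  exact ⟨rfl, fun _ => rfl, fun _ => rfl, fun _ _ => rfl⟩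

theorem christoffel_warped (hG : IsMetricOn G (box ε V)) (hg : IsMetricOn g V) (hV : IsOpen V)
    (h00 : ∀ z ∈ box ε V, G z 0 0 = 1) (h0a : ∀ z ∈ box ε V, ∀ a : Fin m, G z 0 a.succ = 0)
    (hab : ∀ t ∈ Ioo (-ε) ε, ∀ y ∈ V, ∀ a b : Fin m,
      G (joinPt t y) a.succ b.succ = ψ t ^ 2 * g y a b) (hψ : ∀ t ∈ Ioo (-ε) ε, 0 < ψ t)
    (hψs : ContDiffOn ℝ ∞ ψ (Ioo (-ε) ε)) {t : ℝ} (ht : t ∈ Ioo (-ε) ε) {y : Eu m} (hy : y ∈ V) :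
    (∀ i, christoffel G (joinPt t y) i 0 0 = 0) ∧
    (∀ a : Fin m, christoffel G (joinPt t y) 0 0 a.succ = 0) ∧
    (∀ a b : Fin m, christoffel G (joinPt t y) 0 a.succ b.succ = -(ψ t * deriv ψ t) * g y a b) ∧
    (∀ a b : Fin m, christoffel G (joinPt t y) a.succ 0 b.succ
      = deriv ψ t / ψ t * (1 : Matrix (Fin m) (Fin m) ℝ) a b) ∧
    (∀ a b c : Fin m, christoffel G (joinPt t y) c.succ a.succ b.succ = christoffel g y c a b) := by
  have hz : joinPt t y ∈ box ε V := joinPt_mem_box.2 ⟨ht, hy⟩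
  obtain ⟨i00, i0a, ia0, iab⟩ := inv_warped hG hg h00 h0a hab hψ ht hy
  have hψ0 := (hψ t ht).ne'
  have hd : HasDerivAt (fun t => ψ t ^ 2) (2 * ψ t * deriv ψ t) t := by
    have h := ((hψs.contDiffAt (isOpen_Ioo.mem_nhds ht)).differentiableAt
      (by simp)).hasDerivAt.pow 2
    refine h.congr_deriv ?_
    simp
  have p00 : ∀ i, pd (fun z => G z 0 0) (joinPt t y) i = 0 := fun i => by
    rw [pd_congr_on hG.isOpen hz h00, pd_const]
  have p0a : ∀ i (a : Fin m), pd (fun z => G z 0 a.succ) (joinPt t y) i = 0 := fun i a => by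
    rw [pd_congr_on hG.isOpen hz fun z hz => h0a z hz a, pd_const]
  have pa0 : ∀ i (a : Fin m), pd (fun z => G z a.succ 0) (joinPt t y) i = 0 := fun i a => by
    rw [pd_congr_on hG.isOpen hz fun z hz => (hG.symm hz a.succ 0).trans (h0a z hz a), pd_const]
  have pab0 : ∀ a b : Fin m, pd (fun z => G z a.succ b.succ) (joinPt t y) 0
      = 2 * ψ t * deriv ψ t * g y a b := fun a b =>
    pd_zero_slice (hG.smooth _ _) hV ht hy hd fun s hs => hab s hs y hy a b
  have pabc : ∀ a b c : Fin m, pd (fun z => G z a.succ b.succ) (joinPt t y) c.succ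
      = ψ t ^ 2 * pd (fun z => g z a b) y c := fun a b c =>
    pd_succ_slice (hG.smooth _ _) hV ht hy (hg.dAt_metric hy a b)
      (fun z hz => hab t ht z hz a b) c
  refine ⟨fun i => ?_, fun a => ?_, fun a b => ?_, fun a b => ?_, fun a b c => ?_⟩
  · unfold christoffel
    rw [Fin.sum_univ_succ]
    simp [p00, p0a, pa0]
  · unfold christoffel
    rw [Fin.sum_univ_succ]
    simp [p00, p0a, pa0, i0a]
  · unfold christoffel
    rw [Fin.sum_univ_succ]
    simp only [i00, i0a, pa0, pab0]
    simp only [zero_mul, Finset.sum_const_zero]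
    ring
  · unfold christoffel
    rw [Fin.sum_univ_succ]
    simp only [ia0, iab, p0a, pab0]
    have e : ∀ l, (g y)⁻¹ a l / ψ t ^ 2 * (2 * ψ t * deriv ψ t * g y b l + 0 - 0)
        = 2 * (deriv ψ t / ψ t) * ((g y)⁻¹ a l * g y l b) := fun l => by
      rw [hg.symm hy l b]; field_simp; ring
    simp only [e, ← Finset.mul_sum, hg.inv_mul hy, Matrix.one_apply]
    ring
  · unfold christoffel
    rw [Fin.sum_univ_succ]
    simp only [ia0, iab, pabc]
    rw [zero_mul, zero_add]
    congr 1
    refine Finset.sum_congr rfl fun l _ => ?_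
    field_simp

/-- The Ricci tensor of the warped product metric `dt² + ψ² g` in directions tangent to the
fibres. -/
theorem ricci_warped (hG : IsMetricOn G (box ε V)) (hg : IsMetricOn g V) (hV : IsOpen V)
    (h00 : ∀ z ∈ box ε V, G z 0 0 = 1) (h0a : ∀ z ∈ box ε V, ∀ a : Fin m, G z 0 a.succ = 0)
    (hab : ∀ t ∈ Ioo (-ε) ε, ∀ y ∈ V, ∀ a b : Fin m,
      G (joinPt t y) a.succ b.succ = ψ t ^ 2 * g y a b) (hψ : ∀ t ∈ Ioo (-ε) ε, 0 < ψ t)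
    (hψs : ContDiffOn ℝ ∞ ψ (Ioo (-ε) ε)) {t : ℝ} (ht : t ∈ Ioo (-ε) ε) {y : Eu m} (hy : y ∈ V)
    (b c : Fin m) :
    ricci G (joinPt t y) b.succ c.succ
      = ricci g y b c - (ψ t * deriv (deriv ψ) t + ((m : ℝ) - 1) * deriv ψ t ^ 2) * g y b c := by
  have hz : joinPt t y ∈ box ε V := joinPt_mem_box.2 ⟨ht, hy⟩
  have hC := fun {s : ℝ} (hs : s ∈ Ioo (-ε) ε) {x : Eu m} (hx : x ∈ V) =>
    christoffel_warped hG hg hV h00 h0a hab hψ hψs hs hx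
  obtain ⟨c00, c0a, cab0, ca0b, cabc⟩ := hC ht hy
  have ca0 : ∀ a : Fin m, christoffel G (joinPt t y) 0 a.succ 0 = 0 := fun a => by
    rw [hG.christoffel_symm hz, c0a]
  have cab' : ∀ a b : Fin m, christoffel G (joinPt t y) a.succ b.succ 0
      = deriv ψ t / ψ t * (1 : Matrix (Fin m) (Fin m) ℝ) a b := fun a b => by
    rw [hG.christoffel_symm hz, ca0b]
  have hψ0 := (hψ t ht).ne'
  have hdψ : ContDiffOn ℝ ∞ (deriv ψ) (Ioo (-ε) ε) :=
    ((contDiffOn_infty_iff_deriv_of_isOpen isOpen_Ioo).1 hψs).2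
  have d1 : HasDerivAt ψ (deriv ψ t) t :=
    ((hψs.contDiffAt (isOpen_Ioo.mem_nhds ht)).differentiableAt (by simp)).hasDerivAt
  have d2 : HasDerivAt (deriv ψ) (deriv (deriv ψ) t) t :=
    ((hdψ.contDiffAt (isOpen_Ioo.mem_nhds ht)).differentiableAt (by simp)).hasDerivAt
  have q0 : pd (fun z => christoffel G z 0 b.succ c.succ) (joinPt t y) 0
      = -(deriv ψ t * deriv ψ t + ψ t * deriv (deriv ψ) t) * g y b c :=
    pd_zero_slice (hG.smooth_christoffel _ _ _) hV ht hy (d1.mul d2).neg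
      fun s hs => (hC hs hy).2.2.1 b c
  have q1 : pd (fun z => christoffel G z 0 0 c.succ) (joinPt t y) b.succ = 0 := by
    rw [pd_congr_on (g := fun _ => (0 : ℝ)) hG.isOpen hz, pd_const]
    rw [forall_mem_box]
    exact fun s hs x hx => (hC hs hx).2.1 c
  have q2 : ∀ a b c d : Fin m, pd (fun z => christoffel G z a.succ b.succ c.succ) (joinPt t y) d.succ
      = pd (fun z => christoffel g z a b c) y d := by
    intro a b c d
    rw [pd_succ_slice (p := 1) (f := fun z => christoffel g z a b c)
      (hG.smooth_christoffel _ _ _) hV ht hy (ContDiffOn.dAt (hg.smooth_christoffel _ _ _) hV hy)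
      (fun x hx => by rw [(hC ht hx).2.2.2.2, one_mul]), one_mul]
  unfold ricci curvOp
  rw [Fin.sum_univ_succ]
  simp only [Fin.sum_univ_succ (n := m), q0, q1, q2, c0a, ca0, cab0, ca0b, cab', cabc, c00]
  -- The warping contributes `-(ψ ψ'' + ψ'²)` from `q0`, `-m ψ'²` from `s1`, and `+2 ψ'²` from `s2`
  -- and `s3`, which enter with a minus sign; hence the factor `m - 1`.
  have s1 : ∑ x : Fin m, -(ψ t * deriv ψ t) * g y b c
      * (deriv ψ t / ψ t * (1 : Matrix (Fin m) (Fin m) ℝ) x x)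
      = - (m * deriv ψ t ^ 2 * g y b c) := by
    simp only [Matrix.one_apply_eq, Finset.sum_const, Finset.card_univ, Fintype.card_fin]
    simp only [nsmul_eq_mul]
    field_simp
  have s2 : ∑ x : Fin m, deriv ψ t / ψ t * (1 : Matrix (Fin m) (Fin m) ℝ) x c
      * (-(ψ t * deriv ψ t) * g y b x) = - (deriv ψ t ^ 2 * g y b c) := by
    simp only [Matrix.one_apply, mul_ite, mul_one, mul_zero, ite_mul, zero_mul,
      Finset.sum_ite_eq', Finset.mem_univ, if_true]
    field_simp
  have s3 : ∑ x : Fin m, -(ψ t * deriv ψ t) * g y x c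
      * (deriv ψ t / ψ t * (1 : Matrix (Fin m) (Fin m) ℝ) x b) = - (deriv ψ t ^ 2 * g y b c) := by
    simp only [Matrix.one_apply, mul_ite, mul_one, mul_zero, Finset.sum_ite_eq', Finset.mem_univ,
      if_true]
    field_simp
  simp only [Finset.sum_add_distrib, Finset.sum_sub_distrib, s1, s2, s3, mul_zero, zero_mul,
    sub_zero, zero_sub, add_zero, zero_add, Finset.sum_const_zero, Finset.sum_neg_distrib]
  ring

end WarpedMetric

/-! ### From adapted coordinates to an Einstein warped product -/

section Adapted

variable {m : ℕ} {ε : ℝ} {V : Set (Eu m)} {G : Eu (m + 1) → Matrix (Fin (m + 1)) (Fin (m + 1)) ℝ}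

theorem isMetricOn_slice (hG : IsMetricOn G (box ε V)) (hV : IsOpen V) {t : ℝ}
    (ht : t ∈ Ioo (-ε) ε) :
    IsMetricOn (fun y => (G (joinPt t y)).submatrix Fin.succ Fin.succ) V where
  isOpen := hV
  smooth i j := contDiffOn_joinPt_right (hG.smooth i.succ j.succ) ht
  posDef y hy := (hG.posDef _ (joinPt_mem_box.2 ⟨ht, hy⟩)).submatrix (Fin.succ_injective m)

/-- In coordinates in which `∂_0` is the unit normal field of the level sets of `u`, one has
`∂_0 u = |∇u|` and `∂_0` is a unit vector. -/
theorem normal_coordinates (hG : IsMetricOn G (box ε V)) {u : Eu (m + 1) → ℝ}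
    (h0 : ∀ z ∈ box ε V, pd u z ≠ 0)
    (hN : ∀ z ∈ box ε V, ∀ i, √(gradInner G u u z) * G z i 0 = pd u z i) :
    ∀ z ∈ box ε V, 0 < pd u z 0 ∧ gradInner G u u z = pd u z 0 ^ 2 ∧ G z 0 0 = 1 ∧
      ∀ i, pd u z 0 * G z i 0 = pd u z i := by
  intro z hz
  have hw := gradInner_self_pos hG hz (h0 z hz)
  have hr := Real.sqrt_pos.2 hw
  have hrr := Real.mul_self_sqrt hw.le
  set r := √(gradInner G u u z) with hrd
  have h1 : gradInner G u u z = r * pd u z 0 := by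
    rw [← sum_metric_gradV hG hz u 0, Finset.mul_sum, gradInner]
    refine Finset.sum_congr rfl fun i _ => ?_
    rw [← hN z hz i, hG.symm hz 0 i]; ring
  have h2 : pd u z 0 = r := by
    rw [h1] at hrr
    exact (mul_left_cancel₀ hr.ne' hrr).symm
  refine ⟨h2 ▸ hr, by rw [h1, h2]; ring, ?_, fun i => by rw [h2]; exact hN z hz i⟩
  have h3 := hN z hz 0
  rw [h2] at h3
  exact mul_left_cancel₀ hr.ne' (h3.trans (mul_one r).symm)

/-- In coordinates adapted to a potential `u` whose level sets are totally umbilical, the metric of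
a soliton is a warped product with Einstein fibres. -/
theorem exists_warped_of_adapted (hm : 3 ≤ m) (hε : 0 < ε) (hV : IsOpen V) (hVc : IsPreconnected V)
    {y₀ : Eu m} (hy₀ : y₀ ∈ V) (hG : IsMetricOn G (box ε V)) {u h lam : Eu (m + 1) → ℝ} {c : ℝ}
    (hu : ContDiffOn ℝ ∞ u (box ε V)) (hhs : ContDiffOn ℝ ∞ h (box ε V))
    (hlams : ContDiffOn ℝ ∞ lam (box ε V)) (h0 : ∀ z ∈ box ε V, pd u z ≠ 0)
    (hN : ∀ z ∈ box ε V, ∀ i, √(gradInner G u u z) * G z i 0 = pd u z i)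
    (hu0 : ∀ y ∈ V, u (joinPt 0 y) = c) (hh : ∀ z ∈ box ε V, h z ≠ 0)
    (heq : ∀ z ∈ box ε V, ∀ i j, ricci G z i j + h z * hessian G u z i j = lam z * G z i j)
    (hdev : ∀ z ∈ box ε V, deviation (G z)⁻¹ (tracelessRicci G z) (pd u z) = 0) :
    ∃ (f ψ : ℝ → ℝ) (κ : ℝ), ContDiffOn ℝ ∞ ψ (Ioo (-ε) ε) ∧ (∀ t ∈ Ioo (-ε) ε, 0 < ψ t) ∧
      (∀ t ∈ Ioo (-ε) ε, 0 < deriv f t) ∧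
      (∀ t ∈ Ioo (-ε) ε, ∀ y ∈ V, u (joinPt t y) = f t) ∧
      (∀ z ∈ box ε V, G z 0 0 = 1) ∧ (∀ z ∈ box ε V, ∀ a : Fin m, G z 0 a.succ = 0) ∧
      (∀ t ∈ Ioo (-ε) ε, ∀ y ∈ V, ∀ a b : Fin m,
        G (joinPt t y) a.succ b.succ = ψ t ^ 2 * G (joinPt 0 y) a.succ b.succ) ∧
      ∀ y ∈ V, (∀ a b, ricci (fun y => (G (joinPt 0 y)).submatrix Fin.succ Fin.succ) y a b
          = κ * G (joinPt 0 y) a.succ b.succ) ∧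
        κ = lam (joinPt 0 y) - h (joinPt 0 y) * (deriv f 0 * deriv ψ 0)
          + (deriv (deriv ψ) 0 + ((m : ℝ) - 1) * deriv ψ 0 ^ 2) := by
  have hk : 4 ≤ m + 1 := by omega
  have hB := isOpen_box ε hV
  have t0 : (0 : ℝ) ∈ Ioo (-ε) ε := by simp [hε]
  have hnc := normal_coordinates hG h0 hN
  set r : Eu (m + 1) → ℝ := fun z => pd u z 0 with hr
  have hrs : ContDiffOn ℝ ∞ r (box ε V) := contDiffOn_pd hB hu 0
  have hrpos : ∀ z ∈ box ε V, 0 < r z := fun z hz => (hnc z hz).1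
  obtain ⟨hαs, hβs⟩ := smooth_hessCoeff hG hu h0
  set α := hessCoeff G u with hα
  set β := hessCoeff' G u with hβ
  have hH : ∀ z ∈ box ε V, ∀ i j,
      hessian G u z i j = α z * G z i j + β z * (pd u z i * pd u z j) := fun z hz =>
    hessian_eq_of_deviation hG hz hk hu (h0 z hz) (hh z hz) (heq z hz) (hdev z hz)
  have hR : ∀ z ∈ box ε V, ∀ i j, ricci G z i j
      = (lam z - h z * α z) * G z i j + (- (h z * β z)) * (pd u z i * pd u z j) := by
    intro z hz i j
    have := heq z hz i j
    rw [hH z hz] at this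
    linarith
  -- With `r = |∇u|`, the form of the Hessian makes `dr` a multiple of `du`.
  have hpdr : ∀ z ∈ box ε V, ∀ i,
      pd r z i = (α z + β z * gradInner G u u z) / r z * pd u z i := by
    intro z hz i
    have h1 := pd_gradInner_self_of_hessian_eq hG hz hu (hH z hz) i
    have hrd := ContDiffOn.dAt hrs hB hz
    rw [pd_congr_on (g := fun z => r z * r z) hB hz fun z hz => by
      rw [(hnc z hz).2.1]; exact pow_two (r z), pd_mul hrd hrd] at h1
    have h2 := (hrpos z hz).ne'
    rw [div_mul_eq_mul_div, eq_div_iff h2]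
    linarith
  have hws := smooth_gradInner hG hu hu
  -- Along each `t`-line `∂_0 (∂_a u) = ∂_a r = q ∂_a u`, a linear equation with zero initial value
  -- because the slice `t = 0` lies in a level set. So all slices lie in level sets.
  have hus : ∀ z ∈ box ε V, ∀ a : Fin m, pd u z a.succ = 0 := by
    rw [forall_mem_box]
    intro t ht y hy a
    set q : Eu (m + 1) → ℝ := fun z => (α z + β z * gradInner G u u z) / r z with hq
    have hqs : ContDiffOn ℝ ∞ q (box ε V) :=
      (hαs.add (hβs.mul hws)).div hrs fun z hz => (hrpos z hz).ne'
    obtain ⟨A, hA0, -, hA⟩ := exists_smooth_primitive hε (contDiffOn_joinPt_left hqs hy)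
    have h1 := eq_mul_exp_of_hasDerivAt hA0 hA (b := fun t => pd u (joinPt t y) a.succ)
      (fun s hs => by
        have hz : joinPt s y ∈ box ε V := joinPt_mem_box.2 ⟨hs, hy⟩
        have := hasDerivAt_joinPt_comp (F := fun z => pd u z a.succ)
          (ContDiffOn.dAt (contDiffOn_pd hB hu _) hB hz)
        rw [pd_comm hB hu hz] at this
        refine this.congr_deriv ?_
        exact hpdr _ hz _) ht
    have h2 : pd u (joinPt 0 y) a.succ = 0 := by
      rw [← pd_joinPt_comp (ContDiffOn.dAt hu hB (joinPt_mem_box.2 ⟨t0, hy⟩)),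
        pd_congr_on hV hy hu0, pd_const]
    have h3 : pd u (joinPt t y) a.succ = pd u (joinPt 0 y) a.succ * Real.exp (A t) := h1
    rw [h3, h2, zero_mul]
  have h00 : ∀ z ∈ box ε V, G z 0 0 = 1 := fun z hz => (hnc z hz).2.2.1
  have ha0 : ∀ z ∈ box ε V, ∀ a : Fin m, G z a.succ 0 = 0 := by
    intro z hz a
    have h1 := (hnc z hz).2.2.2 a.succ
    rw [hus z hz] at h1
    exact (mul_eq_zero.1 h1).resolve_left (hrpos z hz).ne'
  have h0a : ∀ z ∈ box ε V, ∀ a : Fin m, G z 0 a.succ = 0 := fun z hz a => by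
    rw [hG.symm hz, ha0 z hz]
  have hinv : ∀ z ∈ box ε V, ∀ i, (G z)⁻¹ 0 i = if i = 0 then 1 else 0 := by
    intro z hz i
    have h1 := hG.inv_mul hz i 0
    rw [Fin.sum_univ_succ] at h1
    simp only [h00 z hz, ha0 z hz, mul_one, mul_zero, Finset.sum_const_zero, add_zero] at h1
    rw [hG.inv_symm hz, h1]
  -- As `u` depends on `t` only, the fibre components of the Hessian reduce to `-Γ^0_ab r = (r/2)
  -- ∂_0 G_ab`; they are also equal to `α G_ab`.
  have hG0 : ∀ z ∈ box ε V, ∀ a b : Fin m,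
      pd (fun z => G z a.succ b.succ) z 0 = 2 * (α z / r z) * G z a.succ b.succ := by
    intro z hz a b
    have h1 := hH z hz a.succ b.succ
    have e1 : pd (fun z => pd u z b.succ) z a.succ = 0 := by
      rw [pd_congr_on (g := fun _ => (0 : ℝ)) hB hz fun z hz => hus z hz b, pd_const]
    have e2 : christoffel G z 0 a.succ b.succ = - (1 / 2) * pd (fun z => G z a.succ b.succ) z 0 := by
      unfold christoffel
      rw [Fin.sum_univ_succ]
      simp only [hinv z hz, Fin.succ_ne_zero, if_true, if_false, zero_mul, Finset.sum_const_zero]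
      rw [pd_congr_on (g := fun _ => (0 : ℝ)) hB hz fun z hz => ha0 z hz b,
        pd_congr_on (g := fun _ => (0 : ℝ)) hB hz fun z hz => ha0 z hz a, pd_const, pd_const]
      ring
    unfold hessian at h1
    rw [e1, Fin.sum_univ_succ, e2] at h1
    simp only [hus z hz, mul_zero, Finset.sum_const_zero, add_zero] at h1
    have h2 := (hrpos z hz).ne'
    change 0 - - (1 / 2) * pd (fun z => G z a.succ b.succ) z 0 * r z = _ at h1
    field_simp
    linarith
  have hαy : ∀ z ∈ box ε V, ∀ a : Fin m, pd α z a.succ = 0 := by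
    intro z hz a
    have h1 := sum_mul_pd_hessCoeff hG hz hk hu hαs hβs (h0 z hz) hH (hR z hz)
      (v := Pi.single a.succ 1) (by simp [Pi.single_apply, hus z hz])
    simpa [Pi.single_apply] using h1
  have hry : ∀ z ∈ box ε V, ∀ a : Fin m, pd r z a.succ = 0 := fun z hz a => by
    rw [hpdr z hz, hus z hz, mul_zero]
  -- `α` and `r` are constant on slices, so `α/r` is a function of `t`. The warping function is the
  -- solution of `ψ'/ψ = α/r` with `ψ 0 = 1`.
  set a : ℝ → ℝ := fun t => α (joinPt t y₀) / r (joinPt t y₀) with ha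
  have has : ContDiffOn ℝ ∞ a (Ioo (-ε) ε) :=
    contDiffOn_joinPt_left (hαs.div hrs fun z hz => (hrpos z hz).ne') hy₀
  obtain ⟨A, hA0, hAs, hA⟩ := exists_smooth_primitive hε has
  set ψ : ℝ → ℝ := fun t => Real.exp (A t) with hψ
  have hψs : ContDiffOn ℝ ∞ ψ (Ioo (-ε) ε) := hAs.exp
  have hψd : ∀ t ∈ Ioo (-ε) ε, HasDerivAt ψ (Real.exp (A t) * a t) t := fun t ht => (hA t ht).exp
  have hψ0 : ψ 0 = 1 := by rw [hψ]; simp [hA0]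
  have hψ'0 : deriv ψ 0 = a 0 := by rw [(hψd 0 t0).deriv, hA0]; simp
  set f : ℝ → ℝ := fun t => u (joinPt t y₀) with hf
  have hfd : ∀ t ∈ Ioo (-ε) ε, HasDerivAt f (r (joinPt t y₀)) t := fun t ht =>
    hasDerivAt_joinPt_comp (ContDiffOn.dAt hu hB (joinPt_mem_box.2 ⟨ht, hy₀⟩))
  have hab : ∀ t ∈ Ioo (-ε) ε, ∀ y ∈ V, ∀ a b : Fin m,
        G (joinPt t y) a.succ b.succ = ψ t ^ 2 * G (joinPt 0 y) a.succ b.succ := by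
    intro t ht y hy i j
    have h1 := eq_mul_exp_of_hasDerivAt (ε := ε) (A := fun t => 2 * A t) (a := fun t => 2 * a t)
      (b := fun t => G (joinPt t y) i.succ j.succ) (by simp [hA0])
      (fun s hs => (hA s hs).const_mul 2) (fun s hs => by
        have hz : joinPt s y ∈ box ε V := joinPt_mem_box.2 ⟨hs, hy⟩
        refine (hasDerivAt_joinPt_comp (hG.dAt_metric hz i.succ j.succ)).congr_deriv ?_
        rw [hG0 _ hz, joinPt_eq_of_pd_succ hV hVc hαs hαy hs hy hy₀,
          joinPt_eq_of_pd_succ hV hVc hrs hry hs hy hy₀]) ht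
    have h2 : Real.exp (2 * A t) = ψ t ^ 2 := by
      rw [hψ]; rw [← Real.exp_nat_mul]; norm_num
    have h3 : G (joinPt t y) i.succ j.succ
      = G (joinPt 0 y) i.succ j.succ * Real.exp (2 * A t) := h1
    rw [h3, h2, mul_comm]
  have hg := isMetricOn_slice hG hV t0
  set g := fun y => (G (joinPt 0 y)).submatrix (Fin.succ : Fin m → Fin (m + 1)) Fin.succ with hgd
  set C := deriv (deriv ψ) 0 + ((m : ℝ) - 1) * deriv ψ 0 ^ 2 with hC
  -- The factor in the Ricci tensor of the fibre, from the Ricci tensor of the warped product and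
  -- the soliton equation. Writing `α` as `f' ψ'` expresses it through quantities that two
  -- overlapping charts can compare.
  set ρ : Eu m → ℝ := fun y => lam (joinPt 0 y) - h (joinPt 0 y) * (deriv f 0 * deriv ψ 0) + C with hρ
  have hρs : ContDiffOn ℝ ∞ ρ V :=
    ((contDiffOn_joinPt_right hlams t0).sub
      ((contDiffOn_joinPt_right hhs t0).mul contDiffOn_const)).add contDiffOn_const
  have hric : ∀ y ∈ V, ∀ a b, ricci g y a b = ρ y * g y a b := by
    intro y hy i j
    have hz : joinPt 0 y ∈ box ε V := joinPt_mem_box.2 ⟨t0, hy⟩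
    have h1 := ricci_warped hG hg hV h00 h0a hab (fun t _ => Real.exp_pos _) hψs t0 hy i j
    rw [hR _ hz, hus _ hz, hψ0, joinPt_eq_of_pd_succ hV hVc hαs hαy t0 hy hy₀] at h1
    have h2 : deriv f 0 * deriv ψ 0 = α (joinPt 0 y₀) := by
      rw [(hfd 0 t0).deriv, hψ'0, ha]
      exact mul_div_cancel₀ _ (hrpos _ (joinPt_mem_box.2 ⟨t0, hy₀⟩)).ne'
    have h3 : g y i j = G (joinPt 0 y) i.succ j.succ := rfl
    simp only [hρ, hC, h2]
    rw [h3] at h1 ⊢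
    linarith
  -- Schur's lemma on the fibre, whose dimension is at least `3`.
  have hρc : ∀ y ∈ V, ρ y = ρ y₀ := fun y hy =>
    eq_of_pd_eq_zero hV hVc hρs (fun z hz i => pd_eq_zero_of_ricci_eq hg hz hm hric i) hy hy₀
  refine ⟨f, ψ, ρ y₀, hψs, fun t _ => Real.exp_pos _, ?_, ?_, h00, h0a, hab, ?_⟩
  · intro t ht
    rw [(hfd t ht).deriv]
    exact hrpos _ (joinPt_mem_box.2 ⟨ht, hy₀⟩)
  · intro t ht y hy
    exact joinPt_eq_of_pd_succ hV hVc hu hus ht hy hy₀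
  · intro y hy
    refine ⟨fun i j => ?_, (hρc y hy).symm⟩
    rw [hric y hy, hρc y hy]; rfl

end Adapted

/-! ### Charts in which the metric is a warped product -/

section WarpedChart

variable {m : ℕ} {M : Type*} [TopologicalSpace M]
  [ChartedSpace (EuclideanSpace ℝ (Fin (m + 1))) M] [IsManifold (𝓡 (m + 1)) ∞ M]
  [RiemannianBundle (fun x : M => TangentSpace (𝓡 (m + 1)) x)]

/-- A chart of `M` in which the metric is the warped product `dt² + ψ(t)² ĝ` over an Einstein
metric `ĝ`, with `u` a function of `t` alone. -/
structure IsWarpedChart (u h lam : M → ℝ) (e : OpenPartialHomeomorph M (Eu (m + 1))) (ε : ℝ)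
    (V : Set (Eu m)) (f ψ : ℝ → ℝ) (κ : ℝ) : Prop where
  mem : e ∈ IsManifold.maximalAtlas (𝓡 (m + 1)) ∞ M
  isOpen : IsOpen V
  target : e.target = box ε V
  normal : ∀ z ∈ box ε V, ∀ i, √(gradProd (m + 1) u u (e.symm z)) * gram (m + 1) e.symm z i 0
    = pd (fun z => u (e.symm z)) z i
  normal_pos : ∀ z ∈ box ε V, 0 < √(gradProd (m + 1) u u (e.symm z))
  smooth : ContDiffOn ℝ ∞ ψ (Ioo (-ε) ε)
  pos : ∀ t ∈ Ioo (-ε) ε, 0 < ψ t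
  deriv_pos : ∀ t ∈ Ioo (-ε) ε, 0 < deriv f t
  potential : ∀ t ∈ Ioo (-ε) ε, ∀ y ∈ V, u (e.symm (joinPt t y)) = f t
  gram_zero : ∀ z ∈ box ε V, gram (m + 1) e.symm z 0 0 = 1
  gram_zero_succ : ∀ z ∈ box ε V, ∀ a : Fin m, gram (m + 1) e.symm z 0 a.succ = 0
  gram_succ : ∀ t ∈ Ioo (-ε) ε, ∀ y ∈ V, ∀ a b : Fin m,
    gram (m + 1) e.symm (joinPt t y) a.succ b.succ
      = ψ t ^ 2 * gram (m + 1) e.symm (joinPt 0 y) a.succ b.succ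
  einstein : ∀ y ∈ V, ∀ a b,
    ricci (fun y => (gram (m + 1) e.symm (joinPt 0 y)).submatrix Fin.succ Fin.succ) y a b
      = κ * gram (m + 1) e.symm (joinPt 0 y) a.succ b.succ
  constant : ∀ y ∈ V, κ = lam (e.symm (joinPt 0 y))
    - h (e.symm (joinPt 0 y)) * (deriv f 0 * deriv ψ 0)
    + (deriv (deriv ψ) 0 + ((m : ℝ) - 1) * deriv ψ 0 ^ 2)

/-- Shortening the interval leaves `f`, `ψ` and `κ` unchanged. It is used to give finitely many
charts a common width. -/
theorem IsWarpedChart.restrict {u h lam : M → ℝ} {e : OpenPartialHomeomorph M (Eu (m + 1))}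
    {ε ε' : ℝ} {V : Set (Eu m)} {f ψ : ℝ → ℝ} {κ : ℝ} (H : IsWarpedChart u h lam e ε V f ψ κ)
    (hε : ε' ≤ ε) :
    ∃ e' : OpenPartialHomeomorph M (Eu (m + 1)), IsWarpedChart u h lam e' ε' V f ψ κ ∧
      (∀ x, e' x = e x) ∧ e'.source = e.source ∩ e ⁻¹' box ε' V := by
  have hI : Ioo (-ε') ε' ⊆ Ioo (-ε) ε := Ioo_subset_Ioo (by linarith) hε
  have hb : box ε' V ⊆ box ε V := preimage_mono (prod_mono hI subset_rfl)
  set e' := (e.symm.restrOpen (box ε' V) (isOpen_box ε' H.isOpen)).symm with he'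
  have h1 : ∀ x, e' x = e x := fun x => rfl
  have h2 : (e'.symm : Eu (m + 1) → M) = e.symm := rfl
  have ht : e'.target = box ε' V := by
    change e.target ∩ box ε' V = _
    rw [H.target]; exact inter_eq_right.2 hb
  have hs : e'.source = e.source ∩ e ⁻¹' box ε' V := by
    ext x
    constructor
    · intro hx
      have hx1 := e'.map_source hx
      rw [ht, h1] at hx1
      have hx2 : e.symm (e x) = x := by have := e'.left_inv hx; rwa [h1, h2] at this
      refine ⟨?_, hx1⟩
      rw [← hx2]; exact e.map_target (H.target ▸ hb hx1)
    · rintro ⟨hx1, hx2⟩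
      have hx3 := e'.map_target (x := e x) (ht ▸ hx2)
      rwa [h2, e.left_inv hx1] at hx3
  refine ⟨e', ⟨?_, H.isOpen, ht, ?_, ?_, H.smooth.mono hI, fun t ht => H.pos t (hI ht),
    fun t ht => H.deriv_pos t (hI ht), fun t ht => H.potential t (hI ht), ?_, ?_, ?_, H.einstein,
    H.constant⟩, h1, hs⟩
  · refine e'.mem_maximalAtlas_of_contMDiffOn ?_ ?_
    · exact (contMDiffOn_of_mem_maximalAtlas H.mem).mono (hs ▸ inter_subset_left)
    · refine (contMDiffOn_symm_of_mem_maximalAtlas H.mem).mono ?_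
      rw [ht, H.target]; exact hb
  · exact fun z hz => H.normal z (hb hz)
  · exact fun z hz => H.normal_pos z (hb hz)
  · exact fun z hz => H.gram_zero z (hb hz)
  · exact fun z hz => H.gram_zero_succ z (hb hz)
  · exact fun t ht => H.gram_succ t (hI ht)

variable [IsContMDiffRiemannianBundle (𝓡 (m + 1)) ∞ (EuclideanSpace ℝ (Fin (m + 1)))
      (fun x : M => TangentSpace (𝓡 (m + 1)) x)]

/-- The unit normal vector field of the level sets of `u`. -/
def unitNormal {k : ℕ} (G : Eu k → Matrix (Fin k) (Fin k) ℝ) (u : Eu k → ℝ) (y : Eu k) : Eu k :=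
  WithLp.toLp 2 fun i => gradV G u y i / √(gradInner G u u y)

theorem fderiv_eq_sum_pd {k : ℕ} (f : Eu k → ℝ) (y v : Eu k) :
    fderiv ℝ f y v = ∑ i, pd f y i * v i := by
  have hv := (EuclideanSpace.basisFun (Fin k) ℝ).sum_repr v
  conv_lhs => rw [← hv, map_sum]
  refine Finset.sum_congr rfl fun i _ => ?_
  rw [map_smul, EuclideanSpace.basisFun_apply, smul_eq_mul, mul_comm]
  rfl

/-- Straighten the unit normal field of the level sets inside the given chart. In the resulting
chart the hypotheses of `exists_warped_of_adapted` hold. -/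
theorem exists_warpedChart (hm : 3 ≤ m) {u h lam : M → ℝ} (hsol : IsAlmostSoliton (m + 1) u h lam)
    (hdev : ∀ e ∈ IsManifold.maximalAtlas (𝓡 (m + 1)) ∞ M, ∀ y ∈ e.target,
      deviation (gram (m + 1) e.symm y)⁻¹ (tracelessRicci (gram (m + 1) e.symm) y)
        (pd (fun z => u (e.symm z)) y) = 0)
    {e₀ : OpenPartialHomeomorph M (Eu (m + 1))}
    (he₀ : e₀ ∈ IsManifold.maximalAtlas (𝓡 (m + 1)) ∞ M) {p : M} (hp : p ∈ e₀.source)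
    (hdu : pd (fun z => u (e₀.symm z)) (e₀ p) ≠ 0) :
    ∃ (e : OpenPartialHomeomorph M (Eu (m + 1))) (ε : ℝ) (v₀ : Eu m) (f ψ : ℝ → ℝ) (κ : ℝ),
      0 < ε ∧ IsWarpedChart u h lam e ε (Metric.ball v₀ ε) f ψ κ ∧ p ∈ e.source ∧
        e p = joinPt 0 v₀ ∧ f 0 = u p := by
  set G₀ := gram (m + 1) e₀.symm with hG₀d
  set u₀ : Eu (m + 1) → ℝ := fun z => u (e₀.symm z) with hu₀d
  have hG₀ : IsMetricOn G₀ e₀.target := isMetricOn_chart he₀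
  have hu₀ : ContDiffOn ℝ ∞ u₀ e₀.target := smooth_chart_comp hsol.smooth_u he₀
  set Ω : Set (Eu (m + 1)) := e₀.target ∩ {y | pd u₀ y ≠ 0} with hΩd
  have hΩ : IsOpen Ω := by
    have hc : ContinuousOn (fun y => pd u₀ y) e₀.target :=
      continuousOn_pi.2 fun i => (contDiffOn_pd e₀.open_target hu₀ i).continuousOn
    exact hc.isOpen_inter_preimage e₀.open_target isOpen_compl_singleton
  have hw := fun {y : Eu (m + 1)} (hy : y ∈ Ω) => gradInner_self_pos hG₀ hy.1 hy.2
  have hX : ContDiffOn ℝ ∞ (unitNormal G₀ u₀) Ω := by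
    have hs : ContDiffOn ℝ ∞ (fun y => √(gradInner G₀ u₀ u₀ y)) Ω :=
      ((smooth_gradInner hG₀ hu₀ hu₀).mono inter_subset_left).sqrt fun y hy => (hw hy).ne'
    rw [contDiffOn_euclidean]
    exact fun i => ((smooth_gradV hG₀ hu₀ i).mono inter_subset_left).div hs
      fun y hy => (Real.sqrt_pos.2 (hw hy)).ne'
  have hX1 : ∀ y ∈ Ω, fderiv ℝ u₀ y (unitNormal G₀ u₀ y) ≠ 0 := by
    intro y hy
    rw [fderiv_eq_sum_pd]
    have : ∑ i, pd u₀ y i * unitNormal G₀ u₀ y i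
        = gradInner G₀ u₀ u₀ y / √(gradInner G₀ u₀ u₀ y) := by
      rw [gradInner, Finset.sum_div]
      exact Finset.sum_congr rfl fun i _ => (mul_div_assoc _ _ _).symm
    rw [this]
    exact (div_pos (hw hy) (Real.sqrt_pos.2 (hw hy))).ne'
  have hxΩ : e₀ p ∈ Ω := ⟨e₀.map_source hp, hdu⟩
  obtain ⟨ε, v₀, φ, hε, hφs, hφt, hφ0, hφc, hφc', hφu, hφX⟩ :=
    exists_straightening hΩ (hu₀.mono inter_subset_left) hX hxΩ (hX1 _ hxΩ)
  set e := e₀.trans φ.symm with hed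
  have hsymm : ∀ z, e.symm z = e₀.symm (φ z) := fun z => rfl
  have het : e.target = box ε (Metric.ball v₀ ε) := by
    rw [hed, OpenPartialHomeomorph.trans_target, φ.symm_target, φ.symm_symm, hφs]
    refine inter_eq_left.2 fun z hz => ?_
    exact (hφt (φ.map_source (hφs ▸ hz))).1
  have hes : e.source = e₀.source ∩ e₀ ⁻¹' φ.target := by
    rw [hed, OpenPartialHomeomorph.trans_source, φ.symm_source]
  have he : e ∈ IsManifold.maximalAtlas (𝓡 (m + 1)) ∞ M := by
    refine e.mem_maximalAtlas_of_contMDiffOn ?_ ?_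
    · exact (contMDiffOn_iff_contDiffOn.2 hφc').comp
        ((contMDiffOn_of_mem_maximalAtlas he₀).mono (hes ▸ inter_subset_left))
        (hes ▸ inter_subset_right)
    · refine (contMDiffOn_symm_of_mem_maximalAtlas he₀).comp
        (contMDiffOn_iff_contDiffOn.2 (hφc.mono (by rw [het, hφs]))) fun z hz => ?_
      rw [het, ← hφs] at hz
      exact (hφt (φ.map_source hz)).1
  set G := gram (m + 1) e.symm with hGd
  have hG : IsMetricOn G (box ε (Metric.ball v₀ ε)) := het ▸ isMetricOn_chart he
  set ue : Eu (m + 1) → ℝ := fun z => u (e.symm z) with hued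
  have hB := isOpen_box ε (Metric.isOpen_ball (x := v₀) (ε := ε))
  have hin : ∀ z ∈ box ε (Metric.ball v₀ ε), z ∈ e.target ∧ φ z ∈ Ω ∧ e.symm z ∈ e₀.source ∧
      e₀ (e.symm z) = φ z := by
    intro z hz
    have h1 := hφt (φ.map_source (hφs ▸ hz))
    exact ⟨het ▸ hz, h1, e₀.map_target h1.1, e₀.right_inv h1.1⟩
  -- The first column of the Jacobian is the unit normal, since `φ` carries `∂_0` to it. Lowering
  -- the index turns this into `hN`.
  have hJ : ∀ z ∈ box ε (Metric.ball v₀ ε), ∀ k,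
      jacobian e e₀ z k 0 = unitNormal G₀ u₀ (φ z) k := by
    intro z hz k
    rw [← hφX z (hφs ▸ hz)]
    unfold jacobian
    have : (fun z => e₀ (e.symm z)) =ᶠ[nhds z] φ :=
      Filter.eventually_of_mem (hB.mem_nhds hz) fun z hz => (hin z hz).2.2.2
    rw [Matrix.of_apply, this.fderiv_eq]
  have hgr : ∀ z ∈ box ε (Metric.ball v₀ ε), gradInner G ue ue z = gradInner G₀ u₀ u₀ (φ z) := by
    intro z hz
    obtain ⟨h1, h2, h3, h4⟩ := hin z hz
    have := gradInner_transition hsol.smooth_u hsol.smooth_u he he₀ h1 h3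
    rwa [h4] at this
  have hgp : ∀ z ∈ box ε (Metric.ball v₀ ε), gradProd (m + 1) u u (e.symm z) = gradInner G ue ue z :=
    fun z hz => gradProd_chart hsol.smooth_u hsol.smooth_u he (hin z hz).1
  have hN : ∀ z ∈ box ε (Metric.ball v₀ ε), ∀ i, √(gradInner G ue ue z) * G z i 0 = pd ue z i := by
    intro z hz i
    obtain ⟨h1, h2, h3, h4⟩ := hin z hz
    have hs := (Real.sqrt_pos.2 (hw h2)).ne'
    rw [hgr z hz, hGd, gram_transition he he₀ h1 h3, h4, hued, pd_transition hsol.smooth_u he he₀ h1 h3,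
      h4, Matrix.mul_assoc, Matrix.mul_apply, Finset.mul_sum]
    refine Finset.sum_congr rfl fun k _ => ?_
    rw [Matrix.mul_apply, Matrix.transpose_apply]
    have : ∑ l, G₀ (φ z) k l * jacobian e e₀ z l 0 = pd u₀ (φ z) k / √(gradInner G₀ u₀ u₀ (φ z)) := by
      rw [← sum_metric_gradV hG₀ h2.1, Finset.sum_div]
      refine Finset.sum_congr rfl fun l _ => ?_
      rw [hJ z hz]
      exact (mul_div_assoc _ _ _).symm
    rw [this]
    field_simp
    rfl
  have hpd : ∀ z ∈ box ε (Metric.ball v₀ ε), pd ue z ≠ 0 := by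
    intro z hz h0
    have h1 := hw (hin z hz).2.1
    rw [← hgr z hz, gradInner] at h1
    simp [h0] at h1
  obtain ⟨f, ψ, κ, a1, a2, a3, a4, a5, a6, a7, a8⟩ := exists_warped_of_adapted hm hε
    (Metric.isOpen_ball (x := v₀) (ε := ε)) (convex_ball v₀ ε).isPreconnected
    (Metric.mem_ball_self hε) hG (u := ue) (h := fun z => h (e.symm z))
    (lam := fun z => lam (e.symm z)) (c := u p)
    (het ▸ smooth_chart_comp hsol.smooth_u he) (het ▸ smooth_chart_comp hsol.smooth_h he)
    (het ▸ smooth_chart_comp hsol.smooth_lam he) hpd hN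
    (fun y hy => by
      have h1 := hφu y hy
      rw [hu₀d] at h1
      simp only [e₀.left_inv hp] at h1
      exact h1)
    (fun z _ => hsol.signal.elim (fun H => (H _).ne') fun H => (H _).ne)
    (fun z hz => hsol.equation e he z (hin z hz).1) (fun z hz => hdev e he z (hin z hz).1)
  have hv₀ : v₀ ∈ Metric.ball v₀ ε := Metric.mem_ball_self hε
  have hz₀ : joinPt 0 v₀ ∈ box ε (Metric.ball v₀ ε) := joinPt_mem_box.2 ⟨by simp [hε], hv₀⟩
  have hp0 : e.symm (joinPt 0 v₀) = p := by rw [hsymm, hφ0, e₀.left_inv hp]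
  refine ⟨e, ε, v₀, f, ψ, κ, hε, ⟨he, Metric.isOpen_ball, het, ?_, ?_, a1, a2, a3, a4, a5, a6, a7,
    fun y hy => (a8 y hy).1, fun y hy => (a8 y hy).2⟩, ?_, ?_, ?_⟩
  · intro z hz i
    rw [hgp z hz]; exact hN z hz i
  · intro z hz
    rw [hgp z hz, hgr z hz]
    exact Real.sqrt_pos.2 (hw (hin z hz).2.1)
  · rw [← hp0]; exact e.map_target (hin _ hz₀).1
  · rw [← hp0]; exact e.right_inv (hin _ hz₀).1
  · rw [← a4 0 (by simp [hε]) v₀ hv₀, hued]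
    exact congrArg u hp0

end WarpedChart

/-! ### Locality of the Ricci tensor -/

section Congruence

variable {k : ℕ} {G G' : Eu k → Matrix (Fin k) (Fin k) ℝ} {Ω : Set (Eu k)} {y : Eu k}

theorem christoffel_congr_on (hΩ : IsOpen Ω) (h : ∀ z ∈ Ω, G z = G' z) (hy : y ∈ Ω)
    (c i j : Fin k) : christoffel G y c i j = christoffel G' y c i j := by
  have hp : ∀ a b l, pd (fun z => G z a b) y l = pd (fun z => G' z a b) y l := fun a b l =>
    pd_congr_on hΩ hy (fun z hz => by rw [h z hz]) l
  unfold christoffel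
  simp only [hp, h y hy]

theorem ricci_congr_on (hΩ : IsOpen Ω) (h : ∀ z ∈ Ω, G z = G' z) (hy : y ∈ Ω) (i j : Fin k) :
    ricci G y i j = ricci G' y i j := by
  have hc := fun c i j => christoffel_congr_on hΩ h hy c i j
  have hp : ∀ c a b l, pd (fun z => christoffel G z c a b) y l
      = pd (fun z => christoffel G' z c a b) y l := fun c a b l =>
    pd_congr_on hΩ hy (fun z hz => christoffel_congr_on hΩ h hz c a b) l
  unfold ricci curvOp
  simp only [hc, hp]

end Congruence

/-! ### Uniqueness of normal curves and of the warping data -/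

section Curves

variable {m : ℕ} {M : Type*} [TopologicalSpace M]
  [ChartedSpace (EuclideanSpace ℝ (Fin (m + 1))) M] [IsManifold (𝓡 (m + 1)) ∞ M]
  [RiemannianBundle (fun x : M => TangentSpace (𝓡 (m + 1)) x)]
  [IsContMDiffRiemannianBundle (𝓡 (m + 1)) ∞ (EuclideanSpace ℝ (Fin (m + 1)))
      (fun x : M => TangentSpace (𝓡 (m + 1)) x)]
  {u h lam : M → ℝ} {e e' : OpenPartialHomeomorph M (Eu (m + 1))} {ε : ℝ} {V V' : Set (Eu m)}
  {f ψ f' ψ' : ℝ → ℝ} {κ κ' : ℝ}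

theorem sum_joinPt (g : Fin (m + 1) → Fin (m + 1) → ℝ) (h00 : g 0 0 = 1)
    (h0a : ∀ a : Fin m, g 0 a.succ = 0) (ha0 : ∀ a : Fin m, g a.succ 0 = 0) (z w : Eu (m + 1)) :
    ∑ i, ∑ j, g i j * z i * w j
      = z 0 * w 0 + ∑ a : Fin m, ∑ b : Fin m, g a.succ b.succ * z a.succ * w b.succ := by
  simp only [Fin.sum_univ_succ (n := m), h00, h0a, ha0, zero_mul, Finset.sum_const_zero, add_zero,
    zero_add, one_mul]

theorem IsWarpedChart.mem_target (H : IsWarpedChart u h lam e ε V f ψ κ) {t : ℝ}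
    (ht : t ∈ Ioo (-ε) ε) {y : Eu m} (hy : y ∈ V) : joinPt t y ∈ e.target :=
  H.target ▸ joinPt_mem_box.2 ⟨ht, hy⟩

theorem IsWarpedChart.mem_source (H : IsWarpedChart u h lam e ε V f ψ κ) {t : ℝ}
    (ht : t ∈ Ioo (-ε) ε) {y : Eu m} (hy : y ∈ V) : e.symm (joinPt t y) ∈ e.source :=
  e.map_target (H.mem_target ht hy)

theorem IsWarpedChart.sum_gram (H : IsWarpedChart u h lam e ε V f ψ κ) {t : ℝ}
    (ht : t ∈ Ioo (-ε) ε) {y : Eu m} (hy : y ∈ V) (z w : Eu (m + 1)) :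
    ∑ i, ∑ j, gram (m + 1) e.symm (joinPt t y) i j * z i * w j
      = z 0 * w 0 + ψ t ^ 2 * ∑ a : Fin m, ∑ b : Fin m,
        gram (m + 1) e.symm (joinPt 0 y) a.succ b.succ * z a.succ * w b.succ := by
  have hz : joinPt t y ∈ box ε V := joinPt_mem_box.2 ⟨ht, hy⟩
  rw [sum_joinPt _ (H.gram_zero _ hz) (H.gram_zero_succ _ hz) fun a => by
    rw [(isMetricOn_chart H.mem).symm (H.target ▸ hz), H.gram_zero_succ _ hz], Finset.mul_sum]
  congr 1
  refine Finset.sum_congr rfl fun a _ => ?_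
  rw [Finset.mul_sum]
  refine Finset.sum_congr rfl fun b _ => ?_
  rw [H.gram_succ t ht y hy]; ring

/-- Parametrizations of the form `(t, y) ↦ e⁻¹(t, y)` are smooth and pull the metric back to the
warped product metric. -/
theorem IsWarpedChart.pullback (H : IsWarpedChart u h lam e ε V f ψ κ) {τ : ℝ × Eu m → M}
    (hτ : ∀ t ∈ Ioo (-ε) ε, ∀ y ∈ V, τ (t, y) = e.symm (joinPt t y)) :
    ContMDiffOn 𝓘(ℝ, ℝ × Eu m) (𝓡 (m + 1)) ∞ τ (Ioo (-ε) ε ×ˢ V) ∧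
    ∀ t ∈ Ioo (-ε) ε, ∀ y ∈ V, ∀ (a b : ℝ) (v w : Eu m),
      inner ℝ (mfderiv 𝓘(ℝ, ℝ × Eu m) (𝓡 (m + 1)) τ (t, y) (a, v) :
          TangentSpace (𝓡 (m + 1)) (τ (t, y)))
        (mfderiv 𝓘(ℝ, ℝ × Eu m) (𝓡 (m + 1)) τ (t, y) (b, w) :
          TangentSpace (𝓡 (m + 1)) (τ (t, y)))
      = a * b + ψ t ^ 2 * ∑ i, ∑ j,
        gram (m + 1) e.symm (joinPt 0 y) i.succ j.succ * v i * w j := by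
  have hs : ContMDiffOn 𝓘(ℝ, ℝ × Eu m) (𝓡 (m + 1)) ∞ τ (Ioo (-ε) ε ×ˢ V) := by
    have h1 := (contMDiffOn_symm_of_mem_maximalAtlas H.mem).comp (t := e.target)
      (f := fun q : ℝ × Eu m => (split m).symm q) (s := Ioo (-ε) ε ×ˢ V)
      ((split m).symm.contDiff.contMDiff.contMDiffOn)
      fun q hq => H.mem_target hq.1 hq.2
    exact h1.congr fun q hq => hτ q.1 hq.1 q.2 hq.2
  refine ⟨hs, fun t ht y hy a b v w => ?_⟩
  have hopen : IsOpen (Ioo (-ε) ε ×ˢ V) := isOpen_Ioo.prod H.isOpen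
  have hmem : (t, y) ∈ Ioo (-ε) ε ×ˢ V := ⟨ht, hy⟩
  have hsrc : τ (t, y) ∈ e.source := by rw [hτ t ht y hy]; exact H.mem_source ht hy
  rw [inner_mfderiv_eq_chart ((hs.contMDiffAt (hopen.mem_nhds hmem)).mdifferentiableAt (by simp))
    H.mem hsrc]
  have hfd : fderiv ℝ (fun z => e (τ z)) (t, y)
      = ((split m).symm : ℝ × Eu m →L[ℝ] Eu (m + 1)) := by
    have : (fun z => e (τ z)) =ᶠ[nhds (t, y)] fun q => (split m).symm q := by
      filter_upwards [hopen.mem_nhds hmem] with q hq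
      rw [hτ q.1 hq.1 q.2 hq.2, e.right_inv (H.mem_target hq.1 hq.2)]
      rfl
    rw [this.fderiv_eq]
    exact (split m).symm.fderiv
  have hb : e (τ (t, y)) = joinPt t y := by
    rw [hτ t ht y hy, e.right_inv (H.mem_target ht hy)]
  rw [hfd, hb]
  exact H.sum_gram ht hy (joinPt a v) (joinPt b w)

/-- The slices of a warped chart are smooth immersions, with the expected induced metric. -/
theorem IsWarpedChart.slice (H : IsWarpedChart u h lam e ε V f ψ κ) {t : ℝ}
    (ht : t ∈ Ioo (-ε) ε) :
    ContMDiffOn (𝓡 m) (𝓡 (m + 1)) ∞ (fun y => e.symm (joinPt t y)) V ∧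
    (∀ y ∈ V, Function.Injective (mfderiv (𝓡 m) (𝓡 (m + 1)) (fun y => e.symm (joinPt t y)) y)) ∧
    ∀ y ∈ V, ∀ a b, gram (m + 1) (fun y => e.symm (joinPt t y)) y a b
      = gram (m + 1) e.symm (joinPt t y) a.succ b.succ := by
  have hs : ContMDiffOn (𝓡 m) (𝓡 (m + 1)) ∞ (fun y => e.symm (joinPt t y)) V :=
    (contMDiffOn_symm_of_mem_maximalAtlas H.mem).comp (t := e.target)
      (f := fun y : Eu m => joinPt t y) (s := V)
      (((split m).symm.contDiff.comp (contDiff_const.prodMk contDiff_id)).contMDiff.contMDiffOn)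
      fun y hy => H.mem_target ht hy
  have hmd : ∀ y ∈ V, MDifferentiableAt (𝓡 m) (𝓡 (m + 1)) (fun y => e.symm (joinPt t y)) y :=
    fun y hy => (hs.contMDiffAt (H.isOpen.mem_nhds hy)).mdifferentiableAt (by simp)
  have hfd : ∀ y ∈ V, ∀ v, fderiv ℝ (fun z => e (e.symm (joinPt t z))) y v = joinPt 0 v := by
    intro y hy v
    have : (fun z => e (e.symm (joinPt t z))) =ᶠ[nhds y] fun z => joinPt t z := by
      filter_upwards [H.isOpen.mem_nhds hy] with z hz
      exact e.right_inv (H.mem_target ht hz)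
    rw [this.fderiv_eq, (hasFDerivAt_joinPt_right t y).fderiv]
    rfl
  refine ⟨hs, fun y hy => ?_, fun y hy a b => ?_⟩
  · refine (injective_iff_map_eq_zero _).2 fun (v : Eu m) hv => ?_
    have h1 := (mfderiv_eq_chart (hmd y hy) H.mem (H.mem_source ht hy) v).2
    rw [hfd y hy, e.right_inv (H.mem_target ht hy)] at h1
    have h2 := mfderiv_symm_injective H.mem (H.mem_target ht hy)
    have h3 : joinPt 0 v = (0 : Eu (m + 1)) :=
      h2 ((h1.symm.trans hv).trans
        (map_zero (mfderiv (𝓡 (m + 1)) (𝓡 (m + 1)) e.symm (joinPt t y))).symm)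
    have h4 : v = (0 : Eu m) := by
      ext i
      exact congrArg (fun z : Eu (m + 1) => z i.succ) h3
    exact h4
  · have h1 := inner_mfderiv_eq_chart (hmd y hy) H.mem (H.mem_source ht hy)
      (EuclideanSpace.single a 1) (EuclideanSpace.single b 1)
    rw [hfd y hy, hfd y hy, joinPt_single_succ, joinPt_single_succ,
      e.right_inv (H.mem_target ht hy)] at h1
    refine Eq.trans ?_ (h1.trans ?_)
    · rfl
    · simp

/-- In either chart `∂_0` is the metric dual of `du/|∇u|`, which does not depend on the chart. In
matrices: `Jᵀ g' J e₀ = Jᵀ g' e₀`, and `Jᵀ` and `g'` are invertible. -/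
theorem IsWarpedChart.fderiv_transition (H : IsWarpedChart u h lam e ε V f ψ κ)
    (H' : IsWarpedChart u h lam e' ε V' f' ψ' κ') (hu : ContMDiff (𝓡 (m + 1)) 𝓘(ℝ, ℝ) ∞ u)
    {z : Eu (m + 1)} (hz : z ∈ e.target) (hz' : e.symm z ∈ e'.source) :
    fderiv ℝ (fun z => e' (e.symm z)) z (EuclideanSpace.single 0 1)
      = EuclideanSpace.single 0 1 := by
  set J := jacobian e e' z with hJ
  set z' := e' (e.symm z) with hz'd
  set g' := gram (m + 1) e'.symm z' with hg'
  have hz'1 : z' ∈ e'.target := e'.map_source hz'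
  have hu' : IsUnit J := (Matrix.isUnit_iff_isUnit_det _).2 (isUnit_jacobian H.mem H'.mem hz hz')
  have hug : IsUnit g' := (Matrix.isUnit_iff_isUnit_det _).2
    ((isMetricOn_chart H'.mem).isUnit_det hz'1)
  have hs := (H.normal_pos z (H.target ▸ hz)).ne'
  have h1 : ∀ i, (Jᵀ * g' * J) i 0 = ∑ k, J k i * g' k 0 := by
    intro i
    rw [hJ, hg', hz'd, ← gram_transition H.mem H'.mem hz hz']
    apply mul_left_cancel₀ hs
    rw [H.normal z (H.target ▸ hz), pd_transition hu H.mem H'.mem hz hz', Finset.mul_sum]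
    refine Finset.sum_congr rfl fun k _ => ?_
    have h2 := H'.normal z' (H'.target ▸ hz'1) k
    rw [hz'd, e'.left_inv hz'] at h2
    rw [← h2]; ring
  have h2 : Jᵀ *ᵥ (g' *ᵥ (J *ᵥ Pi.single 0 1)) = Jᵀ *ᵥ (g' *ᵥ Pi.single 0 1) := by
    rw [Matrix.mulVec_mulVec, Matrix.mulVec_mulVec, Matrix.mulVec_single_one,
      Matrix.mulVec_single_one]
    ext i
    exact h1 i
  have h3 := Matrix.mulVec_injective_of_isUnit hug
    (Matrix.mulVec_injective_of_isUnit ((Matrix.isUnit_transpose J).2 hu') h2)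
  rw [Matrix.mulVec_single_one] at h3
  ext k
  have h4 := congrFun h3 k
  have h5 : J k 0 = if k = 0 then 1 else 0 := by simpa [Pi.single_apply] using h4
  exact h5.trans (by simp)

theorem IsWarpedChart.continuousOn_curve (H : IsWarpedChart u h lam e ε V f ψ κ) {y : Eu m}
    (hy : y ∈ V) : ContinuousOn (fun t => e.symm (joinPt t y)) (Ioo (-ε) ε) :=
  e.continuousOn_symm.comp
    ((split m).symm.continuous.comp (by fun_prop : Continuous fun t : ℝ => (t, y))).continuousOn
    fun _ ht => H.mem_target ht hy

/-- Normal curves with a common point coincide. -/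
theorem IsWarpedChart.curve_eq [T2Space M] (H : IsWarpedChart u h lam e ε V f ψ κ)
    (H' : IsWarpedChart u h lam e' ε V' f' ψ' κ') (hu : ContMDiff (𝓡 (m + 1)) 𝓘(ℝ, ℝ) ∞ u)
    {y y' : Eu m} (hy : y ∈ V) (hy' : y' ∈ V') {t₀ : ℝ} (ht₀ : t₀ ∈ Ioo (-ε) ε)
    (h0 : e.symm (joinPt t₀ y) = e'.symm (joinPt t₀ y')) {t : ℝ} (ht : t ∈ Ioo (-ε) ε) :
    e.symm (joinPt t y) = e'.symm (joinPt t y') := by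
  have hc := H.continuousOn_curve hy
  have hc' := H'.continuousOn_curve hy'
  -- The set of times of agreement is open, since in the chart `e'` both curves have derivative
  -- `∂_0`, and relatively closed, since `M` is Hausdorff.
  set U : Set ℝ := {t | t ∈ Ioo (-ε) ε ∧ e.symm (joinPt t y) = e'.symm (joinPt t y')} with hU
  have hUo : IsOpen U := by
    rw [isOpen_iff_mem_nhds]
    rintro s ⟨hs, hse⟩
    have hN : IsOpen (Ioo (-ε) ε ∩ (fun t => e.symm (joinPt t y)) ⁻¹' e'.source) :=
      hc.isOpen_inter_preimage isOpen_Ioo e'.open_source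
    have hsN : s ∈ Ioo (-ε) ε ∩ (fun t => e.symm (joinPt t y)) ⁻¹' e'.source := by
      refine ⟨hs, ?_⟩
      change e.symm (joinPt s y) ∈ e'.source
      rw [hse]; exact H'.mem_source hs hy'
    obtain ⟨δ, hδ, hb⟩ := Metric.isOpen_iff.1 hN s hsN
    have hd : ∀ r ∈ Metric.ball s δ,
        HasDerivAt (fun r => e' (e.symm (joinPt r y)) - joinPt r y') 0 r := by
      intro r hr
      obtain ⟨hr1, hr2⟩ := hb hr
      have hz := H.mem_target hr1 hy
      have hopen := (e.symm.trans e').open_source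
      have hmem : joinPt r y ∈ (e.symm.trans e').source := by
        rw [OpenPartialHomeomorph.trans_source]; exact ⟨hz, hr2⟩
      have h1 : DifferentiableAt ℝ (fun z => e' (e.symm z)) (joinPt r y) :=
        ((smooth_transition H.mem H'.mem).contDiffAt (hopen.mem_nhds hmem)).differentiableAt
          (by simp)
      have h2 : HasDerivAt (fun r => e' (e.symm (joinPt r y)))
          (fderiv ℝ (fun z => e' (e.symm z)) (joinPt r y) (EuclideanSpace.single 0 1)) r :=
        HasFDerivAt.comp_hasDerivAt (l := fun z => e' (e.symm z)) (f := fun r => joinPt r y) r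
          h1.hasFDerivAt (hasDerivAt_joinPt_left r y)
      rw [H.fderiv_transition H' hu hz hr2] at h2
      have h3 := h2.sub (hasDerivAt_joinPt_left r y')
      rw [sub_self] at h3
      exact h3
    have hconst : ∀ r ∈ Metric.ball s δ, e.symm (joinPt r y) = e'.symm (joinPt r y') := by
      intro r hr
      have h1 := Metric.isOpen_ball.is_const_of_deriv_eq_zero (convex_ball s δ).isPreconnected
        (fun r hr => (hd r hr).differentiableAt.differentiableWithinAt)
        (fun r hr => (hd r hr).deriv) hr (Metric.mem_ball_self hδ)
      simp only [hse, e'.right_inv (H'.mem_target hs hy'), sub_self] at h1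
      rw [← sub_eq_zero.1 h1, e'.left_inv (hb hr).2]
    filter_upwards [Metric.ball_mem_nhds s hδ] with r hr
    exact ⟨(hb hr).1, hconst r hr⟩
  have hcl : closure U ∩ Ioo (-ε) ε ⊆ U := by
    rintro s ⟨hsc, hs⟩
    refine ⟨hs, ?_⟩
    have : (nhdsWithin s U).NeBot := mem_closure_iff_nhdsWithin_neBot.1 hsc
    have hsub : U ⊆ Ioo (-ε) ε := fun r hr => hr.1
    refine tendsto_nhds_unique_of_eventuallyEq ((hc s hs).mono hsub) ((hc' s hs).mono hsub) ?_
    exact eventually_nhdsWithin_of_forall fun r hr => hr.2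
  exact (isPreconnected_Ioo.subset_of_closure_inter_subset hUo ⟨t₀, ht₀, ht₀, h0⟩ hcl ht).2

theorem IsWarpedChart.strictMonoOn (H : IsWarpedChart u h lam e ε V f ψ κ) :
    StrictMonoOn f (Ioo (-ε) ε) := by
  refine strictMonoOn_of_deriv_pos (convex_Ioo _ _) (fun t ht => ?_) fun t ht => ?_
  · exact (differentiableAt_of_deriv_ne_zero
      (H.deriv_pos t ht).ne').continuousAt.continuousWithinAt
  · rw [interior_Ioo] at ht
    exact H.deriv_pos t ht

/-- The data of two warped charts that meet in a point of the central slices agree. -/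
theorem IsWarpedChart.data_eq [T2Space M] (hm : 0 < m) (hε : 0 < ε)
    (H : IsWarpedChart u h lam e ε V f ψ κ)
    (H' : IsWarpedChart u h lam e' ε V' f' ψ' κ') (hu : ContMDiff (𝓡 (m + 1)) 𝓘(ℝ, ℝ) ∞ u)
    {y y' : Eu m} (hy : y ∈ V) (hy' : y' ∈ V')
    (h0 : e.symm (joinPt 0 y) = e'.symm (joinPt 0 y')) :
    (∀ t ∈ Ioo (-ε) ε, f t = f' t) ∧ (∀ t ∈ Ioo (-ε) ε, ψ t = ψ' t) ∧ κ = κ' := by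
  have t0 : (0 : ℝ) ∈ Ioo (-ε) ε := by simp [hε]
  have hf : ∀ t ∈ Ioo (-ε) ε, f t = f' t := by
    intro t ht
    rw [← H.potential t ht y hy, ← H'.potential t ht y' hy', H.curve_eq H' hu hy hy' t0 h0 ht]
  set σ : ℝ → Eu m → M := fun t x => e.symm (joinPt t x) with hσ
  have hsl := fun {t : ℝ} (ht : t ∈ Ioo (-ε) ε) => H.slice ht
  set N : Set (Eu m) := V ∩ σ 0 ⁻¹' e'.source with hN
  have hNo : IsOpen N := (hsl t0).1.continuousOn.isOpen_inter_preimage H.isOpen e'.open_source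
  have hyN : y ∈ N := ⟨hy, by
    change e.symm (joinPt 0 y) ∈ e'.source
    rw [h0]; exact H'.mem_source t0 hy'⟩
  -- Equality of the potentials and strict monotonicity of `f'` put the central slice of `e` into
  -- the central slice of `e'`.
  have hχ : ∀ x ∈ N, (split m (e' (σ 0 x))).2 ∈ V' ∧
      e' (σ 0 x) = joinPt 0 (split m (e' (σ 0 x))).2 := by
    intro x hx
    have h1 : joinPt (split m (e' (σ 0 x))).1 (split m (e' (σ 0 x))).2 ∈ box ε V' := by
      rw [joinPt_split, ← H'.target]; exact e'.map_source hx.2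
    obtain ⟨h2, h3⟩ := joinPt_mem_box.1 h1
    refine ⟨h3, ?_⟩
    have h4 := H'.potential _ h2 _ h3
    rw [joinPt_split, e'.left_inv hx.2, H.potential 0 t0 x hx.1, hf 0 t0] at h4
    have h5 := H'.strictMonoOn.injOn t0 h2 h4
    conv_lhs => rw [← joinPt_split (e' (σ 0 x)), ← h5]
  -- The transition map keeps `t` and acts on the slice coordinates independently of `t`; its
  -- derivative along the slices is therefore the same for all `t`.
  have hσt : ∀ t ∈ Ioo (-ε) ε, ∀ x ∈ N, e' (σ t x) = joinPt t 0 + e' (σ 0 x) ∧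
      σ t x ∈ e'.source := by
    intro t ht x hx
    obtain ⟨h1, h2⟩ := hχ x hx
    have h3 : σ t x = e'.symm (joinPt t (split m (e' (σ 0 x))).2) := by
      refine H.curve_eq H' hu hx.1 h1 t0 ?_ ht
      rw [← h2, e'.left_inv hx.2]
    refine ⟨?_, h3 ▸ H'.mem_source ht h1⟩
    rw [h3, e'.right_inv (H'.mem_target ht h1)]
    conv_rhs => rw [h2]
    unfold joinPt
    rw [← map_add]
    simp
  have hfd : ∀ t ∈ Ioo (-ε) ε, fderiv ℝ (fun x => e' (σ t x)) y
      = fderiv ℝ (fun x => e' (σ 0 x)) y := by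
    intro t ht
    have : (fun x => e' (σ t x)) =ᶠ[nhds y] fun x => joinPt t 0 + e' (σ 0 x) := by
      filter_upwards [hNo.mem_nhds hyN] with x hx
      exact (hσt t ht x hx).1
    rw [this.fderiv_eq, fderiv_const_add]
  have hmd := fun {t : ℝ} (ht : t ∈ Ioo (-ε) ε) =>
    ((hsl ht).1.contMDiffAt (H.isOpen.mem_nhds hy)).mdifferentiableAt (n := ∞) (by simp)
  have a₀ : Fin m := ⟨0, hm⟩
  set d : Eu (m + 1) := fderiv ℝ (fun x => e' (σ 0 x)) y (EuclideanSpace.single a₀ 1) with hd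
  have hd0 : d 0 = 0 := by
    have h1 := (mfderiv_eq_chart (hmd t0) H'.mem hyN.2 0).1
    have h2 : HasFDerivAt (fun x => e' (σ 0 x) 0)
        ((EuclideanSpace.proj (0 : Fin (m + 1)) : Eu (m + 1) →L[ℝ] ℝ).comp
          (fderiv ℝ (fun x => e' (σ 0 x)) y)) y :=
      (EuclideanSpace.proj (0 : Fin (m + 1)) : Eu (m + 1) →L[ℝ] ℝ).hasFDerivAt.comp y
        h1.hasFDerivAt
    have h3 : HasFDerivAt (fun x => e' (σ 0 x) 0) (0 : Eu m →L[ℝ] ℝ) y := by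
      refine (hasFDerivAt_const (0 : ℝ) y).congr_of_eventuallyEq ?_
      filter_upwards [hNo.mem_nhds hyN] with x hx
      rw [(hχ x hx).2, joinPt_zero]
    exact congrArg (fun L : Eu m →L[ℝ] ℝ => L (EuclideanSpace.single a₀ 1)) (h2.unique h3)
  set Q := ∑ a : Fin m, ∑ b : Fin m,
    gram (m + 1) e'.symm (joinPt 0 y') a.succ b.succ * d a.succ * d b.succ with hQ
  -- The length of one coordinate vector tangent to the slice, measured in both charts. At `t = 0`
  -- the two warping functions have square `1`, so the constants agree and `ψ = ψ'` follows.
  have hnorm : ∀ t ∈ Ioo (-ε) ε,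
      ψ t ^ 2 * gram (m + 1) e.symm (joinPt 0 y) a₀.succ a₀.succ = ψ' t ^ 2 * Q := by
    intro t ht
    rw [← H.gram_succ t ht y hy, ← (hsl ht).2.2 y hy]
    have h1 := inner_mfderiv_eq_chart (hmd ht) H'.mem (hσt t ht y hyN).2
      (EuclideanSpace.single a₀ 1) (EuclideanSpace.single a₀ 1)
    have h2 : e' (e.symm (joinPt t y)) = joinPt t y' := by
      rw [H.curve_eq H' hu hy hy' t0 h0 ht, e'.right_inv (H'.mem_target ht hy')]
    have h3 : fderiv ℝ (fun z => e' (e.symm (joinPt t z))) y = fderiv ℝ (fun x => e' (σ 0 x)) y :=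
      hfd t ht
    rw [h2, h3, H'.sum_gram ht hy', ← hd, hd0, zero_mul, zero_add] at h1
    exact h1
  have hgpos : 0 < gram (m + 1) e.symm (joinPt 0 y) a₀.succ a₀.succ :=
    ((isMetricOn_chart H.mem).posDef _ (H.mem_target t0 hy)).diag_pos
  have hψ : ∀ t ∈ Ioo (-ε) ε, ψ t = ψ' t := by
    intro t ht
    have e1 : ψ 0 ^ 2 = 1 := by
      have := H.gram_succ 0 t0 y hy a₀ a₀
      exact (mul_right_cancel₀ hgpos.ne' ((one_mul _).trans this)).symm
    have e2 : ψ' 0 ^ 2 = 1 := by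
      have h1 := H'.gram_succ 0 t0 y' hy' a₀ a₀
      have h2 : 0 < gram (m + 1) e'.symm (joinPt 0 y') a₀.succ a₀.succ :=
        ((isMetricOn_chart H'.mem).posDef _ (H'.mem_target t0 hy')).diag_pos
      exact (mul_right_cancel₀ h2.ne' ((one_mul _).trans h1)).symm
    have h1 := hnorm 0 t0
    rw [e1, e2, one_mul, one_mul] at h1
    have h2 := hnorm t ht
    rw [← h1] at h2
    exact (sq_eq_sq₀ (H.pos t ht).le (H'.pos t ht).le).1 (mul_right_cancel₀ hgpos.ne' h2)
  refine ⟨hf, hψ, ?_⟩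
  have ef : f =ᶠ[nhds 0] f' := Filter.eventually_of_mem (isOpen_Ioo.mem_nhds t0) hf
  have eψ : ψ =ᶠ[nhds 0] ψ' := Filter.eventually_of_mem (isOpen_Ioo.mem_nhds t0) hψ
  -- `κ` is determined by `lam` and `h` at the common point and by derivatives of `f` and `ψ` at
  -- `0`, and these agree.
  rw [H.constant y hy, H'.constant y' hy', h0, ef.deriv_eq, eψ.deriv_eq, eψ.deriv.deriv_eq]

end Curves

/-! ### Gluing warped charts along a hypersurface -/

section Gluing

variable {m : ℕ} {M : Type*} [TopologicalSpace M]
  [ChartedSpace (EuclideanSpace ℝ (Fin (m + 1))) M] [IsManifold (𝓡 (m + 1)) ∞ M]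
  [RiemannianBundle (fun x : M => TangentSpace (𝓡 (m + 1)) x)]
  [IsContMDiffRiemannianBundle (𝓡 (m + 1)) ∞ (EuclideanSpace ℝ (Fin (m + 1)))
      (fun x : M => TangentSpace (𝓡 (m + 1)) x)]
  {u h lam : M → ℝ} {ε : ℝ} {V : Set (Eu m)} {f ψ : ℝ → ℝ} {κ : ℝ}
  {e : OpenPartialHomeomorph M (Eu (m + 1))}

theorem IsWarpedChart.split_mem (H : IsWarpedChart u h lam e ε V f ψ κ) {x : M}
    (hx : x ∈ e.source) :
    (split m (e x)).1 ∈ Ioo (-ε) ε ∧ (split m (e x)).2 ∈ V := by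
  have h1 : joinPt (split m (e x)).1 (split m (e x)).2 ∈ box ε V := by
    rw [joinPt_split, ← H.target]; exact e.map_source hx
  exact joinPt_mem_box.1 h1

theorem IsWarpedChart.potential_eq_iff (H : IsWarpedChart u h lam e ε V f ψ κ) (hε : 0 < ε) {x : M}
    (hx : x ∈ e.source) : u x = f 0 ↔ e x 0 = 0 := by
  obtain ⟨h1, h2⟩ := H.split_mem hx
  have h3 := H.potential _ h1 _ h2
  rw [joinPt_split, e.left_inv hx] at h3
  rw [h3]
  exact H.strictMonoOn.injOn.eq_iff h1 (by simp [hε])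

theorem eq_joinPt_of_zero {z : Eu (m + 1)} (hz : z 0 = 0) : joinPt 0 (split m z).2 = z := by
  conv_rhs => rw [← joinPt_split z]
  congr 1
  exact hz.symm

theorem isPreconnected_levelSet_inter (H : IsWarpedChart u h lam e ε V f ψ κ) (hε : 0 < ε)
    (hV : IsPreconnected V) : IsPreconnected (u ⁻¹' {f 0} ∩ e.source) := by
  have t0 : (0 : ℝ) ∈ Ioo (-ε) ε := by simp [hε]
  have : u ⁻¹' {f 0} ∩ e.source = (fun y => e.symm (joinPt 0 y)) '' V := by
    ext x
    constructor
    · rintro ⟨h1, h2⟩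
      refine ⟨_, (H.split_mem h2).2, ?_⟩
      simp only [eq_joinPt_of_zero ((H.potential_eq_iff hε h2).1 h1), e.left_inv h2]
    · rintro ⟨y, hy, rfl⟩
      exact ⟨H.potential 0 t0 y hy, H.mem_source t0 hy⟩
  rw [this]
  exact hV.image _ (H.slice t0).1.continuousOn

/-- A preconnected hypersurface covered by warped charts, of which it is the central slice, has a
neighbourhood that is a warped product with Einstein fibres. -/
theorem isEinsteinWarpedNear_of_charts [T2Space M] (hm : 0 < m) (hε : 0 < ε)
    (hu : ContMDiff (𝓡 (m + 1)) 𝓘(ℝ, ℝ) ∞ u) {E : Set M} (hE : IsPreconnected E)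
    (hne : E.Nonempty)
    (hchart : ∀ x ∈ E, ∃ (e : OpenPartialHomeomorph M (Eu (m + 1))) (V : Set (Eu m))
      (f ψ : ℝ → ℝ) (κ : ℝ), IsWarpedChart u h lam e ε V f ψ κ ∧ x ∈ e.source ∧
        ∀ y ∈ e.source, y ∈ E ↔ e y 0 = 0) :
    IsEinsteinWarpedNear (m + 1) u E := by
  have t0 : (0 : ℝ) ∈ Ioo (-ε) ε := by simp [hε]
  obtain ⟨x₀, hx₀⟩ := hne
  have hchart' : ∀ x : M, ∃ (e : OpenPartialHomeomorph M (Eu (m + 1))) (V : Set (Eu m))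
      (f ψ : ℝ → ℝ) (κ : ℝ), x ∈ E → IsWarpedChart u h lam e ε V f ψ κ ∧ x ∈ e.source ∧
        ∀ y ∈ e.source, y ∈ E ↔ e y 0 = 0 := by
    intro x
    by_cases hx : x ∈ E
    · obtain ⟨e, V, f, ψ, κ, H⟩ := hchart x hx
      exact ⟨e, V, f, ψ, κ, fun _ => H⟩
    · obtain ⟨e, V, f, ψ, κ, -⟩ := hchart x₀ hx₀
      exact ⟨e, V, f, ψ, κ, fun h => absurd h hx⟩
  choose e V f ψ κ hall using hchart'
  have H : ∀ x ∈ E, IsWarpedChart u h lam (e x) ε (V x) (f x) (ψ x) (κ x) := fun x hx =>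
    (hall x hx).1
  have hsrc : ∀ x ∈ E, x ∈ (e x).source := fun x hx => (hall x hx).2.1
  have hmem : ∀ x ∈ E, ∀ y ∈ (e x).source, y ∈ E ↔ e x y 0 = 0 := fun x hx => (hall x hx).2.2
  set χ : M → M → Eu m := fun x y => (split m (e x y)).2 with hχ
  have hχV : ∀ x ∈ E, ∀ y ∈ (e x).source, χ x y ∈ V x := fun x hx y hy => ((H x hx).split_mem hy).2
  have hχ0 : ∀ x ∈ E, ∀ y ∈ (e x).source, y ∈ E → (e x).symm (joinPt 0 (χ x y)) = y := by
    intro x hx y hy hyE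
    rw [hχ]
    simp only [eq_joinPt_of_zero ((hmem x hx y hy).1 hyE), (e x).left_inv hy]
  have hdata : ∀ x ∈ E, ∀ y ∈ E, y ∈ (e x).source →
      (∀ t ∈ Ioo (-ε) ε, f x t = f y t) ∧ (∀ t ∈ Ioo (-ε) ε, ψ x t = ψ y t) ∧ κ x = κ y := by
    intro x hx y hy hyx
    refine (H x hx).data_eq hm hε (H y hy) hu (hχV x hx y hyx) (hχV y hy y (hsrc y hy)) ?_
    rw [hχ0 x hx y hyx hy, hχ0 y hy y (hsrc y hy) hy]
  -- The data are locally constant on `E`, because charts around nearby points meet on `E`; and `E`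
  -- is preconnected.
  have hconst : ∀ x ∈ E, (∀ t ∈ Ioo (-ε) ε, f x t = f x₀ t) ∧
      (∀ t ∈ Ioo (-ε) ε, ψ x t = ψ x₀ t) ∧ κ x = κ x₀ := by
    have : PreconnectedSpace E := isPreconnected_iff_preconnectedSpace.1 hE
    set F : E → (Ioo (-ε) ε → ℝ) × (Ioo (-ε) ε → ℝ) × ℝ := fun x =>
      (fun t => f x t, fun t => ψ x t, κ x) with hF
    have hloc : IsLocallyConstant F := by
      rw [IsLocallyConstant.iff_eventually_eq]
      intro x
      filter_upwards [((e x).open_source.preimage continuous_subtype_val).mem_nhds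
        (hsrc x x.2)] with y hy
      obtain ⟨h1, h2, h3⟩ := hdata x x.2 y y.2 hy
      exact Prod.ext (funext fun t => (h1 t t.2).symm)
        (Prod.ext (funext fun t => (h2 t t.2).symm) h3.symm)
    intro x hx
    have h1 := hloc.apply_eq_of_preconnectedSpace ⟨x, hx⟩ ⟨x₀, hx₀⟩
    exact ⟨fun t ht => congrFun (congrArg Prod.fst h1) ⟨t, ht⟩,
      fun t ht => congrFun (congrArg (fun q => q.2.1) h1) ⟨t, ht⟩,
      congrArg (fun q => q.2.2) h1⟩
  -- Move `x` for time `t` along its normal curve, computed in the chart attached to `x`. By `hkey`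
  -- any chart containing `x` gives the same point, so within a fixed chart `Φ` is the coordinate
  -- parametrisation.
  set Φ : ℝ → M → M := fun t x => (e x).symm (joinPt t (χ x x)) with hΦ
  have hkey : ∀ x ∈ E, ∀ y ∈ E, y ∈ (e x).source → ∀ t ∈ Ioo (-ε) ε,
      Φ t y = (e x).symm (joinPt t (χ x y)) := by
    intro x hx y hy hyx t ht
    refine (H y hy).curve_eq (H x hx) hu (hχV y hy y (hsrc y hy)) (hχV x hx y hyx) t0 ?_ ht
    rw [hχ0 x hx y hyx hy, hχ0 y hy y (hsrc y hy) hy]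
  have hσE : ∀ x ∈ E, ∀ y ∈ V x, (e x).symm (joinPt 0 y) ∈ E ∩ (e x).source := by
    intro x hx y hy
    have h1 := (H x hx).mem_source t0 hy
    refine ⟨(hmem x hx _ h1).2 ?_, h1⟩
    rw [(e x).right_inv ((H x hx).mem_target t0 hy), joinPt_zero]
  have hχσ : ∀ x ∈ E, ∀ y ∈ V x, χ x ((e x).symm (joinPt 0 y)) = y := by
    intro x hx y hy
    rw [hχ]
    simp only [(e x).right_inv ((H x hx).mem_target t0 hy), split_joinPt]
  have hΦσ : ∀ x ∈ E, ∀ t ∈ Ioo (-ε) ε, ∀ y ∈ V x,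
      Φ t ((e x).symm (joinPt 0 y)) = (e x).symm (joinPt t y) := by
    intro x hx t ht y hy
    obtain ⟨h1, h2⟩ := hσE x hx y hy
    rw [hkey x hx _ h1 h2 t ht, hχσ x hx y hy]
  have hpot : ∀ t ∈ Ioo (-ε) ε, ∀ x ∈ E, u (Φ t x) = f x₀ t := by
    intro t ht x hx
    rw [← (hconst x hx).1 t ht]
    exact (H x hx).potential t ht _ (hχV x hx x (hsrc x hx))
  refine ⟨ε, ψ x₀, f x₀, κ x₀, Φ, hε, (H x₀ hx₀).smooth, (H x₀ hx₀).pos, (H x₀ hx₀).deriv_pos,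
    fun x hx => hχ0 x hx x (hsrc x hx) hx, hpot, ?_, ?_, fun x hx => ?_⟩
  · rintro ⟨t, x⟩ ⟨ht, hx⟩ ⟨s, y⟩ ⟨hs, hy⟩ hts
    simp only at ht hx hs hy hts
    -- `u` determines the time; uniqueness of normal curves, followed back to time `0`, then
    -- determines the starting point.
    have h1 : t = s := by
      refine (H x₀ hx₀).strictMonoOn.injOn ht hs ?_
      rw [← hpot t ht x hx, hts, hpot s hs y hy]
    subst h1
    have h2 := (H x hx).curve_eq (H y hy) hu (hχV x hx x (hsrc x hx)) (hχV y hy y (hsrc y hy)) ht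
      hts t0
    rw [hχ0 x hx x (hsrc x hx) hx, hχ0 y hy y (hsrc y hy) hy] at h2
    rw [h2]
  · have : (fun z : ℝ × M => Φ z.1 z.2) '' (Ioo (-ε) ε ×ˢ E) = ⋃ x ∈ E, (e x).source := by
      ext z
      rw [mem_iUnion₂]
      constructor
      · rintro ⟨⟨t, x⟩, ⟨ht, hx⟩, rfl⟩
        exact ⟨x, hx, (H x hx).mem_source ht (hχV x hx x (hsrc x hx))⟩
      · rintro ⟨x, hx, hz⟩
        obtain ⟨h1, h2⟩ := (H x hx).split_mem hz
        refine ⟨((split m (e x z)).1, (e x).symm (joinPt 0 (split m (e x z)).2)),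
          ⟨h1, (hσE x hx _ h2).1⟩, ?_⟩
        simp only [hΦσ x hx _ h1 _ h2, joinPt_split, (e x).left_inv hz]
    rw [this]
    exact isOpen_biUnion fun x _ => (e x).open_source
  · obtain ⟨s1, s2, s3⟩ := (H x hx).slice t0
    obtain ⟨p1, p2⟩ := (H x hx).pullback
      (τ := fun z : ℝ × Eu m => Φ z.1 ((e x).symm (joinPt 0 z.2))) (hΦσ x hx)
    refine ⟨V x, (e x).source, fun y => (e x).symm (joinPt 0 y), (H x hx).isOpen,
      (e x).open_source, hsrc x hx, ?_, ?_, s1, s2, ?_, p1, ?_⟩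
    · ext y
      constructor
      · rintro ⟨z, hz, rfl⟩
        exact hσE x hx z hz
      · rintro ⟨h1, h2⟩
        exact ⟨_, hχV x hx y h2, hχ0 x hx y h2 h1⟩
    · intro y hy z hz hyz
      have h1 : (e x).symm (joinPt 0 y) = (e x).symm (joinPt 0 z) := hyz
      have h2 := hχσ x hx y hy
      rw [h1, hχσ x hx z hz] at h2
      exact h2.symm
    · intro y hy i j
      have hG : ∀ z ∈ V x, gram (m + 1) (fun y => (e x).symm (joinPt 0 y)) z
          = (gram (m + 1) (e x).symm (joinPt 0 z)).submatrix Fin.succ Fin.succ := fun z hz => by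
        ext a b; exact s3 z hz a b
      have h1 := ricci_congr_on (H x hx).isOpen hG hy i j
      have h2 := (H x hx).einstein y hy i j
      rw [← h1, (hconst x hx).2.2] at h2
      exact h2.trans (congrArg _ (s3 y hy i j).symm)
    · intro t ht y hy a b (v : Eu m) (w : Eu m)
      have h1 := p2 t ht y hy a b v w
      have h2 : ∑ i, ∑ j, gram (m + 1) (e x).symm (joinPt 0 y) i.succ j.succ * v i * w j
          = ∑ i, ∑ j, gram (m + 1) (fun y => (e x).symm (joinPt 0 y)) y i j * v i * w j :=
        Finset.sum_congr rfl fun i _ => Finset.sum_congr rfl fun j _ => by rw [s3 y hy i j]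
      rw [h2, (hconst x hx).2.1 t ht] at h1
      exact h1

end Gluing

/-! ### Critical points and the case of a constant potential -/

section Potential

variable {n : ℕ} {M : Type*} [TopologicalSpace M] [ChartedSpace (EuclideanSpace ℝ (Fin n)) M]
  [IsManifold (𝓡 n) ∞ M] [RiemannianBundle (fun x : M => TangentSpace (𝓡 n) x)]
  [IsContMDiffRiemannianBundle (𝓡 n) ∞ (EuclideanSpace ℝ (Fin n))
      (fun x : M => TangentSpace (𝓡 n) x)]

theorem mfderiv_eq_zero_of_pd {u : M → ℝ} (hu : ContMDiff (𝓡 n) 𝓘(ℝ, ℝ) ∞ u)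
    {e : OpenPartialHomeomorph M (Eu n)} (he : e ∈ IsManifold.maximalAtlas (𝓡 n) ∞ M) {p : M}
    (hp : p ∈ e.source) (h : pd (fun z => u (e.symm z)) (e p) = 0) :
    mfderiv (𝓡 n) 𝓘(ℝ, ℝ) u p = 0 := by
  have h1 : HasFDerivAt (fun z => u (e.symm z)) (0 : Eu n →L[ℝ] ℝ) (e p) := by
    have := (ContDiffOn.dAt (smooth_chart_comp hu he) e.open_target
      (e.map_source hp)).hasFDerivAt
    rwa [fderiv_eq_zero_of_pd (congrFun h)] at this
  have h2 : HasMFDerivAt (𝓡 n) (𝓡 n) e p (mfderiv (𝓡 n) (𝓡 n) e p) :=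
    ((contMDiffAt_of_mem_maximalAtlas he hp).mdifferentiableAt (by simp)).hasMFDerivAt
  have h3 := h1.hasMFDerivAt.comp p h2
  have h4 : u =ᶠ[nhds p] (fun z => u (e.symm z)) ∘ e :=
    Filter.eventually_of_mem (e.open_source.mem_nhds hp) fun x hx => by
      simp only [Function.comp_apply, e.left_inv hx]
  rw [(h3.congr_of_eventuallyEq h4).mfderiv]
  exact ContinuousLinearMap.zero_comp _

theorem eq_of_pd_chart_eq_zero [PreconnectedSpace M] {a : M → ℝ}
    (ha : ContMDiff (𝓡 n) 𝓘(ℝ, ℝ) ∞ a)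
    (h : ∀ e ∈ IsManifold.maximalAtlas (𝓡 n) ∞ M, ∀ y ∈ e.target, ∀ i,
      pd (fun z => a (e.symm z)) y i = 0) (x x' : M) : a x = a x' := by
  refine IsLocallyConstant.apply_eq_of_preconnectedSpace ?_ x x'
  rw [IsLocallyConstant.iff_eventually_eq]
  intro x
  set e := chartAt (Eu n) x with hed
  have he : e ∈ IsManifold.maximalAtlas (𝓡 n) ∞ M := IsManifold.chart_mem_maximalAtlas _
  have hx : x ∈ e.source := mem_chart_source (Eu n) x
  obtain ⟨r, hr, hb⟩ := Metric.isOpen_iff.1 e.open_target _ (e.map_source hx)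
  have hN : IsOpen (e.source ∩ e ⁻¹' Metric.ball (e x) r) :=
    e.isOpen_inter_preimage Metric.isOpen_ball
  filter_upwards [hN.mem_nhds ⟨hx, Metric.mem_ball_self hr⟩] with y hy
  have h1 := eq_of_pd_eq_zero Metric.isOpen_ball (convex_ball (e x) r).isPreconnected
    ((smooth_chart_comp ha he).mono hb) (fun z hz => h e he z (hb hz)) hy.2
    (Metric.mem_ball_self hr)
  simpa only [e.left_inv hy.1, e.left_inv hx] using h1

/-- The Hessian of a constant vanishes, so `Ric = λ g`. Schur's lemma makes `λ` locally constant,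
and `M` is connected. -/
theorem isEinstein_of_potential_const [ConnectedSpace M] (hn : 3 ≤ n) {u h lam : M → ℝ}
    (hsol : IsAlmostSoliton n u h lam) {c : ℝ} (hc : ∀ x, u x = c) : IsEinstein n M := by
  have hR : ∀ e ∈ IsManifold.maximalAtlas (𝓡 n) ∞ M, ∀ y ∈ e.target, ∀ i j,
      ricci (gram n e.symm) y i j = lam (e.symm y) * gram n e.symm y i j := by
    intro e he y hy i j
    rw [← hsol.equation e he y hy i j]
    simp [hessian, hc]
  obtain ⟨x₀⟩ := (inferInstance : Nonempty M)
  refine ⟨lam x₀, fun e he y hy i j => ?_⟩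
  rw [hR e he y hy, eq_of_pd_chart_eq_zero hsol.smooth_lam (fun e he y hy i =>
    pd_eq_zero_of_ricci_eq (isMetricOn_chart he) hy hn (hR e he) i) (e.symm y) x₀]

end Potential

/-! ### Neighbourhoods of regular points and of regular level components -/

section Main

variable {m : ℕ} {M : Type*} [TopologicalSpace M]
  [ChartedSpace (EuclideanSpace ℝ (Fin (m + 1))) M] [IsManifold (𝓡 (m + 1)) ∞ M]
  [RiemannianBundle (fun x : M => TangentSpace (𝓡 (m + 1)) x)]
  [IsContMDiffRiemannianBundle (𝓡 (m + 1)) ∞ (EuclideanSpace ℝ (Fin (m + 1)))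
      (fun x : M => TangentSpace (𝓡 (m + 1)) x)]
  {u h lam : M → ℝ}

theorem exists_warpedChart_of_mfderiv_ne_zero (hm : 3 ≤ m) (hsol : IsAlmostSoliton (m + 1) u h lam)
    (hdev : ∀ e ∈ IsManifold.maximalAtlas (𝓡 (m + 1)) ∞ M, ∀ y ∈ e.target,
      deviation (gram (m + 1) e.symm y)⁻¹ (tracelessRicci (gram (m + 1) e.symm) y)
        (pd (fun z => u (e.symm z)) y) = 0)
    {p : M} (hp : mfderiv (𝓡 (m + 1)) 𝓘(ℝ, ℝ) u p ≠ 0) :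
    ∃ (e : OpenPartialHomeomorph M (Eu (m + 1))) (ε : ℝ) (V : Set (Eu m)) (f ψ : ℝ → ℝ) (κ : ℝ),
      0 < ε ∧ IsPreconnected V ∧ IsWarpedChart u h lam e ε V f ψ κ ∧ p ∈ e.source ∧ f 0 = u p := by
  obtain ⟨e, ε, v₀, f, ψ, κ, hε, H, h1, -, h2⟩ := exists_warpedChart hm hsol hdev
    (IsManifold.chart_mem_maximalAtlas p) (mem_chart_source _ p) fun h0 =>
      hp (mfderiv_eq_zero_of_pd hsol.smooth_u (IsManifold.chart_mem_maximalAtlas p)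
        (mem_chart_source _ p) h0)
  exact ⟨e, ε, Metric.ball v₀ ε, f, ψ, κ, hε, (convex_ball v₀ ε).isPreconnected, H, h1, h2⟩

theorem isEinsteinWarpedNear_local [T2Space M] (hm : 3 ≤ m)
    (hsol : IsAlmostSoliton (m + 1) u h lam)
    (hdev : ∀ e ∈ IsManifold.maximalAtlas (𝓡 (m + 1)) ∞ M, ∀ y ∈ e.target,
      deviation (gram (m + 1) e.symm y)⁻¹ (tracelessRicci (gram (m + 1) e.symm) y)
        (pd (fun z => u (e.symm z)) y) = 0)
    {p : M} (hp : mfderiv (𝓡 (m + 1)) 𝓘(ℝ, ℝ) u p ≠ 0) :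
    ∃ O : Set M, IsOpen O ∧ p ∈ O ∧ IsEinsteinWarpedNear (m + 1) u (u ⁻¹' {u p} ∩ O) := by
  obtain ⟨e, ε, V, f, ψ, κ, hε, hV, H, hpe, hfp⟩ :=
    exists_warpedChart_of_mfderiv_ne_zero hm hsol hdev hp
  refine ⟨e.source, e.open_source, hpe, ?_⟩
  rw [← hfp]
  refine isEinsteinWarpedNear_of_charts (h := h) (lam := lam) (by omega) hε hsol.smooth_u
    (isPreconnected_levelSet_inter H hε hV) ⟨p, hfp.symm, hpe⟩
    fun x hx => ⟨e, V, f, ψ, κ, H, hx.2, fun y hy => ?_⟩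
  rw [← H.potential_eq_iff hε hy]
  exact ⟨fun h => h.1, fun h => ⟨h, hy⟩⟩

/-- Finitely many warped charts cover the compact level set; the smallest of their widths serves all
of them, and the charts meeting the component are then glued. -/
theorem isEinsteinWarpedNear_component [T2Space M] (hm : 3 ≤ m)
    (hsol : IsAlmostSoliton (m + 1) u h lam)
    (hdev : ∀ e ∈ IsManifold.maximalAtlas (𝓡 (m + 1)) ∞ M, ∀ y ∈ e.target,
      deviation (gram (m + 1) e.symm y)⁻¹ (tracelessRicci (gram (m + 1) e.symm) y)
        (pd (fun z => u (e.symm z)) y) = 0)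
    {p : M} (hcomp : IsCompact (u ⁻¹' {u p}))
    (hreg : ∀ x, u x = u p → mfderiv (𝓡 (m + 1)) 𝓘(ℝ, ℝ) u x ≠ 0) :
    IsEinsteinWarpedNear (m + 1) u (connectedComponentIn (u ⁻¹' {u p}) p) := by
  set L := u ⁻¹' {u p} with hL
  have hpL : p ∈ L := rfl
  have hex : ∀ x : L, ∃ (e : OpenPartialHomeomorph M (Eu (m + 1))) (ε : ℝ) (V : Set (Eu m))
      (f ψ : ℝ → ℝ) (κ : ℝ), 0 < ε ∧ IsPreconnected V ∧ IsWarpedChart u h lam e ε V f ψ κ ∧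
        (x : M) ∈ e.source ∧ f 0 = u p := by
    intro x
    obtain ⟨e, ε, V, f, ψ, κ, h1, h2, h3, h4, h5⟩ :=
      exists_warpedChart_of_mfderiv_ne_zero hm hsol hdev (hreg x x.2)
    exact ⟨e, ε, V, f, ψ, κ, h1, h2, h3, h4, h5.trans x.2⟩
  choose e ε V f ψ κ hε hV H hsrc hf0 using hex
  obtain ⟨s, hs⟩ := hcomp.elim_finite_subcover (fun x : L => (e x).source)
    (fun x => (e x).open_source) fun x hx => mem_iUnion.2 ⟨⟨x, hx⟩, hsrc ⟨x, hx⟩⟩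
  have hsne : s.Nonempty := by
    obtain ⟨i, hi, -⟩ := mem_iUnion₂.1 (hs hpL)
    exact ⟨i, hi⟩
  set δ := s.inf' hsne ε with hδd
  have hδ : 0 < δ := (Finset.lt_inf'_iff hsne).2 fun i _ => hε i
  have t0 : (0 : ℝ) ∈ Ioo (-δ) δ := by simp [hδ]
  have hEL : connectedComponentIn L p ⊆ L := connectedComponentIn_subset L p
  refine isEinsteinWarpedNear_of_charts (h := h) (lam := lam) (by omega) hδ hsol.smooth_u
    isPreconnected_connectedComponentIn ⟨p, mem_connectedComponentIn hpL⟩ fun x hx => ?_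
  obtain ⟨i, hi, hxi⟩ := mem_iUnion₂.1 (hs (hEL hx))
  obtain ⟨e', H', he', hs'⟩ := (H i).restrict (Finset.inf'_le ε hi)
  have hlev : ∀ y ∈ (e i).source, y ∈ L ↔ e i y 0 = 0 := by
    intro y hy
    rw [← (H i).potential_eq_iff (hε i) hy, hf0 i]
    rfl
  have hxe' : x ∈ e'.source := by
    rw [hs']
    refine ⟨hxi, ?_⟩
    have h1 := (hlev x hxi).1 (hEL hx)
    rw [mem_preimage, ← eq_joinPt_of_zero h1]
    exact joinPt_mem_box.2 ⟨t0, ((H i).split_mem hxi).2⟩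
  refine ⟨e', V i, f i, ψ i, κ i, H', hxe', fun y hy => ?_⟩
  have hyi : y ∈ (e i).source := by rw [hs'] at hy; exact hy.1
  rw [he']
  constructor
  · exact fun hyE => (hlev y hyi).1 (hEL hyE)
  · intro hy0
    -- A chart meets the level set in its connected central slice, so that slice lies in the
    -- component as soon as it contains the point `x` of it.
    have h1 : IsPreconnected (L ∩ e'.source) := by
      have := isPreconnected_levelSet_inter H' hδ (hV i)
      rwa [hf0 i] at this
    rw [connectedComponentIn_eq hx]
    exact h1.subset_connectedComponentIn ⟨hEL hx, hxe'⟩ inter_subset_left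
      ⟨(hlev y hyi).2 hy0, hy⟩

end Main

end BachFlat

end

theorem theorem1p1 {n : ℕ} (hn : 4 ≤ n)
    {M : Type*} [EMetricSpace M] [ConnectedSpace M] [SecondCountableTopology M]
    [ChartedSpace (EuclideanSpace ℝ (Fin n)) M] [IsManifold (𝓡 n) ∞ M]
    [RiemannianBundle (fun x : M => TangentSpace (𝓡 n) x)]
    [IsContMDiffRiemannianBundle (𝓡 n) ∞ (EuclideanSpace ℝ (Fin n))
      (fun x : M => TangentSpace (𝓡 n) x)]
    [IsRiemannianManifold (𝓡 n) M] [CompleteSpace M]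
    (u h lam : M → ℝ)
    (hsol : BachFlat.IsAlmostSoliton n u h lam)
    (hbach : BachFlat.IsBachFlat n M)
    (hlevel : ∀ c : ℝ, IsCompact (u ⁻¹' {c}))
    (hhu : BachFlat.IsIncreasingFunctionOf h u) :
    (BachFlat.IsEinstein n M ∧ (∃ c : ℝ, ∀ x, u x = c) ∧ (∃ c : ℝ, ∀ x, h x = c)) ∨
    ((¬ ∃ c : ℝ, ∀ x, u x = c) ∧
      (∀ p : M, mfderiv (𝓡 n) 𝓘(ℝ, ℝ) u p ≠ 0 →
        ∃ O : Set M, IsOpen O ∧ p ∈ O ∧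
          BachFlat.IsEinsteinWarpedNear n u (u ⁻¹' {u p} ∩ O)) ∧
      (∀ p : M, (∀ x, u x = u p → mfderiv (𝓡 n) 𝓘(ℝ, ℝ) u x ≠ 0) →
        BachFlat.IsEinsteinWarpedNear n u (connectedComponentIn (u ⁻¹' {u p}) p))) := by
  by_cases hconst : ∃ c : ℝ, ∀ x, u x = c
  · left
    obtain ⟨c, hc⟩ := hconst
    refine ⟨BachFlat.isEinstein_of_potential_const (by omega) hsol hc, ⟨c, hc⟩, ?_⟩
    obtain ⟨φ, _, hφ, -⟩ := hhu
    exact ⟨φ c, fun x => by rw [hφ, hc]⟩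
  · right
    -- One coordinate is split off for the normal direction; the level sets have dimension `m ≥ 3`,
    -- as Schur's lemma on the fibres requires.
    obtain ⟨m, rfl⟩ : ∃ m, n = m + 1 := ⟨n - 1, by omega⟩
    have hm : 3 ≤ m := by omega
    have hdev : ∀ e ∈ IsManifold.maximalAtlas (𝓡 (m + 1)) ∞ M, ∀ y ∈ e.target,
        BachFlat.deviation (BachFlat.gram (m + 1) e.symm y)⁻¹
          (BachFlat.tracelessRicci (BachFlat.gram (m + 1) e.symm) y)
          (BachFlat.pd (fun z => u (e.symm z)) y) = 0 := fun e he y hy =>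
      BachFlat.deviation_eq_zero hn hsol hbach hlevel hhu he hy
    exact ⟨hconst, fun p hp => BachFlat.isEinsteinWarpedNear_local hm hsol hdev hp,
      fun p hp => BachFlat.isEinsteinWarpedNear_component hm hsol hdev (hlevel _) hp⟩
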